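/- Let $1<p<\infty$, $\frac1p+\frac1{p'}=1$, $L>0$, $0=\xi_0<\xi_1<\dots<\xi_N=1$, and for $i=1,\dots,N$ let $G_i:\mathbb R\to\mathbb R$ be $C^1$ and $L$-periodic with $0<G_0\le G_i\le G_1$. Let $G(x,y)=G_i(y)$ for $x\in I_i:=(\xi_{i-1},\xi_i)$ and $G(\xi_i,y)=\min\{G_i(y),G_{i+1}(y)\}$ for $1\le i\le N-1$, and set, for $\varepsilon>0$, $$R^\varepsilon=\{(x,y)\in\mathbb R^2: 0<x<1,\ 0<y<\varepsilon G(x,x/\varepsilon)\},\qquad Y_i^*=\{(y_1,y_2)\in\mathbb R^2: 0<y_1<L,\ 0<y_2<G_i(y_1)\}.$$ Let $W^{1,p}_\#(Y_i^*)$ be the space of the functions in $W^{1,p}(Y^*_i)$ that have the same trace on the left and on the right side of $Y_i^*$, and let $\langle\cdot\rangle_{Y_i^*}$ be the average over $Y_i^*$. Let $I^i_\varepsilon$ be the interior of the union of the intervals $[kL\varepsilon,(k+1)L\varepsilon]$, $k\in\mathbb Z$, that are contained in $[\xi_{i-1},\xi_i]$. For $\varphi:R^\varepsilon\to\mathbb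 R$ and $(x,y_1,y_2)\in I_i\times Y_i^*$ define the unfolding $$\mathcal T^i_\varepsilon\varphi(x,y_1,y_2)=\varphi\Big(\varepsilon\Big\lfloor\frac{x}{\varepsilon L}\Big\rfloor L+\varepsilon y_1,\varepsilon y_2\Big)\ \text{ if } x\in I^i_\varepsilon,\qquad \mathcal T^i_\varepsilon\varphi(x,y_1,y_2)=0\ \text{ if } x\in I_i\setminus I^i_\varepsilon.$$ \textbf{Theorem.} Let $f^\varepsilon\in L^{p'}(R^\varepsilon)$ with $\varepsilon^{-1/p'}\|f^\varepsilon\|_{L^{p'}(R^\varepsilon)}\le c$, where $c$ does not depend on $\varepsilon>0$, and suppose that $$\hat f^\varepsilon(x)=\frac1\varepsilon\int_0^{\varepsilon G(x,x/\varepsilon)}f^\varepsilon(x,y)\,dy$$ converges weakly in $L^{p'}(0,1)$ to a function $\hat f$ as $\varepsilon\to0$. Let $u_\varepsilon\in W^{1,p}(R^\varepsilon)$ be the weak solution of the Neumann problem $-\Delta_pu_\varepsilon+|u_\varepsilon|^{p-2}u_\varepsilon=f^\varepsilon$ in $R^\varepsilon$, that is, $$\int_{R^\varepsilon}\big\{|\nabla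 u_\varepsilon|^{p-2}\nabla u_\varepsilon\cdot\nabla\varphi+|u_\varepsilon|^{p-2}u_\varepsilon\varphi\big\}\,dx\,dy=\int_{R^\varepsilon}f^\varepsilon\varphi\,dx\,dy\qquad\forall\varphi\in W^{1,p}(R^\varepsilon).$$ Then for each $i$ there is a unique function $v^i$ with $v^i-y_1\in W^{1,p}_\#(Y_i^*)$, $\langle v^i-y_1\rangle_{Y_i^*}=0$ and $$\int_{Y_i^*}|\nabla v^i|^{p-2}\nabla v^i\cdot\nabla\psi\,dy_1dy_2=0\qquad\forall\psi\in W^{1,p}_\#(Y_i^*)\text{ with }\langle\psi\rangle_{Y_i^*}=0 .$$ Put $$q_i=\frac1L\int_{Y_i^*}|\nabla v^i|^{p-2}\partial_{y_1}v^i\,dy_1dy_2,\qquad r_i=\frac{|Y_i^*|}{L},\qquad q(x)=q_i,\ r(x)=r_i\ \text{ for } x\in I_i .$$ There exist $u\in W^{1,p}(0,1)$ and $u_1^i\in L^p(I_i;W^{1,p}_\#(Y_i^*))$, $i=1,\dots,N$, such that, as $\varepsilon\to0$, for every $i$, $$\begin{aligned} \mathcal T^i_\varepsilon u_\varepsilon&\rightharpoonup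 u&&\text{weakly in }L^p(I_i;W^{1,p}(Y_i^*)),\\ \mathcal T^i_\varepsilon(\partial_xu_\varepsilon)&\rightharpoonup\partial_xu+\partial_{y_1}u_1^i&&\text{weakly in }L^p(I_i\times Y_i^*),\\ \mathcal T^i_\varepsilon(\partial_yu_\varepsilon)&\rightharpoonup\partial_{y_2}u_1^i&&\text{weakly in }L^p(I_i\times Y_i^*), \end{aligned}$$ and $u$ is the unique function in $W^{1,p}(0,1)$ with $$\int_0^1\big\{q\,|u'|^{p-2}u'\varphi'+r\,|u|^{p-2}u\,\varphi\big\}\,dx=\int_0^1\hat f\varphi\,dx\qquad\forall\varphi\in W^{1,p}(0,1).$$ -/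

import Mathlib

open Set Filter Topology MeasureTheory

noncomputable section

namespace ThinDomain

/-- The Euclidean plane, in which gradients take their values. Points of the plane are written as
elements of `ℝ × ℝ`; only its topology, its smooth structure and Lebesgue measure are used. -/
abbrev Plane : Type := EuclideanSpace ℝ (Fin 2)

/-- The map `z ↦ |z|^{p-2} z`, with value `0` at `z = 0`. It is used for scalars (`V = ℝ`) and for
gradients (`V = Plane`, with the Euclidean norm). -/
def pFlux {V : Type*} [NormedAddCommGroup V] [NormedSpace ℝ V] (p : ℝ) (z : V) : V :=
  ‖z‖ ^ (p - 2) • z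

/-! ### Weak derivatives and Sobolev functions -/

/-- `g` is the weak derivative of `w` in the direction `e` on the open set `Ω`. -/
def HasWeakDeriv {E : Type*} [NormedAddCommGroup E] [NormedSpace ℝ E] [MeasureSpace E]
    (Ω : Set E) (e : E) (w g : E → ℝ) : Prop :=
  ∀ φ : E → ℝ, ContDiff ℝ ((⊤ : ℕ∞) : WithTop ℕ∞) φ → HasCompactSupport φ → tsupport φ ⊆ Ω →
    ∫ x in Ω, w x * fderiv ℝ φ x e = -∫ x in Ω, g x * φ x

/-- `w ∈ W^{1,p}(Ω)` for an open set `Ω ⊆ ℝ`, with weak derivative `dw`. -/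
structure IsW1pLine (Ω : Set ℝ) (p : ℝ) (w dw : ℝ → ℝ) : Prop where
  memLp : MemLp w (ENNReal.ofReal p) (volume.restrict Ω)
  deriv_memLp : MemLp dw (ENNReal.ofReal p) (volume.restrict Ω)
  weakDeriv : HasWeakDeriv Ω 1 w dw

/-- `w ∈ W^{1,p}(Ω)` for an open set `Ω ⊆ ℝ²`, with weak gradient `Dw`. -/
structure IsW1p (Ω : Set (ℝ × ℝ)) (p : ℝ) (w : ℝ × ℝ → ℝ) (Dw : ℝ × ℝ → Plane) : Prop where
  memLp : MemLp w (ENNReal.ofReal p) (volume.restrict Ω)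
  grad_memLp : MemLp Dw (ENNReal.ofReal p) (volume.restrict Ω)
  weakDeriv_fst : HasWeakDeriv Ω (1, 0) w (fun z => Dw z 0)
  weakDeriv_snd : HasWeakDeriv Ω (0, 1) w (fun z => Dw z 1)

/-! ### The basic cell and periodic Sobolev functions -/

/-- The cell `{(y₁, y₂) : 0 < y₁ < L, 0 < y₂ < g(y₁)}`. -/
def cell (L : ℝ) (g : ℝ → ℝ) : Set (ℝ × ℝ) :=
  {y | 0 < y.1 ∧ y.1 < L ∧ 0 < y.2 ∧ y.2 < g y.1}

/-- `τl` and `τr` are the traces on the left side `{0} × (0, g(0))` and on the right side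
`{L} × (0, g(L))` of the cell of the Sobolev function `w` with weak gradient `Dw`. Traces are
defined by Green's formula, tested with smooth functions that vanish near the lower and the
upper boundary, but not necessarily near the two sides. -/
structure HasLateralTraces (L : ℝ) (g : ℝ → ℝ) (w : ℝ × ℝ → ℝ) (Dw : ℝ × ℝ → Plane)
    (τl τr : ℝ → ℝ) : Prop where
  left_locallyIntegrable : LocallyIntegrableOn τl (Ioo 0 (g 0))
  right_locallyIntegrable : LocallyIntegrableOn τr (Ioo 0 (g L))
  green : ∀ ψ : ℝ × ℝ → ℝ, ContDiff ℝ ((⊤ : ℕ∞) : WithTop ℕ∞) ψ → HasCompactSupport ψ →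
    tsupport ψ ⊆ {y : ℝ × ℝ | 0 < y.2 ∧ y.2 < g y.1} →
    ∫ y in cell L g, (w y * fderiv ℝ ψ y (1, 0) + Dw y 0 * ψ y) =
      (∫ t in Ioo 0 (g L), τr t * ψ (L, t)) - ∫ t in Ioo 0 (g 0), τl t * ψ (0, t)

/-- `w ∈ W^{1,p}_#(Y*)`: a Sobolev function on the cell with the same trace on the left and on
the right side; `Dw` is its weak gradient. -/
def IsPerW1p (L : ℝ) (g : ℝ → ℝ) (p : ℝ) (w : ℝ × ℝ → ℝ) (Dw : ℝ × ℝ → Plane) : Prop :=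
  IsW1p (cell L g) p w Dw ∧ ∃ τ : ℝ → ℝ, HasLateralTraces L g w Dw τ τ

/-- `v`, with weak gradient `Dv`, solves the auxiliary problem on the cell. -/
structure IsCellSolution (L : ℝ) (g : ℝ → ℝ) (p : ℝ) (v : ℝ × ℝ → ℝ)
    (Dv : ℝ × ℝ → Plane) : Prop where
  periodic : IsPerW1p L g p (fun y => v y - y.1) (fun y => Dv y - EuclideanSpace.single 0 1)
  average_eq_zero : ⨍ y in cell L g, (v y - y.1) = 0
  equation : ∀ (ψ : ℝ × ℝ → ℝ) (Dψ : ℝ × ℝ → Plane), IsPerW1p L g p ψ Dψ →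
    ⨍ y in cell L g, ψ y = 0 →
    ∫ y in cell L g, inner ℝ (pFlux p (Dv y)) (Dψ y) = 0

/-- The coefficient `(1/L) ∫_{Y*} |∇v|^{p-2} ∂_{y₁} v`. -/
def qCoeff (L : ℝ) (g : ℝ → ℝ) (p : ℝ) (Dv : ℝ × ℝ → Plane) : ℝ :=
  L⁻¹ * ∫ y in cell L g, pFlux p (Dv y) 0

/-- The coefficient `|Y*| / L`. -/
def rCoeff (L : ℝ) (g : ℝ → ℝ) : ℝ := volume.real (cell L g) / L

/-! ### Functions on `I × Y` and weak convergence as `ε → 0⁺` -/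

/-- `w ∈ L^p(I; W^{1,p}(Y))`, with gradient `Dw` in the variable `y ∈ Y`. -/
structure IsLpW1p (I : Set ℝ) (Y : Set (ℝ × ℝ)) (p : ℝ) (w : ℝ × ℝ × ℝ → ℝ)
    (Dw : ℝ × ℝ × ℝ → Plane) : Prop where
  memLp : MemLp w (ENNReal.ofReal p) (volume.restrict (I ×ˢ Y))
  grad_memLp : MemLp Dw (ENNReal.ofReal p) (volume.restrict (I ×ˢ Y))
  ae_isW1p : ∀ᵐ x ∂(volume.restrict I), IsW1p Y p (fun y => w (x, y)) (fun y => Dw (x, y))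

/-- `w ∈ L^p(I; W^{1,p}_#(Y*))`, with gradient `Dw` in the variable `y ∈ Y*`. -/
structure IsLpPerW1p (I : Set ℝ) (L : ℝ) (g : ℝ → ℝ) (p : ℝ) (w : ℝ × ℝ × ℝ → ℝ)
    (Dw : ℝ × ℝ × ℝ → Plane) : Prop where
  memLp : MemLp w (ENNReal.ofReal p) (volume.restrict (I ×ˢ cell L g))
  grad_memLp : MemLp Dw (ENNReal.ofReal p) (volume.restrict (I ×ˢ cell L g))
  ae_isPerW1p : ∀ᵐ x ∂(volume.restrict I),
    IsPerW1p L g p (fun y => w (x, y)) (fun y => Dw (x, y))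

/-- `F ε ⇀ F₀` weakly in `L^p(μ)` as `ε → 0⁺`, where `p'` is the conjugate exponent of `p`. -/
structure TendstoWeaklyLp {X : Type*} [MeasurableSpace X] (p p' : ℝ) (μ : Measure X)
    (F : ℝ → X → ℝ) (F₀ : X → ℝ) : Prop where
  memLp : ∀ ε, 0 < ε → MemLp (F ε) (ENNReal.ofReal p) μ
  limit_memLp : MemLp F₀ (ENNReal.ofReal p) μ
  tendsto : ∀ ψ : X → ℝ, MemLp ψ (ENNReal.ofReal p') μ →
    Tendsto (fun ε => ∫ x, F ε x * ψ x ∂μ) (𝓝[>] 0) (𝓝 (∫ x, F₀ x * ψ x ∂μ))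

/-- `w ε ⇀ w₀` weakly in `L^p(I; W^{1,p}(Y))` as `ε → 0⁺`. This space is isometric to a closed
subspace of `L^p(I × Y)³` by `w ↦ (w, ∂_{y₁} w, ∂_{y₂} w)`, so that weak convergence means weak
convergence of the three components. -/
def TendstoWeaklyLpW1p (I : Set ℝ) (Y : Set (ℝ × ℝ)) (p p' : ℝ) (w : ℝ → ℝ × ℝ × ℝ → ℝ)
    (w₀ : ℝ × ℝ × ℝ → ℝ) : Prop :=
  ∃ (Dw : ℝ → ℝ × ℝ × ℝ → Plane) (Dw₀ : ℝ × ℝ × ℝ → Plane),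
    (∀ ε, 0 < ε → IsLpW1p I Y p (w ε) (Dw ε)) ∧ IsLpW1p I Y p w₀ Dw₀ ∧
    TendstoWeaklyLp p p' (volume.restrict (I ×ˢ Y)) w w₀ ∧
    ∀ j : Fin 2, TendstoWeaklyLp p p' (volume.restrict (I ×ˢ Y))
      (fun ε z => Dw ε z j) (fun z => Dw₀ z j)

/-! ### The Neumann problem and the rescaled norm -/

/-- `u`, with weak gradient `Du`, is a weak solution in `W^{1,p}(Ω)` of the Neumann problem
`-Δ_p u + |u|^{p-2} u = f` in `Ω`, `|∇u|^{p-2} ∇u · η = 0` on `∂Ω`. -/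
structure IsNeumannSolution (Ω : Set (ℝ × ℝ)) (p : ℝ) (f u : ℝ × ℝ → ℝ)
    (Du : ℝ × ℝ → Plane) : Prop where
  isW1p : IsW1p Ω p u Du
  equation : ∀ (φ : ℝ × ℝ → ℝ) (Dφ : ℝ × ℝ → Plane), IsW1p Ω p φ Dφ →
    ∫ z in Ω, (inner ℝ (pFlux p (Du z)) (Dφ z) + pFlux p (u z) * φ z) = ∫ z in Ω, f z * φ z

/-- The rescaled norm `ε^{-1/s} ‖f‖_{L^s(Ω)}`. -/
def rescaledNorm (ε s : ℝ) (Ω : Set (ℝ × ℝ)) (f : ℝ × ℝ → ℝ) : ℝ :=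
  ε ^ (-(1 / s)) * (eLpNorm f (ENNReal.ofReal s) (volume.restrict Ω)).toReal

/-- `u`, with weak derivative `du`, is a solution in `W^{1,p}(0,1)` of
`-(q |u'|^{p-2} u')' + r |u|^{p-2} u = f` in `(0,1)` with homogeneous Neumann conditions. -/
structure IsLimitSolution (p : ℝ) (q r f u du : ℝ → ℝ) : Prop where
  isW1p : IsW1pLine (Ioo 0 1) p u du
  equation : ∀ φ dφ : ℝ → ℝ, IsW1pLine (Ioo 0 1) p φ dφ →
    ∫ x in Ioo (0 : ℝ) 1, (q x * pFlux p (du x) * dφ x + r x * pFlux p (u x) * φ x) =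
      ∫ x in Ioo (0 : ℝ) 1, f x * φ x

/-! ### Piecewise periodic thin domains -/

/-- A piecewise periodic profile `G`: a partition `0 = ξ₀ < ⋯ < ξ_N = 1` and `L`-periodic `C¹`
functions `g i` with `0 < G₀ ≤ g i ≤ G₁` such that `G(x, y) = g i y` if `x` is in the `i`-th
interval of the partition. At a point between two intervals `G` is the smaller one of the two
adjacent functions, which makes the thin domains open. The index `i : Fin N` starts at `0`. -/
structure Profile (N : ℕ) (L G₀ G₁ : ℝ) where
  L_pos : 0 < L
  G₀_pos : 0 < G₀
  ξ : Fin (N + 1) → ℝ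
  ξ_strictMono : StrictMono ξ
  ξ_zero : ξ 0 = 0
  ξ_last : ξ (Fin.last N) = 1
  g : Fin N → ℝ → ℝ
  contDiff : ∀ i, ContDiff ℝ 1 (g i)
  periodic : ∀ i, Function.Periodic (g i) L
  lower : ∀ i y, G₀ ≤ g i y
  upper : ∀ i y, g i y ≤ G₁
  G : ℝ → ℝ → ℝ
  G_piece : ∀ i, ∀ x ∈ Ioo (ξ i.castSucc) (ξ i.succ), ∀ y, G x y = g i y
  G_interface : ∀ i j : Fin N, (j : ℕ) = (i : ℕ) + 1 → ∀ y, G (ξ j.castSucc) y = min (g i y) (g j y)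

namespace Profile

variable {N : ℕ} {L G₀ G₁ : ℝ} (P : Profile N L G₀ G₁)

/-- The `i`-th interval of the partition. -/
def piece (i : Fin N) : Set ℝ := Ioo (P.ξ i.castSucc) (P.ξ i.succ)

/-- The cell of the `i`-th piece. -/
def pieceCell (i : Fin N) : Set (ℝ × ℝ) := cell L (P.g i)

/-- The thin domain `{(x, y) : 0 < x < 1, 0 < y < ε G(x, x/ε)}`. -/
def thinDomain (ε : ℝ) : Set (ℝ × ℝ) :=
  {z | z.1 ∈ Ioo 0 1 ∧ 0 < z.2 ∧ z.2 < ε * P.G z.1 (z.1 / ε)}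

/-- The function `x ↦ (1/ε) ∫_0^{ε G(x, x/ε)} f(x, y) dy`. -/
def verticalMean (ε : ℝ) (f : ℝ × ℝ → ℝ) (x : ℝ) : ℝ :=
  ε⁻¹ * ∫ y in Ioo 0 (ε * P.G x (x / ε)), f (x, y)

/-- The interior of the union of those intervals `[kLε, (k+1)Lε]`, `k ∈ ℤ`, that lie in the
closure of the `i`-th piece. -/
def unfoldedPart (i : Fin N) (ε : ℝ) : Set ℝ :=
  interior (⋃ k ∈ {k : ℤ | P.ξ i.castSucc ≤ k * L * ε ∧ (k + 1) * L * ε ≤ P.ξ i.succ},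
    Icc ((k : ℝ) * L * ε) ((k + 1) * L * ε))

open Classical in
/-- The unfolding operator of the `i`-th piece; the integer `⌊x / (ε L)⌋` is the one for which
`x - ε ⌊x / (ε L)⌋ L ∈ [0, ε L)`. -/
def unfold (i : Fin N) (ε : ℝ) (φ : ℝ × ℝ → ℝ) (z : ℝ × ℝ × ℝ) : ℝ :=
  if z.1 ∈ P.unfoldedPart i ε then φ (ε * ⌊z.1 / (ε * L)⌋ * L + ε * z.2.1, ε * z.2.2) else 0

/-- The function on `(0,1)` that is equal to `a i` on the `i`-th piece. -/
def piecewiseConst (a : Fin N → ℝ) (x : ℝ) : ℝ :=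
  ∑ i, (P.piece i).indicator (fun _ => a i) x

end Profile

end ThinDomain

end

/-!
The solutions `u_ε` are compared with explicit correctors, by strict monotonicity of the
`p`-Laplacian. This avoids weak compactness altogether, and the unfolded functions are even seen to
converge strongly.

Write `χ i = v i - y₁`. On the thin domain consider `w_ε = U(x) + ε ∑ b i (x) χ i (z / ε)`, where `U`
is smooth and close to the solution `u₀` of the limit problem, and `b i` is a test function on the
`i`-th piece that is close to `u₀'`. The gradient of `w_ε` is close to `b i ∇v i (z / ε)`, and by
homogeneity its flux is close to `|u₀'|^{p-2} u₀'` times the oscillating cell flux. The cell flux is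
divergence free, also across the upper and the lower boundary, and `L`-periodic, so that its integral
over vertical sections is the constant `q i` (`IsCellSolution.section_flux`). Hence, tested with a
Sobolev function `φ` on the thin domain, it acts like `q i` tested with the derivative of the vertical
average of `φ`, up to an error of order `ε` (`IsCellSolution.abs_integral_flux_sub_le`). The zero-order
terms reduce to vertical averages too (`thin_poincare`); these are bounded in `W^{1,p}(0,1)`, where
weakly convergent data converge uniformly on bounded sets (`eventually_abs_integral_mul_le`). So the
limit equation says that `w_ε` solves the Neumann problem up to a small residual
(`IsHomogenization.exists_residual_le`), and strict monotonicity turns this into smallness of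
`u_ε - w_ε` in the norm of `W^{1,p}`, rescaled by the thickness
(`IsHomogenization.exists_corrector_close`). Unfolding preserves the measure up to a factor, the
incomplete cells are negligible, and the unfolding of `∇v i (z / ε)` is `∇v i (y)`; therefore the
unfolded gradients converge to `u₀' ∇v i`, that is, `u₁ i = u₀' χ i`.

The remaining ingredients:
* All inequalities for `z ↦ |z|^{p-2} z` with a small error term follow for every `p > 1` from one
  compactness argument on the unit sphere (`exists_le_add_mul_of_homogeneous`).
* The cell problem and the limit problem are solved by minimization; minimizing sequences are Cauchy
  by strict monotonicity (`exists_variational_solution`).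
* Equality of the lateral traces means that the periodic extension is weakly differentiable on the
  strip `{0 < y₂ < g(y₁)}` (`IsProfile.isPerW1p_iff`). Everything about the cell is done on the strip.
* The boundary is a graph, so that a Sobolev function is compared with its averages over vertical
  segments (`vertical_poincare`); this replaces extension operators and Rellich's theorem.
-/

noncomputable section

namespace ThinDomain

notation "ℝ²" => ℝ × ℝ

notation "Smooth" => ContDiff ℝ ((⊤ : ℕ∞) : WithTop ℕ∞)

notation "𝕀" => Ioo (0 : ℝ) 1

notation "vol[" Ω "]" => Measure.restrict volume Ω

notation "ofR(" p ")" => ENNReal.ofReal p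

/-! ### Pointwise inequalities for the map `z ↦ |z|^{p-2} z` -/

section Pointwise

variable {V : Type*} [NormedAddCommGroup V] [InnerProductSpace ℝ V]

theorem norm_pFlux {p : ℝ} (hp : 1 < p) (z : V) : ‖pFlux p z‖ = ‖z‖ ^ (p - 1) := by
  unfold pFlux
  rw [norm_smul, Real.norm_of_nonneg (Real.rpow_nonneg (norm_nonneg z) _)]
  rcases eq_or_ne z 0 with rfl | hz
  · simp [Real.zero_rpow (sub_pos.2 hp).ne']
  · have : 0 < ‖z‖ := norm_pos_iff.2 hz
    nth_rewrite 2 [← Real.rpow_one ‖z‖]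
    rw [← Real.rpow_add this]
    ring_nf

theorem norm_pFlux_rpow {p p' : ℝ} (hp : p.HolderConjugate p') (z : V) :
    ‖pFlux p z‖ ^ p' = ‖z‖ ^ p := by
  rw [norm_pFlux hp.lt, ← Real.rpow_mul (norm_nonneg z), hp.sub_one_mul_conj]

theorem inner_pFlux_self {p : ℝ} (hp : 1 < p) (z : V) : inner ℝ (pFlux p z) z = ‖z‖ ^ p := by
  unfold pFlux
  rw [real_inner_smul_left, real_inner_self_eq_norm_sq]
  rcases eq_or_ne z 0 with rfl | hz
  · simp [Real.zero_rpow (by linarith : p ≠ 0)]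
  · have : 0 < ‖z‖ := norm_pos_iff.2 hz
    rw [← Real.rpow_natCast, ← Real.rpow_add this]
    norm_num

theorem pFlux_zero {p : ℝ} : pFlux p (0 : V) = 0 := by simp [pFlux]

theorem pFlux_smul {p : ℝ} (c : ℝ) (z : V) : pFlux p (c • z) = pFlux p c • pFlux p z := by
  unfold pFlux
  rw [norm_smul, Real.mul_rpow (norm_nonneg c) (norm_nonneg z)]
  simp only [smul_smul, smul_eq_mul]
  ring_nf

theorem pFlux_smul_of_pos {p t : ℝ} (ht : 0 < t) (z : V) :
    pFlux p (t • z) = t ^ (p - 1) • pFlux p z := by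
  rw [pFlux_smul]
  congr 1
  rw [pFlux, Real.norm_of_nonneg ht.le, smul_eq_mul]
  nth_rewrite 2 [← Real.rpow_one t]
  rw [← Real.rpow_add ht]
  ring_nf

theorem continuous_pFlux {p : ℝ} (hp : 1 < p) : Continuous (pFlux p : V → V) := by
  rw [continuous_iff_continuousAt]
  intro z
  rcases eq_or_ne z 0 with rfl | hz
  · rw [ContinuousAt, pFlux_zero, tendsto_zero_iff_norm_tendsto_zero]
    simp_rw [norm_pFlux hp]
    have : Continuous fun z : V => ‖z‖ ^ (p - 1) :=
      continuous_norm.rpow_const fun _ => Or.inr (sub_pos.2 hp).le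
    simpa [Real.zero_rpow (sub_pos.2 hp).ne'] using this.tendsto 0
  · exact (continuousAt_id.norm.rpow_const (Or.inl (by simpa using hz))).smul continuousAt_id

theorem inner_pFlux_sub_nonneg {p : ℝ} (hp : 1 < p) (a b : V) :
    0 ≤ inner ℝ (pFlux p a - pFlux p b) (a - b) ∧
      (inner ℝ (pFlux p a - pFlux p b) (a - b) = 0 → a = b) := by
  have hp1 : 0 < p - 1 := sub_pos.2 hp
  have e : inner ℝ (pFlux p a - pFlux p b) (a - b) =
      ‖a‖ ^ p + ‖b‖ ^ p - inner ℝ (pFlux p a) b - inner ℝ (pFlux p b) a := by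
    rw [inner_sub_left, inner_sub_right, inner_sub_right, inner_pFlux_self hp,
      inner_pFlux_self hp]
    ring
  have pw : ∀ s : ℝ, 0 ≤ s → s ^ p = s ^ (p - 1) * s := fun s hs => by
    rw [← Real.rpow_add_one' hs (by linarith)]
    ring_nf
  have h1 : inner ℝ (pFlux p a) b ≤ ‖a‖ ^ (p - 1) * ‖b‖ :=
    norm_pFlux hp a ▸ real_inner_le_norm _ _
  have h2 : inner ℝ (pFlux p b) a ≤ ‖b‖ ^ (p - 1) * ‖a‖ :=
    norm_pFlux hp b ▸ real_inner_le_norm _ _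
  have hmono : StrictMonoOn (fun s : ℝ => s ^ (p - 1)) (Ici 0) :=
    Real.strictMonoOn_rpow_Ici_of_exponent_pos hp1
  have h3 : 0 ≤ (‖a‖ ^ (p - 1) - ‖b‖ ^ (p - 1)) * (‖a‖ - ‖b‖) := by
    rcases le_total ‖a‖ ‖b‖ with h | h
    · exact mul_nonneg_of_nonpos_of_nonpos
        (sub_nonpos.2 (hmono.monotoneOn (norm_nonneg a) (norm_nonneg b) h)) (sub_nonpos.2 h)
    · exact mul_nonneg
        (sub_nonneg.2 (hmono.monotoneOn (norm_nonneg b) (norm_nonneg a) h)) (sub_nonneg.2 h)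
  have pa := pw _ (norm_nonneg a)
  have pb := pw _ (norm_nonneg b)
  refine ⟨by rw [e]; nlinarith, fun h0 => ?_⟩
  rw [e] at h0
  have h4 : (‖a‖ ^ (p - 1) - ‖b‖ ^ (p - 1)) * (‖a‖ - ‖b‖) = 0 := by nlinarith
  have hn : ‖a‖ = ‖b‖ := by
    rcases mul_eq_zero.1 h4 with h | h
    · exact hmono.injOn (norm_nonneg a) (norm_nonneg b) (sub_eq_zero.1 h)
    · exact sub_eq_zero.1 h
  rcases eq_or_ne a 0 with rfl | ha
  · exact (norm_eq_zero.1 (by simpa using hn.symm)).symm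
  have hpos : 0 < ‖a‖ := norm_pos_iff.2 ha
  have h5 : inner ℝ (pFlux p a) b = ‖a‖ ^ (p - 1) * ‖b‖ := by nlinarith
  rw [pFlux, real_inner_smul_left] at h5
  have h6 : ‖a‖ ^ (p - 1) = ‖a‖ ^ (p - 2) * ‖a‖ := by
    rw [← Real.rpow_add_one hpos.ne']
    ring_nf
  rw [h6, mul_assoc] at h5
  have h7 := mul_left_cancel₀ (Real.rpow_pos_of_pos hpos _).ne' h5
  have h8 := inner_eq_norm_mul_iff_real.1 h7
  rw [← hn] at h8
  exact smul_right_injective V hpos.ne' h8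

theorem norm_rpow_add_inner_le {p p' : ℝ} (hp : p.HolderConjugate p') (a b : V) :
    ‖b‖ ^ p + p * inner ℝ (pFlux p b) (a - b) ≤ ‖a‖ ^ p := by
  have hp0 := hp.pos
  have h1 := real_inner_le_norm (pFlux p b) a
  have h2 := Real.young_inequality_of_nonneg (norm_nonneg (pFlux p b)) (norm_nonneg a) hp.symm
  rw [norm_pFlux_rpow hp, show ‖b‖ ^ p / p' = ‖b‖ ^ p * (1 - p⁻¹) by
    rw [← hp.inv_add_inv_eq_one]; ring] at h2
  have h3 := mul_le_mul_of_nonneg_left (h1.trans h2) hp0.le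
  rw [show p * (‖b‖ ^ p * (1 - p⁻¹) + ‖a‖ ^ p / p) = (p - 1) * ‖b‖ ^ p + ‖a‖ ^ p by
    field_simp] at h3
  rw [inner_sub_right, inner_pFlux_self hp.lt]
  linarith

/-- On a finite-dimensional space, a positively `p`-homogeneous function `f` that is nonpositive
wherever the nonnegative `p`-homogeneous function `h` vanishes is bounded by `C h`, up to an
arbitrarily small multiple of `‖z‖^p`. This replaces the explicit inequalities for the `p`-Laplacian,
whose form depends on whether `p < 2`. -/
theorem exists_le_add_mul_of_homogeneous {W : Type*} [NormedAddCommGroup W] [NormedSpace ℝ W]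
    [FiniteDimensional ℝ W] {p : ℝ} {f h : W → ℝ} (hf : Continuous f) (hh : Continuous h)
    (hf_hom : ∀ t : ℝ, 0 < t → ∀ z, f (t • z) = t ^ p * f z)
    (hh_hom : ∀ t : ℝ, 0 < t → ∀ z, h (t • z) = t ^ p * h z)
    (h_nonneg : ∀ z, 0 ≤ h z) (h_zero : ∀ z, h z = 0 → f z ≤ 0) (f_zero : f 0 ≤ 0)
    {δ : ℝ} (hδ : 0 < δ) : ∃ C : ℝ, 0 ≤ C ∧ ∀ z, f z ≤ δ * ‖z‖ ^ p + C * h z := by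
  have key : ∃ n : ℕ, ∀ z ∈ Metric.sphere (0 : W) 1, f z < δ + n * h z := by
    have hc := (isCompact_sphere (0 : W) 1).elim_directed_cover
      (fun n : ℕ => {z | f z < δ + n * h z})
      (fun n => isOpen_lt hf (continuous_const.add (continuous_const.mul hh)))
      (fun z _ => ?_) ?_
    · exact hc
    · rw [mem_iUnion]
      rcases (h_nonneg z).eq_or_lt with h0 | h0
      · refine ⟨0, ?_⟩
        have := h_zero z h0.symm
        simp only [mem_ofPred_eq]
        rw [← h0]
        linarith
      · obtain ⟨n, hn⟩ := exists_nat_gt ((f z - δ) / h z)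
        refine ⟨n, ?_⟩
        rw [div_lt_iff₀ h0] at hn
        simp only [mem_ofPred_eq]
        linarith
    · refine directed_of_isDirected_le fun n m hnm z hz => ?_
      simp only [mem_ofPred_eq] at hz ⊢
      have : (n : ℝ) * h z ≤ m * h z :=
        mul_le_mul_of_nonneg_right (by exact_mod_cast hnm) (h_nonneg z)
      linarith
  obtain ⟨n, hn⟩ := key
  refine ⟨n, n.cast_nonneg, fun z => ?_⟩
  rcases eq_or_ne z 0 with rfl | hz
  · have : 0 ≤ δ * ‖(0 : W)‖ ^ p := by positivity
    have := mul_nonneg (n.cast_nonneg (α := ℝ)) (h_nonneg 0)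
    linarith
  · have hpos : 0 < ‖z‖ := norm_pos_iff.2 hz
    have e : z = ‖z‖ • (‖z‖⁻¹ • z) := by rw [smul_smul, mul_inv_cancel₀ hpos.ne', one_smul]
    have hs : ‖z‖⁻¹ • z ∈ Metric.sphere (0 : W) 1 := by
      simp [norm_smul, hpos.ne']
    have h1 := hn _ hs
    have h2 : f z = ‖z‖ ^ p * f (‖z‖⁻¹ • z) := by
      conv_lhs => rw [e]
      exact hf_hom _ hpos _
    have h3 : h z = ‖z‖ ^ p * h (‖z‖⁻¹ • z) := by
      conv_lhs => rw [e]
      exact hh_hom _ hpos _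
    rw [h2, h3]
    have := mul_le_mul_of_nonneg_left h1.le (Real.rpow_nonneg hpos.le p)
    linarith

theorem mul_norm_prod_rpow_le {W : Type*} [NormedAddCommGroup W] (p : ℝ) {δ : ℝ} (hδ : 0 < δ)
    (a b : W) :
    δ * ‖(a, b)‖ ^ p ≤ δ * (‖a‖ ^ p + ‖b‖ ^ p) := by
  refine mul_le_mul_of_nonneg_left ?_ hδ.le
  rw [Prod.norm_def]
  have := Real.rpow_nonneg (norm_nonneg a) p
  have := Real.rpow_nonneg (norm_nonneg b) p
  rcases max_choice ‖a‖ ‖b‖ with h | h <;> simp only [h] <;> linarith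

theorem continuous_norm_rpow {W : Type*} [NormedAddCommGroup W] {p : ℝ} (hp : 0 ≤ p) :
    Continuous fun z : W => ‖z‖ ^ p :=
  continuous_norm.rpow_const fun _ => Or.inr hp

theorem norm_smul_rpow {W : Type*} [NormedAddCommGroup W] [NormedSpace ℝ W] (p : ℝ) {t : ℝ}
    (ht : 0 < t) (z : W) : ‖t • z‖ ^ p = t ^ p * ‖z‖ ^ p := by
  rw [norm_smul, Real.norm_of_nonneg ht.le, Real.mul_rpow ht.le (norm_nonneg z)]

variable [FiniteDimensional ℝ V]

/-- Strong monotonicity of the flux, up to a small error. -/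
theorem norm_sub_rpow_le_inner_pFlux {p : ℝ} (hp : 1 < p) {δ : ℝ} (hδ : 0 < δ) :
    ∃ C : ℝ, 0 ≤ C ∧ ∀ a b : V, ‖a - b‖ ^ p ≤ δ * (‖a‖ ^ p + ‖b‖ ^ p) +
      C * inner ℝ (pFlux p a - pFlux p b) (a - b) := by
  have hp0 : 0 < p := by linarith
  obtain ⟨C, hC, h⟩ := exists_le_add_mul_of_homogeneous (W := V × V) (p := p)
    (f := fun z => ‖z.1 - z.2‖ ^ p)
    (h := fun z => inner ℝ (pFlux p z.1 - pFlux p z.2) (z.1 - z.2))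
    ((continuous_norm_rpow hp0.le).comp (continuous_fst.sub continuous_snd))
    ((((continuous_pFlux hp).comp continuous_fst).sub
      ((continuous_pFlux hp).comp continuous_snd)).inner (continuous_fst.sub continuous_snd))
    (fun t ht z => by simp only [Prod.smul_fst, Prod.smul_snd, ← smul_sub, norm_smul_rpow p ht])
    (fun t ht z => by
      simp only [Prod.smul_fst, Prod.smul_snd, pFlux_smul_of_pos ht, ← smul_sub,
        real_inner_smul_left, real_inner_smul_right]
      rw [← mul_assoc, mul_comm t, ← Real.rpow_add_one ht.ne', sub_add_cancel])
    (fun z => (inner_pFlux_sub_nonneg hp z.1 z.2).1)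
    (fun z hz => by
      simp only [(inner_pFlux_sub_nonneg hp z.1 z.2).2 hz, sub_self, norm_zero]
      rw [Real.zero_rpow hp0.ne'])
    (by simp [Real.zero_rpow hp0.ne']) hδ
  exact ⟨C, hC, fun a b => (h (a, b)).trans (add_le_add_left (mul_norm_prod_rpow_le p hδ a b) _)⟩

theorem norm_pFlux_sub_rpow_le {p p' : ℝ} (hp : p.HolderConjugate p') {δ : ℝ} (hδ : 0 < δ) :
    ∃ C : ℝ, 0 ≤ C ∧ ∀ a b : V, ‖pFlux p a - pFlux p b‖ ^ p' ≤ δ * (‖a‖ ^ p + ‖b‖ ^ p) +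
      C * ‖a - b‖ ^ p := by
  have hp0 : 0 < p := hp.pos
  have hp'0 : 0 < p' := hp.symm.pos
  obtain ⟨C, hC, h⟩ := exists_le_add_mul_of_homogeneous (W := V × V) (p := p)
    (f := fun z => ‖pFlux p z.1 - pFlux p z.2‖ ^ p')
    (h := fun z => ‖z.1 - z.2‖ ^ p)
    ((continuous_norm_rpow hp'0.le).comp (((continuous_pFlux hp.lt).comp continuous_fst).sub
      ((continuous_pFlux hp.lt).comp continuous_snd)))
    ((continuous_norm_rpow hp0.le).comp (continuous_fst.sub continuous_snd))
    (fun t ht z => by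
      simp only [Prod.smul_fst, Prod.smul_snd, pFlux_smul_of_pos ht, ← smul_sub]
      rw [norm_smul_rpow p' (Real.rpow_pos_of_pos ht _), ← Real.rpow_mul ht.le,
        hp.sub_one_mul_conj])
    (fun t ht z => by simp only [Prod.smul_fst, Prod.smul_snd, ← smul_sub, norm_smul_rpow p ht])
    (fun z => by positivity)
    (fun z hz => by
      have : z.1 = z.2 := by
        have := (Real.rpow_eq_zero (norm_nonneg _) hp0.ne').1 hz
        exact sub_eq_zero.1 (norm_eq_zero.1 this)
      simp only [this, sub_self, norm_zero]
      rw [Real.zero_rpow hp'0.ne'])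
    (by simp [Real.zero_rpow hp'0.ne']) hδ
  exact ⟨C, hC, fun a b => (h (a, b)).trans (add_le_add_left (mul_norm_prod_rpow_le p hδ a b) _)⟩

end Pointwise

/-! ### Integrals of `p`-th powers -/

section LpTools

variable {α : Type*} [MeasurableSpace α] {μ : Measure α}
variable {V : Type*} [NormedAddCommGroup V]

theorem integrable_norm_rpow {p : ℝ} (hp : 0 < p) {X : α → V}
    (hX : MemLp X ofR(p) μ) : Integrable (fun x => ‖X x‖ ^ p) μ := by
  have := hX.integrable_norm_rpow (by simpa using hp) ENNReal.ofReal_ne_top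
  rwa [ENNReal.toReal_ofReal hp.le] at this

theorem memLp_of_integrable_norm_rpow {p : ℝ} (hp : 0 < p) {X : α → V}
    (hX : AEStronglyMeasurable X μ) (h : Integrable (fun x => ‖X x‖ ^ p) μ) :
    MemLp X ofR(p) μ := by
  rw [← integrable_norm_rpow_iff hX (by simpa using hp) ENNReal.ofReal_ne_top,
    ENNReal.toReal_ofReal hp.le]
  exact h

theorem eLpNorm_eq_ofReal {p : ℝ} (hp : 0 < p) {X : α → V}
    (hX : MemLp X ofR(p) μ) :
    eLpNorm X ofR(p) μ = ENNReal.ofReal ((∫ x, ‖X x‖ ^ p ∂μ) ^ (1 / p)) := by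
  rw [hX.eLpNorm_eq_integral_rpow_norm (by simpa using hp) ENNReal.ofReal_ne_top,
    ENNReal.toReal_ofReal hp.le, one_div]

theorem integral_rpow_nonneg {p : ℝ} (X : α → V) : 0 ≤ ∫ x, ‖X x‖ ^ p ∂μ :=
  integral_nonneg fun _ => Real.rpow_nonneg (norm_nonneg _) _

theorem rpow_integral_le {p : ℝ} (hp : 0 < p) {X : α → V} {a : ℝ} (h : ∫ x, ‖X x‖ ^ p ∂μ ≤ a) :
    (∫ x, ‖X x‖ ^ p ∂μ) ^ (1 / p) ≤ a ^ (1 / p) :=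
  Real.rpow_le_rpow (integral_rpow_nonneg _) h (by positivity)

theorem rpow_integral_le_mul {p : ℝ} (hp : 0 < p) {X : α → V} {β W : Type*} [MeasurableSpace β]
    {ν : Measure β} [NormedAddCommGroup W] {Y : β → W} {a : ℝ} (ha : 0 ≤ a)
    (h : ∫ x, ‖X x‖ ^ p ∂μ ≤ a ^ p * ∫ y, ‖Y y‖ ^ p ∂ν) :
    (∫ x, ‖X x‖ ^ p ∂μ) ^ (1 / p) ≤ a * (∫ y, ‖Y y‖ ^ p ∂ν) ^ (1 / p) := by
  refine (rpow_integral_le hp h).trans_eq ?_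
  rw [Real.mul_rpow (by positivity) (by positivity), ← Real.rpow_mul ha,
    mul_one_div_cancel hp.ne', Real.rpow_one]

theorem integrable_norm_mul_norm {p p' : ℝ} (hp : p.HolderConjugate p') {W : Type*}
    [NormedAddCommGroup W] {X : α → V} {Y : α → W} (hX : MemLp X ofR(p) μ)
    (hY : MemLp Y ofR(p') μ) : Integrable (fun x => ‖X x‖ * ‖Y x‖) μ := by
  have : ENNReal.HolderTriple ofR(p') ofR(p) 1 :=
    hp.symm.ennrealOfReal
  exact memLp_one_iff_integrable.1 (hY.norm.mul hX.norm)

theorem integrable_inner_of_memLp [InnerProductSpace ℝ V] {p p' : ℝ} (hp : p.HolderConjugate p')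
    {X Y : α → V} (hX : MemLp X ofR(p) μ) (hY : MemLp Y ofR(p') μ) :
    Integrable (fun x => inner ℝ (Y x) (X x)) μ :=
  (integrable_norm_mul_norm hp hX hY).mono' (hY.1.inner hX.1) <| .of_forall fun x => by
    rw [mul_comm]
    exact norm_inner_le_norm _ _

theorem integrable_mul_of_memLp {p p' : ℝ} (hp : p.HolderConjugate p')
    {X Y : α → ℝ} (hX : MemLp X ofR(p) μ) (hY : MemLp Y ofR(p') μ) :
    Integrable (fun x => X x * Y x) μ :=
  (integrable_norm_mul_norm hp hX hY).mono' (hX.1.mul hY.1) <| .of_forall fun x => by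
    rw [norm_mul]

theorem abs_integral_inner_le [InnerProductSpace ℝ V] {p p' : ℝ} (hp : p.HolderConjugate p')
    {X Y : α → V} (hX : MemLp X ofR(p) μ) (hY : MemLp Y ofR(p') μ) :
    |∫ x, inner ℝ (Y x) (X x) ∂μ| ≤
      (∫ x, ‖Y x‖ ^ p' ∂μ) ^ (1 / p') * (∫ x, ‖X x‖ ^ p ∂μ) ^ (1 / p) := by
  refine le_trans (abs_integral_le_integral_abs) (le_trans ?_
    (integral_mul_norm_le_Lp_mul_Lq hp.symm hY hX))
  refine integral_mono (integrable_inner_of_memLp hp hX hY).abs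
    (integrable_norm_mul_norm hp.symm hY hX) fun x => abs_real_inner_le_norm _ _

theorem abs_integral_mul_le {p p' : ℝ} (hp : p.HolderConjugate p')
    {X Y : α → ℝ} (hX : MemLp X ofR(p) μ) (hY : MemLp Y ofR(p') μ) :
    |∫ x, X x * Y x ∂μ| ≤
      (∫ x, ‖X x‖ ^ p ∂μ) ^ (1 / p) * (∫ x, ‖Y x‖ ^ p' ∂μ) ^ (1 / p') :=
  (abs_integral_inner_le hp hX hY).trans_eq (mul_comm _ _)

theorem norm_add_rpow_le {p : ℝ} (hp : 1 < p) (a b : V) :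
    ‖a + b‖ ^ p ≤ 2 ^ p * (‖a‖ ^ p + ‖b‖ ^ p) := by
  have ha : 0 ≤ ‖a‖ ^ p := by positivity
  have hb : 0 ≤ ‖b‖ ^ p := by positivity
  have h : ‖a + b‖ ≤ 2 * max ‖a‖ ‖b‖ := by
    linarith [norm_add_le a b, le_max_left ‖a‖ ‖b‖, le_max_right ‖a‖ ‖b‖]
  refine (Real.rpow_le_rpow (norm_nonneg _) h (by linarith)).trans ?_
  rw [Real.mul_rpow two_pos.le (by positivity)]
  gcongr
  rcases max_choice ‖a‖ ‖b‖ with h | h <;> rw [h] <;> linarith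

theorem integral_norm_add_rpow_le {p : ℝ} (hp : 1 < p) {X Y : α → V}
    (hX : MemLp X ofR(p) μ) (hY : MemLp Y ofR(p) μ) :
    ∫ x, ‖X x + Y x‖ ^ p ∂μ ≤ 2 ^ p * (∫ x, ‖X x‖ ^ p ∂μ + ∫ x, ‖Y x‖ ^ p ∂μ) := by
  have hp0 : 0 < p := by linarith
  have hX' := integrable_norm_rpow hp0 hX
  have hY' := integrable_norm_rpow hp0 hY
  rw [← integral_add hX' hY', ← integral_const_mul]
  exact integral_mono (integrable_norm_rpow hp0 (hX.add hY)) ((hX'.add hY').const_mul _)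
    fun x => norm_add_rpow_le hp _ _

theorem integral_norm_sub_rpow_le {p : ℝ} (hp : 1 < p) {X Y : α → V}
    (hX : MemLp X ofR(p) μ) (hY : MemLp Y ofR(p) μ) :
    ∫ x, ‖X x - Y x‖ ^ p ∂μ ≤ 2 ^ p * (∫ x, ‖X x‖ ^ p ∂μ + ∫ x, ‖Y x‖ ^ p ∂μ) := by
  simpa [sub_eq_add_neg] using integral_norm_add_rpow_le hp hX hY.neg

theorem memLp_pFlux [InnerProductSpace ℝ V] {p p' : ℝ} (hp : p.HolderConjugate p') {X : α → V}
    (hX : MemLp X ofR(p) μ) :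
    MemLp (fun x => pFlux p (X x)) ofR(p') μ := by
  refine memLp_of_integrable_norm_rpow hp.symm.pos
    ((continuous_pFlux hp.lt).comp_aestronglyMeasurable hX.1) ?_
  simp_rw [norm_pFlux_rpow hp]
  exact integrable_norm_rpow hp.pos hX

/-- Completeness of `L^p`, in terms of functions. -/
theorem exists_limit_of_cauchy_rpow [CompleteSpace V] {p : ℝ} (hp : 1 < p) {X : ℕ → α → V}
    (hX : ∀ n, MemLp (X n) ofR(p) μ)
    (hc : ∀ η : ℝ, 0 < η → ∃ N, ∀ m ≥ N, ∀ n ≥ N, ∫ x, ‖X m x - X n x‖ ^ p ∂μ ≤ η) :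
    ∃ X' : α → V, MemLp X' ofR(p) μ ∧
      Tendsto (fun n => ∫ x, ‖X n x - X' x‖ ^ p ∂μ) atTop (𝓝 0) := by
  have hp0 : 0 < p := by linarith
  have : Fact (1 ≤ ofR(p)) := ⟨by simpa using hp.le⟩
  have hd : ∀ {Y Z : α → V} (hY : MemLp Y ofR(p) μ)
      (hZ : MemLp Z ofR(p) μ),
      dist (hY.toLp Y) (hZ.toLp Z) = (∫ x, ‖Y x - Z x‖ ^ p ∂μ) ^ (1 / p) := by
    intro Y Z hY hZ
    rw [dist_eq_norm, ← MemLp.toLp_sub, Lp.norm_toLp, eLpNorm_eq_ofReal hp0 (hY.sub hZ),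
      ENNReal.toReal_ofReal (by positivity)]
    rfl
  have hcs : CauchySeq fun n => (hX n).toLp (X n) := by
    rw [Metric.cauchySeq_iff]
    intro ε hε
    obtain ⟨N, hN⟩ := hc ((ε / 2) ^ p) (by positivity)
    refine ⟨N, fun m hm n hn => ?_⟩
    rw [hd]
    calc (∫ x, ‖X m x - X n x‖ ^ p ∂μ) ^ (1 / p) ≤ ((ε / 2) ^ p) ^ (1 / p) :=
          Real.rpow_le_rpow (integral_rpow_nonneg _) (hN m hm n hn) (by positivity)
      _ = ε / 2 := by
          rw [← Real.rpow_mul (by positivity), mul_one_div_cancel hp0.ne', Real.rpow_one]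
      _ < ε := by linarith
  obtain ⟨Y, hY⟩ := cauchySeq_tendsto_of_complete hcs
  refine ⟨Y, Lp.memLp Y, ?_⟩
  have h1 := tendsto_iff_dist_tendsto_zero.1 hY
  have h2 : Tendsto (fun n => dist ((hX n).toLp (X n)) Y ^ p) atTop (𝓝 0) := by
    have := h1.rpow_const (p := p) (Or.inr hp0.le)
    rwa [Real.zero_rpow hp0.ne'] at this
  refine h2.congr fun n => ?_
  have := hd (hX n) (Lp.memLp Y)
  rw [Lp.toLp_coeFn] at this
  rw [this, ← Real.rpow_mul (integral_rpow_nonneg _), one_div_mul_cancel hp0.ne',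
    Real.rpow_one]

theorem tendsto_integral_inner_of_tendsto_rpow [InnerProductSpace ℝ V] {p p' : ℝ}
    (hp : p.HolderConjugate p') {ι : Type*}
    {l : Filter ι} {X : ι → α → V} {X' F : α → V} (hX : ∀ n, MemLp (X n) ofR(p) μ)
    (hX' : MemLp X' ofR(p) μ) (hF : MemLp F ofR(p') μ)
    (h : Tendsto (fun n => ∫ x, ‖X n x - X' x‖ ^ p ∂μ) l (𝓝 0)) :
    Tendsto (fun n => ∫ x, inner ℝ (F x) (X n x) ∂μ) l (𝓝 (∫ x, inner ℝ (F x) (X' x) ∂μ)) := by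
  rw [tendsto_iff_norm_sub_tendsto_zero]
  have hb : ∀ n, ‖∫ x, inner ℝ (F x) (X n x) ∂μ - ∫ x, inner ℝ (F x) (X' x) ∂μ‖ ≤
      (∫ x, ‖F x‖ ^ p' ∂μ) ^ (1 / p') * (∫ x, ‖X n x - X' x‖ ^ p ∂μ) ^ (1 / p) := fun n => by
    rw [← integral_sub (integrable_inner_of_memLp hp (hX n) hF)
      (integrable_inner_of_memLp hp hX' hF)]
    simp_rw [← inner_sub_right]
    exact abs_integral_inner_le hp ((hX n).sub hX') hF
  refine squeeze_zero (fun _ => norm_nonneg _) hb ?_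
  have := (h.rpow_const (p := 1 / p) (Or.inr (one_div_nonneg.2 hp.nonneg))).const_mul
    ((∫ x, ‖F x‖ ^ p' ∂μ) ^ (1 / p'))
  rwa [Real.zero_rpow (one_div_ne_zero hp.ne_zero), mul_zero] at this

theorem tendsto_integral_mul_of_tendsto_rpow {p p' : ℝ} (hp : p.HolderConjugate p') {ι : Type*}
    {l : Filter ι} {X : ι → α → ℝ} {X' ψ : α → ℝ} (hX : ∀ n, MemLp (X n) ofR(p) μ)
    (hX' : MemLp X' ofR(p) μ) (hψ : MemLp ψ ofR(p') μ)
    (h : Tendsto (fun n => ∫ x, ‖X n x - X' x‖ ^ p ∂μ) l (𝓝 0)) :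
    Tendsto (fun n => ∫ x, X n x * ψ x ∂μ) l (𝓝 (∫ x, X' x * ψ x ∂μ)) :=
  tendsto_integral_inner_of_tendsto_rpow hp hX hX' hψ h

end LpTools

/-! ### Existence of solutions by minimization -/

section Existence

variable {α : Type*} [MeasurableSpace α] {μ : Measure α}
variable {V : Type*} [NormedAddCommGroup V] [InnerProductSpace ℝ V] [FiniteDimensional ℝ V]

/-- The functional `Z ↦ ∫ (w |Z|^p / p - F · Z)` has a minimizer on the affine space `X₀ + K` if
`K` is closed in `L^p`. A minimizing sequence is a Cauchy sequence because of the uniform convexity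
of `z ↦ |z|^p`, so no weak compactness is needed. The theorem states the Euler equation. -/
theorem exists_variational_solution {p p' : ℝ} (hp : p.HolderConjugate p')
    (K : Submodule ℝ (α → V)) (hK : ∀ X ∈ K, MemLp X ofR(p) μ)
    (hK_closed : ∀ (X : ℕ → α → V) (X' : α → V), (∀ n, X n ∈ K) →
      MemLp X' ofR(p) μ →
      Tendsto (fun n => ∫ x, ‖X n x - X' x‖ ^ p ∂μ) atTop (𝓝 0) → ∃ Y ∈ K, Y =ᵐ[μ] X')
    {X₀ : α → V} (hX₀ : MemLp X₀ ofR(p) μ)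
    {F : α → V} (hF : MemLp F ofR(p') μ)
    {w : α → ℝ} {c₀ c₁ : ℝ} (hw : AEStronglyMeasurable w μ) (hc₀ : 0 < c₀)
    (hw₀ : ∀ x, c₀ ≤ w x) (hw₁ : ∀ x, w x ≤ c₁) :
    ∃ X ∈ K, ∀ Y ∈ K,
      ∫ x, w x * inner ℝ (pFlux p (X₀ x + X x)) (Y x) ∂μ = ∫ x, inner ℝ (F x) (Y x) ∂μ := by
  have hp0 : 0 < p := hp.pos
  have hw₁' : ∀ x, |w x| ≤ c₁ := fun x => by
    rw [abs_of_nonneg (hc₀.le.trans (hw₀ x))]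
    exact hw₁ x
  -- admissible functions `Z = X₀ + X`, with the functional `J` and its gradient `G`
  set A : Set (α → V) := {Z | Z - X₀ ∈ K} with hA
  have hAm : ∀ Z ∈ A, MemLp Z ofR(p) μ := fun Z hZ => by simpa using (hK _ hZ).add hX₀
  have line : ∀ Z ∈ A, ∀ Y ∈ K, ∀ t : ℝ, Z + t • Y ∈ A := fun Z hZ Y hY t => by
    rw [hA, mem_ofPred_eq, add_sub_right_comm]
    exact K.add_mem hZ (K.smul_mem t hY)
  set j : α → V → ℝ := fun x z => w x * ‖z‖ ^ p / p - inner ℝ (F x) z with hj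
  set J : (α → V) → ℝ := fun Z => ∫ x, j x (Z x) ∂μ with hJ
  have ij : ∀ {Z}, MemLp Z ofR(p) μ → Integrable (fun x => j x (Z x)) μ := fun hZ =>
    (((integrable_norm_rpow hp0 hZ).bdd_mul hw (.of_forall hw₁')).div_const p).sub
      (integrable_inner_of_memLp hp hZ hF)
  set G : (α → V) → α → V := fun Z x => w x • pFlux p (Z x) - F x with hG
  have iG : ∀ {Z}, MemLp Z ofR(p) μ → MemLp (G Z) ofR(p') μ := fun hZ => by
    have h := memLp_pFlux hp hZ
    refine MemLp.sub ?_ hF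
    exact h.of_le_mul (c := c₁) (hw.smul h.1) (.of_forall fun x => by
      rw [norm_smul]
      gcongr
      exact hw₁' x)
  -- the functional lies above its tangents
  have tangent : ∀ {Z Z'}, MemLp Z ofR(p) μ → MemLp Z' ofR(p) μ →
      J Z + ∫ x, inner ℝ (G Z x) (Z' x - Z x) ∂μ ≤ J Z' := fun {Z Z'} hZ hZ' => by
    have i := integrable_inner_of_memLp hp (hZ'.sub hZ) (iG hZ)
    simp only [Pi.sub_apply] at i
    rw [hJ]
    simp only
    rw [← integral_add (ij hZ) i]
    refine integral_mono ((ij hZ).add i) (ij hZ') fun x => ?_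
    have h := mul_le_mul_of_nonneg_left (norm_rpow_add_inner_le hp (Z' x) (Z x))
      (div_nonneg (hc₀.le.trans (hw₀ x)) hp0.le)
    rw [mul_add, ← mul_assoc, div_mul_cancel₀ _ hp0.ne'] at h
    simp only [hj, hG, inner_sub_left, real_inner_smul_left,
      inner_sub_right (F x)]
    linarith [mul_div_right_comm (w x) (‖Z x‖ ^ p) p, mul_div_right_comm (w x) (‖Z' x‖ ^ p) p]
  -- coercivity
  obtain ⟨B, hB⟩ : ∃ B : ℝ, ∀ Z ∈ A, c₀ / (2 * p) * ∫ x, ‖Z x‖ ^ p ∂μ ≤ J Z + B := by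
    set θ : ℝ := (c₀ / 2) ^ (1 / p) with hθ
    have hθ0 : 0 < θ := by positivity
    have hθp : θ ^ p = c₀ / 2 := by
      rw [hθ, ← Real.rpow_mul (by positivity), one_div_mul_cancel hp0.ne', Real.rpow_one]
    refine ⟨∫ x, ((‖F x‖ / θ) ^ p' / p') ∂μ, fun Z hZ => ?_⟩
    have iF : Integrable (fun x => (‖F x‖ / θ) ^ p' / p') μ := by
      simp_rw [Real.div_rpow (norm_nonneg _) hθ0.le]
      exact ((integrable_norm_rpow hp.symm.pos hF).div_const _).div_const p'
    rw [← integral_add (ij (hAm Z hZ)) iF, ← integral_const_mul]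
    refine integral_mono ((integrable_norm_rpow hp0 (hAm Z hZ)).const_mul _)
      ((ij (hAm Z hZ)).add iF) fun x => ?_
    have y1 : inner ℝ (F x) (Z x) ≤ (θ * ‖Z x‖) ^ p / p + (‖F x‖ / θ) ^ p' / p' := by
      refine (real_inner_le_norm _ _).trans (le_trans (le_of_eq ?_)
        (Real.young_inequality_of_nonneg (a := θ * ‖Z x‖) (b := ‖F x‖ / θ)
        (by positivity) (by positivity) hp))
      field_simp
    rw [Real.mul_rpow hθ0.le (norm_nonneg _), hθp] at y1
    have y2 : c₀ * ‖Z x‖ ^ p / p ≤ w x * ‖Z x‖ ^ p / p := by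
      gcongr
      exact hw₀ x
    have y3 : c₀ / (2 * p) * ‖Z x‖ ^ p = c₀ * ‖Z x‖ ^ p / p - c₀ / 2 * ‖Z x‖ ^ p / p := by
      field_simp
      ring
    simp only [hj]
    linarith
  have hX₀A : X₀ ∈ A := by simp [hA]
  have hbdd : BddBelow (J '' A) := ⟨-B, by
    rintro _ ⟨Z, hZ, rfl⟩
    have h0 : 0 ≤ c₀ / (2 * p) * ∫ x, ‖Z x‖ ^ p ∂μ := by positivity
    linarith [hB Z hZ]⟩
  set m := sInf (J '' A) with hm
  have hmle : ∀ Z ∈ A, m ≤ J Z := fun Z hZ => csInf_le hbdd ⟨Z, hZ, rfl⟩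
  have hseq : ∀ n : ℕ, ∃ Z ∈ A, J Z < m + 1 / ((n : ℝ) + 1) := fun n => by
    obtain ⟨_, ⟨Z, hZ, rfl⟩, h⟩ := exists_lt_of_csInf_lt (⟨_, X₀, hX₀A, rfl⟩ : (J '' A).Nonempty)
      (show sInf (J '' A) < m + 1 / ((n : ℝ) + 1) from lt_add_of_pos_right _ (by positivity))
    exact ⟨Z, hZ, h⟩
  choose Z hZA hZJ using hseq
  have hZm := fun n => hAm _ (hZA n)
  set E := (m + 1 + B) / (c₀ / (2 * p)) with hE
  have hbound : ∀ n, ∫ x, ‖Z n x‖ ^ p ∂μ ≤ E := fun n => by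
    rw [hE, le_div_iff₀' (by positivity)]
    have h1 : 1 / ((n : ℝ) + 1) ≤ 1 := by
      rw [div_le_one (by positivity)]
      linarith [n.cast_nonneg (α := ℝ)]
    linarith [hB _ (hZA n), hZJ n]
  have hE0 : 0 ≤ E := (integral_rpow_nonneg _).trans (hbound 0)
  -- the tangents at the two points that trisect the segment from `Z k` to `Z n` bound the
  -- monotonicity gap between these points
  have hcauchy : ∀ η : ℝ, 0 < η → ∃ N, ∀ k ≥ N, ∀ n ≥ N, ∫ x, ‖Z k x - Z n x‖ ^ p ∂μ ≤ η := by
    intro η hη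
    set E' := 2 ^ p * (E + 2 ^ p * (E + E)) with hE'
    have hE'0 : 0 ≤ E' := by positivity
    obtain ⟨C, hC, hCb⟩ := norm_sub_rpow_le_inner_pFlux (V := V) hp.lt
      (δ := η / (3 ^ p * 4 * (E' + 1))) (by positivity)
    obtain ⟨N, hN⟩ := exists_nat_gt (4 * 3 ^ p * C / c₀ / η)
    refine ⟨N, fun k hk n hn => ?_⟩
    set D : α → V := fun x => (1 / 3 : ℝ) • (Z n x - Z k x) with hD
    have hDK : D ∈ K := by
      convert K.smul_mem (1 / 3 : ℝ) (K.sub_mem (hZA n) (hZA k)) using 1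
      ext x
      simp [hD]
    have hDm := hK _ hDK
    have hP := line _ (hZA k) _ hDK 1
    have hQ := line _ (hZA n) _ hDK (-1)
    set P := Z k + (1 : ℝ) • D with hPd
    set Q := Z n + (-1 : ℝ) • D with hQd
    have hPx : ∀ x, P x = Z k x + D x := fun x => by simp [hPd]
    have hQx : ∀ x, Q x = Z n x - D x := fun x => by simp [hQd, sub_eq_add_neg]
    have hQP : ∀ x, Q x - P x = D x := fun x => by
      rw [hPx, hQx, hD]
      module
    have iP := integrable_norm_rpow hp0 (hAm _ hP)
    have iQ := integrable_norm_rpow hp0 (hAm _ hQ)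
    have gP := integrable_inner_of_memLp hp hDm (iG (hAm _ hP))
    have gQ := integrable_inner_of_memLp hp hDm (iG (hAm _ hQ))
    have t1 := tangent (hAm _ hP) (hZm k)
    have t2 := tangent (hAm _ hQ) (hZm n)
    simp only [hPx, hQx, sub_add_cancel_left, sub_sub_cancel, inner_neg_right, integral_neg] at t1 t2
    have gap : ∫ x, inner ℝ (G Q x) (D x) ∂μ - ∫ x, inner ℝ (G P x) (D x) ∂μ ≤
        1 / ((k : ℝ) + 1) + 1 / ((n : ℝ) + 1) := by
      linarith [hZJ k, hZJ n, hmle _ hP, hmle _ hQ]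
    have h2 : ∫ x, ‖Z k x - Z n x‖ ^ p ∂μ = 3 ^ p * ∫ x, ‖D x‖ ^ p ∂μ := by
      rw [← integral_const_mul]
      congr 1
      ext x
      rw [← norm_smul_rpow p (by norm_num : (0 : ℝ) < 3), hD, smul_smul, norm_sub_rev]
      norm_num
    have b := integral_norm_sub_rpow_le hp.lt (hZm k) (hZm n)
    have bD : ∫ x, ‖D x‖ ^ p ∂μ ≤ 2 ^ p * (E + E) := by
      have h3 : 1 ≤ (3 : ℝ) ^ p := Real.one_le_rpow (by norm_num) hp0.le
      have h0 := le_mul_of_one_le_left (integral_rpow_nonneg (p := p) (μ := μ) D) h3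
      refine (h0.trans (h2.symm.le.trans b)).trans ?_
      gcongr <;> exact hbound _
    have bP : ∫ x, ‖P x‖ ^ p ∂μ ≤ E' := by
      simp_rw [hPx]
      refine (integral_norm_add_rpow_le hp.lt (hZm k) hDm).trans ?_
      exact mul_le_mul_of_nonneg_left (add_le_add (hbound k) bD) (by positivity)
    have bQ : ∫ x, ‖Q x‖ ^ p ∂μ ≤ E' := by
      simp_rw [hQx]
      refine (integral_norm_sub_rpow_le hp.lt (hZm n) hDm).trans ?_
      exact mul_le_mul_of_nonneg_left (add_le_add (hbound n) bD) (by positivity)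
    have h1 : ∫ x, ‖D x‖ ^ p ∂μ ≤ η / (3 ^ p * 4 * (E' + 1)) *
        (∫ x, ‖Q x‖ ^ p ∂μ + ∫ x, ‖P x‖ ^ p ∂μ) + C / c₀ *
        (∫ x, inner ℝ (G Q x) (D x) ∂μ - ∫ x, inner ℝ (G P x) (D x) ∂μ) := by
      have gQP := gQ.sub gP
      simp only [Pi.sub_def] at gQP
      rw [← integral_add iQ iP, ← integral_sub gQ gP, ← integral_const_mul, ← integral_const_mul,
        ← integral_add ((iQ.fun_add iP).const_mul _) (gQP.const_mul _)]
      refine integral_mono (integrable_norm_rpow hp0 hDm)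
        (((iQ.fun_add iP).const_mul _).add (gQP.const_mul _)) fun x => ?_
      have h := hCb (Q x) (P x)
      rw [hQP] at h
      refine h.trans (add_le_add le_rfl ?_)
      rw [← inner_sub_left, hG]
      simp only [sub_sub_sub_cancel_right, ← smul_sub, real_inner_smul_left]
      have h0 := (inner_pFlux_sub_nonneg hp.lt (Q x) (P x)).1
      rw [hQP] at h0
      rw [div_mul_eq_mul_div, le_div_iff₀ hc₀, mul_assoc, mul_comm _ c₀]
      gcongr
      exact hw₀ x
    have h3 : η / (3 ^ p * 4 * (E' + 1)) *
        (∫ x, ‖Q x‖ ^ p ∂μ + ∫ x, ‖P x‖ ^ p ∂μ) ≤ η / 3 ^ p / 2 := by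
      calc _ ≤ η / (3 ^ p * 4 * (E' + 1)) * (2 * (E' + 1)) := by
            gcongr
            linarith
        _ = _ := by
          field_simp
          norm_num
    rw [h2, ← le_div_iff₀' (by positivity)]
    refine h1.trans ?_
    have h4 : C / c₀ * (1 / ((k : ℝ) + 1) + 1 / ((n : ℝ) + 1)) ≤ η / 3 ^ p / 2 := by
      have hN0 : (0 : ℝ) ≤ 4 * 3 ^ p * C / c₀ / η := by positivity
      have hN' : C / c₀ ≤ η / 3 ^ p / 4 * N := by
        have := (mul_lt_mul_of_pos_left hN (show 0 < η / 3 ^ p / 4 by positivity)).le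
        refine le_trans (le_of_eq ?_) this
        field_simp
      have f : ∀ l : ℕ, N ≤ l → C / c₀ * (1 / ((l : ℝ) + 1)) ≤ η / 3 ^ p / 4 := fun l hl => by
        rw [mul_one_div, div_le_iff₀ (by positivity)]
        refine hN'.trans ?_
        gcongr
        exact (Nat.cast_le.2 hl).trans (le_add_of_nonneg_right zero_le_one)
      linarith [f k hk, f n hn]
    have h5 := mul_le_mul_of_nonneg_left gap (div_nonneg hC hc₀.le)
    linarith
  obtain ⟨Z', hZ', hlim⟩ := exists_limit_of_cauchy_rpow hp.lt hZm hcauchy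
  obtain ⟨X, hXK, hXe⟩ := hK_closed (fun n => Z n - X₀) (Z' - X₀) hZA (hZ'.sub hX₀) (by
    simpa using hlim)
  set U : α → V := fun x => X₀ x + X x with hU
  have hUA : U ∈ A := by
    rwa [show U = X₀ + X from rfl, hA, mem_ofPred_eq, add_sub_cancel_left]
  have hUm := hAm U hUA
  have hlimU : Tendsto (fun n => ∫ x, ‖Z n x - U x‖ ^ p ∂μ) atTop (𝓝 0) :=
    hlim.congr fun n => integral_congr_ae (hXe.mono fun x hx => by simp [hU, hx])
  -- the limit is a minimizer since the tangent at `U` is continuous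
  have hJU : J U ≤ m := by
    have h1 := (tendsto_integral_inner_of_tendsto_rpow hp hZm hUm (iG hUm) hlimU).const_add
      (J U - ∫ x, inner ℝ (G U x) (U x) ∂μ)
    have h2 : Tendsto (fun n : ℕ => m + 1 / ((n : ℝ) + 1)) atTop (𝓝 (m + 0)) :=
      tendsto_one_div_add_atTop_nhds_zero_nat.const_add m
    have := le_of_tendsto_of_tendsto' h1 h2 fun n => ?_
    · linarith
    · have h3 := tangent hUm (hZm n)
      simp_rw [inner_sub_right] at h3
      rw [integral_sub (integrable_inner_of_memLp hp (hZm n) (iG hUm))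
        (integrable_inner_of_memLp hp hUm (iG hUm))] at h3
      linarith [hZJ n]
  -- one half of the Euler equation
  have half : ∀ Y ∈ K, 0 ≤ ∫ x, inner ℝ (G U x) (Y x) ∂μ := by
    intro Y hY
    have hYm := hK Y hY
    have hm' : ∀ t : ℝ, MemLp (U + t • Y) ofR(p) μ := fun t => hAm _ (line U hUA Y hY t)
    have hn : ∀ n : ℕ, (0 : ℝ) < 1 / ((n : ℝ) + 1) := fun n => by positivity
    have lim : Tendsto (fun n : ℕ => ∫ x, inner ℝ (G (U + (1 / ((n : ℝ) + 1)) • Y) x) (Y x) ∂μ)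
        atTop (𝓝 (∫ x, inner ℝ (G U x) (Y x) ∂μ)) := by
      refine tendsto_integral_of_dominated_convergence
        (fun x => c₁ * (‖‖U x‖ + ‖Y x‖‖ ^ (p - 1) * ‖Y x‖) + ‖F x‖ * ‖Y x‖)
        (fun n => (iG (hm' _)).1.inner hYm.1) ?_ (fun n => .of_forall fun x => ?_)
        (.of_forall fun x => ?_)
      · have := integrable_norm_mul_norm hp.symm
          (memLp_pFlux hp (hUm.norm.add hYm.norm)) hYm
        simp only [norm_pFlux hp.lt, Pi.add_apply] at this
        exact (this.const_mul _).add (integrable_norm_mul_norm hp.symm hF hYm)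
      · refine (norm_inner_le_norm _ _).trans ?_
        rw [← mul_assoc, ← add_mul]
        refine mul_le_mul_of_nonneg_right ((norm_sub_le _ _).trans (add_le_add ?_ le_rfl))
          (norm_nonneg _)
        rw [norm_smul, norm_pFlux hp.lt]
        refine mul_le_mul (hw₁' x) (Real.rpow_le_rpow (norm_nonneg _) ?_
          (sub_nonneg.2 hp.lt.le)) (by positivity) ((abs_nonneg _).trans (hw₁' x))
        rw [Real.norm_of_nonneg (by positivity : 0 ≤ ‖U x‖ + ‖Y x‖)]
        refine (norm_add_le _ _).trans (add_le_add le_rfl ?_)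
        rw [Pi.smul_apply, norm_smul, Real.norm_of_nonneg (hn n).le]
        refine mul_le_of_le_one_left (norm_nonneg _) ?_
        rw [div_le_one (by positivity)]
        linarith [n.cast_nonneg (α := ℝ)]
      · have h1 : Tendsto (fun n : ℕ => U x + (1 / ((n : ℝ) + 1)) • Y x) atTop (𝓝 (U x)) := by
          simpa using tendsto_const_nhds.add
            ((tendsto_one_div_add_atTop_nhds_zero_nat (𝕜 := ℝ)).smul_const (Y x))
        exact ((((continuous_pFlux hp.lt).tendsto _).comp h1).const_smul (w x)).sub_const (F x)
          |>.inner tendsto_const_nhds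
    refine ge_of_tendsto lim (.of_forall fun n => ?_)
    have h1 := tangent (hm' (1 / ((n : ℝ) + 1))) hUm
    have h2 := hJU.trans (hmle _ (line U hUA Y hY (1 / ((n : ℝ) + 1))))
    simp only [Pi.add_apply, Pi.smul_apply, sub_add_cancel_left, inner_neg_right,
      real_inner_smul_right, integral_neg, integral_const_mul] at h1
    exact nonneg_of_mul_nonneg_right (by linarith) (hn n)
  refine ⟨X, hXK, fun Y hY => ?_⟩
  have h1 := half (-Y) (K.neg_mem hY)
  simp only [Pi.neg_apply, inner_neg_right, integral_neg] at h1
  have h2 := le_antisymm (neg_nonneg.1 h1) (half Y hY)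
  simp only [hG, inner_sub_left, real_inner_smul_left] at h2
  rwa [integral_sub, sub_eq_zero] at h2
  · exact (integrable_inner_of_memLp hp (hK Y hY) (memLp_pFlux hp hUm)).bdd_mul hw
      (.of_forall hw₁')
  · exact integrable_inner_of_memLp hp (hK Y hY) hF

end Existence

/-! ### Calculus of weak derivatives -/

section WeakDeriv

/-- `φ` is a test function on `Ω`: smooth, with compact support contained in `Ω`. -/
structure IsTest {E : Type*} [NormedAddCommGroup E] [NormedSpace ℝ E] (Ω : Set E)
    (φ : E → ℝ) : Prop where
  smooth : Smooth φ
  compact : HasCompactSupport φ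
  subset : tsupport φ ⊆ Ω

variable {E : Type*} [NormedAddCommGroup E] [NormedSpace ℝ E]

theorem continuous_fderiv_apply {φ : E → ℝ} (h : Smooth φ) (e : E) :
    Continuous fun x => fderiv ℝ φ x e :=
  (h.continuous_fderiv (by simp)).clm_apply continuous_const

theorem contDiff_fderiv_apply {φ : E → ℝ} (h : Smooth φ) (e : E) :
    Smooth fun x => fderiv ℝ φ x e :=
  (h.fderiv_right (by simp)).clm_apply contDiff_const

theorem tsupport_fderiv_apply_subset (φ : E → ℝ) (e : E) :
    tsupport (fun x => fderiv ℝ φ x e) ⊆ tsupport φ := by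
  refine closure_minimal (fun x hx => ?_) (isClosed_tsupport φ)
  by_contra h
  have h0 : fderiv ℝ φ x = 0 := by
    have := (notMem_tsupport_iff_eventuallyEq.1 h).fderiv_eq (𝕜 := ℝ)
    rw [this]
    simp
  exact hx (by simp only [h0, zero_apply])

theorem IsTest.continuous {Ω : Set E} {φ : E → ℝ} (h : IsTest Ω φ) : Continuous φ :=
  h.smooth.continuous

theorem IsTest.fderiv_apply {Ω : Set E} {φ : E → ℝ} (h : IsTest Ω φ) (e : E) :
    IsTest Ω fun x => fderiv ℝ φ x e where
  smooth := contDiff_fderiv_apply h.smooth e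
  compact := HasCompactSupport.of_support_subset_isCompact h.compact
    ((subset_tsupport _).trans (tsupport_fderiv_apply_subset φ e))
  subset := (tsupport_fderiv_apply_subset φ e).trans h.subset

theorem IsTest.exists_norm_le {Ω : Set E} {φ : E → ℝ} (h : IsTest Ω φ) : ∃ C, ∀ x, ‖φ x‖ ≤ C :=
  h.continuous.bounded_above_of_compact_support h.compact

theorem IsTest.mono {Ω Ω' : Set E} (hΩ : Ω ⊆ Ω') {φ : E → ℝ} (h : IsTest Ω φ) : IsTest Ω' φ :=
  ⟨h.smooth, h.compact, h.subset.trans hΩ⟩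

theorem IsTest.eq_zero {Ω : Set E} {φ : E → ℝ} (h : IsTest Ω φ) {x : E} (hx : x ∉ Ω) : φ x = 0 :=
  image_eq_zero_of_notMem_tsupport fun h' => hx (h.subset h')

theorem IsTest.mul_left {Ω Ω' : Set E} {b φ : E → ℝ} (h : IsTest Ω φ)
    (hb : Smooth b) (hs : tsupport b ∩ Ω ⊆ Ω') :
    IsTest Ω' fun x => b x * φ x where
  smooth := hb.mul h.smooth
  compact := h.compact.mul_left
  subset := fun _ hx => hs ⟨tsupport_mul_subset_left hx, h.subset (tsupport_mul_subset_right hx)⟩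

theorem IsTest.add {Ω : Set E} {φ ψ : E → ℝ} (h : IsTest Ω φ) (h' : IsTest Ω ψ) :
    IsTest Ω fun x => φ x + ψ x where
  smooth := h.smooth.add h'.smooth
  compact := h.compact.add h'.compact
  subset := fun x hx => by
    rcases tsupport_add φ ψ hx with h1 | h1
    · exact h.subset h1
    · exact h'.subset h1

theorem IsTest.neg {Ω : Set E} {φ : E → ℝ} (h : IsTest Ω φ) : IsTest Ω fun x => -φ x where
  smooth := h.smooth.neg
  compact := h.compact.neg
  subset := (tsupport_neg φ).le.trans h.subset

theorem fderiv_mul_apply {b φ : E → ℝ} (hb : Smooth b)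
    (hφ : Smooth φ) (e x : E) :
    fderiv ℝ (fun x => b x * φ x) x e = b x * fderiv ℝ φ x e + fderiv ℝ b x e * φ x := by
  rw [fderiv_fun_mul (hb.differentiable (by simp) x) (hφ.differentiable (by simp) x)]
  simp only [add_apply, smul_apply, smul_eq_mul]
  ring

theorem IsTest.comp_affine {Ω : Set E} {φ : E → ℝ} {a : ℝ} (ha : a ≠ 0) (c : E)
    (h : IsTest ((fun y => a • y + c) ⁻¹' Ω) φ) : IsTest Ω fun x => φ (a⁻¹ • (x - c)) where
  smooth := h.smooth.comp ((contDiff_id.sub contDiff_const).const_smul _)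
  compact :=
    h.compact.comp_homeomorph
      ((Homeomorph.subRight c).trans (Homeomorph.smulOfNeZero a⁻¹ (inv_ne_zero ha)))
  subset := by
    intro x hx
    have h1 := h.subset (tsupport_comp_subset_preimage φ (f := fun x => a⁻¹ • (x - c))
      (by fun_prop) hx)
    simpa [smul_smul, mul_inv_cancel₀ ha] using h1

theorem fderiv_comp_affine {φ : E → ℝ} (hφ : Differentiable ℝ φ) (a : ℝ) (c x e : E) :
    fderiv ℝ (fun x => φ (a • (x - c))) x e = a * fderiv ℝ φ (a • (x - c)) e := by
  have h1 : HasFDerivAt (fun x : E => a • (x - c)) (a • ContinuousLinearMap.id ℝ E) x :=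
    ((hasFDerivAt_id x).sub_const c).const_smul a
  have h2 := (hφ (a • (x - c))).hasFDerivAt.comp x h1
  rw [show (fun x => φ (a • (x - c))) = φ ∘ fun x => a • (x - c) from rfl, h2.fderiv]
  simp

variable [MeasureSpace E]

theorem hasWeakDeriv_iff {Ω : Set E} {e : E} {w g : E → ℝ} :
    HasWeakDeriv Ω e w g ↔ ∀ φ, IsTest Ω φ →
      ∫ x in Ω, w x * fderiv ℝ φ x e = -∫ x in Ω, g x * φ x :=
  ⟨fun h φ hφ => h φ hφ.1 hφ.2 hφ.3, fun h φ h1 h2 h3 => h φ ⟨h1, h2, h3⟩⟩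

theorem setIntegral_mul_test {Ω : Set E} {φ : E → ℝ} (h : IsTest Ω φ) (w : E → ℝ) :
    ∫ x in Ω, w x * φ x = ∫ x, w x * φ x :=
  setIntegral_eq_integral_of_forall_compl_eq_zero fun x hx => by rw [h.eq_zero hx, mul_zero]

theorem hasWeakDeriv_iff_integral {Ω : Set E} {e : E} {w g : E → ℝ} :
    HasWeakDeriv Ω e w g ↔ ∀ φ, IsTest Ω φ →
      ∫ x, w x * fderiv ℝ φ x e = -∫ x, g x * φ x := by
  rw [hasWeakDeriv_iff]
  refine forall₂_congr fun φ hφ => ?_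
  rw [setIntegral_mul_test (hφ.fderiv_apply e), setIntegral_mul_test hφ]

theorem HasWeakDeriv.mono {Ω Ω' : Set E} {e : E} {w g : E → ℝ} (h : HasWeakDeriv Ω' e w g)
    (hΩ : Ω ⊆ Ω') : HasWeakDeriv Ω e w g :=
  hasWeakDeriv_iff_integral.2 fun φ hφ => hasWeakDeriv_iff_integral.1 h φ (hφ.mono hΩ)

theorem HasWeakDeriv.congr_ae {Ω : Set E} {e : E} {w g w' g' : E → ℝ} (h : HasWeakDeriv Ω e w g)
    (hw : w =ᵐ[vol[Ω]] w') (hg : g =ᵐ[vol[Ω]] g') :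
    HasWeakDeriv Ω e w' g' := hasWeakDeriv_iff.2 fun φ hφ => by
  have e1 : ∫ x in Ω, w' x * fderiv ℝ φ x e = ∫ x in Ω, w x * fderiv ℝ φ x e :=
    integral_congr_ae (hw.mono fun x hx => by simp only [hx])
  have e2 : ∫ x in Ω, g' x * φ x = ∫ x in Ω, g x * φ x :=
    integral_congr_ae (hg.mono fun x hx => by simp only [hx])
  rw [e1, e2]
  exact hasWeakDeriv_iff.1 h φ hφ

theorem HasWeakDeriv.const_mul {Ω : Set E} {e : E} {w g : E → ℝ} (h : HasWeakDeriv Ω e w g)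
    (c : ℝ) : HasWeakDeriv Ω e (fun x => c * w x) (fun x => c * g x) :=
  hasWeakDeriv_iff.2 fun φ hφ => by
    simp_rw [mul_assoc]
    rw [integral_const_mul, integral_const_mul, hasWeakDeriv_iff.1 h φ hφ, mul_neg]

theorem HasWeakDeriv.of_tendsto {Ω : Set E} {e : E} {w g : ℕ → E → ℝ} {w' g' : E → ℝ}
    (h : ∀ n, HasWeakDeriv Ω e (w n) (g n))
    (hw : ∀ φ, IsTest Ω φ → Tendsto (fun n => ∫ x in Ω, w n x * φ x) atTop
      (𝓝 (∫ x in Ω, w' x * φ x)))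
    (hg : ∀ φ, IsTest Ω φ → Tendsto (fun n => ∫ x in Ω, g n x * φ x) atTop
      (𝓝 (∫ x in Ω, g' x * φ x))) :
    HasWeakDeriv Ω e w' g' :=
  hasWeakDeriv_iff.2 fun φ hφ =>
    tendsto_nhds_unique (hw _ (hφ.fderiv_apply e))
      ((hg φ hφ).neg.congr fun n => (hasWeakDeriv_iff.1 (h n) φ hφ).symm)

variable [BorelSpace E]

theorem IsTest.integrable_mul {Ω : Set E} {w φ : E → ℝ} (h : IsTest Ω φ)
    (hw : LocallyIntegrableOn w Ω) : Integrable fun x => w x * φ x := by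
  have h1 : IntegrableOn (fun x => w x * φ x) (tsupport φ) :=
    (hw.integrableOn_compact_subset h.subset h.compact.isCompact).mul_continuousOn
      h.continuous.continuousOn h.compact.isCompact
  refine (integrableOn_iff_integrable_of_support_subset fun x hx => ?_).1 h1
  by_contra hx'
  exact hx (by simp only [image_eq_zero_of_notMem_tsupport hx', mul_zero])

theorem HasWeakDeriv.add {Ω : Set E} {e : E} {w g w' g' : E → ℝ} (h : HasWeakDeriv Ω e w g)
    (h' : HasWeakDeriv Ω e w' g') (hw : LocallyIntegrableOn w Ω) (hg : LocallyIntegrableOn g Ω)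
    (hw' : LocallyIntegrableOn w' Ω) (hg' : LocallyIntegrableOn g' Ω) :
    HasWeakDeriv Ω e (fun x => w x + w' x) (fun x => g x + g' x) :=
  hasWeakDeriv_iff_integral.2 fun φ hφ => by
    simp_rw [add_mul]
    rw [integral_add ((hφ.fderiv_apply e).integrable_mul hw)
      ((hφ.fderiv_apply e).integrable_mul hw'), integral_add (hφ.integrable_mul hg)
      (hφ.integrable_mul hg'), hasWeakDeriv_iff_integral.1 h φ hφ,
      hasWeakDeriv_iff_integral.1 h' φ hφ, neg_add]

/-- The product rule for a smooth function `b` and a Sobolev function `w`. It suffices that `w` has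
a weak derivative on a set `Ω'` that contains the part of `Ω` where `b` lives. -/
theorem HasWeakDeriv.mul_smooth {Ω Ω' : Set E} {e : E} {w g b : E → ℝ}
    (h : HasWeakDeriv Ω' e w g) (hw : LocallyIntegrableOn w Ω') (hg : LocallyIntegrableOn g Ω')
    (hb : Smooth b) (hs : tsupport b ∩ Ω ⊆ Ω') :
    HasWeakDeriv Ω e (fun x => b x * w x) (fun x => b x * g x + fderiv ℝ b x e * w x) :=
  hasWeakDeriv_iff_integral.2 fun φ hφ => by
    have t := hφ.mul_left hb hs
    have t' := hφ.mul_left (contDiff_fderiv_apply hb e)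
      ((inter_subset_inter_left _ (tsupport_fderiv_apply_subset b e)).trans hs)
    have h1 := hasWeakDeriv_iff_integral.1 h _ t
    have e1 : ∀ x, b x * w x * fderiv ℝ φ x e =
        w x * fderiv ℝ (fun x => b x * φ x) x e - w x * (fderiv ℝ b x e * φ x) := fun x => by
      rw [fderiv_mul_apply hb hφ.smooth]
      ring
    have e2 : ∀ x, (b x * g x + fderiv ℝ b x e * w x) * φ x =
        g x * (b x * φ x) + w x * (fderiv ℝ b x e * φ x) := fun x => by ring
    simp_rw [e1, e2]
    rw [integral_sub ((t.fderiv_apply e).integrable_mul hw) (t'.integrable_mul hw),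
      integral_add (t.integrable_mul hg) (t'.integrable_mul hw), h1]
    ring

theorem IsTest.integrable [IsFiniteMeasureOnCompacts (volume : Measure E)] {Ω : Set E} {φ : E → ℝ}
    (h : IsTest Ω φ) : Integrable φ :=
  h.continuous.integrable_of_hasCompactSupport h.compact

theorem IsTest.memLp [IsFiniteMeasureOnCompacts (volume : Measure E)] {Ω : Set E} {φ : E → ℝ}
    (h : IsTest Ω φ) (p : ENNReal) (s : Set E) : MemLp φ p vol[s] :=
  (h.continuous.memLp_of_hasCompactSupport h.compact).restrict s

variable [FiniteDimensional ℝ E] [(volume : Measure E).IsAddHaarMeasure]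

theorem locallyIntegrableOn_of_memLp {F : Type*} [NormedAddCommGroup F] {Ω : Set E} {p : ℝ}
    (hp : 1 ≤ p) {w : E → F} (h : MemLp w ofR(p) vol[Ω]) :
    LocallyIntegrableOn w Ω :=
  locallyIntegrableOn_of_locallyIntegrable_restrict (h.locallyIntegrable (by simpa using hp))

theorem integral_fderiv_test {Ω : Set E} {φ : E → ℝ} (h : IsTest Ω φ) (e : E) :
    ∫ x, fderiv ℝ φ x e = 0 := by
  have := integral_mul_fderiv_eq_neg_fderiv_mul_of_integrable (μ := (volume : Measure E))
    (f := fun _ => (1 : ℝ)) (g := φ) (v := e) (by simp) (by simpa using (h.fderiv_apply e).integrable)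
    (by simpa using h.integrable)
    (fun x _ => differentiableAt_const _) (fun x _ => h.smooth.differentiable (by simp) x)
  simpa using this

theorem hasWeakDeriv_of_contDiff {Ω : Set E} {e : E} {w : E → ℝ}
    (hw : Smooth w) :
    HasWeakDeriv Ω e w (fun x => fderiv ℝ w x e) :=
  hasWeakDeriv_iff_integral.2 fun φ hφ => by
    have t : IsTest Ω fun x => w x * φ x := hφ.mul_left hw inter_subset_right
    have h0 := integral_fderiv_test t e
    simp_rw [fderiv_mul_apply hw hφ.smooth] at h0
    have li : LocallyIntegrableOn w Ω := hw.continuous.locallyIntegrable.locallyIntegrableOn _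
    have li' : LocallyIntegrableOn (fun x => fderiv ℝ w x e) Ω :=
      (continuous_fderiv_apply hw e).locallyIntegrable.locallyIntegrableOn _
    rw [integral_add ((hφ.fderiv_apply e).integrable_mul li) (hφ.integrable_mul li')] at h0
    linarith

/-- Change of variables `x = a y + c` in weak derivatives. -/
theorem HasWeakDeriv.comp_affine {Ω : Set E} {e : E} {w g : E → ℝ} (h : HasWeakDeriv Ω e w g)
    {a : ℝ} (ha : a ≠ 0) (c : E) :
    HasWeakDeriv ((fun y => a • y + c) ⁻¹' Ω) e (fun y => w (a • y + c))
      (fun y => a * g (a • y + c)) :=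
  hasWeakDeriv_iff_integral.2 fun φ hφ => by
    have cv : ∀ f : E → ℝ, ∫ y, f (a • y + c) =
        |(a ^ Module.finrank ℝ E)⁻¹| * ∫ x, f x := fun f => by
      rw [Measure.integral_comp_smul volume (fun y => f (y + c)) a, smul_eq_mul,
        integral_add_right_eq_self (fun y => f y) c]
    have h1 := hasWeakDeriv_iff_integral.1 h _ (hφ.comp_affine ha)
    simp_rw [fderiv_comp_affine (hφ.smooth.differentiable (by simp))] at h1
    have e1 := cv fun x => w x * (a⁻¹ * fderiv ℝ φ (a⁻¹ • (x - c)) e)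
    have e2 := cv fun x => g x * φ (a⁻¹ • (x - c))
    simp only [add_sub_cancel_right, smul_smul, inv_mul_cancel₀ ha, one_smul] at e1 e2
    rw [h1, mul_neg, ← e2] at e1
    have e3 : ∀ y, w (a • y + c) * (a⁻¹ * fderiv ℝ φ y e) =
      a⁻¹ * (w (a • y + c) * fderiv ℝ φ y e) := fun y => by ring
    simp_rw [e3] at e1
    rw [integral_const_mul] at e1
    simp_rw [mul_assoc a]
    rw [integral_const_mul]
    field_simp at e1
    linarith

end WeakDeriv

/-! ### Vertical averages of Sobolev functions -/

section Vertical

/-- The set of the points between the graph of `Γ` and the axis, over `I`. -/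
def subgraph (I : Set ℝ) (Γ : ℝ → ℝ) : Set ℝ² := {z | z.1 ∈ I ∧ 0 < z.2 ∧ z.2 < Γ z.1}

theorem isOpen_subgraph {I : Set ℝ} {Γ : ℝ → ℝ} (hI : IsOpen I) (hΓ : Continuous Γ) :
    IsOpen (subgraph I Γ) :=
  (hI.preimage continuous_fst).inter ((isOpen_lt continuous_const continuous_snd).inter
    (isOpen_lt continuous_snd (hΓ.comp continuous_fst)))

/-- A smooth probability density with compact support in `(0, h)`. -/
structure IsDensity (h : ℝ) (ρ : ℝ → ℝ) : Prop where
  test : IsTest (Ioo 0 h) ρ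
  nonneg : ∀ t, 0 ≤ ρ t
  integral_eq_one : ∫ t, ρ t = 1

theorem exists_isDensity {h : ℝ} (hh : 0 < h) : ∃ ρ, IsDensity h ρ := by
  let f : ContDiffBump (h / 2) := ⟨h / 8, h / 4, by positivity, by linarith⟩
  refine ⟨f.normed volume, ⟨f.contDiff_normed, f.hasCompactSupport_normed, ?_⟩,
    f.nonneg_normed, f.integral_normed⟩
  rw [f.tsupport_normed_eq, Real.closedBall_eq_Icc]
  intro x hx
  have h1 : f.rOut = h / 4 := rfl
  rw [h1] at hx
  constructor <;> linarith [hx.1, hx.2]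

theorem hasDerivAt_integral_Iic {f : ℝ → ℝ} (hf : Continuous f) (hi : Integrable f) (y : ℝ) :
    HasDerivAt (fun y => ∫ s in Iic y, f s) (f y) y := by
  have h1 : HasDerivAt (fun y => (∫ s in (0 : ℝ)..y, f s) + ∫ s in Iic 0, f s) (f y) y :=
    (intervalIntegral.integral_hasDerivAt_right (hf.intervalIntegrable _ _)
      (hf.stronglyMeasurableAtFilter _ _) hf.continuousAt).add_const _
  refine h1.congr_of_eventuallyEq (.of_forall fun z => ?_)
  simp only
  rw [← intervalIntegral.integral_Iic_sub_Iic hi.integrableOn hi.integrableOn, sub_add_cancel]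

theorem contDiff_primitive {f : ℝ → ℝ} (hf : Smooth f) (hi : Integrable f) :
    Smooth fun y => ∫ s in Iic y, f s := by
  have h := hasDerivAt_integral_Iic hf.continuous hi
  rw [contDiff_infty_iff_deriv, funext fun y => (h y).deriv]
  exact ⟨fun y => (h y).differentiableAt, hf⟩

/-- The primitive `∫_{-∞}^y h(x, s) ds` of a test function is smooth. -/
theorem contDiff_integral_Iic {h : ℝ² → ℝ} (hs : Smooth h)
    (hc : HasCompactSupport h) :
    Smooth fun z : ℝ² => ∫ s in Iic z.2, h (z.1, s) := by
  have hk : IsCompact (Prod.snd '' tsupport h) := hc.isCompact.image continuous_snd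
  have h1 := contDiffOn_convolution_right_with_param (𝕜 := ℝ) (μ := (volume : Measure ℝ))
    (f := (Ici (0 : ℝ)).indicator fun _ => (1 : ℝ)) (n := ⊤) (ContinuousLinearMap.mul ℝ ℝ)
    (g := fun x s => h (x, s)) (s := (univ : Set ℝ)) isOpen_univ hk
    (fun x s _ hs => by
      by_contra h0
      exact hs ⟨(x, s), subset_tsupport _ h0, rfl⟩)
    ((locallyIntegrable_const (1 : ℝ)).indicator measurableSet_Ici) hs.contDiffOn
  rw [univ_prod_univ, contDiffOn_univ] at h1
  refine contDiffOn_univ.1 ((contDiffOn_univ.2 h1).congr fun z _ => ?_)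
  symm
  rw [convolution_def, ← integral_sub_left_eq_self _ volume z.2, ← integral_indicator
    measurableSet_Iic]
  congr 1
  ext t
  simp only [ContinuousLinearMap.mul_apply', sub_sub_cancel, indicator, mem_Iic, mem_Ici,
    sub_nonneg]
  split_ifs <;> simp

theorem contDiff_integral_snd {h : ℝ² → ℝ} (hs : Smooth h)
    (hc : HasCompactSupport h) :
    Smooth fun x : ℝ => ∫ s, h (x, s) := by
  obtain ⟨M, hM⟩ : ∃ M, ∀ z ∈ tsupport h, z.2 ≤ M := by
    obtain ⟨M, hM⟩ := (hc.isCompact.image continuous_snd).bddAbove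
    exact ⟨M, fun z hz => hM ⟨z, hz, rfl⟩⟩
  have h1 := (contDiff_integral_Iic hs hc).comp (contDiff_id.prodMk (contDiff_const (c := M)))
  refine contDiffOn_univ.1 ((contDiffOn_univ.2 h1).congr fun x _ => ?_)
  simp only [Function.comp_apply, id]
  symm
  refine setIntegral_eq_integral_of_forall_compl_eq_zero fun s hs => ?_
  by_contra h0
  exact hs (hM (x, s) (subset_tsupport _ h0))

theorem integrable_slice {h : ℝ² → ℝ} (hs : Continuous h)
    (hc : HasCompactSupport h) (x : ℝ) : Integrable fun s => h (x, s) := by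
  refine (hs.comp (Continuous.prodMk_right x)).integrable_of_hasCompactSupport ?_
  refine HasCompactSupport.of_support_subset_isCompact (hc.isCompact.image continuous_snd) ?_
  exact fun s hs => ⟨(x, s), subset_tsupport _ hs, rfl⟩

/-- The vertical primitive of `h(x, y) - ρ(y) ∫ h(x, s) ds`. -/
def verticalPrimitive (ρ : ℝ → ℝ) (h : ℝ² → ℝ) (z : ℝ²) : ℝ :=
  (∫ s in Iic z.2, h (z.1, s)) - (∫ t in Iic z.2, ρ t) * ∫ s, h (z.1, s)

theorem isTest_vertical_primitive {I : Set ℝ} {Γ : ℝ → ℝ} {h₀ : ℝ} (hΓ : ∀ x, h₀ ≤ Γ x)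
    {ρ : ℝ → ℝ} (hρ : IsDensity h₀ ρ) {h : ℝ² → ℝ} (hh : IsTest (subgraph I Γ) h) :
    IsTest (subgraph I Γ) (verticalPrimitive ρ h) := by
  have hsm : Smooth (verticalPrimitive ρ h) :=
    (contDiff_integral_Iic hh.smooth hh.compact).sub
      (((contDiff_primitive hρ.test.smooth hρ.test.integrable).comp contDiff_snd).mul
        ((contDiff_integral_snd hh.smooth hh.compact).comp contDiff_fst))
  have hρne : (tsupport ρ).Nonempty := by
    by_contra h0
    rw [not_nonempty_iff_eq_empty, tsupport_eq_empty_iff] at h0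
    have := hρ.integral_eq_one
    simp [h0] at this
  set S : Set ℝ := Prod.snd '' tsupport h ∪ tsupport ρ with hS
  have hSc : IsCompact S :=
    (hh.compact.isCompact.image continuous_snd).union hρ.test.compact.isCompact
  have hSne : S.Nonempty := hρne.mono subset_union_right
  have hc0 : 0 < sInf S := by
    rcases hSc.sInf_mem hSne with ⟨z, hz, h1⟩ | h1
    · rw [← h1]
      exact (hh.subset hz).2.1
    · exact (hρ.test.subset h1).1
  have hcle : ∀ s ∈ S, sInf S ≤ s := fun s hs => csInf_le hSc.bddBelow hs
  have hleM : ∀ s ∈ S, s ≤ sSup S := fun s hs => le_csSup hSc.bddAbove hs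
  set c := sInf S
  set M := sSup S
  set d := sSup (tsupport ρ)
  have hd : d ∈ tsupport ρ := hρ.test.compact.isCompact.sSup_mem hρne
  have hdle : ∀ t ∈ tsupport ρ, t ≤ d := fun t ht =>
    le_csSup hρ.test.compact.isCompact.bddAbove ht
  set Kt : Set ℝ² := tsupport h ∪ (Prod.fst '' tsupport h) ×ˢ {d} with hKt
  have hKtc : IsCompact Kt := hh.compact.isCompact.union
    ((hh.compact.isCompact.image continuous_fst).prod isCompact_singleton)
  set K' : Set ℝ² := (fun q : ℝ² × ℝ => (q.1.1, q.2)) ''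
    ((Kt ×ˢ Icc c M) ∩ {q | q.2 ≤ q.1.2}) with hK'
  have hK'c : IsCompact K' := by
    refine IsCompact.image ((hKtc.prod isCompact_Icc).inter_right
      (isClosed_le continuous_snd (continuous_snd.comp continuous_fst))) (by fun_prop)
  have hK'sub : K' ⊆ subgraph I Γ := by
    rintro _ ⟨⟨⟨x, y'⟩, y⟩, ⟨⟨h1, h2⟩, h3⟩, rfl⟩
    simp only [mem_ofPred_eq] at h3
    refine ⟨?_, hc0.trans_le h2.1, ?_⟩
    · rcases h1 with h1 | ⟨⟨z, hz, h1⟩, _⟩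
      · exact (hh.subset h1).1
      · simp only at h1 ⊢
        rw [← h1]
        exact (hh.subset hz).1
    · simp only
      rcases h1 with h1 | ⟨_, h1⟩
      · exact h3.trans_lt (hh.subset h1).2.2
      · simp only [mem_singleton_iff] at h1
        exact (h3.trans_lt (h1 ▸ (hρ.test.subset hd).2)).trans_le (hΓ _)
  have hsupp : Function.support (verticalPrimitive ρ h) ⊆ K' := by
    rintro ⟨x, y⟩ hz
    by_contra hn
    refine hz ?_
    rw [verticalPrimitive]
    simp only
    by_cases hx : x ∈ Prod.fst '' tsupport h
    · rcases lt_or_ge y c with hy | hy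
      · have e1 : ∫ s in Iic y, h (x, s) = 0 :=
          setIntegral_eq_zero_of_forall_eq_zero fun s hs => by
            by_contra h0
            exact (hcle s (Or.inl ⟨(x, s), subset_tsupport _ h0, rfl⟩)).not_gt
              (lt_of_le_of_lt hs hy)
        have e2 : ∫ t in Iic y, ρ t = 0 :=
          setIntegral_eq_zero_of_forall_eq_zero fun s hs => by
            by_contra h0
            exact (hcle s (Or.inr (subset_tsupport _ h0))).not_gt (lt_of_le_of_lt hs hy)
        rw [e1, e2, zero_mul, sub_zero]
      · have key : ∀ y', (x, y') ∈ Kt → y' < y := by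
          intro y' hy'
          by_contra hlt
          rw [not_lt] at hlt
          refine hn ⟨((x, y'), y), ⟨⟨hy', hy, ?_⟩, hlt⟩, rfl⟩
          refine hlt.trans (hleM _ ?_)
          rcases hy' with h1 | ⟨_, h1⟩
          · exact Or.inl ⟨_, h1, rfl⟩
          · simp only [mem_singleton_iff] at h1
            exact Or.inr (h1 ▸ hd)
        have e1 : ∫ s in Iic y, h (x, s) = ∫ s, h (x, s) :=
          setIntegral_eq_integral_of_forall_compl_eq_zero fun s hs => by
            by_contra h0
            exact hs (key s (Or.inl (subset_tsupport _ h0))).le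
        have e2 : ∫ t in Iic y, ρ t = 1 := by
          rw [← hρ.integral_eq_one]
          refine setIntegral_eq_integral_of_forall_compl_eq_zero fun s hs => ?_
          by_contra h0
          exact hs ((hdle s (subset_tsupport _ h0)).trans (key d (Or.inr ⟨hx, rfl⟩)).le)
        rw [e1, e2, one_mul, sub_self]
    · have e : ∀ s, h (x, s) = 0 := fun s => by
        by_contra h0
        exact hx ⟨(x, s), subset_tsupport _ h0, rfl⟩
      simp [e]
  exact ⟨hsm, HasCompactSupport.of_support_subset_isCompact hK'c hsupp,
    (closure_minimal hsupp hK'c.isClosed).trans hK'sub⟩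

end Vertical

section Vertical2

theorem locallyIntegrable_comp_fst {b : ℝ → ℝ} (hb : Integrable b) :
    LocallyIntegrable fun z : ℝ² => b z.1 := by
  rw [locallyIntegrable_iff]
  intro k hk
  obtain ⟨R, hR⟩ := (hk.image continuous_snd).isBounded.subset_closedBall (0 : ℝ)
  have h1 : Integrable (fun z : ℝ² => b z.1 *
      (Metric.closedBall (0 : ℝ) R).indicator (fun _ => (1 : ℝ)) z.2) :=
    hb.mul_prod ((integrable_indicator_iff measurableSet_closedBall).2
      (integrableOn_const (measure_closedBall_lt_top.ne)))
  refine (h1.integrableOn (s := k)).congr_fun_ae ?_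
  filter_upwards [ae_restrict_mem hk.measurableSet] with z hz
  rw [indicator_of_mem (hR ⟨z, hz, rfl⟩), mul_one]

theorem ae_comp_fst {P : ℝ → Prop} (h : ∀ᵐ x, P x) : ∀ᵐ z : ℝ², P z.1 :=
  Measure.quasiMeasurePreserving_fst.ae h

theorem IsDensity.integral_Iic_mem {h₀ : ℝ} {ρ : ℝ → ℝ} (hρ : IsDensity h₀ ρ) (y : ℝ) :
    (∫ t in Iic y, ρ t) ∈ Icc (0 : ℝ) 1 :=
  ⟨setIntegral_nonneg measurableSet_Iic fun t _ => hρ.nonneg t,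
    (setIntegral_le_integral hρ.test.integrable (.of_forall hρ.nonneg)).trans hρ.integral_eq_one.le⟩

theorem fderiv_vertical_primitive {I : Set ℝ} {Γ : ℝ → ℝ} {h₀ : ℝ} (hΓ : ∀ x, h₀ ≤ Γ x)
    {ρ : ℝ → ℝ} (hρ : IsDensity h₀ ρ) {h : ℝ² → ℝ} (hh : IsTest (subgraph I Γ) h)
    (z : ℝ²) :
    fderiv ℝ (verticalPrimitive ρ h) z (0, 1) = h z - ρ z.2 * ∫ s, h (z.1, s) := by
  set H := verticalPrimitive ρ h with hH
  have hd := ((isTest_vertical_primitive hΓ hρ hh).smooth.differentiable (by simp) z).hasFDerivAt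
  have hl : HasDerivAt (fun y : ℝ => (z.1, y)) ((0 : ℝ), (1 : ℝ)) z.2 :=
    (hasDerivAt_const _ _).prodMk (hasDerivAt_id _)
  have h1 : HasDerivAt (fun y => H (z.1, y)) (fderiv ℝ H z (0, 1)) z.2 :=
    HasFDerivAt.comp_hasDerivAt (l := H) z.2 (f := fun y => (z.1, y)) hd hl
  have h2 : HasDerivAt (fun y => H (z.1, y)) (h (z.1, z.2) - ρ z.2 * ∫ s, h (z.1, s)) z.2 :=
    (hasDerivAt_integral_Iic (hh.continuous.comp (Continuous.prodMk_right z.1))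
      (integrable_slice hh.continuous hh.compact z.1) z.2).sub
      ((hasDerivAt_integral_Iic hρ.test.continuous hρ.test.integrable z.2).mul_const
        (∫ s, h (z.1, s)))
  exact h1.unique h2

theorem integral_indicator_mul {E : Type*} [MeasureSpace E] {Ω : Set E} (hΩ : MeasurableSet Ω)
    (w f : E → ℝ) : ∫ z, Ω.indicator w z * f z = ∫ z in Ω, w z * f z := by
  rw [← integral_indicator hΩ]
  congr 1
  ext z
  by_cases hz : z ∈ Ω <;> simp [hz]

/-- A Sobolev function differs from its vertical averages at most by the integral of its vertical
derivative. The proof tests the weak derivative with vertical primitives. -/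
theorem abs_sub_vertical_average_le {I : Set ℝ} {Γ : ℝ → ℝ} {h₀ : ℝ} (hI : IsOpen I)
    (hΓc : Continuous Γ) (hΓ : ∀ x, h₀ ≤ Γ x) {ρ : ℝ → ℝ} (hρ : IsDensity h₀ ρ)
    {w g : ℝ² → ℝ} (hw : IntegrableOn w (subgraph I Γ)) (hg : IntegrableOn g (subgraph I Γ))
    (hD : HasWeakDeriv (subgraph I Γ) (0, 1) w g) :
    ∀ᵐ z, z ∈ subgraph I Γ →
      |w z - ∫ t, ρ t * w (z.1, t)| ≤ ∫ y in Ioo 0 (Γ z.1), |g (z.1, y)| := by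
  set Ω := subgraph I Γ with hΩ
  have hΩo : IsOpen Ω := isOpen_subgraph hI hΓc
  set W := Ω.indicator w with hW
  set Gf := Ω.indicator g with hGf
  have iW : Integrable W := (integrable_indicator_iff hΩo.measurableSet).2 hw
  have iG : Integrable Gf := (integrable_indicator_iff hΩo.measurableSet).2 hg
  set R : ℝ → ℝ := fun y => ∫ t in Iic y, ρ t with hR
  have hRc : Continuous R := continuous_iff_continuousAt.2 fun y =>
    (hasDerivAt_integral_Iic hρ.test.continuous hρ.test.integrable y).continuousAt
  -- `∂₂w` integrated against the kernel `k s` gives the average of `w` minus `w(·, s)`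
  set k : ℝ → ℝ → ℝ := fun s y => (if s ≤ y then 1 else 0) - R y with hk
  have hk1 : ∀ s y, ‖k s y‖ ≤ 1 := fun s y => by
    have := hρ.integral_Iic_mem y
    simp only [hk, Real.norm_eq_abs, abs_le]
    split_ifs <;> constructor <;> linarith [this.1, this.2]
  have hkm : Measurable fun q : ℝ² => k q.1 q.2 :=
    (Measurable.ite (measurableSet_le measurable_fst measurable_snd) measurable_const
      measurable_const).sub (hRc.measurable.comp measurable_snd)
  obtain ⟨Cρ, hCρ⟩ := hρ.test.exists_norm_le
  set A : ℝ → ℝ := fun x => ∫ t, ρ t * W (x, t) with hA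
  have iρW : Integrable (fun z : ℝ² => ρ z.2 * W z) :=
    iW.bdd_mul (hρ.test.continuous.comp continuous_snd).aestronglyMeasurable
      (.of_forall fun z => hCρ z.2)
  have iA : Integrable A := iρW.integral_prod_left
  set b : ℝ → ℝ := fun x => ∫ y, ‖Gf (x, y)‖ with hb
  have ib : Integrable b := iG.norm.integral_prod_left
  set B : ℝ² → ℝ := fun z => ∫ y, Gf (z.1, y) * k z.2 y with hB
  have hsl : ∀ᵐ x, Integrable fun y => Gf (x, y) := iG.prod_right_ae
  have hBb : ∀ᵐ z, ‖B z‖ ≤ b z.1 := by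
    filter_upwards [ae_comp_fst hsl] with z hz
    refine norm_integral_le_of_norm_le hz.norm (.of_forall fun y => ?_)
    rw [norm_mul]
    exact mul_le_of_le_one_right (norm_nonneg _) (hk1 _ _)
  have mB : AEStronglyMeasurable B := by
    have h1 : AEStronglyMeasurable (fun q : ℝ² × ℝ => Gf (q.1.1, q.2))
        ((volume : Measure ℝ²).prod volume) :=
      iG.1.comp_quasiMeasurePreserving
        (QuasiMeasurePreserving.prodMap Measure.quasiMeasurePreserving_fst
          (Measure.QuasiMeasurePreserving.id volume))
    have h2 : AEStronglyMeasurable (fun q : ℝ² × ℝ => k q.1.2 q.2)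
        ((volume : Measure ℝ²).prod volume) :=
      (hkm.comp ((measurable_snd.comp measurable_fst).prodMk measurable_snd)).aestronglyMeasurable
    exact (h1.mul h2).integral_prod_right'
  have lB : LocallyIntegrable B := by
    refine (locallyIntegrable_comp_fst ib).mono mB ?_
    filter_upwards [hBb] with z hz
    exact hz.trans (le_abs_self _)
  have lA : LocallyIntegrable fun z : ℝ² => A z.1 := locallyIntegrable_comp_fst iA
  have lW : LocallyIntegrable W := iW.locallyIntegrable
  have key := hΩo.ae_eq_zero_of_integral_contDiff_smul_eq_zero
    (f := fun z => W z - A z.1 + B z) (μ := volume)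
    (((lW.sub lA).add lB).locallyIntegrableOn _) (fun h h1 h2 h3 => ?_)
  · filter_upwards [key, hBb] with z h1 h2 hz
    have h4 : A z.1 = ∫ t, ρ t * w (z.1, t) := by
      refine integral_congr_ae (.of_forall fun t => ?_)
      simp only
      by_cases ht : ρ t = 0
      · simp [ht]
      · have ht' := hρ.test.subset (subset_tsupport _ ht)
        have : (z.1, t) ∈ Ω := ⟨hz.1, ht'.1, ht'.2.trans_le (hΓ _)⟩
        rw [hW, indicator_of_mem this]
    have h5 : b z.1 = ∫ y in Ioo 0 (Γ z.1), |g (z.1, y)| := by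
      rw [hb, ← integral_indicator measurableSet_Ioo]
      refine integral_congr_ae (.of_forall fun y => ?_)
      simp only [hGf, indicator, mem_Ioo, Real.norm_eq_abs]
      by_cases hy : 0 < y ∧ y < Γ z.1
      · have : (z.1, y) ∈ Ω := ⟨hz.1, hy⟩
        simp [this, hy]
      · have : (z.1, y) ∉ Ω := fun h => hy h.2
        simp [this, hy]
    have h6 := h1 hz
    rw [hW, indicator_of_mem hz, h4] at h6
    rw [← h5, show w z - ∫ t, ρ t * w (z.1, t) = -B z by linarith, abs_neg]
    exact h2
  · have hh : IsTest Ω h := ⟨h1, h2, h3⟩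
    set m : ℝ → ℝ := fun x => ∫ s, h (x, s) with hm
    set H := verticalPrimitive ρ h with hH
    have tH : IsTest Ω H := isTest_vertical_primitive hΓ hρ hh
    have dH : ∀ z, fderiv ℝ H z (0, 1) = h z - ρ z.2 * m z.1 :=
      fderiv_vertical_primitive hΓ hρ hh
    have e0 := hasWeakDeriv_iff.1 hD H tH
    rw [← integral_indicator_mul hΩo.measurableSet, ← integral_indicator_mul hΩo.measurableSet]
      at e0
    have lWΩ := lW.locallyIntegrableOn Ω
    have i1 : Integrable fun z => W z * h z := hh.integrable_mul lWΩ
    have i2 : Integrable fun z => W z * fderiv ℝ H z (0, 1) :=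
      (tH.fderiv_apply _).integrable_mul lWΩ
    have i3 : Integrable fun z => A z.1 * h z := hh.integrable_mul (lA.locallyIntegrableOn Ω)
    have i4 : Integrable fun z => B z * h z := hh.integrable_mul (lB.locallyIntegrableOn Ω)
    have i5 : Integrable fun z : ℝ² => W z * (ρ z.2 * m z.1) :=
      (i1.sub i2).congr (.of_forall fun z => by simp only [Pi.sub_apply, dH]; ring)
    have e2 : ∫ z, A z.1 * h z = ∫ z : ℝ², W z * (ρ z.2 * m z.1) := by
      rw [Measure.volume_eq_prod, integral_prod _ i3, integral_prod _ i5]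
      congr 1
      ext x
      simp only
      rw [integral_const_mul]
      simp only [hA]
      rw [← integral_mul_const]
      congr 1
      ext t
      simp only [hm]
      ring
    have e3 : ∫ z, B z * h z = ∫ z, Gf z * H z := by
      rw [Measure.volume_eq_prod, integral_prod _ i4,
        integral_prod _ (tH.integrable_mul (iG.locallyIntegrable.locallyIntegrableOn Ω))]
      refine integral_congr_ae ?_
      filter_upwards [hsl] with x hx
      have sw : Integrable (Function.uncurry fun s y => h (x, s) * (Gf (x, y) * k s y))
          (volume.prod volume) := by
        have := ((integrable_slice hh.continuous hh.compact x).mul_prod hx).bdd_mul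
          (hkm.aestronglyMeasurable (μ := volume.prod volume)) (.of_forall fun q => hk1 q.1 q.2)
        refine this.congr (.of_forall fun q => ?_)
        simp only [Function.uncurry]
        ring
      calc ∫ s, B (x, s) * h (x, s) = ∫ s, ∫ y, h (x, s) * (Gf (x, y) * k s y) := by
            congr 1
            ext s
            rw [integral_const_mul, mul_comm]
        _ = ∫ y, ∫ s, h (x, s) * (Gf (x, y) * k s y) := integral_integral_swap sw
        _ = ∫ y, Gf (x, y) * H (x, y) := by
            congr 1
            ext y
            have i6 := integrable_slice hh.continuous hh.compact x
            have e4 : ∀ s, h (x, s) * (Gf (x, y) * k s y) =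
                Gf (x, y) * ((Iic y).indicator (fun s => h (x, s)) s - R y * h (x, s)) := by
              intro s
              simp only [hk, indicator, mem_Iic]
              split_ifs <;> ring
            simp_rw [e4]
            rw [integral_const_mul, integral_sub (i6.indicator measurableSet_Iic)
              (i6.const_mul _), integral_indicator measurableSet_Iic, integral_const_mul]
            rfl
    have e5 : ∫ z, W z * fderiv ℝ H z (0, 1) = (∫ z, W z * h z) -
        ∫ z : ℝ², W z * (ρ z.2 * m z.1) := by
      rw [← integral_sub i1 i5]
      congr 1
      ext z
      rw [dH]
      ring
    have e6 : ∀ z, h z • (W z - A z.1 + B z) = W z * h z - A z.1 * h z + B z * h z := fun z => by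
      rw [smul_eq_mul]
      ring
    simp_rw [e6]
    have i13 : Integrable fun z => W z * h z - A z.1 * h z := i1.sub i3
    rw [integral_add i13 i4, integral_sub i1 i3, e2, e3]
    rw [e5] at e0
    linarith

end Vertical2

/-! ### Sobolev functions on an interval -/

section Line

theorem isTest_slice {Ω : Set ℝ²} {φ : ℝ² → ℝ} (hφ : IsTest Ω φ) (x : ℝ) :
    IsTest (Prod.mk x ⁻¹' Ω) fun y => φ (x, y) where
  smooth := hφ.smooth.comp (contDiff_const.prodMk contDiff_id)
  compact := HasCompactSupport.of_support_subset_isCompact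
    (hφ.compact.isCompact.image continuous_snd) fun s hs => ⟨(x, s), subset_tsupport _ hs, rfl⟩
  subset := (tsupport_comp_subset_preimage φ (f := fun y => (x, y)) (by fun_prop)).trans
    (preimage_mono hφ.subset)

theorem fderiv_slice {φ : ℝ² → ℝ} (hφ : Differentiable ℝ φ) (x y : ℝ) :
    fderiv ℝ (fun y => φ (x, y)) y 1 = fderiv ℝ φ (x, y) (0, 1) := by
  have hl : HasDerivAt (fun y : ℝ => (x, y)) ((0 : ℝ), (1 : ℝ)) y :=
    (hasDerivAt_const _ _).prodMk (hasDerivAt_id _)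
  have h1 : HasDerivAt (fun y => φ (x, y)) (fderiv ℝ φ (x, y) (0, 1)) y :=
    HasFDerivAt.comp_hasDerivAt (l := φ) y (f := fun y => (x, y)) (hφ (x, y)).hasFDerivAt hl
  rw [fderiv_apply_one_eq_deriv, h1.deriv]

theorem abs_sub_average_le {b : ℝ} {ρ : ℝ → ℝ} (hρ : IsDensity b ρ)
    {w g : ℝ → ℝ} (hw : IntegrableOn w (Ioo 0 b)) (hg : IntegrableOn g (Ioo 0 b))
    (hD : HasWeakDeriv (Ioo 0 b) 1 w g) :
    ∀ᵐ y, y ∈ Ioo 0 b → |w y - ∫ t, ρ t * w t| ≤ ∫ y in Ioo 0 b, |g y| := by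
  have hΩ : subgraph (Ioo 0 1) (fun _ => b) = Ioo 0 1 ×ˢ Ioo 0 b := by
    ext z
    simp [subgraph]
  have hint : ∀ f : ℝ → ℝ, IntegrableOn f (Ioo 0 b) →
      IntegrableOn (fun z : ℝ² => f z.2) (subgraph (Ioo 0 1) fun _ => b) := fun f hf => by
    rw [hΩ, IntegrableOn, Measure.volume_eq_prod, ← Measure.prod_restrict]
    exact hf.comp_snd _
  have key := abs_sub_vertical_average_le isOpen_Ioo continuous_const (fun _ => le_rfl) hρ
    (hint w hw) (hint g hg) (hasWeakDeriv_iff_integral.2 fun φ hφ => ?_)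
  · rw [Measure.volume_eq_prod] at key
    have h1 := Measure.ae_ae_of_ae_prod key
    have h2 : ∃ x ∈ 𝕀, ∀ᵐ y, (x, y) ∈ subgraph (Ioo 0 1) (fun _ => b) →
        |w y - ∫ t, ρ t * w t| ≤ ∫ y in Ioo 0 b, |g y| := by
      by_contra hcon
      have h3 : 𝕀 ⊆ {x | ¬ ∀ᵐ y, (x, y) ∈ subgraph (Ioo 0 1) (fun _ => b) →
        |w y - ∫ t, ρ t * w t| ≤ ∫ y in Ioo 0 b, |g y|} := fun x hx h => hcon ⟨x, hx, h⟩
      have h4 := measure_mono_null h3 (ae_iff.1 h1)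
      simp at h4
    obtain ⟨x, hx, h3⟩ := h2
    exact h3.mono fun y hy hyb => hy ⟨hx, hyb⟩
  · have lw := (hint w hw).locallyIntegrableOn
    have lg := (hint g hg).locallyIntegrableOn
    rw [Measure.volume_eq_prod, integral_prod _ ((hφ.fderiv_apply _).integrable_mul lw),
      integral_prod _ (hφ.integrable_mul lg), ← integral_neg]
    congr 1
    ext x
    have := hasWeakDeriv_iff_integral.1 hD _
      ((isTest_slice hφ x).mono fun y hy => hy.2)
    simp_rw [fderiv_slice (hφ.smooth.differentiable (by simp))] at this
    exact this

theorem hasWeakDeriv_primitive {b : ℝ} {g : ℝ → ℝ} (hg : IntegrableOn g (Ioo 0 b)) :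
    HasWeakDeriv (Ioo 0 b) 1 (fun x => ∫ t in Ioo 0 x, g t) g :=
  hasWeakDeriv_iff.2 fun φ hφ => by
    set μ := (volume : Measure ℝ).restrict (Ioo 0 b) with hμ
    obtain ⟨C, hC⟩ := (hφ.fderiv_apply 1).exists_norm_le
    have hm : Measurable fun q : ℝ² => if q.2 < q.1 then fderiv ℝ φ q.1 1 else 0 :=
      Measurable.ite (measurableSet_lt measurable_snd measurable_fst)
        ((hφ.fderiv_apply 1).continuous.measurable.comp measurable_fst) measurable_const
    have sw : Integrable (Function.uncurry fun x t => (if t < x then fderiv ℝ φ x 1 else 0) * g t)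
        (μ.prod μ) := by
      have h1 : Integrable (fun q : ℝ² => g q.2) (μ.prod μ) := Integrable.comp_snd hg _
      refine h1.bdd_mul (c := C) (f := fun q : ℝ² => if q.2 < q.1 then fderiv ℝ φ q.1 1 else 0)
        hm.aestronglyMeasurable (.of_forall fun q => ?_)
      split_ifs
      · exact hC _
      · simpa using (norm_nonneg _).trans (hC 0)
    calc ∫ x in Ioo 0 b, (∫ t in Ioo 0 x, g t) * fderiv ℝ φ x 1
        = ∫ x, ∫ t, (if t < x then fderiv ℝ φ x 1 else 0) * g t ∂μ ∂μ := by
          refine setIntegral_congr_fun measurableSet_Ioo fun x hx => ?_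
          rw [mul_comm, ← integral_const_mul, hμ, ← integral_indicator measurableSet_Ioo,
            ← integral_indicator measurableSet_Ioo]
          congr 1
          ext t
          by_cases h1 : 0 < t
          · by_cases h2 : t < x
            · simp [h1, h2, h2.trans hx.2]
            · simp [h2, indicator]
          · simp [h1]
      _ = ∫ t, ∫ x, (if t < x then fderiv ℝ φ x 1 else 0) * g t ∂μ ∂μ :=
          integral_integral_swap sw
      _ = ∫ t in Ioo 0 b, -(g t * φ t) := by
          refine setIntegral_congr_fun measurableSet_Ioo fun t ht => ?_
          rw [integral_mul_const, mul_comm, ← mul_neg]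
          congr 1
          have e1 : ∫ x, (if t < x then fderiv ℝ φ x 1 else 0) ∂μ =
              ∫ x in Ioi t, deriv φ x := by
            rw [hμ, ← integral_indicator measurableSet_Ioo, ← integral_indicator measurableSet_Ioi]
            congr 1
            ext x
            by_cases h1 : t < x
            · by_cases h2 : x < b
              · simp [h1, h2, ht.1.trans h1]
              · have : fderiv ℝ φ x 1 = 0 := (hφ.fderiv_apply 1).eq_zero fun h => h2 h.2
                rw [fderiv_apply_one_eq_deriv] at this
                simp [h1, h2, this]
            · simp [h1]
          rw [e1]
          exact HasCompactSupport.integral_Ioi_deriv_eq (hφ.smooth.of_le (by simp)) hφ.compact t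
      _ = -∫ t in Ioo 0 b, g t * φ t := integral_neg _

/-- A Sobolev function on an interval is the primitive of its weak derivative. -/
theorem exists_eq_add_integral {b : ℝ} (hb : 0 < b) {w g : ℝ → ℝ}
    (hw : IntegrableOn w (Ioo 0 b)) (hg : IntegrableOn g (Ioo 0 b))
    (hD : HasWeakDeriv (Ioo 0 b) 1 w g) :
    ∃ C, ∀ᵐ y, y ∈ Ioo 0 b → w y = C + ∫ t in Ioo 0 y, g t := by
  obtain ⟨ρ, hρ⟩ := exists_isDensity hb
  have hP := hasWeakDeriv_primitive hg
  have iP : IntegrableOn (fun x => ∫ t in Ioo 0 x, g t) (Ioo 0 b) := by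
    have h1 : IntegrableOn (fun x => ∫ t in (0 : ℝ)..x, g t) (Icc 0 b) :=
      (intervalIntegral.continuousOn_primitive_interval (a := 0) (b := b) (by
        rw [uIcc_of_le hb.le, integrableOn_Icc_iff_integrableOn_Ioo]
        exact hg)).integrableOn_compact isCompact_uIcc |>.mono_set (by rw [uIcc_of_le hb.le])
    refine (h1.mono_set Ioo_subset_Icc_self).congr_fun (fun x hx => ?_) measurableSet_Ioo
    simp only
    rw [intervalIntegral.integral_of_le hx.1.le, integral_Ioc_eq_integral_Ioo]
  have h1 := (hD.add (hP.const_mul (-1)) hw.locallyIntegrableOn hg.locallyIntegrableOn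
    (IntegrableOn.locallyIntegrableOn (iP.const_mul (-1)))
    (IntegrableOn.locallyIntegrableOn (hg.const_mul (-1))))
  have h2 := abs_sub_average_le hρ (hw.add (iP.const_mul (-1)))
    (hg.add (hg.const_mul (-1))) h1
  refine ⟨∫ t, ρ t * (w t + -1 * ∫ s in Ioo 0 t, g s), h2.mono fun y hy hyb => ?_⟩
  have h3 := hy hyb
  simp only [Pi.add_apply] at h3
  have e : ∀ y, |g y + -1 * g y| = 0 := fun y => by simp
  simp only [e, integral_zero] at h3
  have h4 := abs_eq_zero.1 (le_antisymm h3 (abs_nonneg _))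
  linarith

theorem ae_eq_const_of_hasWeakDeriv_zero {b : ℝ} (hb : 0 < b) {w : ℝ → ℝ}
    (hw : IntegrableOn w (Ioo 0 b)) (hD : HasWeakDeriv (Ioo 0 b) 1 w fun _ => 0) :
    ∃ C, ∀ᵐ y, y ∈ Ioo 0 b → w y = C := by
  obtain ⟨C, hC⟩ := exists_eq_add_integral hb hw (integrableOn_zero) hD
  exact ⟨C, by simpa using hC⟩

theorem rpow_integral_norm_le {α : Type*} [MeasurableSpace α] {μ : Measure α} [IsFiniteMeasure μ]
    {V : Type*} [NormedAddCommGroup V] {p : ℝ} (hp : 1 < p) {f : α → V}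
    (hf : MemLp f ofR(p) μ) :
    (∫ x, ‖f x‖ ∂μ) ^ p ≤ μ.real univ ^ (p - 1) * ∫ x, ‖f x‖ ^ p ∂μ := by
  have hpq := Real.HolderConjugate.conjExponent hp
  have h1 := integral_mul_norm_le_Lp_mul_Lq hpq hf.norm
    (memLp_const (1 : ℝ) : MemLp (fun _ : α => (1 : ℝ)) (ENNReal.ofReal p.conjExponent) μ)
  simp only [norm_norm, norm_one, mul_one, Real.one_rpow, integral_const, smul_eq_mul] at h1
  have h2 := Real.rpow_le_rpow (integral_nonneg fun x => norm_nonneg _) h1 hpq.nonneg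
  refine h2.trans (le_of_eq ?_)
  rw [Real.mul_rpow (by positivity) (by positivity), ← Real.rpow_mul (by positivity),
    ← Real.rpow_mul (by positivity), one_div_mul_cancel hpq.ne_zero, Real.rpow_one, mul_comm]
  congr 2
  rw [one_div, ← hpq.one_sub_inv]
  have := hpq.ne_zero
  field_simp

theorem integral_norm_le_rpow {α : Type*} [MeasurableSpace α] {μ : Measure α} [IsFiniteMeasure μ]
    {V : Type*} [NormedAddCommGroup V] {p a : ℝ} (hp : 1 < p) {f : α → V} (hf : MemLp f ofR(p) μ)
    (h : μ.real univ ^ (p - 1) * ∫ x, ‖f x‖ ^ p ∂μ ≤ a) : ∫ x, ‖f x‖ ∂μ ≤ a ^ (1 / p) := by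
  have h1 := (rpow_integral_norm_le hp hf).trans h
  rwa [one_div, Real.le_rpow_inv_iff_of_pos (by positivity) (le_trans (by positivity) h1)
    (by linarith)]

end Line

/-! ### The Poincaré inequality in the vertical direction -/

section Sobolev

theorem IsW1p.mono {Ω Ω' : Set ℝ²} {p : ℝ} {w : ℝ² → ℝ} {Dw : ℝ² → Plane}
    (h : IsW1p Ω' p w Dw) (hΩ : Ω ⊆ Ω') : IsW1p Ω p w Dw :=
  ⟨h.memLp.mono_measure (Measure.restrict_mono hΩ le_rfl),
    h.grad_memLp.mono_measure (Measure.restrict_mono hΩ le_rfl),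
    h.weakDeriv_fst.mono hΩ, h.weakDeriv_snd.mono hΩ⟩

theorem memLp_plane_apply {α : Type*} [MeasurableSpace α] {μ : Measure α} {p : ENNReal}
    {D : α → Plane} (h : MemLp D p μ) (j : Fin 2) : MemLp (fun z => D z j) p μ :=
  h.of_le ((EuclideanSpace.proj (𝕜 := ℝ) j).continuous.comp_aestronglyMeasurable h.1)
    (.of_forall fun z => PiLp.norm_apply_le (D z) j)

theorem integral_plane_apply_le {α : Type*} [MeasurableSpace α] {μ : Measure α} {p : ℝ}
    (hp : 0 < p) {D : α → Plane} (h : MemLp D ofR(p) μ) (j : Fin 2) :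
    ∫ z, ‖D z j‖ ^ p ∂μ ≤ ∫ z, ‖D z‖ ^ p ∂μ :=
  integral_mono (integrable_norm_rpow hp (memLp_plane_apply h j)) (integrable_norm_rpow hp h)
    fun z => Real.rpow_le_rpow (norm_nonneg _) (PiLp.norm_apply_le (D z) j) hp.le

theorem IsW1p.locallyIntegrableOn {Ω : Set ℝ²} {p : ℝ} (hp : 1 ≤ p) {w : ℝ² → ℝ}
    {Dw : ℝ² → Plane} (h : IsW1p Ω p w Dw) :
    LocallyIntegrableOn w Ω ∧ ∀ j, LocallyIntegrableOn (fun z => Dw z j) Ω :=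
  ⟨locallyIntegrableOn_of_memLp hp h.memLp,
    fun j => locallyIntegrableOn_of_memLp hp (memLp_plane_apply h.grad_memLp j)⟩

theorem IsW1p.add {Ω : Set ℝ²} {p : ℝ} (hp : 1 ≤ p) {w w' : ℝ² → ℝ}
    {Dw Dw' : ℝ² → Plane} (h : IsW1p Ω p w Dw) (h' : IsW1p Ω p w' Dw') :
    IsW1p Ω p (fun z => w z + w' z) (fun z => Dw z + Dw' z) where
  memLp := h.memLp.add h'.memLp
  grad_memLp := h.grad_memLp.add h'.grad_memLp
  weakDeriv_fst := h.weakDeriv_fst.add h'.weakDeriv_fst (h.locallyIntegrableOn hp).1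
    ((h.locallyIntegrableOn hp).2 0) (h'.locallyIntegrableOn hp).1
    ((h'.locallyIntegrableOn hp).2 0)
  weakDeriv_snd := h.weakDeriv_snd.add h'.weakDeriv_snd (h.locallyIntegrableOn hp).1
    ((h.locallyIntegrableOn hp).2 1) (h'.locallyIntegrableOn hp).1
    ((h'.locallyIntegrableOn hp).2 1)

theorem IsW1p.const_mul {Ω : Set ℝ²} {p : ℝ} {w : ℝ² → ℝ}
    {Dw : ℝ² → Plane} (h : IsW1p Ω p w Dw) (c : ℝ) :
    IsW1p Ω p (fun z => c * w z) (fun z => c • Dw z) where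
  memLp := h.memLp.const_mul c
  grad_memLp := h.grad_memLp.const_smul c
  weakDeriv_fst := by simpa using h.weakDeriv_fst.const_mul c
  weakDeriv_snd := by simpa using h.weakDeriv_snd.const_mul c

theorem IsW1p.sub {Ω : Set ℝ²} {p : ℝ} (hp : 1 ≤ p) {w w' : ℝ² → ℝ}
    {Dw Dw' : ℝ² → Plane} (h : IsW1p Ω p w Dw) (h' : IsW1p Ω p w' Dw') :
    IsW1p Ω p (fun z => w z - w' z) (fun z => Dw z - Dw' z) := by
  simpa [sub_eq_add_neg] using h.add hp (h'.const_mul (-1))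

theorem IsW1pLine.add {Ω : Set ℝ} {p : ℝ} (hp : 1 ≤ p) {w w' dw dw' : ℝ → ℝ}
    (h : IsW1pLine Ω p w dw) (h' : IsW1pLine Ω p w' dw') :
    IsW1pLine Ω p (fun z => w z + w' z) (fun z => dw z + dw' z) where
  memLp := h.memLp.add h'.memLp
  deriv_memLp := h.deriv_memLp.add h'.deriv_memLp
  weakDeriv := h.weakDeriv.add h'.weakDeriv (locallyIntegrableOn_of_memLp hp h.memLp)
    (locallyIntegrableOn_of_memLp hp h.deriv_memLp) (locallyIntegrableOn_of_memLp hp h'.memLp)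
    (locallyIntegrableOn_of_memLp hp h'.deriv_memLp)

theorem IsW1pLine.const_mul {Ω : Set ℝ} {p : ℝ} {w dw : ℝ → ℝ} (h : IsW1pLine Ω p w dw) (c : ℝ) :
    IsW1pLine Ω p (fun z => c * w z) (fun z => c * dw z) where
  memLp := h.memLp.const_mul c
  deriv_memLp := h.deriv_memLp.const_mul c
  weakDeriv := h.weakDeriv.const_mul c

theorem IsW1pLine.sub {Ω : Set ℝ} {p : ℝ} (hp : 1 ≤ p) {w w' dw dw' : ℝ → ℝ}
    (h : IsW1pLine Ω p w dw) (h' : IsW1pLine Ω p w' dw') :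
    IsW1pLine Ω p (fun z => w z - w' z) (fun z => dw z - dw' z) := by
  simpa [sub_eq_add_neg] using h.add hp (h'.const_mul (-1))

theorem IsTest.prod {A B : Set ℝ} {η ρ : ℝ → ℝ} (hη : IsTest A η) (hρ : IsTest B ρ) :
    IsTest (A ×ˢ B) fun z : ℝ² => η z.1 * ρ z.2 := by
  have h1 : Function.support (fun z : ℝ² => η z.1 * ρ z.2) ⊆ tsupport η ×ˢ tsupport ρ :=
    fun z hz => ⟨subset_tsupport _ (left_ne_zero_of_mul hz),
      subset_tsupport _ (right_ne_zero_of_mul hz)⟩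
  have h2 := hη.compact.isCompact.prod hρ.compact.isCompact
  exact ⟨(hη.smooth.comp contDiff_fst).mul (hρ.smooth.comp contDiff_snd),
    HasCompactSupport.of_support_subset_isCompact h2 h1,
    (closure_minimal h1 h2.isClosed).trans (prod_mono hη.subset hρ.subset)⟩

theorem fderiv_prod_mul {η ρ : ℝ → ℝ} (hη : Differentiable ℝ η) (hρ : Differentiable ℝ ρ)
    (z e : ℝ²) : fderiv ℝ (fun z : ℝ² => η z.1 * ρ z.2) z e =
      e.1 * deriv η z.1 * ρ z.2 + η z.1 * (e.2 * deriv ρ z.2) := by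
  have h1 : HasFDerivAt (fun z : ℝ² => η z.1) _ z :=
    ((hη z.1).hasDerivAt.hasFDerivAt).comp z hasFDerivAt_fst
  have h2 : HasFDerivAt (fun z : ℝ² => ρ z.2) _ z :=
    ((hρ z.2).hasDerivAt.hasFDerivAt).comp z hasFDerivAt_snd
  rw [(h1.fun_mul h2).fderiv]
  simp
  ring

/-- The average of `w(x, ·)` with the density `ρ`. -/
def verticalAverage (ρ : ℝ → ℝ) (w : ℝ² → ℝ) (x : ℝ) : ℝ := ∫ t, ρ t * w (x, t)

theorem verticalAverage_eq {h : ℝ} {ρ : ℝ → ℝ} (hρ : IsDensity h ρ) (w : ℝ² → ℝ) (x : ℝ) :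
    verticalAverage ρ w x = ∫ t in Ioo 0 h, ρ t * w (x, t) :=
  (setIntegral_eq_integral_of_forall_compl_eq_zero fun t ht => by
    rw [hρ.test.eq_zero ht, zero_mul]).symm

theorem memLp_of_rpow_norm_le {α : Type*} [MeasurableSpace α] {μ : Measure α} {p : ℝ} (hp : 0 < p)
    {X Y : α → ℝ} (hX : AEStronglyMeasurable X μ) (hY : Integrable Y μ)
    (h : ∀ᵐ x ∂μ, ‖X x‖ ^ p ≤ Y x) :
    MemLp X ofR(p) μ ∧ ∫ x, ‖X x‖ ^ p ∂μ ≤ ∫ x, Y x ∂μ := by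
  have i := hY.mono' ((continuous_norm_rpow hp.le).comp_aestronglyMeasurable hX) <|
    h.mono fun x hx => by rwa [Real.norm_of_nonneg (by positivity)]
  exact ⟨memLp_of_integrable_norm_rpow hp hX i, integral_mono_ae i hY h⟩

theorem memLp_verticalAverage {p h C : ℝ} (hp : 1 < p) {J : Set ℝ} {ρ : ℝ → ℝ}
    (hh : 0 ≤ h) (hρ : IsDensity h ρ) (hC : ∀ t, |ρ t| ≤ C) {w : ℝ² → ℝ}
    (hw : MemLp w ofR(p) vol[J ×ˢ Ioo 0 h]) :
    MemLp (verticalAverage ρ w) ofR(p) vol[J] ∧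
      ∫ x in J, ‖verticalAverage ρ w x‖ ^ p ≤
        C ^ p * h ^ (p - 1) * ∫ z in J ×ˢ Ioo 0 h, ‖w z‖ ^ p := by
  have hp0 : 0 < p := by linarith
  have hC0 : 0 ≤ C := (abs_nonneg _).trans (hC 0)
  rw [Measure.volume_eq_prod, ← Measure.prod_restrict] at hw ⊢
  set μ := (volume : Measure ℝ).restrict J
  set ν := (volume : Measure ℝ).restrict (Ioo 0 h) with hν
  have hN := integrable_norm_rpow hp0 hw
  have m1 : AEStronglyMeasurable (verticalAverage ρ w) μ := by
    rw [show verticalAverage ρ w = fun x => ∫ t, ρ t * w (x, t) ∂ν from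
      funext fun x => verticalAverage_eq hρ w x]
    exact ((hρ.test.continuous.comp continuous_snd).aestronglyMeasurable.mul
      hw.1).integral_prod_right'
  have hb : ∀ᵐ x ∂μ, ‖verticalAverage ρ w x‖ ^ p ≤
      C ^ p * h ^ (p - 1) * ∫ t, ‖w (x, t)‖ ^ p ∂ν := by
    filter_upwards [hN.prod_right_ae, hw.1.prodMk_left] with x h1 h2
    have h3 : MemLp (fun t => w (x, t)) ofR(p) ν :=
      memLp_of_integrable_norm_rpow hp0 h2 h1
    have h4 : ‖verticalAverage ρ w x‖ ≤ C * ∫ t, ‖w (x, t)‖ ∂ν := by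
      rw [verticalAverage_eq hρ, ← integral_const_mul]
      refine norm_integral_le_of_norm_le ((h3.integrable (by simpa using hp.le)).norm.const_mul _)
        (.of_forall fun t => ?_)
      rw [norm_mul]
      exact mul_le_mul_of_nonneg_right (hC t) (norm_nonneg _)
    have h5 := rpow_integral_norm_le hp h3
    rw [show ν.real univ = h by simp [hν, hh]] at h5
    refine (Real.rpow_le_rpow (norm_nonneg _) h4 hp0.le).trans ?_
    rw [Real.mul_rpow hC0 (integral_nonneg fun _ => norm_nonneg _), mul_assoc]
    gcongr
  rw [integral_prod _ hN, ← integral_const_mul]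
  exact memLp_of_rpow_norm_le hp0 m1 (hN.integral_prod_left.const_mul _) hb

theorem isW1pLine_verticalAverage {p h : ℝ} (hp : 1 < p) (hh : 0 ≤ h) {J : Set ℝ} {ρ : ℝ → ℝ}
    (hρ : IsDensity h ρ) {Ω : Set ℝ²} (hΩ : J ×ˢ Ioo 0 h ⊆ Ω) {w : ℝ² → ℝ}
    {Dw : ℝ² → Plane} (hw : IsW1p Ω p w Dw) :
    IsW1pLine J p (verticalAverage ρ w) (verticalAverage ρ fun z => Dw z 0) := by
  obtain ⟨C, hC⟩ := hρ.test.exists_norm_le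
  have hw' := hw.mono hΩ
  obtain ⟨l1, l2⟩ := hw'.locallyIntegrableOn hp.le
  refine ⟨(memLp_verticalAverage hp hh hρ hC hw'.memLp).1,
    (memLp_verticalAverage hp hh hρ hC (memLp_plane_apply hw'.grad_memLp 0)).1,
    hasWeakDeriv_iff_integral.2 fun η hη => ?_⟩
  have t := hη.prod hρ.test
  have h1 := hasWeakDeriv_iff_integral.1 hw'.weakDeriv_fst _ t
  have e1 : ∀ z : ℝ², fderiv ℝ (fun z : ℝ² => η z.1 * ρ z.2) z (1, 0) =
      fderiv ℝ η z.1 1 * ρ z.2 := fun z => by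
    rw [fderiv_prod_mul (hη.smooth.differentiable (by simp))
      (hρ.test.smooth.differentiable (by simp)), fderiv_apply_one_eq_deriv]
    simp
  have i1 := (t.fderiv_apply (1, 0)).integrable_mul l1
  have i2 := t.integrable_mul (l2 0)
  simp_rw [e1] at h1 i1
  rw [Measure.volume_eq_prod, integral_prod _ i1, integral_prod _ i2] at h1
  have e2 : ∀ (f : ℝ² → ℝ) (c x : ℝ), ∫ y, f (x, y) * (c * ρ y) = verticalAverage ρ f x * c := by
    intro f c x
    rw [verticalAverage, ← integral_mul_const]
    congr 1
    ext t
    ring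
  have e3 := fun x => e2 (fun z => Dw z 0) (η x) x
  simp only at e3
  simp_rw [e2, e3] at h1
  exact h1

/-- The Poincaré inequality in the vertical direction. -/
theorem vertical_poincare {p : ℝ} (hp : 1 < p) {I : Set ℝ} (hI : IsOpen I) (hIv : volume I ≠ ⊤)
    {Γ : ℝ → ℝ} (hΓc : Continuous Γ) {h₀ M : ℝ} (hh : 0 < h₀) (hΓ : ∀ x, h₀ ≤ Γ x)
    (hM : ∀ x, Γ x ≤ M)
    {ρ : ℝ → ℝ} (hρ : IsDensity h₀ ρ) {w : ℝ² → ℝ} {Dw : ℝ² → Plane}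
    (hw : IsW1p (subgraph I Γ) p w Dw) :
    MemLp (fun z => w z - verticalAverage ρ w z.1) ofR(p)
        vol[subgraph I Γ] ∧
      ∫ z in subgraph I Γ, ‖w z - verticalAverage ρ w z.1‖ ^ p ≤
        M ^ p * ∫ z in subgraph I Γ, ‖Dw z‖ ^ p := by
  set Ω := subgraph I Γ with hΩ
  have hp0 : 0 < p := by linarith
  have hM0 : 0 < M := hh.trans_le ((hΓ 0).trans (hM 0))
  have hΩo : IsOpen Ω := isOpen_subgraph hI hΓc
  have hsub : Ω ⊆ I ×ˢ Ioo 0 M := fun z hz => ⟨hz.1, hz.2.1, hz.2.2.trans_le (hM _)⟩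
  have hfin : volume Ω ≠ ⊤ := by
    refine ((measure_mono hsub).trans_lt ?_).ne
    rw [Measure.volume_eq_prod, Measure.prod_prod]
    exact ENNReal.mul_lt_top hIv.lt_top (by simp)
  have : IsFiniteMeasure vol[Ω] := ⟨by simpa using hfin.lt_top⟩
  have hg : MemLp (fun z => Dw z 1) ofR(p) vol[Ω] :=
    memLp_plane_apply hw.grad_memLp 1
  have hp1 : 1 ≤ ofR(p) := by simpa using hp.le
  have key := abs_sub_vertical_average_le hI hΓc hΓ hρ (hw.memLp.integrable hp1)
    (hg.integrable hp1) hw.weakDeriv_snd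
  set Gf : ℝ² → ℝ := Ω.indicator fun z => Dw z 1 with hGf
  have eG : (fun z => ‖Gf z‖ ^ p) = Ω.indicator fun z => ‖Dw z 1‖ ^ p := by
    ext z
    by_cases hz : z ∈ Ω <;> simp [hGf, hz, hp0.ne']
  have iGp : Integrable fun z => ‖Gf z‖ ^ p := by
    rw [eG, integrable_indicator_iff hΩo.measurableSet]
    exact integrable_norm_rpow hp0 hg
  have iG : Integrable Gf :=
    (integrable_indicator_iff hΩo.measurableSet).2 (hg.integrable hp1)
  set Nf : ℝ → ℝ := fun x => ∫ y, ‖Gf (x, y)‖ ^ p with hNf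
  rw [Measure.volume_eq_prod] at iGp iG
  have iN : Integrable Nf := iGp.integral_prod_left
  have hN0 : ∀ x, 0 ≤ Nf x := fun x => integral_nonneg fun y => by positivity
  have hsl : ∀ᵐ x, (∫ y in Ioo 0 (Γ x), |Gf (x, y)|) ^ p ≤ M ^ (p - 1) * Nf x := by
    filter_upwards [iGp.prod_right_ae, iG.prod_right_ae] with x h1 h2
    have h3 : MemLp (fun y => Gf (x, y)) ofR(p) vol[Ioo 0 (Γ x)] :=
      (memLp_of_integrable_norm_rpow hp0 h2.1 h1).restrict _
    have h4 := rpow_integral_norm_le hp h3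
    refine h4.trans (mul_le_mul ?_ ?_ (integral_rpow_nonneg _) (by positivity))
    · refine Real.rpow_le_rpow (by positivity) ?_ (by linarith)
      simp [(hh.le.trans (hΓ x)), hM x]
    · exact setIntegral_le_integral h1 (.of_forall fun y => by positivity)
  have hb : ∀ᵐ z ∂vol[Ω], ‖w z - verticalAverage ρ w z.1‖ ^ p ≤
      M ^ (p - 1) * Nf z.1 := by
    filter_upwards [ae_restrict_of_ae key, ae_restrict_of_ae (ae_comp_fst hsl),
      ae_restrict_mem hΩo.measurableSet] with z h1 h2 hz
    refine le_trans (Real.rpow_le_rpow (norm_nonneg _) ((h1 hz).trans_eq ?_) hp0.le) h2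
    refine setIntegral_congr_fun measurableSet_Ioo fun y hy => ?_
    have : (z.1, y) ∈ Ω := ⟨hz.1, hy.1, hy.2⟩
    simp [hGf, this]
  have iNΩ' : IntegrableOn (fun z : ℝ² => M ^ (p - 1) * Nf z.1) (univ ×ˢ Ioo 0 M) := by
    rw [IntegrableOn, Measure.volume_eq_prod, ← Measure.prod_restrict, Measure.restrict_univ]
    exact (iN.comp_fst _).const_mul _
  have hsub' : Ω ⊆ univ ×ˢ Ioo 0 M := hsub.trans (prod_mono (subset_univ _) le_rfl)
  have iNΩ := iNΩ'.mono_set hsub'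
  have mA : AEStronglyMeasurable (fun z : ℝ² => verticalAverage ρ w z.1)
      vol[Ω] := by
    have h1 : MemLp (verticalAverage ρ w) ofR(p) vol[I] := by
      obtain ⟨C, hC⟩ := hρ.test.exists_norm_le
      refine (memLp_verticalAverage hp hh.le hρ hC (hw.memLp.mono_measure
        (Measure.restrict_mono ?_ le_rfl))).1
      exact fun z hz => ⟨hz.1, hz.2.1, hz.2.2.trans_le (hΓ _)⟩
    have h2 := h1.1.comp_fst (ν := (vol[univ] : Measure ℝ))
    rw [Measure.prod_restrict] at h2
    exact h2.mono_measure (Measure.restrict_mono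
      (hsub.trans (prod_mono le_rfl (subset_univ _))) le_rfl)
  refine (memLp_of_rpow_norm_le hp0 (hw.memLp.1.sub mA) iNΩ hb).imp_right fun h => h.trans ?_
  calc ∫ z in Ω, M ^ (p - 1) * Nf z.1
      ≤ ∫ z in univ ×ˢ Ioo 0 M, M ^ (p - 1) * Nf z.1 :=
        setIntegral_mono_set iNΩ' (.of_forall fun z => mul_nonneg (by positivity) (hN0 _))
          (LE.le.eventuallyLE hsub')
    _ = M ^ p * ∫ x, Nf x := by
        rw [Measure.volume_eq_prod, ← Measure.prod_restrict, Measure.restrict_univ,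
          integral_const_mul, integral_fun_fst]
        simp only [Measure.real, Measure.restrict_apply_univ, Real.volume_Ioo, sub_zero,
          ENNReal.toReal_ofReal hM0.le, smul_eq_mul]
        rw [← mul_assoc, ← Real.rpow_add_one hM0.ne']
        simp
    _ = M ^ p * ∫ z in Ω, ‖Dw z 1‖ ^ p := by
        rw [hNf, ← integral_prod _ iGp, ← integral_indicator hΩo.measurableSet, ← eG]
        rfl
    _ ≤ M ^ p * ∫ z in Ω, ‖Dw z‖ ^ p :=
        mul_le_mul_of_nonneg_left (integral_plane_apply_le hp0 hw.grad_memLp 1) (by positivity)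

end Sobolev

/-! ### Periodic extension -/

section Periodic

/-- A positive `C¹` function `g` of period `L` with the bounds `G₀ ≤ g ≤ G₁`. -/
structure IsProfile (L G₀ G₁ : ℝ) (g : ℝ → ℝ) : Prop where
  L_pos : 0 < L
  G₀_pos : 0 < G₀
  contDiff : ContDiff ℝ 1 g
  periodic : Function.Periodic g L
  lower : ∀ y, G₀ ≤ g y
  upper : ∀ y, g y ≤ G₁

/-- The `L`-periodic extension in the first variable of a function on the cell. -/
def perExt {V : Type*} (L : ℝ) (F : ℝ² → V) (y : ℝ²) : V := F (L * Int.fract (y.1 / L), y.2)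

variable {V : Type*} {L G₀ G₁ : ℝ} {g : ℝ → ℝ}

theorem IsProfile.pos (hg : IsProfile L G₀ G₁ g) (x : ℝ) : 0 < g x :=
  hg.G₀_pos.trans_le (hg.lower x)

theorem IsProfile.G₁_pos (hg : IsProfile L G₀ G₁ g) : 0 < G₁ := (hg.pos 0).trans_le (hg.upper 0)

theorem cell_eq_subgraph (L : ℝ) (g : ℝ → ℝ) : cell L g = subgraph (Ioo 0 L) g := by
  ext y
  simp [cell, subgraph, and_assoc]

theorem IsProfile.isOpen_subgraph (hg : IsProfile L G₀ G₁ g) {I : Set ℝ} (hI : IsOpen I) :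
    IsOpen (subgraph I g) := ThinDomain.isOpen_subgraph hI hg.contDiff.continuous

theorem IsProfile.isOpen_cell (hg : IsProfile L G₀ G₁ g) : IsOpen (cell L g) :=
  cell_eq_subgraph L g ▸ hg.isOpen_subgraph isOpen_Ioo

theorem IsProfile.periodic_int (hg : IsProfile L G₀ G₁ g) (k : ℤ) (t : ℝ) :
    g (t + k * L) = g t := hg.periodic.int_mul k t

theorem perExt_add_int (hL : L ≠ 0) (F : ℝ² → V) (k : ℤ) (y : ℝ²) :
    perExt L F (y + (k * L, 0)) = perExt L F y := by
  have : (y.1 + k * L) / L = y.1 / L + k := by field_simp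
  simp [perExt, this]

theorem perExt_of_mem (hL : 0 < L) (F : ℝ² → V) {y : ℝ²} (h : y.1 ∈ Ioo 0 L) :
    perExt L F y = F y := by
  have : Int.fract (y.1 / L) = y.1 / L :=
    Int.fract_eq_self.2 ⟨div_nonneg h.1.le hL.le, (div_lt_one hL).2 h.2⟩
  rw [perExt, this, mul_div_cancel₀ _ hL.ne']

theorem perExt_of_mem_cell (hL : 0 < L) (F : ℝ² → V) {y : ℝ²} (h : y ∈ cell L g) :
    perExt L F y = F y := perExt_of_mem hL F ⟨h.1, h.2.1⟩

theorem ae_forall_fst_ne (L : ℝ) : ∀ᵐ y : ℝ², ∀ k : ℤ, y.1 ≠ k * L := by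
  refine ae_comp_fst (P := fun x => ∀ k : ℤ, x ≠ k * L) ?_
  rw [ae_all_iff]
  exact fun k => Measure.ae_ne volume _

theorem measurePreserving_shift (a : ℝ) :
    MeasurePreserving (fun y : ℝ² => y + (a, 0)) volume volume :=
  measurePreserving_add_right volume (a, 0)

theorem measurableEmbedding_shift (a : ℝ) :
    MeasurableEmbedding (fun y : ℝ² => y + (a, 0)) :=
  (MeasurableEquiv.addRight ((a, 0) : ℝ²)).measurableEmbedding

/-- The translates of the cell. -/
def tile (L : ℝ) (g : ℝ → ℝ) (k : ℤ) : Set ℝ² := subgraph (Ioo (k * L) ((k + 1) * L)) g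

theorem IsProfile.preimage_tile (hg : IsProfile L G₀ G₁ g) (k : ℤ) :
    (fun y : ℝ² => y + (k * L, 0)) ⁻¹' tile L g k = cell L g := by
  ext y
  simp only [tile, subgraph, cell, mem_preimage, mem_ofPred_eq, Prod.fst_add, Prod.snd_add,
    add_zero, hg.periodic_int, mem_Ioo, and_assoc]
  refine and_congr (by simp) (and_congr_left fun _ => ?_)
  constructor <;> intro h <;> linarith

theorem IsProfile.measurableSet_tile (hg : IsProfile L G₀ G₁ g) (k : ℤ) :
    MeasurableSet (tile L g k) := (hg.isOpen_subgraph isOpen_Ioo).measurableSet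

theorem IsProfile.setIntegral_tile [NormedAddCommGroup V] [NormedSpace ℝ V]
    (hg : IsProfile L G₀ G₁ g) (k : ℤ) (H : ℝ² → V) :
    ∫ y in tile L g k, H y = ∫ y in cell L g, H (y + (k * L, 0)) := by
  rw [← hg.preimage_tile k,
    (measurePreserving_shift (k * L)).setIntegral_preimage_emb (measurableEmbedding_shift _)]

theorem IsProfile.integrableOn_tile [NormedAddCommGroup V] (hg : IsProfile L G₀ G₁ g) (k : ℤ)
    {H : ℝ² → V} :
    IntegrableOn H (tile L g k) ↔ IntegrableOn (fun y => H (y + (k * L, 0))) (cell L g) := by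
  rw [← hg.preimage_tile k]
  exact ((measurePreserving_shift (k * L)).integrableOn_comp_preimage
    (measurableEmbedding_shift _)).symm

theorem disjoint_tile (hL : 0 < L) (g : ℝ → ℝ) :
    Pairwise fun j k => Disjoint (tile L g j) (tile L g k) := by
  intro j k hjk
  rw [disjoint_left]
  rintro y ⟨⟨h1, h2⟩, -⟩ ⟨⟨h3, h4⟩, -⟩
  have h5 : (j : ℝ) < k + 1 := lt_of_mul_lt_mul_right (h1.trans h4) hL.le
  have h6 : (k : ℝ) < j + 1 := lt_of_mul_lt_mul_right (h3.trans h2) hL.le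
  have h7 : j < k + 1 := by exact_mod_cast h5
  have h8 : k < j + 1 := by exact_mod_cast h6
  omega

theorem exists_mem_tile (hL : 0 < L) {y : ℝ²} (hy : 0 < y.2 ∧ y.2 < g y.1)
    (hne : ∀ k : ℤ, y.1 ≠ k * L) : ∃ k : ℤ, y ∈ tile L g k := by
  refine ⟨⌊y.1 / L⌋, ⟨lt_of_le_of_ne ?_ (hne _).symm, ?_⟩, hy⟩
  · exact (le_div_iff₀ hL).1 (Int.floor_le _)
  · exact (div_lt_iff₀ hL).1 (Int.lt_floor_add_one _)

/-- Integrals over the infinite strip are sums of integrals over the cell. -/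
theorem IsProfile.setIntegral_strip [NormedAddCommGroup V] [NormedSpace ℝ V]
    (hg : IsProfile L G₀ G₁ g) {H : ℝ² → V} (hH : IntegrableOn H (subgraph univ g))
    {n : ℕ} (hn : ∀ y, n * L ≤ |y.1| → H y = 0) :
    ∫ y in subgraph univ g, H y =
      ∑ j ∈ Finset.range (2 * n), ∫ y in cell L g, H (y + (((j - n : ℤ) : ℝ) * L, 0)) := by
  have hsub : ∀ k, tile L g k ⊆ subgraph univ g := fun k y hy => ⟨mem_univ _, hy.2⟩
  have hL := hg.L_pos
  rw [setIntegral_eq_of_subset_of_ae_sdiff_eq_zero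
    (s := ⋃ j ∈ Finset.range (2 * n), tile L g (j - n))
    (hg.isOpen_subgraph isOpen_univ).measurableSet.nullMeasurableSet
    (iUnion₂_subset fun j _ => hsub _), integral_biUnion_finset]
  · exact Finset.sum_congr rfl fun j _ => hg.setIntegral_tile _ H
  · exact fun j _ => hg.measurableSet_tile _
  · intro j _ k _ hjk
    refine disjoint_tile hL g ?_
    intro h
    exact hjk (by exact_mod_cast (sub_left_inj.1 h))
  · exact fun j _ => hH.mono_set (hsub _)
  · filter_upwards [ae_forall_fst_ne L] with y hy hyS
    obtain ⟨k, hk⟩ := exists_mem_tile hL hyS.1.2 hy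
    refine hn y (not_lt.1 fun hlt => hyS.2 ?_)
    rw [abs_lt] at hlt
    have h1 : (-n : ℝ) < k + 1 := lt_of_mul_lt_mul_right
      (show (-n : ℝ) * L < (k + 1) * L by linarith [hlt.1, hk.1.2]) hL.le
    have h2 : (k : ℝ) < n := lt_of_mul_lt_mul_right (hk.1.1.trans hlt.2) hL.le
    have h3 : (-n : ℤ) < k + 1 := by exact_mod_cast h1
    have h4 : k < n := by exact_mod_cast h2
    simp only [mem_iUnion, Finset.mem_range]
    refine ⟨(k + n).toNat, by omega, ?_⟩
    have : ((k + n).toNat : ℤ) - n = k := by omega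
    rw [this]
    exact hk

theorem IsProfile.integrableOn_perExt [NormedAddCommGroup V] (hg : IsProfile L G₀ G₁ g)
    {F : ℝ² → V} (hF : IntegrableOn F (cell L g)) {I : Set ℝ} (hI : Bornology.IsBounded I) :
    IntegrableOn (perExt L F) (subgraph I g) := by
  have hL := hg.L_pos
  obtain ⟨R, hR⟩ := hI.exists_norm_le
  obtain ⟨n, hn⟩ := exists_nat_gt (R / L)
  have h1 : IntegrableOn (perExt L F) (⋃ k ∈ Finset.Ico (-n : ℤ) n, tile L g k) := by
    rw [integrableOn_finset_iUnion]
    intro k _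
    rw [hg.integrableOn_tile]
    refine hF.congr_fun (fun y hy => ?_) hg.isOpen_cell.measurableSet
    rw [perExt_add_int hL.ne', perExt_of_mem_cell hL F hy]
  refine h1.mono_set_ae ?_
  filter_upwards [ae_forall_fst_ne L] with y hy hyS
  obtain ⟨k, hk⟩ := exists_mem_tile hL hyS.2 hy
  have hlt : |y.1| < n * L := (hR _ hyS.1).trans_lt ((div_lt_iff₀ hL).1 hn)
  rw [abs_lt] at hlt
  have h1 : (-n : ℝ) < k + 1 := lt_of_mul_lt_mul_right
    (show (-n : ℝ) * L < (k + 1) * L by linarith [hlt.1, hk.1.2]) hL.le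
  have h2 : (k : ℝ) < n := lt_of_mul_lt_mul_right (hk.1.1.trans hlt.2) hL.le
  have h3 : (-n : ℤ) < k + 1 := by exact_mod_cast h1
  have h4 : k < n := by exact_mod_cast h2
  exact mem_iUnion₂.2 ⟨k, Finset.mem_Ico.2 ⟨by omega, h4⟩, hk⟩

theorem IsProfile.volume_cell_lt_top (hg : IsProfile L G₀ G₁ g) : volume (cell L g) < ⊤ := by
  have h : cell L g ⊆ Ioo 0 L ×ˢ Ioo 0 G₁ := fun y hy =>
    ⟨⟨hy.1, hy.2.1⟩, hy.2.2.1, hy.2.2.2.trans_le (hg.upper _)⟩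
  refine (measure_mono h).trans_lt ?_
  rw [Measure.volume_eq_prod, Measure.prod_prod]
  exact ENNReal.mul_lt_top (by simp) (by simp)

theorem IsProfile.isFiniteMeasure_cell (hg : IsProfile L G₀ G₁ g) :
    IsFiniteMeasure vol[cell L g] := ⟨by simpa using hg.volume_cell_lt_top⟩

theorem IsProfile.integrableOn_cell [NormedAddCommGroup V] (hg : IsProfile L G₀ G₁ g) {p : ℝ}
    (hp : 1 ≤ p) {F : ℝ² → V} (hF : MemLp F ofR(p) vol[cell L g]) :
    IntegrableOn F (cell L g) :=
  have := hg.isFiniteMeasure_cell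
  hF.integrable (by simpa using hp)

theorem IsProfile.memLp_perExt [NormedAddCommGroup V] (hg : IsProfile L G₀ G₁ g) {p : ℝ}
    (hp : 1 ≤ p) {F : ℝ² → V} (hF : MemLp F ofR(p) vol[cell L g])
    {I : Set ℝ} (hI : Bornology.IsBounded I) :
    MemLp (perExt L F) ofR(p) vol[subgraph I g] :=
  memLp_of_integrable_norm_rpow (by linarith)
    (hg.integrableOn_perExt (hg.integrableOn_cell hp hF) hI).1
    (hg.integrableOn_perExt (integrable_norm_rpow (by linarith) hF) hI)

theorem IsProfile.locallyIntegrableOn_perExt [NormedAddCommGroup V] (hg : IsProfile L G₀ G₁ g)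
    {F : ℝ² → V} (hF : IntegrableOn F (cell L g)) :
    LocallyIntegrableOn (perExt L F) (subgraph univ g) := by
  intro y _
  refine ⟨subgraph univ g ∩ {z | z.1 ∈ Ioo (y.1 - 1) (y.1 + 1)}, ?_, ?_⟩
  · exact inter_mem self_mem_nhdsWithin (mem_nhdsWithin_of_mem_nhds
      ((isOpen_Ioo.preimage continuous_fst).mem_nhds ⟨by simp, by simp⟩))
  · exact (hg.integrableOn_perExt hF (Metric.isBounded_Ioo (y.1 - 1) (y.1 + 1))).mono_set
      fun z hz => ⟨hz.2, hz.1.2⟩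

/-- A function with compact support vanishes for large first coordinates. -/
theorem exists_nat_forall_eq_zero (hL : 0 < L) {φ : ℝ² → ℝ} (hφ : HasCompactSupport φ) :
    ∃ n : ℕ, ∀ y : ℝ², n * L ≤ |y.1| → y ∉ tsupport φ := by
  obtain ⟨R, hR⟩ := (hφ.isCompact.image continuous_fst).isBounded.exists_norm_le
  obtain ⟨n, hn⟩ := exists_nat_gt (R / L)
  refine ⟨n, fun y hy h => ?_⟩
  have h1 := hR _ ⟨y, h, rfl⟩
  rw [div_lt_iff₀ hL] at hn
  rw [Real.norm_eq_abs] at h1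
  linarith

end Periodic

/-! ### Lateral traces and the periodic extension -/

section Traces

variable {L G₀ G₁ : ℝ} {g : ℝ → ℝ}

/-- Sobolev functions on the cell whose periodic extension is weakly differentiable on the
strip. -/
structure HasPerWeakGrad (L : ℝ) (g : ℝ → ℝ) (p : ℝ) (w : ℝ² → ℝ) (Dw : ℝ² → Plane) :
    Prop where
  memLp : MemLp w ofR(p) vol[cell L g]
  grad_memLp : MemLp Dw ofR(p) vol[cell L g]
  weakDeriv_fst : HasWeakDeriv (subgraph univ g) (1, 0) (perExt L w) (fun z => perExt L Dw z 0)
  weakDeriv_snd : HasWeakDeriv (subgraph univ g) (0, 1) (perExt L w) (fun z => perExt L Dw z 1)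

theorem IsTest.shift {φ : ℝ² → ℝ} (hg : IsProfile L G₀ G₁ g)
    (h : IsTest (subgraph univ g) φ) (k : ℤ) :
    IsTest (subgraph univ g) fun y => φ (y + (k * L, 0)) := by
  have h1 := IsTest.comp_affine (Ω := subgraph univ g) one_ne_zero (-(k * L, 0)) (φ := φ) ?_
  · simpa only [inv_one, one_smul, sub_neg_eq_add] using h1
  · refine h.mono fun y hy => ?_
    have h2 : g (y.1 + -(k * L)) = g y.1 := by
      have := hg.periodic_int (-k) y.1
      rwa [Int.cast_neg, neg_mul] at this
    refine ⟨mem_univ _, ?_, ?_⟩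
    · simpa using hy.2.1
    · simpa [h2] using hy.2.2

theorem fderiv_shift (φ : ℝ² → ℝ) (c y e : ℝ²) :
    fderiv ℝ (fun y => φ (y + c)) y e = fderiv ℝ φ (y + c) e := by
  rw [fderiv_comp_add_right]

/-- A function on the cell vanishes in the mean if it is orthogonal to all test functions of the
first variable. -/
theorem IsProfile.setIntegral_eq_zero_of_test_fst (hg : IsProfile L G₀ G₁ g) {F : ℝ² → ℝ}
    (hF : IntegrableOn F (cell L g))
    (h : ∀ η, IsTest (Ioo 0 L) η → ∫ y in cell L g, η y.1 * F y = 0) :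
    ∫ y in cell L g, F y = 0 := by
  have hm := hg.isOpen_cell.measurableSet
  have iF : Integrable ((cell L g).indicator F) := (integrable_indicator_iff hm).2 hF
  rw [Measure.volume_eq_prod] at iF
  have h0 := isOpen_Ioo.ae_eq_zero_of_integral_contDiff_smul_eq_zero (U := Ioo 0 L)
    (f := fun x => ∫ t, (cell L g).indicator F (x, t)) (μ := volume)
    (iF.integral_prod_left.locallyIntegrable.locallyIntegrableOn _) (fun η h1 h2 h3 => ?_)
  · rw [← integral_indicator hm, Measure.volume_eq_prod, integral_prod _ iF]
    refine integral_eq_zero_of_ae ?_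
    filter_upwards [h0] with x hx
    by_cases hxL : x ∈ Ioo 0 L
    · exact hx hxL
    · have : ∀ t, (cell L g).indicator F (x, t) = 0 := fun t =>
        indicator_of_notMem (fun h => hxL ⟨h.1, h.2.1⟩) _
      simp [this]
  · obtain ⟨C, hC⟩ := h1.continuous.bounded_above_of_compact_support h2
    have h4 := h η ⟨h1, h2, h3⟩
    rw [← integral_indicator hm] at h4
    have e : ((cell L g).indicator fun y => η y.1 * F y) =
        fun y => η y.1 * (cell L g).indicator F y := by
      ext y
      by_cases hy : y ∈ cell L g <;> simp [hy]
    rw [e, Measure.volume_eq_prod, integral_prod] at h4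
    · simpa only [integral_const_mul, smul_eq_mul] using h4
    · exact iF.bdd_mul (h1.continuous.comp continuous_fst).aestronglyMeasurable
        (.of_forall fun y => hC y.1)

theorem integrableOn_mul_test {Ω : Set ℝ²} {F φ : ℝ² → ℝ} (hφ : IsTest Ω φ)
    {s : Set ℝ²} (hF : IntegrableOn F s) : IntegrableOn (fun y => F y * φ y) s := by
  obtain ⟨C, hC⟩ := hφ.exists_norm_le
  exact hF.mul_bdd (c := C) hφ.continuous.aestronglyMeasurable (.of_forall hC)

theorem IsProfile.strip_pairing (hg : IsProfile L G₀ G₁ g) {w D : ℝ² → ℝ}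
    (hw : IntegrableOn w (cell L g)) (hD : IntegrableOn D (cell L g)) {φ : ℝ² → ℝ}
    (hφ : IsTest (subgraph univ g) φ) (e : ℝ²) {n : ℕ}
    (hn : ∀ y : ℝ², n * L ≤ |y.1| → y ∉ tsupport φ) :
    ∫ y in subgraph univ g, (perExt L w y * fderiv ℝ φ y e + perExt L D y * φ y) =
      ∑ j ∈ Finset.range (2 * n), ∫ y in cell L g,
        (w y * fderiv ℝ (fun y => φ (y + (((j - n : ℤ) : ℝ) * L, 0))) y e +
          D y * φ (y + (((j - n : ℤ) : ℝ) * L, 0))) := by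
  have hL := hg.L_pos
  rw [hg.setIntegral_strip (n := n)]
  · refine Finset.sum_congr rfl fun j _ => setIntegral_congr_fun hg.isOpen_cell.measurableSet
      fun y hy => ?_
    rw [perExt_add_int hL.ne', perExt_add_int hL.ne', perExt_of_mem_cell hL w hy,
      perExt_of_mem_cell hL D hy, fderiv_shift]
  · exact (((hφ.fderiv_apply e).integrable_mul (hg.locallyIntegrableOn_perExt hw)).fun_add
      (hφ.integrable_mul (hg.locallyIntegrableOn_perExt hD))).integrableOn
  · intro y hy
    have h1 := hn y hy
    rw [image_eq_zero_of_notMem_tsupport h1,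
      image_eq_zero_of_notMem_tsupport (fun h => h1 (tsupport_fderiv_apply_subset φ e h))]
    simp

theorem hasWeakDeriv_of_integral_add {Ω : Set ℝ²} {e : ℝ²} {w D : ℝ² → ℝ}
    (hw : LocallyIntegrableOn w Ω) (hD : LocallyIntegrableOn D Ω) :
    HasWeakDeriv Ω e w D ↔
      ∀ φ, IsTest Ω φ → ∫ y in Ω, (w y * fderiv ℝ φ y e + D y * φ y) = 0 := by
  rw [hasWeakDeriv_iff]
  refine forall₂_congr fun φ hφ => ?_
  rw [integral_add ((hφ.fderiv_apply e).integrable_mul hw).integrableOn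
    (hφ.integrable_mul hD).integrableOn, add_eq_zero_iff_eq_neg]

theorem perExt_apply (F : ℝ² → Plane) (j : Fin 2) :
    (fun z => perExt L F z j) = perExt L fun z => F z j := rfl

/-- Equality of the lateral traces makes the periodic extension weakly differentiable. -/
theorem IsPerW1p.hasPerWeakGrad (hg : IsProfile L G₀ G₁ g) {p : ℝ} (hp : 1 ≤ p)
    {w : ℝ² → ℝ} {Dw : ℝ² → Plane} (h : IsPerW1p L g p w Dw) :
    HasPerWeakGrad L g p w Dw := by
  obtain ⟨h1, τ, hτ⟩ := h
  have hL := hg.L_pos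
  have iw := hg.integrableOn_cell hp h1.memLp
  have iD := fun j => hg.integrableOn_cell hp (memLp_plane_apply h1.grad_memLp j)
  refine ⟨h1.memLp, h1.grad_memLp, ?_, ?_⟩
  · rw [perExt_apply, hasWeakDeriv_of_integral_add (hg.locallyIntegrableOn_perExt iw)
      (hg.locallyIntegrableOn_perExt (iD 0))]
    intro φ hφ
    obtain ⟨n, hn⟩ := exists_nat_forall_eq_zero hL hφ.compact
    rw [hg.strip_pairing iw (iD 0) hφ _ hn]
    set I : ℤ → ℝ := fun k => ∫ t in Ioo 0 (g 0), τ t * φ (k * L, t) with hI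
    have hgL : g L = g 0 := by simpa using hg.periodic 0
    have e : ∀ k : ℤ, ∫ y in cell L g, (w y * fderiv ℝ (fun y => φ (y + ((k : ℝ) * L, 0))) y (1, 0)
        + Dw y 0 * φ (y + ((k : ℝ) * L, 0))) = I (k + 1) - I k := fun k => by
      have t := hφ.shift hg k
      rw [hτ.green _ t.smooth t.compact (t.subset.trans fun y hy => hy.2), hgL]
      simp only [hI, Prod.mk_add_mk, add_zero, zero_add]
      congr 4
      ext t
      push_cast
      ring_nf
    simp_rw [e]
    have e2 := Finset.sum_range_sub (fun j : ℕ => I (j - n)) (2 * n)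
    simp only [Nat.cast_add, Nat.cast_one] at e2
    have e3 : ∀ j : ℕ, (j : ℤ) - n + 1 = j + 1 - n := fun j => by ring
    simp_rw [e3, e2]
    have e4 : ∀ k : ℤ, (n : ℝ) ≤ |(k : ℝ)| → I k = 0 := fun k hk => by
      refine integral_eq_zero_of_ae (.of_forall fun t => ?_)
      have : φ (k * L, t) = 0 := image_eq_zero_of_notMem_tsupport (hn _ (by
        rw [abs_mul, abs_of_pos hL]
        exact mul_le_mul_of_nonneg_right hk hL.le))
      simp [this]
    rw [e4 _ (by push_cast; rw [two_mul, add_sub_cancel_right]; exact le_abs_self _),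
      e4 _ (by push_cast; rw [zero_sub, abs_neg]; exact le_abs_self _), sub_zero]
  · rw [perExt_apply, hasWeakDeriv_of_integral_add (hg.locallyIntegrableOn_perExt iw)
      (hg.locallyIntegrableOn_perExt (iD 1))]
    intro φ hφ
    obtain ⟨n, hn⟩ := exists_nat_forall_eq_zero hL hφ.compact
    rw [hg.strip_pairing iw (iD 1) hφ _ hn]
    refine Finset.sum_eq_zero fun j _ => ?_
    have t := hφ.shift hg (j - n)
    set ζ : ℝ² → ℝ := fun y => φ (y + (((j - n : ℤ) : ℝ) * L, 0)) with hζ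
    refine hg.setIntegral_eq_zero_of_test_fst ((integrableOn_mul_test (t.fderiv_apply (0, 1))
      iw).fun_add (integrableOn_mul_test t (iD 1))) fun η hη => ?_
    have hηs : Smooth fun y : ℝ² => η y.1 :=
      hη.smooth.comp contDiff_fst
    have t2 : IsTest (cell L g) fun y => η y.1 * ζ y := t.mul_left hηs (by
      rintro y ⟨h3, h4⟩
      have h5 := hη.subset (tsupport_comp_subset_preimage η continuous_fst h3)
      exact ⟨h5.1, h5.2, h4.2⟩)
    have h2 := (hasWeakDeriv_of_integral_add (h1.locallyIntegrableOn hp).1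
      ((h1.locallyIntegrableOn hp).2 1)).1 h1.weakDeriv_snd _ t2
    refine Eq.trans (integral_congr_ae (.of_forall fun y => ?_)) h2
    simp only
    rw [fderiv_mul_apply hηs t.smooth]
    have : fderiv ℝ (fun y : ℝ² => η y.1) y (0, 1) = 0 := by
      have h6 : HasFDerivAt (fun z : ℝ² => η z.1) _ y :=
        ((hη.smooth.differentiable (by simp) y.1).hasDerivAt.hasFDerivAt).comp y hasFDerivAt_fst
      rw [h6.fderiv]
      simp
    rw [this]
    ring

end Traces

section Traces2

variable {L G₀ G₁ : ℝ} {g : ℝ → ℝ}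

theorem IsProfile.exists_lipschitz (hg : IsProfile L G₀ G₁ g) :
    ∃ K, 0 ≤ K ∧ ∀ s, g 0 - K * |s| ≤ g s := by
  have hc : Continuous (deriv g) := hg.contDiff.continuous_deriv le_rfl
  have hper : Function.Periodic (deriv g) L := fun x => by
    have : deriv g x = deriv (fun y => g (y + L)) x := by
      rw [show (fun y => g (y + L)) = g from funext hg.periodic]
    rw [this, deriv_comp_add_const]
  obtain ⟨K, hK⟩ := (hper.isBounded_of_continuous hg.L_pos.ne' hc).exists_norm_le
  have hK' : ∀ x, ‖deriv g x‖ ≤ K := fun x => hK _ ⟨x, rfl⟩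
  refine ⟨K, (norm_nonneg _).trans (hK' 0), fun s => ?_⟩
  have h1 := Convex.norm_image_sub_le_of_norm_deriv_le (s := univ) (f := g) (x := 0) (y := s)
    (fun x _ => hg.contDiff.differentiable (by simp) x) (fun x _ => hK' x) convex_univ trivial
    trivial
  rw [Real.norm_eq_abs, Real.norm_eq_abs, sub_zero, abs_le] at h1
  linarith [h1.1]

/-- The lateral cut-off `Θ(s / δ(t))`, whose width `δ(t)` shrinks at the upper boundary. -/
def lateralCutoff (Θ : ℝ → ℝ) (a K : ℝ) (z : ℝ²) : ℝ := Θ (z.1 * (K + 1) / (a - z.2))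

theorem contDiffAt_lateralCutoff {Θ : ℝ → ℝ} (hΘ : Smooth Θ)
    {a K : ℝ} {z : ℝ²} (hz : z.2 < a) :
    ContDiffAt ℝ ((⊤ : ℕ∞) : WithTop ℕ∞) (lateralCutoff Θ a K) z := by
  refine hΘ.contDiffAt.comp z (ContDiffAt.div ?_ ?_ (by linarith))
  · exact (contDiff_fst.mul contDiff_const).contDiffAt
  · exact (contDiff_const.sub contDiff_snd).contDiffAt

/-- The integrand of Green's formula in the direction `y₁`. -/
def green (w D φ : ℝ² → ℝ) (z : ℝ²) : ℝ := w z * fderiv ℝ φ z (1, 0) + D z * φ z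

theorem IsTest.integrable_green {S : Set ℝ²} {φ w D : ℝ² → ℝ} (h : IsTest S φ)
    (hw : LocallyIntegrableOn w S) (hD : LocallyIntegrableOn D S) : Integrable (green w D φ) :=
  ((h.fderiv_apply _).integrable_mul hw).add (h.integrable_mul hD)

theorem eventuallyEq_zero_of_notMem_tsupport {ζ : ℝ → ℝ} {z : ℝ²} (h : z.2 ∉ tsupport ζ)
    (θ : ℝ² → ℝ) : (fun z : ℝ² => ζ z.2 * θ z) =ᶠ[𝓝 z] fun _ => 0 := by
  have : (fun z : ℝ² => ζ z.2) =ᶠ[𝓝 z] fun _ => 0 :=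
    (notMem_tsupport_iff_eventuallyEq.1 h).comp_tendsto continuous_snd.continuousAt
  exact this.mono fun y hy => by simp only at hy ⊢; rw [hy, zero_mul]

theorem IsProfile.isTest_lateralCutoff {K : ℝ} (hK : 0 ≤ K)
    (hgK : ∀ s, g 0 - K * |s| ≤ g s) {Θ : ℝ → ℝ} (hΘ : IsTest (Ioo (-1) 1) Θ)
    {ζ : ℝ → ℝ} (hζ : IsTest (Ioo 0 (g 0)) ζ) :
    IsTest (subgraph univ g) fun z => ζ z.2 * lateralCutoff Θ (g 0) K z := by
  set a := g 0
  have hsupp : Function.support (fun z : ℝ² => ζ z.2 * lateralCutoff Θ a K z) ⊆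
      (fun q : ℝ² => (q.1 * (a - q.2) / (K + 1), q.2)) '' (tsupport Θ ×ˢ tsupport ζ) := by
    intro z hz
    have h1 := subset_tsupport _ (left_ne_zero_of_mul hz)
    have h2 : z.1 * (K + 1) / (a - z.2) ∈ tsupport Θ :=
      subset_tsupport Θ (right_ne_zero_of_mul hz)
    have h3 := (hζ.subset h1).2
    refine ⟨(z.1 * (K + 1) / (a - z.2), z.2), ⟨h2, h1⟩, ?_⟩
    have : a - z.2 ≠ 0 := by linarith
    have : K + 1 ≠ 0 := by positivity
    ext
    · simp only
      field_simp
    · rfl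
  have hk : IsCompact ((fun q : ℝ² => (q.1 * (a - q.2) / (K + 1), q.2)) ''
      (tsupport Θ ×ˢ tsupport ζ)) :=
    (hΘ.compact.isCompact.prod hζ.compact.isCompact).image (by fun_prop)
  refine ⟨contDiff_iff_contDiffAt.2 fun z => ?_,
    HasCompactSupport.of_support_subset_isCompact hk hsupp,
    (closure_minimal hsupp hk.isClosed).trans ?_⟩
  · rcases lt_or_ge z.2 a with h | h
    · exact (hζ.smooth.comp contDiff_snd).contDiffAt.mul (contDiffAt_lateralCutoff hΘ.smooth h)
    · exact contDiffAt_const.congr_of_eventuallyEq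
        (eventuallyEq_zero_of_notMem_tsupport (fun h' => (hζ.subset h').2.not_ge h) _)
  · rintro _ ⟨q, ⟨h1, h2⟩, rfl⟩
    have h3 := hΘ.subset h1
    have h4 := hζ.subset h2
    refine ⟨mem_univ _, h4.1, lt_of_lt_of_le ?_ (hgK _)⟩
    simp only
    have h5 : 0 < a - q.2 := by linarith [h4.2]
    have h6 : |q.1| < 1 := abs_lt.2 ⟨h3.1, h3.2⟩
    rw [abs_div, abs_mul, abs_of_pos h5, abs_of_pos (by positivity : 0 < K + 1)]
    have h7 : K * (|q.1| * (a - q.2) / (K + 1)) < a - q.2 := by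
      rw [← mul_div_assoc, div_lt_iff₀ (by positivity)]
      have : |q.1| * (a - q.2) ≤ a - q.2 := mul_le_of_le_one_left h5.le h6.le
      nlinarith
    linarith

theorem hasCompactSupport_lipschitz {ψ : ℝ² → ℝ} (h : Smooth ψ)
    (hc : HasCompactSupport ψ) : ∃ C, 0 ≤ C ∧ ∀ z : ℝ², ψ (0, z.2) = 0 → |ψ z| ≤ C * |z.1| := by
  obtain ⟨C, hC⟩ := h.lipschitzWith_of_hasCompactSupport hc (by simp)
  refine ⟨C, C.2, fun z hz => ?_⟩
  have h1 := hC.dist_le_mul z (0, z.2)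
  rw [hz, Real.dist_eq, sub_zero, Prod.dist_eq] at h1
  simpa using h1

/-- A test function that vanishes on the axis `y₁ = 0` may be cut off at this axis. -/
theorem integral_left_eq_zero (hg : IsProfile L G₀ G₁ g) {w D : ℝ² → ℝ}
    (hw : LocallyIntegrableOn w (subgraph univ g)) (hD : LocallyIntegrableOn D (subgraph univ g))
    (h : HasWeakDeriv (subgraph univ g) (1, 0) w D) {ψ : ℝ² → ℝ}
    (hψ : IsTest (subgraph univ g) ψ) (h0 : ∀ t, ψ (0, t) = 0) :
    ∫ z in subgraph (Iio 0) g, green w D ψ z = 0 := by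
  set S := subgraph univ g
  -- The cut-offs `P ((n + 1) y₁)` tend to the indicator of `y₁ < 0`. Their derivatives, of order `n`
  -- for `|y₁|` of order `1 / n`, stay bounded after multiplication by `ψ = O(|y₁|)`.
  set P : ℝ → ℝ := fun s => Real.smoothTransition (-s - 1) with hP
  have hPs : Smooth P :=
    Real.smoothTransition.contDiff.comp (contDiff_id.neg.sub contDiff_const)
  have hP1 : ∀ s, s < -2 → P s = 1 := fun s hs =>
    Real.smoothTransition.one_of_one_le (by linarith)
  have hP0 : ∀ s, -1 ≤ s → P s = 0 := fun s hs =>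
    Real.smoothTransition.zero_of_nonpos (by linarith)
  have hPb : ∀ s, |P s| ≤ 1 := fun s => by
    rw [abs_of_nonneg (Real.smoothTransition.nonneg _)]
    exact Real.smoothTransition.le_one _
  have hP' : ∀ s, (s < -2 ∨ -1 < s) → deriv P s = 0 := by
    rintro s (hs | hs)
    · have : P =ᶠ[𝓝 s] fun _ => 1 := (eventually_lt_nhds hs).mono hP1
      rw [this.deriv_eq, deriv_const]
    · have : P =ᶠ[𝓝 s] fun _ => 0 := (eventually_gt_nhds hs).mono fun x hx => hP0 x hx.le
      rw [this.deriv_eq, deriv_const]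
  obtain ⟨C, hC⟩ := Continuous.bounded_above_of_compact_support
    (f := fun s => s * deriv P s) (continuous_id.mul (hPs.continuous_deriv (by simp)))
    (HasCompactSupport.intro (K := Icc (-2) (-1)) isCompact_Icc fun s hs => by
      rw [hP' s (by by_contra! h; exact hs h), mul_zero])
  obtain ⟨C', hC'0, hC'⟩ := hasCompactSupport_lipschitz hψ.smooth hψ.compact
  set Pn : ℕ → ℝ² → ℝ := fun n z => P ((n + 1 : ℝ) * z.1) with hPn
  have hPns : ∀ n, Smooth (Pn n) := fun n =>
    hPs.comp (contDiff_const.mul contDiff_fst)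
  have dPn : ∀ n z, fderiv ℝ (Pn n) z (1, 0) = (n + 1 : ℝ) * deriv P ((n + 1 : ℝ) * z.1) := by
    intro n z
    have h1 : HasDerivAt (fun x : ℝ => P ((n + 1 : ℝ) * x))
        (deriv P ((n + 1 : ℝ) * z.1) * ((n + 1 : ℝ) * 1)) z.1 :=
      (hPs.differentiable (by simp) _).hasDerivAt.comp z.1 ((hasDerivAt_id _).const_mul _)
    have h2 : HasFDerivAt (Pn n) _ z := h1.hasFDerivAt.comp z hasFDerivAt_fst
    rw [h2.fderiv]
    simp
    ring
  have t : ∀ n, IsTest S fun z => Pn n z * ψ z := fun n => hψ.mul_left (hPns n) inter_subset_right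
  have hint4 : Integrable ((tsupport ψ).indicator fun z => ‖w z‖) :=
    (integrable_indicator_iff (isClosed_tsupport ψ).measurableSet).2
      (hw.integrableOn_compact_subset hψ.subset hψ.compact.isCompact).norm
  have e0 : ∀ n, ∫ z in S, (w z * (Pn n z * fderiv ℝ ψ z (1, 0) +
      (n + 1 : ℝ) * deriv P ((n + 1 : ℝ) * z.1) * ψ z) + D z * (Pn n z * ψ z)) = 0 := fun n => by
    have h1 := (hasWeakDeriv_of_integral_add hw hD).1 h _ (t n)
    simp_rw [fderiv_mul_apply (hPns n) hψ.smooth, dPn] at h1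
    exact h1
  have hSm : MeasurableSet S := (hg.isOpen_subgraph isOpen_univ).measurableSet
  have lim := tendsto_integral_of_dominated_convergence (μ := vol[S])
    (F := fun (n : ℕ) (z : ℝ²) => w z * (Pn n z * fderiv ℝ ψ z (1, 0) +
      (n + 1 : ℝ) * deriv P ((n + 1 : ℝ) * z.1) * ψ z) + D z * (Pn n z * ψ z))
    (f := fun z => (Iio (0 : ℝ)).indicator (fun _ => green w D ψ z) z.1)
    (fun z => ‖w z * fderiv ℝ ψ z (1, 0)‖ + C * C' * (tsupport ψ).indicator (fun z => ‖w z‖) z +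
      ‖D z * ψ z‖) ?_ ?_ ?_ ?_
  · simp_rw [e0] at lim
    have h1 := tendsto_nhds_unique lim tendsto_const_nhds
    rw [← integral_indicator hSm] at h1
    rw [← integral_indicator (hg.isOpen_subgraph isOpen_Iio).measurableSet]
    refine Eq.trans (integral_congr_ae (.of_forall fun z => ?_)) h1
    have hm : ∀ I : Set ℝ, z ∈ subgraph I g ↔ z.1 ∈ I ∧ 0 < z.2 ∧ z.2 < g z.1 := fun _ => Iff.rfl
    by_cases h2 : z.1 < 0 <;> by_cases h3 : 0 < z.2 ∧ z.2 < g z.1 <;>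
      simp [indicator, S, hm, h2, h3]
  · intro n
    refine ((t n).integrable_green hw hD).1.restrict.congr (.of_forall fun z => ?_)
    simp only
    rw [green, fderiv_mul_apply (hPns n) hψ.smooth, dPn]
  · exact ((((hψ.fderiv_apply _).integrable_mul hw).norm.add (hint4.const_mul _)).add
      (hψ.integrable_mul hD).norm).restrict
  · intro n
    refine .of_forall fun z => ?_
    refine (norm_add_le _ _).trans (add_le_add ?_ ?_)
    · rw [mul_add]
      refine (norm_add_le _ _).trans (add_le_add ?_ ?_)
      · rw [mul_left_comm, norm_mul]
        exact mul_le_of_le_one_left (norm_nonneg _) (hPb _)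
      · by_cases hz : z ∈ tsupport ψ
        · rw [indicator_of_mem hz, norm_mul, mul_comm]
          refine mul_le_mul_of_nonneg_right ?_ (norm_nonneg _)
          rw [Real.norm_eq_abs, abs_mul, abs_mul]
          have h1 := hC ((n + 1 : ℝ) * z.1)
          rw [Real.norm_eq_abs, abs_mul, abs_mul] at h1
          calc |(n + 1 : ℝ)| * |deriv P ((n + 1 : ℝ) * z.1)| * |ψ z|
              ≤ |(n + 1 : ℝ)| * |deriv P ((n + 1 : ℝ) * z.1)| * (C' * |z.1|) := by
                gcongr
                exact hC' z (h0 _)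
            _ = |(n + 1 : ℝ)| * |z.1| * |deriv P ((n + 1 : ℝ) * z.1)| * C' := by ring
            _ ≤ C * C' := mul_le_mul_of_nonneg_right h1 hC'0
        · rw [image_eq_zero_of_notMem_tsupport hz, indicator_of_notMem hz]
          simp
    · rw [mul_left_comm, norm_mul]
      exact mul_le_of_le_one_left (norm_nonneg _) (hPb _)
  · refine .of_forall fun z => ?_
    rcases lt_or_ge z.1 0 with hz | hz
    · have : ∀ᶠ n : ℕ in atTop, (n + 1 : ℝ) * z.1 < -2 := by
        have h1 : Tendsto (fun n : ℕ => ((n : ℝ) + 1) * z.1) atTop atBot :=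
          (tendsto_atTop_add_const_right _ _ tendsto_natCast_atTop_atTop).atTop_mul_const_of_neg hz
        exact h1.eventually_lt_atBot _
      refine tendsto_const_nhds.congr' (this.mono fun n hn => ?_)
      simp only [hPn]
      rw [hP1 _ hn, hP' _ (Or.inl hn), indicator_of_mem (by exact hz), green]
      ring
    · refine tendsto_const_nhds.congr fun n => ?_
      have h1 : 0 ≤ (n + 1 : ℝ) * z.1 := by positivity
      simp only [hPn]
      rw [hP0 _ (by linarith), hP' _ (Or.inr (by linarith)),
        indicator_of_notMem (by simpa using hz)]
      ring

/-- The trace on the axis `y₁ = 0` of a Sobolev function on the strip, from Green's formula for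
the lateral cut-off. -/
def axisTrace (g : ℝ → ℝ) (w D : ℝ² → ℝ) (Z : ℝ² → ℝ) (t : ℝ) : ℝ :=
  ∫ s, (subgraph (Iio 0) g).indicator (green w D Z) (s, t)

/-- Green's formula on the left half of the strip defines a trace on the axis. The trace is found by
testing with `ζ(y₂) θ(y)`, where `θ` is the lateral cut-off; a general `ψ` differs from such a function
by one that vanishes on the axis. -/
theorem exists_axis_trace (hg : IsProfile L G₀ G₁ g) {w D : ℝ² → ℝ}
    (hw : LocallyIntegrableOn w (subgraph univ g)) (hD : LocallyIntegrableOn D (subgraph univ g))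
    (h : HasWeakDeriv (subgraph univ g) (1, 0) w D) :
    ∃ τ : ℝ → ℝ, LocallyIntegrableOn τ (Ioo 0 (g 0)) ∧ ∀ ψ, IsTest (subgraph univ g) ψ →
      ∫ z in subgraph (Iio 0) g, green w D ψ z = ∫ t in Ioo 0 (g 0), τ t * ψ (0, t) := by
  obtain ⟨K, hK, hgK⟩ := hg.exists_lipschitz
  let bΘ : ContDiffBump (0 : ℝ) := ⟨1 / 4, 1 / 2, by norm_num, by norm_num⟩
  have hΘ : IsTest (Ioo (-1) 1) bΘ := by
    refine ⟨bΘ.contDiff, bΘ.hasCompactSupport, ?_⟩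
    rw [bΘ.tsupport_eq, Real.closedBall_eq_Icc]
    intro x hx
    have h1 : bΘ.rOut = 1 / 2 := rfl
    rw [h1] at hx
    constructor <;> linarith [hx.1, hx.2]
  have hΘ0 : bΘ 0 = 1 := bΘ.one_of_mem_closedBall (by simp [bΘ])
  set θ := lateralCutoff bΘ (g 0) K with hθ
  have hm : MeasurableSet (subgraph (Iio 0) g) := (hg.isOpen_subgraph isOpen_Iio).measurableSet
  set τ := axisTrace g w D θ with hτ
  have key : ∀ ζ, IsTest (Ioo 0 (g 0)) ζ → Integrable (fun t => τ t * ζ t) ∧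
      ∫ z in subgraph (Iio 0) g, green w D (fun z => ζ z.2 * θ z) z = ∫ t, τ t * ζ t := by
    intro ζ hζ
    have t := IsProfile.isTest_lateralCutoff hK hgK hΘ hζ
    have i2 := (t.integrable_green hw hD).indicator hm
    have e1 : ∀ s t, (subgraph (Iio 0) g).indicator (green w D fun z => ζ z.2 * θ z) (s, t) =
        (subgraph (Iio 0) g).indicator (green w D θ) (s, t) * ζ t := by
      intro s t
      by_cases hz : (s, t) ∈ subgraph (Iio 0) g
      · rw [indicator_of_mem hz, indicator_of_mem hz, green, green]
        by_cases ht : t ∈ Ioo 0 (g 0)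
        · have h1 : HasFDerivAt (fun z : ℝ² => ζ z.2) _ (s, t) :=
            ((hζ.smooth.differentiable (by simp) t).hasDerivAt.hasFDerivAt).comp (s, t)
              hasFDerivAt_snd
          have h2 := ((contDiffAt_lateralCutoff (K := K) hΘ.smooth (z := (s, t)) ht.2
            ).differentiableAt (by simp)).hasFDerivAt
          rw [(h1.fun_mul h2).fderiv]
          simp
          ring
        · have h1 : t ∉ tsupport ζ := fun h => ht (hζ.subset h)
          rw [(eventuallyEq_zero_of_notMem_tsupport (z := (s, t)) h1 θ).fderiv_eq,
            image_eq_zero_of_notMem_tsupport h1]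
          simp
      · rw [indicator_of_notMem hz, indicator_of_notMem hz, zero_mul]
    have i3 := i2
    rw [Measure.volume_eq_prod] at i3
    have e2 : ∀ t, ∫ s, (subgraph (Iio 0) g).indicator (green w D fun z => ζ z.2 * θ z) (s, t) =
        τ t * ζ t := fun t => by
      simp_rw [e1]
      rw [integral_mul_const, hτ, axisTrace]
    constructor
    · exact i3.integral_prod_right.congr (.of_forall e2)
    · rw [← integral_indicator hm, Measure.volume_eq_prod, integral_prod_symm _ i3]
      exact integral_congr_ae (.of_forall e2)
  refine ⟨τ, fun t ht => ?_, fun ψ hψ => ?_⟩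
  · obtain ⟨r, hr, hr'⟩ := Metric.isOpen_iff.1 isOpen_Ioo t ht
    let b : ContDiffBump t := ⟨r / 4, r / 2, by positivity, by linarith⟩
    have hb : IsTest (Ioo 0 (g 0)) b := by
      refine ⟨b.contDiff, b.hasCompactSupport, ?_⟩
      rw [b.tsupport_eq]
      exact (Metric.closedBall_subset_ball (show r / 2 < r by linarith)).trans hr'
    refine ⟨Metric.closedBall t (r / 4), mem_nhdsWithin_of_mem_nhds
      (Metric.closedBall_mem_nhds _ (by positivity)), ?_⟩
    refine ((key b hb).1.integrableOn).congr_fun (fun x hx => ?_) measurableSet_closedBall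
    simp only
    rw [b.one_of_mem_closedBall hx, mul_one]
  · have hζ : IsTest (Ioo 0 (g 0)) fun t => ψ (0, t) := (isTest_slice hψ 0).mono fun y hy => hy.2
    have t := IsProfile.isTest_lateralCutoff hK hgK hΘ hζ
    have t2 : IsTest (subgraph univ g) fun z => ψ z + -(ψ (0, z.2) * θ z) := hψ.add t.neg
    have h1 := integral_left_eq_zero hg hw hD h t2 fun s => by
      simp [hθ, lateralCutoff, hΘ0]
    have e : ∀ z, green w D (fun z => ψ z + -(ψ (0, z.2) * θ z)) z =
        green w D ψ z - green w D (fun z => ψ (0, z.2) * θ z) z := fun z => by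
      rw [green, fderiv_fun_add (hψ.smooth.differentiable (by simp) _)
        (t.neg.smooth.differentiable (by simp) _), fderiv_fun_neg, add_apply, neg_apply,
        green, green]
      ring
    simp_rw [e] at h1
    rw [integral_sub (hψ.integrable_green hw hD).integrableOn
      (t.integrable_green hw hD).integrableOn, (key _ hζ).2, sub_eq_zero] at h1
    rw [h1, setIntegral_mul_test hζ]

theorem ae_subgraph_split (hL : 0 < L) (g : ℝ → ℝ) (F : ℝ² → ℝ) :
    (subgraph (Iio L) g).indicator F =ᵐ[volume]
      fun z => (subgraph (Iio 0) g).indicator F z + (cell L g).indicator F z := by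
  filter_upwards [ae_forall_fst_ne L] with z hz
  have h0 : z.1 ≠ 0 := by simpa using hz 0
  have hm : ∀ I : Set ℝ, z ∈ subgraph I g ↔ z.1 ∈ I ∧ 0 < z.2 ∧ z.2 < g z.1 := fun _ => Iff.rfl
  by_cases h3 : 0 < z.2 ∧ z.2 < g z.1
  · rcases lt_or_gt_of_ne h0 with h | h
    · simp [indicator, cell_eq_subgraph, hm, h3, h, h.trans hL, h.not_gt]
    · simp [indicator, cell_eq_subgraph, hm, h3, h, h.not_gt]
  · simp [indicator, cell_eq_subgraph, hm, h3]

/-- If the periodic extension is weakly differentiable, then the lateral traces are equal. -/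
theorem HasPerWeakGrad.isPerW1p (hg : IsProfile L G₀ G₁ g) {p : ℝ} (hp : 1 ≤ p)
    {w : ℝ² → ℝ} {Dw : ℝ² → Plane} (h : HasPerWeakGrad L g p w Dw) :
    IsPerW1p L g p w Dw := by
  have hL := hg.L_pos
  have hm := hg.isOpen_cell.measurableSet
  have hsub : cell L g ⊆ subgraph univ g := fun y hy => ⟨mem_univ _, hy.2.2⟩
  have hcong : ∀ F : ℝ² → ℝ, perExt L F =ᵐ[vol[cell L g]] F := fun F => by
    filter_upwards [ae_restrict_mem hm] with y hy using perExt_of_mem_cell hL F hy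
  have iw := hg.integrableOn_cell hp h.memLp
  have iD := fun j => hg.integrableOn_cell hp (memLp_plane_apply h.grad_memLp j)
  have lw := hg.locallyIntegrableOn_perExt iw
  have lD := hg.locallyIntegrableOn_perExt (iD 0)
  refine ⟨⟨h.memLp, h.grad_memLp, (h.weakDeriv_fst.mono hsub).congr_ae (hcong w)
    (hcong fun z => Dw z 0), (h.weakDeriv_snd.mono hsub).congr_ae (hcong w)
    (hcong fun z => Dw z 1)⟩, ?_⟩
  obtain ⟨τ, hτ, hB⟩ := exists_axis_trace hg lw lD h.weakDeriv_fst
  have hgL : g L = g 0 := by simpa using hg.periodic 0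
  refine ⟨τ, hτ, hgL ▸ hτ, fun ψ h1 h2 h3 => ?_⟩
  have hψ : IsTest (subgraph univ g) ψ := ⟨h1, h2, fun y hy => ⟨mem_univ _, h3 hy⟩⟩
  have t := hψ.shift hg 1
  simp only [Int.cast_one, one_mul] at t
  set F := green (perExt L w) (perExt L fun z => Dw z 0) ψ with hF
  have iF : Integrable F := hψ.integrable_green lw lD
  have m0 := (hg.isOpen_subgraph (isOpen_Iio (a := (0 : ℝ)))).measurableSet
  have e1 : ∫ z in subgraph (Iio L) g, F z = (∫ z in subgraph (Iio 0) g, F z) +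
      ∫ z in cell L g, F z := by
    rw [← integral_indicator (hg.isOpen_subgraph isOpen_Iio).measurableSet,
      ← integral_indicator m0, ← integral_indicator hm,
      ← integral_add (iF.indicator m0) (iF.indicator hm)]
    exact integral_congr_ae (ae_subgraph_split hL g F)
  have e2 : ∫ z in subgraph (Iio L) g, F z = ∫ z in subgraph (Iio 0) g, F (z + (L, 0)) := by
    have : (fun y : ℝ² => y + (L, 0)) ⁻¹' subgraph (Iio L) g = subgraph (Iio 0) g := by
      ext y
      simp [subgraph, hg.periodic y.1]
    rw [← this, (measurePreserving_shift L).setIntegral_preimage_emb (measurableEmbedding_shift _)]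
  have e3 : ∀ z, F (z + (L, 0)) =
      green (perExt L w) (perExt L fun z => Dw z 0) (fun y => ψ (y + (L, 0))) z := fun z => by
    have p1 := perExt_add_int hL.ne' w 1 z
    have p2 := perExt_add_int hL.ne' (fun z => Dw z 0) 1 z
    simp only [Int.cast_one, one_mul] at p1 p2
    simp only [hF, green]
    rw [fderiv_shift, p1, p2]
  have e4 : ∫ z in cell L g, F z =
      ∫ y in cell L g, (w y * fderiv ℝ ψ y (1, 0) + Dw y 0 * ψ y) := by
    refine setIntegral_congr_fun hm fun y hy => ?_
    simp only [hF, green]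
    rw [perExt_of_mem_cell hL w hy, perExt_of_mem_cell hL (fun z => Dw z 0) hy]
  rw [← e4, hgL]
  have b1 := hB _ hψ
  have b2 := hB _ t
  simp_rw [← e3] at b2
  simp only [Prod.mk_add_mk, zero_add, add_zero] at b2
  rw [← b2, ← b1, ← e2, e1]
  ring

end Traces2

/-! ### The auxiliary problem on the cell -/

section Cell

variable {L G₀ G₁ : ℝ} {g : ℝ → ℝ}

theorem HasPerWeakGrad.integrableOn (hg : IsProfile L G₀ G₁ g) {p : ℝ} (hp : 1 ≤ p)
    {w : ℝ² → ℝ} {Dw : ℝ² → Plane} (h : HasPerWeakGrad L g p w Dw) :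
    IntegrableOn w (cell L g) ∧ ∀ j, IntegrableOn (fun z => Dw z j) (cell L g) :=
  ⟨hg.integrableOn_cell hp h.memLp,
    fun j => hg.integrableOn_cell hp (memLp_plane_apply h.grad_memLp j)⟩

theorem HasPerWeakGrad.add (hg : IsProfile L G₀ G₁ g) {p : ℝ} (hp : 1 ≤ p)
    {w w' : ℝ² → ℝ} {Dw Dw' : ℝ² → Plane} (h : HasPerWeakGrad L g p w Dw)
    (h' : HasPerWeakGrad L g p w' Dw') :
    HasPerWeakGrad L g p (fun z => w z + w' z) (fun z => Dw z + Dw' z) := by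
  obtain ⟨i1, i2⟩ := h.integrableOn hg hp
  obtain ⟨i3, i4⟩ := h'.integrableOn hg hp
  exact ⟨h.memLp.add h'.memLp, h.grad_memLp.add h'.grad_memLp,
    h.weakDeriv_fst.add h'.weakDeriv_fst (hg.locallyIntegrableOn_perExt i1)
      (hg.locallyIntegrableOn_perExt (i2 0)) (hg.locallyIntegrableOn_perExt i3)
      (hg.locallyIntegrableOn_perExt (i4 0)),
    h.weakDeriv_snd.add h'.weakDeriv_snd (hg.locallyIntegrableOn_perExt i1)
      (hg.locallyIntegrableOn_perExt (i2 1)) (hg.locallyIntegrableOn_perExt i3)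
      (hg.locallyIntegrableOn_perExt (i4 1))⟩

theorem HasPerWeakGrad.const_mul {p : ℝ}
    {w : ℝ² → ℝ} {Dw : ℝ² → Plane} (h : HasPerWeakGrad L g p w Dw) (c : ℝ) :
    HasPerWeakGrad L g p (fun z => c * w z) (fun z => c • Dw z) where
  memLp := h.memLp.const_mul c
  grad_memLp := h.grad_memLp.const_smul c
  weakDeriv_fst := h.weakDeriv_fst.const_mul c
  weakDeriv_snd := h.weakDeriv_snd.const_mul c

theorem IsProfile.hasPerWeakGrad_const (hg : IsProfile L G₀ G₁ g) (p c : ℝ) :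
    HasPerWeakGrad L g p (fun _ => c) (fun _ => 0) := by
  have := hg.isFiniteMeasure_cell
  have h : ∀ e, HasWeakDeriv (subgraph univ g) e (fun _ => c) (fun _ => 0) := fun e => by
    have := hasWeakDeriv_of_contDiff (Ω := subgraph univ g) (e := e)
      (contDiff_const (c := c) (𝕜 := ℝ))
    simpa using this
  exact ⟨memLp_const c, memLp_const 0, h _, h _⟩

theorem IsProfile.hasWeakDeriv_perExt_of_tendsto (hg : IsProfile L G₀ G₁ g) {p p' : ℝ}
    (hp : p.HolderConjugate p') {e : ℝ²} {w D : ℕ → ℝ² → ℝ} {w' D' : ℝ² → ℝ}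
    (hw : ∀ n, MemLp (w n) ofR(p) vol[cell L g])
    (hD : ∀ n, MemLp (D n) ofR(p) vol[cell L g])
    (hw' : MemLp w' ofR(p) vol[cell L g])
    (hD' : MemLp D' ofR(p) vol[cell L g])
    (h : ∀ n, HasWeakDeriv (subgraph univ g) e (perExt L (w n)) (perExt L (D n)))
    (h1 : Tendsto (fun n => ∫ x in cell L g, ‖w n x - w' x‖ ^ p) atTop (𝓝 0))
    (h2 : Tendsto (fun n => ∫ x in cell L g, ‖D n x - D' x‖ ^ p) atTop (𝓝 0)) :
    HasWeakDeriv (subgraph univ g) e (perExt L w') (perExt L D') := by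
  have hp1 := hp.lt.le
  have iw := fun n => hg.integrableOn_cell hp1 (hw n)
  have iD := fun n => hg.integrableOn_cell hp1 (hD n)
  have iw' := hg.integrableOn_cell hp1 hw'
  have iD' := hg.integrableOn_cell hp1 hD'
  rw [hasWeakDeriv_of_integral_add (hg.locallyIntegrableOn_perExt iw')
    (hg.locallyIntegrableOn_perExt iD')]
  intro φ hφ
  obtain ⟨n, hn⟩ := exists_nat_forall_eq_zero hg.L_pos hφ.compact
  have e0 := fun m => (hasWeakDeriv_of_integral_add (hg.locallyIntegrableOn_perExt (iw m))
    (hg.locallyIntegrableOn_perExt (iD m))).1 (h m) φ hφ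
  simp_rw [hg.strip_pairing (iw _) (iD _) hφ _ hn] at e0
  rw [hg.strip_pairing iw' iD' hφ _ hn]
  have lim : ∀ χ, IsTest (subgraph univ g) χ →
      Tendsto (fun m => ∫ y in cell L g, (w m y * fderiv ℝ χ y e + D m y * χ y)) atTop
        (𝓝 (∫ y in cell L g, (w' y * fderiv ℝ χ y e + D' y * χ y))) := fun χ t => by
    have e1 : ∀ a b : ℝ² → ℝ, IntegrableOn a (cell L g) → IntegrableOn b (cell L g) →
        ∫ y in cell L g, (a y * fderiv ℝ χ y e + b y * χ y) =
        (∫ y in cell L g, a y * fderiv ℝ χ y e) + ∫ y in cell L g, b y * χ y := fun a b ha hb =>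
      integral_add (integrableOn_mul_test (t.fderiv_apply e) ha) (integrableOn_mul_test t hb)
    rw [e1 _ _ iw' iD']
    simp_rw [e1 _ _ (iw _) (iD _)]
    exact (tendsto_integral_mul_of_tendsto_rpow hp hw hw' ((t.fderiv_apply e).memLp _ _) h1).add
      (tendsto_integral_mul_of_tendsto_rpow hp hD hD' (t.memLp _ _) h2)
  have lim' := tendsto_finsetSum (Finset.range (2 * n)) fun j _ => lim _ (hφ.shift hg (j - n))
  simp_rw [e0] at lim'
  exact tendsto_nhds_unique lim' tendsto_const_nhds

theorem IsProfile.volume_cell_pos (hg : IsProfile L G₀ G₁ g) : 0 < volume.real (cell L g) := by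
  refine ENNReal.toReal_pos (hg.isOpen_cell.measure_pos _ ⟨(L / 2, G₀ / 2), ?_⟩).ne'
    hg.volume_cell_lt_top.ne
  have hL := hg.L_pos
  have hG := hg.G₀_pos
  have := hg.lower (L / 2)
  exact ⟨by positivity, by simp only; linarith, by positivity, by simp only; linarith⟩

/-- The Poincaré inequality on the cell, for functions with vanishing mean. -/
theorem IsProfile.cell_poincare (hg : IsProfile L G₀ G₁ g) {p : ℝ} (hp : 1 < p) :
    ∃ C, 0 ≤ C ∧ ∀ w Dw, IsW1p (cell L g) p w Dw → ∫ y in cell L g, w y = 0 →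
      ∫ y in cell L g, ‖w y‖ ^ p ≤ C * ∫ y in cell L g, ‖Dw y‖ ^ p := by
  have hp0 : 0 < p := by linarith
  have := hg.isFiniteMeasure_cell
  have hL := hg.L_pos
  have hG := hg.G₀_pos
  obtain ⟨ρ, hρ⟩ := exists_isDensity hG
  obtain ⟨η, hη⟩ := exists_isDensity hL
  obtain ⟨Cρ, hCρ⟩ := hρ.test.exists_norm_le
  have hCρ0 : 0 ≤ Cρ := (norm_nonneg _).trans (hCρ 0)
  set m := vol[cell L g].real univ with hm
  have hm0 : 0 ≤ m := measureReal_nonneg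
  have hG1 : 0 ≤ G₁ := hG.le.trans ((hg.lower 0).trans (hg.upper 0))
  have hvol : 0 < m := by simpa [hm] using hg.volume_cell_pos
  set C₁ := m * (L ^ (p - 1) * (Cρ ^ p * G₀ ^ (p - 1))) with hC₁
  set C₂ := 2 ^ p * (G₁ ^ p + C₁) with hC₂
  refine ⟨2 ^ p * (C₂ + C₂), by positivity, fun w Dw hw hw0 => ?_⟩
  have hrect : Ioo 0 L ×ˢ Ioo 0 G₀ ⊆ cell L g := fun y hy =>
    ⟨hy.1.1, hy.1.2, hy.2.1, hy.2.2.trans_le (hg.lower _)⟩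
  have hD0 := integral_rpow_nonneg (μ := vol[cell L g]) (p := p) Dw
  have v1 := vertical_poincare hp isOpen_Ioo (by simp) hg.contDiff.continuous hG hg.lower hg.upper
    hρ (cell_eq_subgraph L g ▸ hw)
  rw [← cell_eq_subgraph] at v1
  have v2 := isW1pLine_verticalAverage hp hG.le hρ hrect hw
  have v3 := (memLp_verticalAverage hp hG.le hρ hCρ
    ((memLp_plane_apply hw.grad_memLp 0).mono_measure (Measure.restrict_mono hrect le_rfl))).2
  set a := verticalAverage ρ w
  set da := verticalAverage ρ fun z => Dw z 0
  have hp1 : 1 ≤ ofR(p) := by simpa using hp.le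
  have v4 := abs_sub_average_le hη (v2.memLp.integrable hp1) (v2.deriv_memLp.integrable hp1)
    v2.weakDeriv
  set c := ∫ t, η t * a t
  have v5 := rpow_integral_norm_le hp v2.deriv_memLp
  have e5 : vol[Ioo 0 L].real univ = L := by simp [hL.le]
  rw [e5] at v5
  have b1 : ∀ᵐ y ∂vol[cell L g], ‖a y.1 - c‖ ^ p ≤
      L ^ (p - 1) * (Cρ ^ p * G₀ ^ (p - 1)) * ∫ y in cell L g, ‖Dw y‖ ^ p := by
    filter_upwards [ae_restrict_of_ae (ae_comp_fst v4),
      ae_restrict_mem hg.isOpen_cell.measurableSet] with y h1 h2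
    refine (Real.rpow_le_rpow (norm_nonneg _) (h1 ⟨h2.1, h2.2.1⟩) hp0.le).trans (v5.trans ?_)
    rw [mul_assoc]
    refine mul_le_mul_of_nonneg_left (v3.trans ?_) (by positivity)
    refine mul_le_mul_of_nonneg_left ?_ (by positivity)
    exact (setIntegral_mono_set (integrable_norm_rpow hp0 (memLp_plane_apply hw.grad_memLp 0))
      (.of_forall fun y => by positivity) (LE.le.eventuallyLE hrect)).trans
      (integral_plane_apply_le hp0 hw.grad_memLp 0)
  have mac : AEStronglyMeasurable (fun y : ℝ² => a y.1 - c) vol[cell L g] :=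
    ((hw.memLp.1.sub v1.1.1).sub (aestronglyMeasurable_const (b := c))).congr
      (.of_forall fun y => by simp)
  obtain ⟨hac, b2⟩ := memLp_of_rpow_norm_le hp0 mac (integrable_const _) b1
  rw [integral_const, smul_eq_mul, ← hm, ← mul_assoc] at b2
  have b3 : ∫ y in cell L g, ‖w y - c‖ ^ p ≤ C₂ * ∫ y in cell L g, ‖Dw y‖ ^ p := by
    have h1 := integral_norm_add_rpow_le hp v1.1 hac
    simp only [sub_add_sub_cancel] at h1
    refine h1.trans ?_
    rw [hC₂, mul_assoc, add_mul]
    exact mul_le_mul_of_nonneg_left (add_le_add v1.2 b2) (by positivity)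
  have hwc : MemLp (fun y => w y - c) ofR(p) vol[cell L g] :=
    hw.memLp.sub (memLp_const c)
  have b4 : ∫ y in cell L g, ‖c‖ ^ p ≤ ∫ y in cell L g, ‖w y - c‖ ^ p := by
    have h1 : m * c = -∫ y in cell L g, (w y - c) := by
      rw [integral_sub (hw.memLp.integrable hp1) (integrable_const _), hw0, integral_const, ← hm]
      simp
    have h2 : m * |c| ≤ ∫ y in cell L g, ‖w y - c‖ := by
      rw [show m * |c| = |m * c| by rw [abs_mul, abs_of_pos hvol], h1, abs_neg]
      exact norm_integral_le_integral_norm (fun y => w y - c)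
    have h3 := (Real.rpow_le_rpow (by positivity) h2 hp0.le).trans (rpow_integral_norm_le hp hwc)
    rw [Real.mul_rpow hm0 (abs_nonneg _), ← hm] at h3
    rw [integral_const, ← hm, smul_eq_mul, Real.norm_eq_abs]
    have h4 : m ^ p = m ^ (p - 1) * m := by
      rw [← Real.rpow_add_one hvol.ne']
      simp
    rw [h4, mul_assoc] at h3
    exact le_of_mul_le_mul_left h3 (by positivity)
  have h1 := integral_norm_add_rpow_le hp hwc (memLp_const (μ := vol[cell L g]) c)
  simp only [sub_add_cancel] at h1
  refine h1.trans ?_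
  rw [mul_assoc, add_mul]
  exact mul_le_mul_of_nonneg_left (add_le_add b3 (b4.trans b3)) (by positivity)

theorem IsProfile.setAverage_eq_zero_iff (hg : IsProfile L G₀ G₁ g) (w : ℝ² → ℝ) :
    ⨍ y in cell L g, w y = 0 ↔ ∫ y in cell L g, w y = 0 := by
  rw [setAverage_eq, smul_eq_mul, mul_eq_zero, inv_eq_zero]
  simp [hg.volume_cell_pos.ne']

theorem IsProfile.isPerW1p_iff (hg : IsProfile L G₀ G₁ g) {p : ℝ} (hp : 1 ≤ p)
    {w : ℝ² → ℝ} {Dw : ℝ² → Plane} :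
    IsPerW1p L g p w Dw ↔ HasPerWeakGrad L g p w Dw :=
  ⟨fun h => h.hasPerWeakGrad hg hp, fun h => h.isPerW1p hg hp⟩

/-- The cell problem is solved by minimization over the gradients of periodic functions, which are a
closed subspace by the Poincaré inequality. -/
theorem IsProfile.exists_isCellSolution (hg : IsProfile L G₀ G₁ g) {p p' : ℝ}
    (hp : p.HolderConjugate p') : ∃ v Dv, IsCellSolution L g p v Dv := by
  have := hg.isFiniteMeasure_cell
  have hp1 := hp.lt.le
  have hp0 := hp.pos
  obtain ⟨C, hC0, hC⟩ := hg.cell_poincare hp.lt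
  set K : Submodule ℝ (ℝ² → Plane) :=
    { carrier := {X | ∃ w, HasPerWeakGrad L g p w X ∧ ∫ y in cell L g, w y = 0}
      add_mem' := by
        rintro X Y ⟨w, h1, h2⟩ ⟨w', h3, h4⟩
        refine ⟨_, h1.add hg hp1 h3, ?_⟩
        rw [integral_add (h1.integrableOn hg hp1).1 (h3.integrableOn hg hp1).1, h2, h4, add_zero]
      zero_mem' := ⟨_, hg.hasPerWeakGrad_const p 0, by simp⟩
      smul_mem' := by
        rintro c X ⟨w, h1, h2⟩
        refine ⟨_, h1.const_mul c, ?_⟩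
        rw [integral_const_mul, h2, mul_zero] } with hK
  have hcl : ∀ (X : ℕ → ℝ² → Plane) (X' : ℝ² → Plane), (∀ n, X n ∈ K) →
      MemLp X' ofR(p) vol[cell L g] →
      Tendsto (fun n => ∫ x in cell L g, ‖X n x - X' x‖ ^ p) atTop (𝓝 0) →
      ∃ Y ∈ K, Y =ᵐ[vol[cell L g]] X' := by
    intro X X' hX hX' hlim
    choose w hw hw0 using hX
    have hdiff : ∀ m n, ∫ x in cell L g, ‖w m x - w n x‖ ^ p ≤
        C * ∫ x in cell L g, ‖X m x - X n x‖ ^ p := fun m n => by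
      have h1 := (hw m).add hg hp1 ((hw n).const_mul (-1))
      have h2 := hC _ _ (h1.isPerW1p hg hp1).1 (by
        rw [integral_add ((hw m).integrableOn hg hp1).1
          (((hw n).const_mul (-1)).integrableOn hg hp1).1, integral_const_mul, hw0, hw0]
        simp)
      simpa [sub_eq_add_neg] using h2
    obtain ⟨w', hw', hlim'⟩ := exists_limit_of_cauchy_rpow hp.lt (fun n => (hw n).memLp)
      (fun η hη => by
        set d := η / (2 * 2 ^ p * C + 1) with hd
        have h1 : 0 < d := by positivity
        obtain ⟨N, hN⟩ := (hlim.eventually (gt_mem_nhds h1)).exists_forall_of_atTop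
        refine ⟨N, fun m hm n hn => (hdiff m n).trans ?_⟩
        have h2 := integral_norm_sub_rpow_le hp.lt ((hw m).grad_memLp.sub hX')
          ((hw n).grad_memLp.sub hX')
        simp only [Pi.sub_apply, sub_sub_sub_cancel_right] at h2
        have h3 : d * (2 * 2 ^ p * C + 1) = η := div_mul_cancel₀ _ (by positivity)
        calc C * ∫ x in cell L g, ‖X m x - X n x‖ ^ p ≤ C * (2 ^ p * (d + d)) :=
              mul_le_mul_of_nonneg_left (h2.trans (by gcongr; exacts [(hN m hm).le, (hN n hn).le]))
                hC0
          _ ≤ η := by linarith)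
    have hj : ∀ j : Fin 2, Tendsto (fun n => ∫ x in cell L g, ‖X n x j - X' x j‖ ^ p) atTop
        (𝓝 0) := fun j => by
      refine squeeze_zero (fun n => integral_rpow_nonneg _) (fun n => ?_) hlim
      exact integral_plane_apply_le hp0 ((hw n).grad_memLp.sub hX') j
    have hD := fun n j => memLp_plane_apply (hw n).grad_memLp j
    refine ⟨X', ⟨w', ⟨hw', hX', ?_, ?_⟩, ?_⟩, ae_eq_refl _⟩
    · exact hg.hasWeakDeriv_perExt_of_tendsto hp (fun n => (hw n).memLp) (fun n => hD n 0) hw'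
        (memLp_plane_apply hX' 0) (fun n => (hw n).weakDeriv_fst) hlim' (hj 0)
    · exact hg.hasWeakDeriv_perExt_of_tendsto hp (fun n => (hw n).memLp) (fun n => hD n 1) hw'
        (memLp_plane_apply hX' 1) (fun n => (hw n).weakDeriv_snd) hlim' (hj 1)
    · have h1 := tendsto_integral_mul_of_tendsto_rpow hp (fun n => (hw n).memLp) hw'
        (memLp_const (1 : ℝ)) hlim'
      simp only [mul_one, hw0] at h1
      exact (tendsto_nhds_unique h1 tendsto_const_nhds)
  obtain ⟨X, ⟨w, hX, hw0⟩, hXeq⟩ := exists_variational_solution hp (μ := vol[cell L g])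
    K (fun X ⟨w, h1, _⟩ => h1.grad_memLp) hcl
    (X₀ := fun _ => EuclideanSpace.single 0 1) (memLp_const _) (F := fun _ => 0) (memLp_const _)
    (w := fun _ => 1) aestronglyMeasurable_const one_pos (fun _ => le_rfl) (fun _ => le_rfl)
  refine ⟨fun y => w y + y.1, fun y => X y + EuclideanSpace.single 0 1, ?_, ?_, ?_⟩
  · simpa using hX.isPerW1p hg hp1
  · rw [hg.setAverage_eq_zero_iff]
    simpa using hw0
  · intro ψ Dψ h1 h2
    have := hXeq Dψ ⟨ψ, h1.hasPerWeakGrad hg hp1, (hg.setAverage_eq_zero_iff ψ).1 h2⟩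
    simpa [add_comm] using this

end Cell

/-! ### The flux on the periodic strip -/

section CellFlux

variable {L G₀ G₁ : ℝ} {g : ℝ → ℝ}

theorem setIntegral_subgraph {I : Set ℝ} {Γ : ℝ → ℝ} (hI : MeasurableSet I)
    (hΩ : MeasurableSet (subgraph I Γ)) {F : ℝ² → ℝ} (hF : IntegrableOn F (subgraph I Γ)) :
    ∫ z in subgraph I Γ, F z = ∫ x in I, ∫ t in Ioo 0 (Γ x), F (x, t) ∧
      IntegrableOn (fun x => ∫ t in Ioo 0 (Γ x), F (x, t)) I := by
  have e : ∀ x, ∫ t, (subgraph I Γ).indicator F (x, t) =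
      I.indicator (fun x => ∫ t in Ioo 0 (Γ x), F (x, t)) x := fun x => by
    by_cases hx : x ∈ I
    · rw [indicator_of_mem hx, ← integral_indicator measurableSet_Ioo]
      simp [indicator, subgraph, hx]
    · simp [indicator, subgraph, hx]
  have i1 := (integrable_indicator_iff hΩ).2 hF
  rw [Measure.volume_eq_prod] at i1
  constructor
  · rw [← integral_indicator hΩ, Measure.volume_eq_prod, integral_prod _ i1]
    simp_rw [e]
    rw [integral_indicator hI]
  · rw [← integrable_indicator_iff hI]
    exact i1.integral_prod_left.congr (.of_forall e)

theorem memLp_of_eq_zero {E V : Type*} [MeasureSpace E] [NormedAddCommGroup V] {s t : Set E}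
    {f : E → V} {p : ENNReal} (hs : MeasurableSet s) (ht : NullMeasurableSet t) (hst : s ⊆ t)
    (hf : MemLp f p vol[s]) (h0 : ∀ x ∈ t, x ∉ s → f x = 0) :
    MemLp f p vol[t] := by
  have h1 : MemLp (s.indicator f) p vol[t] := by
    rw [memLp_indicator_iff_restrict hs, Measure.restrict_restrict hs, inter_eq_self_of_subset_left
      hst]
    exact hf
  refine h1.ae_eq ?_
  filter_upwards [ae_restrict_mem₀ ht] with x hx
  by_cases hxs : x ∈ s
  · rw [indicator_of_mem hxs]
  · rw [indicator_of_notMem hxs, h0 x hx hxs]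

theorem perExt_eq_shift {V : Type*} (hL : L ≠ 0) (F : ℝ² → V) (y : ℝ²) :
    perExt L F y = F (y + (((-⌊y.1 / L⌋ : ℤ) : ℝ) * L, 0)) := by
  rw [perExt, Int.fract]
  congr 1
  ext
  · simp only [Prod.fst_add]
    push_cast
    field_simp
    ring
  · simp

theorem IsProfile.preimage_strip (hg : IsProfile L G₀ G₁ g) (k : ℤ) :
    (fun y : ℝ² => y + (k * L, 0)) ⁻¹' subgraph univ g = subgraph univ g := by
  ext y
  simp [subgraph, hg.periodic_int]

theorem IsW1p.shift (hg : IsProfile L G₀ G₁ g) {p : ℝ} {Φ : ℝ² → ℝ} {DΦ : ℝ² → Plane}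
    (h : IsW1p (subgraph univ g) p Φ DΦ) (k : ℤ) :
    IsW1p (subgraph univ g) p (fun y => Φ (y + (k * L, 0))) fun y => DΦ (y + (k * L, 0)) := by
  have hm : MeasurePreserving (fun y : ℝ² => y + (k * L, 0))
      vol[subgraph univ g] vol[subgraph univ g] := by
    have := (measurePreserving_shift (k * L)).restrict_preimage_emb (measurableEmbedding_shift _)
      (subgraph univ g)
    rwa [hg.preimage_strip] at this
  have hd : ∀ e w D, HasWeakDeriv (subgraph univ g) e w D → HasWeakDeriv (subgraph univ g) e
      (fun y : ℝ² => w (y + (k * L, 0))) fun y => D (y + (k * L, 0)) := fun e w D h => by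
    have := h.comp_affine one_ne_zero ((k * L, 0) : ℝ²)
    simp only [one_smul, one_mul] at this
    rwa [hg.preimage_strip] at this
  exact ⟨h.memLp.comp_measurePreserving hm, h.grad_memLp.comp_measurePreserving hm,
    hd _ _ _ h.weakDeriv_fst, hd _ _ _ h.weakDeriv_snd⟩

theorem isW1p_zero (Ω : Set ℝ²) (p : ℝ) : IsW1p Ω p (fun _ => 0) fun _ => 0 :=
  ⟨MemLp.zero', MemLp.zero', fun φ _ _ _ => by simp, fun φ _ _ _ => by simp⟩

theorem IsW1p.finset_sum {ι : Type*} {Ω : Set ℝ²} {p : ℝ} (hp : 1 ≤ p) (s : Finset ι)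
    {w : ι → ℝ² → ℝ} {D : ι → ℝ² → Plane} (h : ∀ k ∈ s, IsW1p Ω p (w k) (D k)) :
    IsW1p Ω p (fun y => ∑ k ∈ s, w k y) fun y => ∑ k ∈ s, D k y := by
  classical
  induction s using Finset.induction_on with
  | empty => simpa using isW1p_zero Ω p
  | insert a s ha ih =>
    simp_rw [Finset.sum_insert ha]
    exact (h a (by simp)).add hp (ih fun k hk => h k (by simp [hk]))

/-- The sum of the translates of a function on the strip by the periods. -/
def periodize {V : Type*} [AddCommMonoid V] [TopologicalSpace V] (L : ℝ) (Φ : ℝ² → V)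
    (y : ℝ²) : V := ∑' k : ℤ, Φ (y + (k * L, 0))

theorem periodize_eq_sum {V : Type*} [NormedAddCommGroup V] (hL : 0 < L) {Φ : ℝ² → V} {n : ℕ}
    (h : ∀ y, n * L ≤ |y.1| → Φ y = 0) (m : ℕ) {y : ℝ²} (hy : |y.1| < m * L) :
    periodize L Φ y = ∑ k ∈ Finset.Ioo (-(n + m) : ℤ) (n + m), Φ (y + (k * L, 0)) := by
  refine tsum_eq_sum fun k hk => h _ ?_
  by_contra hcon
  rw [not_le] at hcon
  refine hk (Finset.mem_Ioo.2 (abs_lt.1 ?_))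
  have h1 : |(k : ℝ) * L| < (n + m) * L := by
    rw [show (k : ℝ) * L = (y.1 + k * L) - y.1 by ring]
    refine (abs_sub _ _).trans_lt ?_
    simp only [Prod.fst_add] at hcon
    linarith
  rw [abs_mul, abs_of_pos hL] at h1
  have h3 := lt_of_mul_lt_mul_right h1 hL.le
  exact_mod_cast h3

theorem perExt_periodize {V : Type*} [NormedAddCommGroup V] (hL : L ≠ 0) (Φ : ℝ² → V) :
    perExt L (periodize L Φ) = periodize L Φ := by
  ext y
  rw [perExt_eq_shift hL]
  simp only [periodize]
  rw [← (Equiv.addRight ⌊y.1 / L⌋).tsum_eq]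
  congr 1
  ext k
  congr 1
  ext
  · simp
    ring
  · simp

theorem IsW1p.hasPerWeakGrad_periodize (hg : IsProfile L G₀ G₁ g) {p : ℝ} (hp : 1 ≤ p)
    {Φ : ℝ² → ℝ} {DΦ : ℝ² → Plane} (h : IsW1p (subgraph univ g) p Φ DΦ) {n : ℕ}
    (h0 : ∀ y, n * L ≤ |y.1| → Φ y = 0) (h0' : ∀ y, n * L ≤ |y.1| → DΦ y = 0) :
    HasPerWeakGrad L g p (periodize L Φ) (periodize L DΦ) := by
  have hL := hg.L_pos
  have hs := fun m : ℕ => IsW1p.finset_sum hp (Finset.Ioo (-(n + m) : ℤ) (n + m))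
    fun k _ => h.shift hg k
  have hsub : cell L g ⊆ subgraph univ g := fun y hy => ⟨mem_univ _, hy.2.2⟩
  have hc : ∀ y ∈ cell L g, |y.1| < ((1 : ℕ) : ℝ) * L := fun y hy => by
    rw [abs_of_pos hy.1]
    simpa using hy.2.1
  have hs1 := (hs 1).mono hsub
  have hd : ∀ (e : ℝ²) (w D : ℝ² → ℝ), (∀ φ, IsTest (subgraph univ g) φ →
      ∃ w' D' : ℝ² → ℝ, HasWeakDeriv (subgraph univ g) e w' D' ∧ ∀ y ∈ tsupport φ, w y = w' y ∧
        D y = D' y) → HasWeakDeriv (subgraph univ g) e w D := fun e w D hyp => by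
    refine hasWeakDeriv_iff_integral.2 fun φ hφ => ?_
    obtain ⟨w', D', h1, h2⟩ := hyp φ hφ
    have h3 := hasWeakDeriv_iff_integral.1 h1 φ hφ
    have e1 : (fun y => w y * fderiv ℝ φ y e) = fun y => w' y * fderiv ℝ φ y e := by
      ext y
      by_cases hy : y ∈ tsupport φ
      · rw [(h2 y hy).1]
      · rw [image_eq_zero_of_notMem_tsupport fun h => hy (tsupport_fderiv_apply_subset φ e h)]
        simp
    have e2 : (fun y => D y * φ y) = fun y => D' y * φ y := by
      ext y
      by_cases hy : y ∈ tsupport φ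
      · rw [(h2 y hy).2]
      · rw [image_eq_zero_of_notMem_tsupport hy]
        simp
    rw [e1, e2, h3]
  refine ⟨hs1.memLp.ae_eq ?_, hs1.grad_memLp.ae_eq ?_, ?_, ?_⟩
  · filter_upwards [ae_restrict_mem hg.isOpen_cell.measurableSet] with y hy
    exact (periodize_eq_sum hL h0 1 (hc y hy)).symm
  · filter_upwards [ae_restrict_mem hg.isOpen_cell.measurableSet] with y hy
    exact (periodize_eq_sum hL h0' 1 (hc y hy)).symm
  all_goals
    rw [perExt_periodize hL.ne', perExt_periodize hL.ne']
    refine hd _ _ _ fun φ hφ => ?_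
    obtain ⟨m, hm⟩ := exists_nat_forall_eq_zero hL hφ.compact
  · refine ⟨_, _, (hs m).weakDeriv_fst, fun y hy => ?_⟩
    have h1 : |y.1| < m * L := not_le.1 fun h => hm y h hy
    exact ⟨periodize_eq_sum hL h0 m h1, by rw [periodize_eq_sum hL h0' m h1]⟩
  · refine ⟨_, _, (hs m).weakDeriv_snd, fun y hy => ?_⟩
    have h1 : |y.1| < m * L := not_le.1 fun h => hm y h hy
    exact ⟨periodize_eq_sum hL h0 m h1, by rw [periodize_eq_sum hL h0' m h1]⟩

theorem IsCellSolution.memLp {p : ℝ} {v : ℝ² → ℝ} {Dv : ℝ² → Plane}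
    (hg : IsProfile L G₀ G₁ g) (h : IsCellSolution L g p v Dv) :
    MemLp Dv ofR(p) vol[cell L g] := by
  have := hg.isFiniteMeasure_cell
  have h1 := h.periodic.1.grad_memLp.add
    (memLp_const (μ := vol[cell L g]) (EuclideanSpace.single (0 : Fin 2) (1 : ℝ)))
  refine h1.ae_eq (.of_forall fun y => ?_)
  simp

/-- The equation on the cell holds for all periodic test functions, whatever their mean. -/
theorem IsCellSolution.equation' {p : ℝ} (hp : 1 ≤ p) {v : ℝ² → ℝ} {Dv : ℝ² → Plane}
    (hg : IsProfile L G₀ G₁ g) (h : IsCellSolution L g p v Dv) {ψ : ℝ² → ℝ}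
    {Dψ : ℝ² → Plane} (hψ : HasPerWeakGrad L g p ψ Dψ) :
    ∫ y in cell L g, inner ℝ (pFlux p (Dv y)) (Dψ y) = 0 := by
  have := hg.isFiniteMeasure_cell
  have h1 := hψ.add hg hp (hg.hasPerWeakGrad_const p (-⨍ y in cell L g, ψ y))
  have h2 := h.equation _ _ (h1.isPerW1p hg hp) ?_
  · simpa using h2
  · have h3 : ∫ y in cell L g, (ψ y - ⨍ y in cell L g, ψ y) = 0 :=
      integral_sub_average _ _
    rw [hg.setAverage_eq_zero_iff]
    simpa [sub_eq_add_neg] using h3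

/-- The periodic extension of the flux is divergence free on the strip, also with respect to test
functions that do not vanish at the upper and the lower boundary. -/
theorem IsCellSolution.integral_strip_eq_zero {p p' : ℝ} (hp : p.HolderConjugate p')
    {v : ℝ² → ℝ} {Dv : ℝ² → Plane} (hg : IsProfile L G₀ G₁ g)
    (h : IsCellSolution L g p v Dv) {Φ : ℝ² → ℝ} {DΦ : ℝ² → Plane}
    (hΦ : IsW1p (subgraph univ g) p Φ DΦ) {n : ℕ}
    (h0 : ∀ y, n * L ≤ |y.1| → Φ y = 0) (h0' : ∀ y, n * L ≤ |y.1| → DΦ y = 0) :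
    ∫ y in subgraph univ g, inner ℝ (perExt L (fun y => pFlux p (Dv y)) y) (DΦ y) = 0 := by
  have hL := hg.L_pos
  have hm := hg.isOpen_cell.measurableSet
  have hA : MemLp (fun y => pFlux p (Dv y)) ofR(p') vol[cell L g] :=
    memLp_pFlux hp (h.memLp hg)
  have hsub : cell L g ⊆ subgraph univ g := fun y hy => ⟨mem_univ _, hy.2.2⟩
  have hi : IntegrableOn (fun y => inner ℝ (perExt L (fun y => pFlux p (Dv y)) y) (DΦ y))
      (subgraph univ g) := by
    set I : Set ℝ := Ioo (-(n * L)) (n * L)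
    have hIS : subgraph I g ⊆ subgraph univ g := fun y hy => ⟨mem_univ _, hy.2⟩
    have h1 : IntegrableOn (fun y => inner ℝ (perExt L (fun y => pFlux p (Dv y)) y) (DΦ y))
        (subgraph I g) := integrable_inner_of_memLp hp
      (hΦ.grad_memLp.mono_measure (Measure.restrict_mono hIS le_rfl))
      (hg.memLp_perExt hp.symm.lt.le hA (Metric.isBounded_Ioo _ _))
    refine h1.of_forall_sdiff_eq_zero (hg.isOpen_subgraph isOpen_univ).measurableSet
      fun y hy => ?_
    rw [h0' y, inner_zero_right]
    by_contra hcon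
    rw [not_le, abs_lt] at hcon
    exact hy.2 ⟨hcon, hy.1.2⟩
  rw [hg.setIntegral_strip hi (n := n) (fun y hy => by rw [h0' y hy, inner_zero_right])]
  have e1 : ∀ k : ℤ, ∫ y in cell L g, inner ℝ (perExt L (fun y => pFlux p (Dv y))
      (y + (k * L, 0))) (DΦ (y + (k * L, 0))) =
      ∫ y in cell L g, inner ℝ (pFlux p (Dv y)) (DΦ (y + (k * L, 0))) := fun k =>
    setIntegral_congr_fun hm fun y hy => by
      rw [perExt_add_int hL.ne', perExt_of_mem_cell hL _ hy]
  simp_rw [e1]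
  rw [← integral_finsetSum]
  · refine Eq.trans (setIntegral_congr_fun hm fun y hy => ?_)
      (h.equation' hp.lt.le hg (hΦ.hasPerWeakGrad_periodize hg hp.lt.le h0 h0'))
    rw [← inner_sum]
    congr 1
    symm
    have e2 : periodize L DΦ y = ∑ k ∈ Finset.Ico (-n : ℤ) n, DΦ (y + (k * L, 0)) := by
      refine tsum_eq_sum fun k hk => h0' _ ?_
      by_contra hcon
      rw [not_le, abs_lt] at hcon
      refine hk (Finset.mem_Ico.2 ?_)
      simp only [Prod.fst_add] at hcon
      have h1 : (-n : ℝ) < k + 1 := lt_of_mul_lt_mul_right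
        (show (-n : ℝ) * L < (k + 1) * L by linarith [hcon.1, hy.2.1]) hL.le
      have h2 : (k : ℝ) < n := lt_of_mul_lt_mul_right
        (show (k : ℝ) * L < n * L by linarith [hcon.2, hy.1]) hL.le
      have h3 : (-n : ℤ) < k + 1 := by exact_mod_cast h1
      have h4 : k < n := by exact_mod_cast h2
      omega
    rw [e2]
    symm
    refine Finset.sum_bij (fun j _ => (j : ℤ) - n) ?_ ?_ ?_ ?_
    · intro j hj
      rw [Finset.mem_range] at hj
      rw [Finset.mem_Ico]
      omega
    · intro j _ k _ hjk
      omega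
    · intro k hk
      rw [Finset.mem_Ico] at hk
      exact ⟨(k + n).toNat, by rw [Finset.mem_range]; omega, by omega⟩
    · intro j _
      rfl
  · intro j _
    exact integrable_inner_of_memLp hp
      ((hΦ.shift hg _).grad_memLp.mono_measure (Measure.restrict_mono hsub le_rfl)) hA

end CellFlux

/-! ### The section flux -/

section CellCoefficient

variable {L G₀ G₁ : ℝ} {g : ℝ → ℝ} {p p' : ℝ} {v : ℝ² → ℝ} {Dv : ℝ² → Plane}

theorem norm_single_fst (c : ℝ) : ‖EuclideanSpace.single (0 : Fin 2) c‖ = |c| := by simp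

theorem inner_single_fst (z : Plane) (c : ℝ) :
    inner ℝ z (EuclideanSpace.single (0 : Fin 2) c) = z 0 * c := by
  simp [EuclideanSpace.inner_single_right, mul_comm]

theorem IsTest.isW1p_strip (hg : IsProfile L G₀ G₁ g) {η : ℝ → ℝ} (hη : IsTest (Ioo 0 L) η)
    (p : ℝ) : IsW1p (subgraph univ g) p (fun y => η y.1)
      fun y => EuclideanSpace.single 0 (deriv η y.1) := by
  have := hg.isFiniteMeasure_cell
  have hs : Smooth fun y : ℝ² => η y.1 :=
    hη.smooth.comp contDiff_fst
  have hd : ∀ y e : ℝ², fderiv ℝ (fun y : ℝ² => η y.1) y e = e.1 * deriv η y.1 :=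
    fun y e => by
      have h6 : HasFDerivAt (fun z : ℝ² => η z.1) _ y :=
        ((hη.smooth.differentiable (by simp) y.1).hasDerivAt.hasFDerivAt).comp y hasFDerivAt_fst
      rw [h6.fderiv]
      simp
  have hd' : ∀ x, fderiv ℝ η x 1 = deriv η x := fun x => fderiv_apply_one_eq_deriv
  have hm : ∀ ζ, IsTest (Ioo 0 L) ζ → MemLp (fun y : ℝ² => ζ y.1) ofR(p)
      vol[subgraph univ g] := fun ζ hζ => by
    obtain ⟨C, hC⟩ := hζ.exists_norm_le
    refine memLp_of_eq_zero hg.isOpen_cell.measurableSet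
      (hg.isOpen_subgraph isOpen_univ).measurableSet.nullMeasurableSet (fun y hy => ⟨mem_univ _, hy.2.2⟩)
      (MemLp.of_bound (hζ.continuous.comp continuous_fst).aestronglyMeasurable C
        (.of_forall fun y => hC y.1)) fun y hy hy' => hζ.eq_zero fun h => hy' ⟨h.1, h.2, hy.2⟩
  refine ⟨hm η hη, ?_, ?_, ?_⟩
  · have h1 := hm _ (hη.fderiv_apply 1)
    simp_rw [hd'] at h1
    refine h1.of_le ?_ (.of_forall fun y => by rw [norm_single_fst, Real.norm_eq_abs])
    refine Continuous.aestronglyMeasurable ?_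
    have hc : Continuous (deriv η) := hη.smooth.continuous_deriv (by simp)
    refine (PiLp.continuous_toLp 2 _).comp (continuous_pi fun j => ?_)
    fin_cases j
    · exact hc.comp continuous_fst
    · exact continuous_const
  · simpa [hd] using hasWeakDeriv_of_contDiff (Ω := subgraph univ g) (e := (1, 0)) hs
  · simpa [hd] using hasWeakDeriv_of_contDiff (Ω := subgraph univ g) (e := (0, 1)) hs

/-- The flux through almost every vertical section of the strip is the same. -/
theorem IsCellSolution.section_flux (hp : p.HolderConjugate p') (hg : IsProfile L G₀ G₁ g)
    (h : IsCellSolution L g p v Dv) :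
    ∀ᵐ x : ℝ, ∫ t in Ioo 0 (g x), perExt L (fun y => pFlux p (Dv y) 0) (x, t) =
      qCoeff L g p Dv := by
  have := hg.isFiniteMeasure_cell
  have hL := hg.L_pos
  have hm := hg.isOpen_cell.measurableSet
  have hm' : MeasurableSet (subgraph (Ioo 0 L) g) := cell_eq_subgraph L g ▸ hm
  have hA : MemLp (fun y => pFlux p (Dv y)) ofR(p') vol[cell L g] :=
    memLp_pFlux hp (h.memLp hg)
  set A0 := perExt L (fun y => pFlux p (Dv y) 0) with hA0
  set a : ℝ → ℝ := fun x => ∫ t in Ioo 0 (g x), A0 (x, t) with ha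
  have hA0c : ∀ y ∈ cell L g, A0 y = pFlux p (Dv y) 0 := fun y hy => perExt_of_mem_cell hL _ hy
  have iA : IntegrableOn A0 (cell L g) :=
    (hg.integrableOn_cell hp.symm.lt.le (memLp_plane_apply hA 0)).congr_fun
      (fun y hy => (hA0c y hy).symm) hm
  obtain ⟨s1, s2⟩ := setIntegral_subgraph measurableSet_Ioo hm' (cell_eq_subgraph L g ▸ iA)
  have hD : HasWeakDeriv (Ioo 0 L) 1 a fun _ => 0 := hasWeakDeriv_iff.2 fun η hη => by
    have t := hη.isW1p_strip hg p
    obtain ⟨C, hC⟩ := (hη.fderiv_apply 1).exists_norm_le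
    have i1 : IntegrableOn (fun y : ℝ² => A0 y * fderiv ℝ η y.1 1) (cell L g) :=
      iA.mul_bdd (c := C) ((hη.fderiv_apply 1).continuous.comp continuous_fst).aestronglyMeasurable
        (.of_forall fun y => hC y.1)
    have h1 := (setIntegral_subgraph measurableSet_Ioo hm' (cell_eq_subgraph L g ▸ i1)).1
    simp only [integral_mul_const] at h1
    rw [← cell_eq_subgraph] at h1
    have hout : ∀ x, x ∉ Ioo 0 L → η x = 0 ∧ deriv η x = 0 := fun x hx =>
      ⟨hη.eq_zero hx, by
        have := (hη.fderiv_apply 1).eq_zero hx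
        rwa [fderiv_apply_one_eq_deriv] at this⟩
    have hbig : ∀ y : ℝ², (1 : ℕ) * L ≤ |y.1| → y.1 ∉ Ioo 0 L := fun y hy h => by
      rw [abs_of_pos h.1, Nat.cast_one, one_mul] at hy
      exact hy.not_gt h.2
    have h2 := h.integral_strip_eq_zero hp hg t (n := 1)
      (fun y hy => (hout _ (hbig y hy)).1) (fun y hy => by simp [(hout _ (hbig y hy)).2])
    rw [setIntegral_eq_of_subset_of_forall_sdiff_eq_zero
      (hg.isOpen_subgraph isOpen_univ).measurableSet (s := cell L g)
      (fun y hy => ⟨mem_univ _, hy.2.2⟩)] at h2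
    · simp only [zero_mul, integral_zero, neg_zero]
      rw [← h1, ← h2]
      refine setIntegral_congr_fun hm fun y hy => ?_
      rw [inner_single_fst, fderiv_apply_one_eq_deriv]
      rfl
    · intro y hy
      rw [inner_single_fst, (hout y.1 fun h => hy.2 ⟨h.1, h.2, hy.1.2⟩).2, mul_zero]
  obtain ⟨c, hc⟩ := ae_eq_const_of_hasWeakDeriv_zero hL s2 hD
  have hcq : c = qCoeff L g p Dv := by
    have h1 : ∫ x in Ioo 0 L, a x = L * c := by
      rw [setIntegral_congr_ae measurableSet_Ioo hc]
      simp [hL.le]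
    rw [qCoeff, ← setIntegral_congr_fun hm fun y hy => hA0c y hy]
    have h2 : ∫ y in cell L g, A0 y = L * c := by
      rw [cell_eq_subgraph, s1, ← h1]
    rw [h2, inv_mul_cancel_left₀ hL.ne']
  rw [← hcq]
  have haper : ∀ (k : ℤ) x, a (x + k * L) = a x := fun k x => by
    simp only [ha]
    rw [hg.periodic_int]
    congr 1
    ext t
    have := perExt_add_int hL.ne' (fun y => pFlux p (Dv y) 0) k (x, t)
    simpa using this
  have hk : ∀ᵐ x : ℝ, ∀ k : ℤ, x + k * L ∈ Ioo 0 L → a (x + k * L) = c := by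
    rw [ae_all_iff]
    intro k
    exact (measurePreserving_add_right volume ((k : ℝ) * L)).quasiMeasurePreserving.ae hc
  have hne : ∀ᵐ x : ℝ, ∀ k : ℤ, x ≠ k * L := by
    rw [ae_all_iff]
    exact fun k => Measure.ae_ne volume _
  filter_upwards [hk, hne] with x h1 h2
  have h3 := h1 (-⌊x / L⌋)
  rw [haper] at h3
  refine h3 ⟨?_, ?_⟩
  · have h4 := (le_div_iff₀ hL).1 (Int.floor_le (x / L))
    have h5 := lt_of_le_of_ne h4 (h2 _).symm
    push_cast
    linarith
  · have h4 := (div_lt_iff₀ hL).1 (Int.lt_floor_add_one (x / L))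
    push_cast
    linarith

theorem IsCellSolution.qCoeff_eq (hp : p.HolderConjugate p') (hg : IsProfile L G₀ G₁ g)
    (h : IsCellSolution L g p v Dv) :
    qCoeff L g p Dv = L⁻¹ * ∫ y in cell L g, ‖Dv y‖ ^ p := by
  have := hg.isFiniteMeasure_cell
  have hA : MemLp (fun y => pFlux p (Dv y)) ofR(p') vol[cell L g] :=
    memLp_pFlux hp (h.memLp hg)
  have h1 := h.equation' hp.lt.le hg (h.periodic.hasPerWeakGrad hg hp.lt.le)
  simp only [inner_sub_right, inner_single_fst, mul_one, inner_pFlux_self hp.lt] at h1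
  rw [integral_sub (integrable_norm_rpow hp.pos (h.memLp hg))
    (hg.integrableOn_cell hp.symm.lt.le (memLp_plane_apply hA 0)), sub_eq_zero] at h1
  rw [qCoeff, h1]

/-- The coefficient is positive: otherwise `v` would be constant, and `v - y₁` could not be
periodic. -/
theorem IsCellSolution.qCoeff_pos (hp : p.HolderConjugate p') (hg : IsProfile L G₀ G₁ g)
    (h : IsCellSolution L g p v Dv) : 0 < qCoeff L g p Dv := by
  have hL := hg.L_pos
  have hG := hg.G₀_pos
  have hm := hg.isOpen_cell.measurableSet
  rw [h.qCoeff_eq hp hg]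
  refine mul_pos (inv_pos.2 hL) (lt_of_le_of_ne (integral_rpow_nonneg _) fun h0 => ?_)
  have h1 := (integral_eq_zero_iff_of_nonneg (fun y => by positivity)
    (integrable_norm_rpow hp.pos (h.memLp hg))).1 h0.symm
  have h2 : ∀ᵐ y ∂vol[cell L g], Dv y = 0 := h1.mono fun y hy => by
    simpa [Real.rpow_eq_zero (norm_nonneg _) hp.ne_zero] using hy
  obtain ⟨ρ, hρ⟩ := exists_isDensity hG
  let b : ContDiffBump (L / 2) := ⟨L, 2 * L, hL, by linarith⟩
  have hb : IsTest univ b := ⟨b.contDiff, b.hasCompactSupport, subset_univ _⟩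
  have hb1 : ∀ x ∈ Ioo (-(L / 2)) (3 * L / 2), b x = 1 := fun x hx =>
    b.one_of_mem_closedBall (by
      have : b.rIn = L := rfl
      rw [this, Real.closedBall_eq_Icc]
      constructor <;> linarith [hx.1, hx.2])
  have t := hb.prod hρ.test
  obtain ⟨τ, hτ⟩ := h.periodic.2
  have h3 := hτ.green _ t.smooth t.compact (t.subset.trans fun y hy =>
    ⟨hy.2.1, hy.2.2.trans_le (hg.lower _)⟩)
  have hgL : g L = g 0 := by simpa using hg.periodic 0
  rw [hgL] at h3
  simp only [hb1 L ⟨by linarith, by linarith⟩, hb1 0 ⟨by linarith, by linarith⟩, sub_self] at h3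
  have h4 : ∫ y in cell L g, ((v y - y.1) * fderiv ℝ (fun z : ℝ² => b z.1 * ρ z.2) y (1, 0) +
      (Dv y - EuclideanSpace.single 0 1 : Plane) 0 * (b y.1 * ρ y.2)) = -∫ y in cell L g, ρ y.2 := by
    rw [← integral_neg]
    refine integral_congr_ae ?_
    filter_upwards [h2, ae_restrict_mem hm] with y hy hyc
    have h5 : y.1 ∈ Ioo (-(L / 2)) (3 * L / 2) := ⟨by linarith [hyc.1], by linarith [hyc.2.1]⟩
    have h6 : deriv b y.1 = 0 := by
      have : b =ᶠ[𝓝 y.1] fun _ => 1 := by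
        filter_upwards [isOpen_Ioo.mem_nhds h5] with x hx using hb1 x hx
      rw [this.deriv_eq, deriv_const]
    rw [fderiv_prod_mul (hb.smooth.differentiable (by simp))
      (hρ.test.smooth.differentiable (by simp)), h6, hb1 _ h5, hy]
    simp
  rw [h4] at h3
  have iρ : IntegrableOn (fun y : ℝ² => ρ y.2) (subgraph (Ioo 0 L) g) := by
    rw [← cell_eq_subgraph]
    have := hg.isFiniteMeasure_cell
    obtain ⟨C, hC⟩ := hρ.test.exists_norm_le
    exact Integrable.of_bound (hρ.test.continuous.comp continuous_snd).aestronglyMeasurable C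
      (.of_forall fun y => hC y.2)
  have h5 : ∫ y in cell L g, ρ y.2 = L := by
    rw [cell_eq_subgraph, (setIntegral_subgraph measurableSet_Ioo
      (cell_eq_subgraph L g ▸ hm) iρ).1]
    have : ∀ x, ∫ t in Ioo 0 (g x), ρ t = 1 := fun x => by
      rw [← hρ.integral_eq_one]
      exact setIntegral_eq_integral_of_forall_compl_eq_zero fun t ht =>
        hρ.test.eq_zero fun h => ht ⟨h.1, h.2.trans_le (hg.lower _)⟩
    simp [this, hL.le]
  rw [h5] at h3
  linarith

theorem IsCellSolution.ae_eq (hp : p.HolderConjugate p') (hg : IsProfile L G₀ G₁ g)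
    (h : IsCellSolution L g p v Dv) {v' : ℝ² → ℝ} {Dv' : ℝ² → Plane}
    (h' : IsCellSolution L g p v' Dv') : v' =ᵐ[vol[cell L g]] v := by
  have hp1 := hp.lt.le
  obtain ⟨C, hC0, hC⟩ := hg.cell_poincare hp.lt
  have h1 := (h'.periodic.hasPerWeakGrad hg hp1).add hg hp1
    ((h.periodic.hasPerWeakGrad hg hp1).const_mul (-1))
  have e1 : ∀ y, v' y - y.1 + -1 * (v y - y.1) = v' y - v y := fun y => by ring
  have e2 : ∀ y, Dv' y - EuclideanSpace.single 0 1 + (-1 : ℝ) • (Dv y - EuclideanSpace.single 0 1) =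
      Dv' y - Dv y := fun y => by
    rw [neg_smul, one_smul]
    abel
  simp_rw [e1, e2] at h1
  have a1 := h.equation' hp1 hg h1
  have a2 := h'.equation' hp1 hg h1
  have i := fun {D : ℝ² → Plane} (hD : MemLp D ofR(p)
    vol[cell L g]) => integrable_inner_of_memLp hp h1.grad_memLp
      (memLp_pFlux hp hD)
  have a3 : ∫ y in cell L g, inner ℝ (pFlux p (Dv' y) - pFlux p (Dv y)) (Dv' y - Dv y) = 0 := by
    simp_rw [inner_sub_left]
    rw [integral_sub (i (h'.memLp hg)) (i (h.memLp hg)), a1, a2, sub_zero]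
  have i3 : IntegrableOn (fun y => inner ℝ (pFlux p (Dv' y) - pFlux p (Dv y)) (Dv' y - Dv y))
      (cell L g) := by
    simp_rw [inner_sub_left]
    exact (i (h'.memLp hg)).sub (i (h.memLp hg))
  have a4 := (integral_eq_zero_iff_of_nonneg
    (fun y => (inner_pFlux_sub_nonneg hp.lt (Dv' y) (Dv y)).1) i3).1 a3
  have hint : ∫ y in cell L g, (v' y - v y) = 0 := by
    have h2 := (hg.setAverage_eq_zero_iff _).1 h.average_eq_zero
    have h3 := (hg.setAverage_eq_zero_iff _).1 h'.average_eq_zero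
    have i4 := hg.integrableOn_cell hp1 h.periodic.1.memLp
    have i5 := hg.integrableOn_cell hp1 h'.periodic.1.memLp
    have := integral_sub i5 i4
    rw [h2, h3] at this
    simpa using this
  have h2 := hC _ _ (h1.isPerW1p hg hp1).1 hint
  have h3 : ∫ y in cell L g, ‖Dv' y - Dv y‖ ^ p = 0 := by
    refine integral_eq_zero_of_ae (a4.mono fun y hy => ?_)
    simp only
    rw [(inner_pFlux_sub_nonneg hp.lt (Dv' y) (Dv y)).2 hy]
    simp [hp.ne_zero]
  rw [h3, mul_zero] at h2
  have h4 := (integral_eq_zero_iff_of_nonneg (fun y => by positivity)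
    (integrable_norm_rpow hp.pos h1.memLp)).1 (le_antisymm h2 (integral_rpow_nonneg _))
  refine h4.mono fun y hy => ?_
  have : ‖v' y - v y‖ = 0 := (Real.rpow_eq_zero (norm_nonneg _) hp.ne_zero).1 hy
  exact sub_eq_zero.1 (norm_eq_zero.1 this)

end CellCoefficient

/-! ### The homogenized problem -/

section Limit

/-- Two copies of a measure, on the disjoint union of two copies of the space. -/
def doubleMeasure {α : Type*} [MeasurableSpace α] (μ : Measure α) : Measure (α ⊕ α) :=
  μ.map Sum.inl + μ.map Sum.inr

theorem measurableEmbedding_inl (α : Type*) [MeasurableSpace α] :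
    MeasurableEmbedding (Sum.inl : α → α ⊕ α) :=
  ⟨Sum.inl_injective, measurable_inl, fun _ => measurableSet_inl_image.2⟩

theorem measurableEmbedding_inr (α : Type*) [MeasurableSpace α] :
    MeasurableEmbedding (Sum.inr : α → α ⊕ α) :=
  ⟨Sum.inr_injective, measurable_inr, fun _ => measurableSet_inr_image.2⟩

theorem integral_doubleMeasure {α : Type*} [MeasurableSpace α] {μ : Measure α} {F : α ⊕ α → ℝ}
    (hF : Integrable F (doubleMeasure μ)) :
    ∫ x, F x ∂(doubleMeasure μ) = (∫ x, F (Sum.inl x) ∂μ) + ∫ x, F (Sum.inr x) ∂μ := by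
  rw [doubleMeasure, integral_add_measure hF.left_of_add_measure hF.right_of_add_measure,
    (measurableEmbedding_inl α).integral_map, (measurableEmbedding_inr α).integral_map]

theorem aestronglyMeasurable_doubleMeasure {α : Type*} [MeasurableSpace α] {μ : Measure α}
    {F : α ⊕ α → ℝ} (h1 : AEStronglyMeasurable (fun x => F (Sum.inl x)) μ)
    (h2 : AEStronglyMeasurable (fun x => F (Sum.inr x)) μ) :
    AEStronglyMeasurable F (doubleMeasure μ) :=
  ((measurableEmbedding_inl α).aestronglyMeasurable_map_iff.2 h1).add_measure
    ((measurableEmbedding_inr α).aestronglyMeasurable_map_iff.2 h2)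

theorem memLp_doubleMeasure {α : Type*} [MeasurableSpace α] {μ : Measure α} {p : ℝ} (hp : 0 < p)
    {F : α ⊕ α → ℝ} : MemLp F ofR(p) (doubleMeasure μ) ↔
      MemLp (fun x => F (Sum.inl x)) ofR(p) μ ∧
        MemLp (fun x => F (Sum.inr x)) ofR(p) μ := by
  refine ⟨fun h => ⟨(measurableEmbedding_inl α).memLp_map_measure_iff.1 h.left_of_add_measure,
    (measurableEmbedding_inr α).memLp_map_measure_iff.1 h.right_of_add_measure⟩, fun ⟨h1, h2⟩ =>
    memLp_of_integrable_norm_rpow hp (aestronglyMeasurable_doubleMeasure h1.1 h2.1)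
      (Integrable.add_measure ?_ ?_)⟩
  · exact (measurableEmbedding_inl α).integrable_map_iff.2 (integrable_norm_rpow hp h1)
  · exact (measurableEmbedding_inr α).integrable_map_iff.2 (integrable_norm_rpow hp h2)

variable {p p' c₀ c₁ : ℝ} {q r f : ℝ → ℝ}

/-- The limit problem is solved by minimization over pairs `(u', u)`, regarded as functions on two
copies of the interval with the weights `q` and `r`. -/
theorem exists_isLimitSolution (hp : p.HolderConjugate p') (hc₀ : 0 < c₀) (hc : c₀ ≤ c₁)
    (hqm : AEStronglyMeasurable q vol[Ioo 0 1])
    (hrm : AEStronglyMeasurable r vol[Ioo 0 1])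
    (hq : ∀ᵐ x ∂vol[Ioo 0 1], q x ∈ Icc c₀ c₁)
    (hr : ∀ᵐ x ∂vol[Ioo 0 1], r x ∈ Icc c₀ c₁)
    (hf : MemLp f ofR(p') vol[Ioo 0 1]) :
    ∃ u du, IsLimitSolution p q r f u du := by
  have hp0 := hp.pos
  have hp1 := hp.lt.le
  set μ := (volume : Measure ℝ).restrict (Ioo 0 1) with hμ
  set K : Submodule ℝ (ℝ ⊕ ℝ → ℝ) :=
    { carrier := {X | IsW1pLine (Ioo 0 1) p (fun x => X (Sum.inr x)) fun x => X (Sum.inl x)}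
      add_mem' := fun h1 h2 => h1.add hp1 h2
      zero_mem' := ⟨MemLp.zero', MemLp.zero', fun φ _ _ _ => by simp⟩
      smul_mem' := fun c X h => h.const_mul c }
  have hKm : ∀ X ∈ K, MemLp X ofR(p) (doubleMeasure μ) := fun X hX =>
    (memLp_doubleMeasure hp0).2 ⟨hX.deriv_memLp, hX.memLp⟩
  have hcl : ∀ (X : ℕ → ℝ ⊕ ℝ → ℝ) (X' : ℝ ⊕ ℝ → ℝ), (∀ n, X n ∈ K) →
      MemLp X' ofR(p) (doubleMeasure μ) →
      Tendsto (fun n => ∫ x, ‖X n x - X' x‖ ^ p ∂(doubleMeasure μ)) atTop (𝓝 0) →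
      ∃ Y ∈ K, Y =ᵐ[doubleMeasure μ] X' := by
    intro X X' hX hX' hlim
    obtain ⟨h1, h2⟩ := (memLp_doubleMeasure hp0).1 hX'
    have hd := fun n => (hKm _ (hX n)).sub hX'
    have e := fun n => integral_doubleMeasure (integrable_norm_rpow hp0 (hd n))
    simp only [Pi.sub_apply] at e
    simp_rw [e] at hlim
    have l1 : Tendsto (fun n => ∫ x, ‖X n (Sum.inl x) - X' (Sum.inl x)‖ ^ p ∂μ) atTop (𝓝 0) :=
      squeeze_zero (fun n => integral_rpow_nonneg _)
        (fun n => le_add_of_nonneg_right (integral_rpow_nonneg _)) hlim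
    have l2 : Tendsto (fun n => ∫ x, ‖X n (Sum.inr x) - X' (Sum.inr x)‖ ^ p ∂μ) atTop (𝓝 0) :=
      squeeze_zero (fun n => integral_rpow_nonneg _)
        (fun n => le_add_of_nonneg_left (integral_rpow_nonneg _)) hlim
    refine ⟨X', ⟨h2, h1, HasWeakDeriv.of_tendsto (fun n => (hX n).weakDeriv) (fun φ hφ => ?_)
      fun φ hφ => ?_⟩, ae_eq_refl _⟩
    · exact tendsto_integral_mul_of_tendsto_rpow hp (fun n => (hX n).memLp) h2 (hφ.memLp _ _) l2
    · exact tendsto_integral_mul_of_tendsto_rpow hp (fun n => (hX n).deriv_memLp) h1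
        (hφ.memLp _ _) l1
  -- Off a null set the weights are `q` and `r`.
  set W : ℝ ⊕ ℝ → ℝ := Sum.elim (fun x => max c₀ (min c₁ (q x))) fun x => max c₀ (min c₁ (r x))
    with hW
  set Fs : ℝ ⊕ ℝ → ℝ := Sum.elim (fun _ => 0) f with hFs
  have hWm : AEStronglyMeasurable W (doubleMeasure μ) := by
    refine aestronglyMeasurable_doubleMeasure ?_ ?_
    · exact aestronglyMeasurable_const.sup (aestronglyMeasurable_const.inf hqm)
    · exact aestronglyMeasurable_const.sup (aestronglyMeasurable_const.inf hrm)
  have hF : MemLp Fs ofR(p') (doubleMeasure μ) :=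
    (memLp_doubleMeasure hp.symm.pos).2 ⟨MemLp.zero', hf⟩
  have hW0 : ∀ x, c₀ ≤ W x := fun x => by cases x <;> exact le_max_left _ _
  have hW1 : ∀ x, W x ≤ c₁ := fun x => by cases x <;> exact max_le hc (min_le_left _ _)
  obtain ⟨X, hX, hXeq⟩ := exists_variational_solution hp K hKm hcl (X₀ := fun _ => 0) MemLp.zero'
    hF hWm hc₀ hW0 hW1
  refine ⟨fun x => X (Sum.inr x), fun x => X (Sum.inl x), hX, fun φ dφ hφ => ?_⟩
  have h1 := hXeq (Sum.elim dφ φ) hφ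
  have iX := hKm X hX
  have iY := hKm (Sum.elim dφ φ) hφ
  simp only [zero_add] at h1
  rw [integral_doubleMeasure, integral_doubleMeasure] at h1
  · simp only [hW, hFs, Sum.elim_inl, Sum.elim_inr, inner_zero_left, integral_zero, zero_add] at h1
    have e2 : ∫ x, f x * φ x ∂μ = ∫ x, inner ℝ (f x) (φ x) ∂μ := by
      simp [mul_comm]
    rw [e2, ← h1, ← integral_add]
    · refine integral_congr_ae ?_
      filter_upwards [hq, hr] with x h2 h3
      rw [min_eq_right h2.2, max_eq_right h2.1, min_eq_right h3.2, max_eq_right h3.1]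
      simp only [RCLike.inner_apply, conj_trivial]
      ring
    · have := (integrable_inner_of_memLp hp ((memLp_doubleMeasure hp0).1 iY).1
        (memLp_pFlux hp ((memLp_doubleMeasure hp0).1 iX).1)).bdd_mul (c := c₁)
        (f := fun x => max c₀ (min c₁ (q x)))
        (aestronglyMeasurable_const.sup (aestronglyMeasurable_const.inf hqm))
        (.of_forall fun x => by
          rw [Real.norm_eq_abs, abs_of_nonneg (hc₀.le.trans (le_max_left _ _))]
          exact max_le hc (min_le_left _ _))
      exact this
    · have := (integrable_inner_of_memLp hp ((memLp_doubleMeasure hp0).1 iY).2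
        (memLp_pFlux hp ((memLp_doubleMeasure hp0).1 iX).2)).bdd_mul (c := c₁)
        (f := fun x => max c₀ (min c₁ (r x)))
        (aestronglyMeasurable_const.sup (aestronglyMeasurable_const.inf hrm))
        (.of_forall fun x => by
          rw [Real.norm_eq_abs, abs_of_nonneg (hc₀.le.trans (le_max_left _ _))]
          exact max_le hc (min_le_left _ _))
      exact this
  · exact integrable_inner_of_memLp hp iY hF
  · refine (integrable_inner_of_memLp hp iY (memLp_pFlux hp iX)).bdd_mul (c := c₁) hWm
      (.of_forall fun x => ?_)
    rw [Real.norm_eq_abs, abs_of_nonneg (hc₀.le.trans (hW0 x))]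
    exact hW1 x

theorem IsLimitSolution.ae_eq (hp : p.HolderConjugate p') (hc₀ : 0 < c₀)
    (hqm : AEStronglyMeasurable q vol[Ioo 0 1])
    (hrm : AEStronglyMeasurable r vol[Ioo 0 1])
    (hq : ∀ᵐ x ∂vol[Ioo 0 1], q x ∈ Icc c₀ c₁)
    (hr : ∀ᵐ x ∂vol[Ioo 0 1], r x ∈ Icc c₀ c₁)
    {u du w dw : ℝ → ℝ} (hu : IsLimitSolution p q r f u du) (hw : IsLimitSolution p q r f w dw) :
    w =ᵐ[vol[Ioo 0 1]] u := by
  have hd := hw.isW1p.sub hp.lt.le hu.isW1p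
  have h1 := hu.equation _ _ hd
  have h2 := hw.equation _ _ hd
  have ib : ∀ {a b z : ℝ → ℝ}, AEStronglyMeasurable z vol[Ioo 0 1] →
      (∀ᵐ x ∂vol[Ioo 0 1], z x ∈ Icc c₀ c₁) →
      MemLp a ofR(p) vol[Ioo 0 1] →
      MemLp b ofR(p) vol[Ioo 0 1] →
      IntegrableOn (fun x => z x * pFlux p (a x) * b x) (Ioo 0 1) := fun hz hz' ha hb => by
    have := (integrable_mul_of_memLp hp hb (memLp_pFlux hp ha)).bdd_mul (c := c₁) hz
      (hz'.mono fun x hx => by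
        rw [Real.norm_eq_abs, abs_of_nonneg (hc₀.le.trans hx.1)]
        exact hx.2)
    refine this.congr (.of_forall fun x => ?_)
    simp only
    ring
  have i1 := (ib hqm hq hw.isW1p.deriv_memLp hd.deriv_memLp).fun_add
    (ib hrm hr hw.isW1p.memLp hd.memLp)
  have i2 := (ib hqm hq hu.isW1p.deriv_memLp hd.deriv_memLp).fun_add
    (ib hrm hr hu.isW1p.memLp hd.memLp)
  have h3 := integral_sub i1 i2
  rw [h1, h2, sub_self] at h3
  have i3 := i1.sub i2
  have hmon : ∀ a b : ℝ, 0 ≤ (pFlux p a - pFlux p b) * (a - b) ∧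
      ((pFlux p a - pFlux p b) * (a - b) = 0 → a = b) := fun a b => by
    have := inner_pFlux_sub_nonneg hp.lt a b
    simpa only [RCLike.inner_apply, conj_trivial, mul_comm (a - b)] using this
  have e : ∀ x, (q x * pFlux p (dw x) * (dw x - du x) + r x * pFlux p (w x) * (w x - u x)) -
      (q x * pFlux p (du x) * (dw x - du x) + r x * pFlux p (u x) * (w x - u x)) =
      q x * ((pFlux p (dw x) - pFlux p (du x)) * (dw x - du x)) +
        r x * ((pFlux p (w x) - pFlux p (u x)) * (w x - u x)) := fun x => by ring
  have h4 := (integral_eq_zero_iff_of_nonneg_ae (by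
    filter_upwards [hq, hr] with x hx hx'
    simp only [Pi.sub_apply, Pi.zero_apply]
    rw [e]
    exact add_nonneg (mul_nonneg (hc₀.le.trans hx.1) (hmon _ _).1)
      (mul_nonneg (hc₀.le.trans hx'.1) (hmon _ _).1)) i3).1 h3
  filter_upwards [h4, hq, hr] with x h5 hx hx'
  simp only [Pi.sub_apply, Pi.zero_apply] at h5
  rw [e] at h5
  have n1 := mul_nonneg (hc₀.le.trans hx.1) (hmon (dw x) (du x)).1
  have n2 := mul_nonneg (hc₀.le.trans hx'.1) (hmon (w x) (u x)).1
  have h6 : r x * ((pFlux p (w x) - pFlux p (u x)) * (w x - u x)) = 0 := by linarith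
  rcases mul_eq_zero.1 h6 with h7 | h7
  · linarith [hx'.1]
  · exact (hmon _ _).2 h7

end Limit

/-! ### Scaling and unfolding -/

section Unfolding

variable {L G₀ G₁ ε : ℝ} {g : ℝ → ℝ}

/-- The profile at scale `ε`. -/
def scaled (ε : ℝ) (g : ℝ → ℝ) (x : ℝ) : ℝ := ε * g (x / ε)

theorem IsProfile.continuous_scaled (hg : IsProfile L G₀ G₁ g) (ε : ℝ) :
    Continuous (scaled ε g) :=
  continuous_const.mul (hg.contDiff.continuous.comp (continuous_id.div_const ε))

theorem IsProfile.isOpen_scaled (hg : IsProfile L G₀ G₁ g) {I : Set ℝ} (hI : IsOpen I) :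
    IsOpen (subgraph I (scaled ε g)) := ThinDomain.isOpen_subgraph hI (hg.continuous_scaled ε)

theorem preimage_inv_smul_strip (hε : 0 < ε) (g : ℝ → ℝ) :
    (fun z : ℝ² => ε⁻¹ • z) ⁻¹' subgraph univ g = subgraph univ (scaled ε g) := by
  ext z
  simp only [subgraph, scaled, mem_preimage, mem_univ, true_and, Prod.smul_fst, Prod.smul_snd,
    smul_eq_mul, mem_ofPred_eq, inv_mul_eq_div]
  rw [div_pos_iff_of_pos_right hε, div_lt_iff₀' hε]

theorem map_inv_smul_restrict (hε : 0 < ε) {Ω : Set ℝ²} (hΩ : MeasurableSet Ω) :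
    Measure.map (fun z : ℝ² => ε⁻¹ • z)
      vol[(fun z : ℝ² => ε⁻¹ • z) ⁻¹' Ω] =
      ENNReal.ofReal (ε ^ 2) • vol[Ω] := by
  have hm : Measurable fun z : ℝ² => ε⁻¹ • z := measurable_const_smul _
  rw [← Measure.restrict_map hm hΩ, Measure.map_addHaar_smul volume (inv_ne_zero hε.ne'),
    Measure.restrict_smul]
  congr 2
  rw [Module.finrank_prod, Module.finrank_self, inv_pow, inv_inv, abs_of_pos (by positivity)]

theorem measurePreserving_inv_smul (hε : 0 < ε) {Ω : Set ℝ²} (hΩ : MeasurableSet Ω) :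
    MeasurePreserving (fun z : ℝ² => ε⁻¹ • z)
      vol[(fun z : ℝ² => ε⁻¹ • z) ⁻¹' Ω]
      (ENNReal.ofReal (ε ^ 2) • vol[Ω]) :=
  ⟨measurable_const_smul _, map_inv_smul_restrict hε hΩ⟩

theorem setIntegral_comp_inv_smul (hε : 0 < ε) {Ω : Set ℝ²} (hΩ : MeasurableSet Ω)
    (F : ℝ² → ℝ) : ∫ z in (fun z : ℝ² => ε⁻¹ • z) ⁻¹' Ω, F (ε⁻¹ • z) =
      ε ^ 2 * ∫ z in Ω, F z := by
  have := (measurePreserving_inv_smul hε hΩ).integral_comp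
    (Homeomorph.smulOfNeZero ε⁻¹ (inv_ne_zero hε.ne')).measurableEmbedding F
  rw [this, integral_smul_measure, ENNReal.toReal_ofReal (by positivity), smul_eq_mul]

theorem memLp_comp_inv_smul {V : Type*} [NormedAddCommGroup V] (hε : 0 < ε) {Ω : Set ℝ²}
    (hΩ : MeasurableSet Ω) {F : ℝ² → V} {p : ENNReal} (hF : MemLp F p vol[Ω]) :
    MemLp (fun z => F (ε⁻¹ • z)) p vol[(fun z : ℝ² => ε⁻¹ • z) ⁻¹' Ω] :=
  (hF.smul_measure ENNReal.ofReal_ne_top).comp_measurePreserving (measurePreserving_inv_smul hε hΩ)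

/-- The map that unfolds the strip of size `ε`: the first variable selects a cell of size `ε`, the
others are the coordinates in this cell. -/
def unfoldMap (L ε : ℝ) (q : ℝ × ℝ²) : ℝ² :=
  (ε * ⌊q.1 / (ε * L)⌋ * L + ε * q.2.1, ε * q.2.2)

theorem unfoldMap_eq (L ε : ℝ) (q : ℝ × ℝ²) :
    unfoldMap L ε q = ε • (q.2 + ((⌊q.1 / (ε * L)⌋ : ℝ) * L, 0)) := by
  ext
  · simp [unfoldMap]
    ring
  · simp [unfoldMap]

theorem measurable_unfoldMap (L ε : ℝ) : Measurable (unfoldMap L ε) := by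
  unfold unfoldMap
  have h : Measurable fun q : ℝ × ℝ² => ((⌊q.1 / (ε * L)⌋ : ℤ) : ℝ) :=
    (measurable_from_top (f := fun k : ℤ => (k : ℝ))).comp
      (Int.measurable_floor.comp (measurable_fst.div_const _))
  exact (((measurable_const.mul h).mul_const _).add
    (measurable_const.mul (measurable_fst.comp measurable_snd))).prodMk
    (measurable_const.mul (measurable_snd.comp measurable_snd))

/-- Unfolding preserves the measure, up to a factor. -/
theorem IsProfile.measurePreserving_unfoldMap (hg : IsProfile L G₀ G₁ g) (hε : 0 < ε) :
    MeasurePreserving (unfoldMap L ε) ((volume : Measure ℝ).prod vol[cell L g])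
      (ENNReal.ofReal (L / ε) • vol[subgraph univ (scaled ε g)]) := by
  have hL := hg.L_pos
  have hεL : 0 < ε * L := mul_pos hε hL
  refine ⟨measurable_unfoldMap L ε, Measure.ext fun B hB => ?_⟩
  have hSm : MeasurableSet (subgraph univ g) := (hg.isOpen_subgraph isOpen_univ).measurableSet
  rw [Measure.map_apply (measurable_unfoldMap L ε) hB,
    Measure.prod_apply (measurable_unfoldMap L ε hB)]
  set C : Set ℝ² := (fun y : ℝ² => ε • y) ⁻¹' B with hC
  have hCm : MeasurableSet C := measurable_const_smul ε hB
  set F : ℤ → ENNReal := fun k => volume (tile L g k ∩ C) with hF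
  have hFk : ∀ k : ℤ, vol[cell L g] ((fun y => y + ((k : ℝ) * L, 0)) ⁻¹' C) = F k := by
    intro k
    have hmm : Measurable fun y : ℝ² => y + ((k : ℝ) * L, 0) := measurable_add_const _
    rw [Measure.restrict_apply (hmm hCm), hF, ← hg.preimage_tile k, inter_comm, ← preimage_inter]
    exact (measurePreserving_shift (k * L)).measure_preimage
      ((hg.measurableSet_tile k).inter hCm).nullMeasurableSet
  have e1 : ∀ x : ℝ, vol[cell L g] (Prod.mk x ⁻¹' (unfoldMap L ε ⁻¹' B)) =
      F ⌊x / (ε * L)⌋ := by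
    intro x
    rw [← hFk]
    congr 1
    ext y
    simp only [mem_preimage, unfoldMap_eq, hC]
  simp_rw [e1]
  have hfl : Measurable fun x : ℝ => ⌊x / (ε * L)⌋ :=
    Int.measurable_floor.comp (measurable_id.div_const _)
  rw [← lintegral_map (f := F) (measurable_from_top) hfl, lintegral_countable']
  have e2 : ∀ k : ℤ, (Measure.map (fun x : ℝ => ⌊x / (ε * L)⌋) volume) {k} =
      ENNReal.ofReal (ε * L) := by
    intro k
    rw [Measure.map_apply hfl (measurableSet_singleton k)]
    have : (fun x : ℝ => ⌊x / (ε * L)⌋) ⁻¹' {k} = Ico (k * (ε * L)) ((k + 1) * (ε * L)) := by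
      ext x
      simp only [mem_preimage, mem_singleton_iff, Int.floor_eq_iff, mem_Ico]
      rw [le_div_iff₀ hεL, div_lt_iff₀ hεL]
    rw [this, Real.volume_Ico]
    congr 1
    ring
  simp_rw [e2]
  rw [ENNReal.tsum_mul_right]
  have e3 : ∑' k, F k = volume (subgraph univ g ∩ C) := by
    rw [hF, ← measure_iUnion]
    · rw [← iUnion_inter]
      refine measure_congr ?_
      filter_upwards [ae_forall_fst_ne L] with y hy
      refine propext (and_congr_left fun _ => ⟨fun h => ?_, fun h => ?_⟩)
      · obtain ⟨k, hk⟩ := mem_iUnion.1 h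
        exact ⟨mem_univ _, hk.2⟩
      · exact mem_iUnion.2 (exists_mem_tile hL h.2 hy)
    · exact fun j k hjk => (disjoint_tile hL g hjk).mono inter_subset_left inter_subset_left
    · exact fun k => (hg.measurableSet_tile k).inter hCm
  have e4 : volume (subgraph univ (scaled ε g) ∩ B) =
      ENNReal.ofReal (ε ^ 2) * volume (subgraph univ g ∩ C) := by
    have h1 := congrArg (fun μ => μ C) (map_inv_smul_restrict hε hSm)
    simp only [Measure.smul_apply, smul_eq_mul] at h1
    rw [Measure.map_apply (measurable_const_smul _) hCm, preimage_inv_smul_strip hε,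
      Measure.restrict_apply (measurable_const_smul _ hCm), Measure.restrict_apply hCm] at h1
    have h2 : (fun z : ℝ² => ε⁻¹ • z) ⁻¹' C = B := by
      ext z
      simp [hC, smul_smul, hε.ne']
    rw [h2, inter_comm, inter_comm C] at h1
    exact h1
  rw [e3, Measure.smul_apply, smul_eq_mul, Measure.restrict_apply hB, inter_comm B, e4, ← mul_assoc,
    ← ENNReal.ofReal_mul (by positivity), mul_comm]
  congr 2
  field_simp

theorem unfoldMap_fst_sub_mem (hL : 0 < L) (hε : 0 < ε) {q : ℝ × ℝ²} (hq : q.2.1 ∈ Ioo 0 L) :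
    |(unfoldMap L ε q).1 - q.1| ≤ ε * L := by
  have hεL : 0 < ε * L := mul_pos hε hL
  have h1 := (le_div_iff₀ hεL).1 (Int.floor_le (q.1 / (ε * L)))
  have h2 := (div_lt_iff₀ hεL).1 (Int.lt_floor_add_one (q.1 / (ε * L)))
  have h3 : 0 < ε * q.2.1 := mul_pos hε hq.1
  have h4 : ε * q.2.1 < ε * L := mul_lt_mul_of_pos_left hq.2 hε
  simp only [unfoldMap]
  rw [abs_le]
  constructor <;> nlinarith

theorem tendsto_unfoldMap_fst (hL : 0 < L) {q : ℝ × ℝ²} (hq : q.2.1 ∈ Ioo 0 L) :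
    Tendsto (fun ε => (unfoldMap L ε q).1) (𝓝[>] 0) (𝓝 q.1) := by
  rw [tendsto_iff_norm_sub_tendsto_zero]
  have h : Tendsto (fun ε => ε * L) (𝓝[>] 0) (𝓝 0) := by
    have : Tendsto (fun ε : ℝ => ε * L) (𝓝 0) (𝓝 (0 * L)) := tendsto_id.mul_const L
    rw [zero_mul] at this
    exact this.mono_left nhdsWithin_le_nhds
  refine squeeze_zero' (.of_forall fun _ => norm_nonneg _) ?_ h
  filter_upwards [self_mem_nhdsWithin] with ε hε using unfoldMap_fst_sub_mem hL hε hq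

theorem IsProfile.perExt_unfoldMap {V : Type*} (hg : IsProfile L G₀ G₁ g) (hε : 0 < ε)
    (F : ℝ² → V) {q : ℝ × ℝ²} (hq : q.2 ∈ cell L g) :
    perExt L F (ε⁻¹ • unfoldMap L ε q) = F q.2 := by
  rw [unfoldMap_eq, smul_smul, inv_mul_cancel₀ hε.ne', one_smul, perExt_add_int hg.L_pos.ne',
    perExt_of_mem_cell hg.L_pos F hq]

theorem IsProfile.aestronglyMeasurable_perExt {V : Type*} [NormedAddCommGroup V]
    (hg : IsProfile L G₀ G₁ g) (hε : 0 < ε) {F : ℝ² → V} (hF : IntegrableOn F (cell L g)) :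
    AEStronglyMeasurable (fun z => perExt L F (ε⁻¹ • z))
      vol[subgraph univ (scaled ε g)] := by
  have hSm : MeasurableSet (subgraph univ g) := (hg.isOpen_subgraph isOpen_univ).measurableSet
  have h1 := (hg.locallyIntegrableOn_perExt hF).aestronglyMeasurable
  have h2 := (h1.smul_measure (ENNReal.ofReal (ε ^ 2))).comp_measurePreserving
    (measurePreserving_inv_smul hε hSm)
  rwa [preimage_inv_smul_strip hε] at h2

theorem IsProfile.integral_unfoldMap (hg : IsProfile L G₀ G₁ g) (hε : 0 < ε) {H : ℝ² → ℝ}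
    (hH : AEStronglyMeasurable H vol[subgraph univ (scaled ε g)]) :
    ∫ q, H (unfoldMap L ε q) ∂((volume : Measure ℝ).prod vol[cell L g]) =
      L / ε * ∫ z in subgraph univ (scaled ε g), H z := by
  have hT := hg.measurePreserving_unfoldMap hε
  rw [← integral_map hT.measurable.aemeasurable (f := H), hT.map_eq, integral_smul_measure,
    ENNReal.toReal_ofReal (div_pos hg.L_pos hε).le, smul_eq_mul]
  rw [hT.map_eq]
  exact hH.smul_measure _

/-- Averages of a rapidly oscillating function with a continuous weight converge. -/
theorem IsProfile.tendsto_integral_oscillating (hg : IsProfile L G₀ G₁ g) {h : ℝ → ℝ}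
    (hc : Continuous h) (hs : HasCompactSupport h) {a : ℝ² → ℝ}
    (ha : IntegrableOn a (cell L g)) :
    Tendsto (fun ε => ε⁻¹ * ∫ z in subgraph univ (scaled ε g), h z.1 * perExt L a (ε⁻¹ • z))
      (𝓝[>] 0) (𝓝 (L⁻¹ * ((∫ x, h x) * ∫ y in cell L g, a y))) := by
  have hL := hg.L_pos
  have hm := hg.isOpen_cell.measurableSet
  set ν := (volume : Measure ℝ).prod vol[cell L g] with hν
  obtain ⟨C, hC⟩ := hc.bounded_above_of_compact_support hs
  have hC0 : 0 ≤ C := (norm_nonneg _).trans (hC 0)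
  obtain ⟨R, hR⟩ := hs.isCompact.isBounded.exists_norm_le
  have hcell : ∀ᵐ q ∂ν, q.2 ∈ cell L g :=
    Measure.quasiMeasurePreserving_snd.ae (ae_restrict_mem hm)
  have e1 : ∀ ε, 0 < ε → ε⁻¹ * ∫ z in subgraph univ (scaled ε g), h z.1 * perExt L a (ε⁻¹ • z) =
      L⁻¹ * ∫ q, h (unfoldMap L ε q).1 * a q.2 ∂ν := by
    intro ε hε
    have h1 := hg.integral_unfoldMap hε (H := fun z => h z.1 * perExt L a (ε⁻¹ • z))
      ((hc.comp continuous_fst).aestronglyMeasurable.mul (hg.aestronglyMeasurable_perExt hε ha))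
    have h2 : ∫ q, h (unfoldMap L ε q).1 * a q.2 ∂ν =
        ∫ q, h (unfoldMap L ε q).1 * perExt L a (ε⁻¹ • unfoldMap L ε q) ∂ν :=
      integral_congr_ae (hcell.mono fun q hq => by
        simp only
        rw [hg.perExt_unfoldMap hε a hq])
    rw [h2, h1]
    field_simp
  have lim : Tendsto (fun ε => ∫ q, h (unfoldMap L ε q).1 * a q.2 ∂ν) (𝓝[>] 0)
      (𝓝 (∫ q, h q.1 * a q.2 ∂ν)) := by
    refine tendsto_integral_filter_of_dominated_convergence
      (fun q => (Icc (-(R + L)) (R + L)).indicator (fun _ => C) q.1 * ‖a q.2‖)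
      (.of_forall fun ε => ?_) ?_ ?_ ?_
    · exact ((hc.measurable.comp (measurable_fst.comp
        (measurable_unfoldMap L ε))).aestronglyMeasurable).mul (AEStronglyMeasurable.comp_snd ha.1)
    · have hev : ∀ᶠ ε : ℝ in 𝓝[>] 0, ε ∈ Ioo 0 1 := Ioo_mem_nhdsGT one_pos
      filter_upwards [hev] with ε hε
      refine hcell.mono fun q hq => ?_
      rw [norm_mul]
      refine mul_le_mul_of_nonneg_right ?_ (norm_nonneg _)
      by_cases hq1 : q.1 ∈ Icc (-(R + L)) (R + L)
      · rw [indicator_of_mem hq1]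
        exact hC _
      · rw [indicator_of_notMem hq1, norm_le_zero_iff]
        by_contra h0
        have h1 := hR _ (subset_tsupport _ h0)
        have h2 := unfoldMap_fst_sub_mem (ε := ε) hL hε.1 ⟨hq.1, hq.2.1⟩
        rw [Real.norm_eq_abs, abs_le] at h1
        rw [abs_le] at h2
        have h3 : ε * L ≤ L := mul_le_of_le_one_left hL.le hε.2.le
        exact hq1 ⟨by linarith, by linarith⟩
    · exact Integrable.mul_prod ((integrable_indicator_iff measurableSet_Icc).2
        (integrableOn_const (by simp))) ha.norm
    · exact hcell.mono fun q hq => ((hc.tendsto _).comp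
        (tendsto_unfoldMap_fst hL ⟨hq.1, hq.2.1⟩)).mul_const _
  have e2 : ∫ q, h q.1 * a q.2 ∂ν = (∫ x, h x) * ∫ y in cell L g, a y := integral_prod_mul _ _
  rw [← e2]
  refine (lim.const_mul L⁻¹).congr' ?_
  filter_upwards [self_mem_nhdsWithin] with ε hε using (e1 ε hε).symm

end Unfolding

/-! ### The pieces of a thin domain -/

namespace Profile

variable {N : ℕ} {L G₀ G₁ : ℝ} (P : Profile N L G₀ G₁)

theorem isProfile (i : Fin N) : IsProfile L G₀ G₁ (P.g i) :=
  ⟨P.L_pos, P.G₀_pos, P.contDiff i, P.periodic i, P.lower i, P.upper i⟩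

theorem isOpen_piece (i : Fin N) : IsOpen (P.piece i) := isOpen_Ioo

theorem measurableSet_piece (i : Fin N) : MeasurableSet (P.piece i) := measurableSet_Ioo

theorem piece_subset (i : Fin N) : P.piece i ⊆ Ioo 0 1 := by
  rw [← P.ξ_zero, ← P.ξ_last]
  exact Ioo_subset_Ioo (P.ξ_strictMono.monotone (Fin.zero_le _))
    (P.ξ_strictMono.monotone (Fin.le_last _))

theorem pairwise_disjoint_piece : Pairwise (Function.onFun Disjoint P.piece) := by
  intro i j hij
  wlog h : i < j generalizing i j
  · exact (this hij.symm (lt_of_le_of_ne (not_lt.1 h) hij.symm)).symm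
  refine disjoint_left.2 fun x hx hx' => ?_
  have h1 : P.ξ i.succ ≤ P.ξ j.castSucc := P.ξ_strictMono.monotone (by
    rw [Fin.le_def]
    simpa using h)
  exact absurd (hx.2.trans_le h1) (not_lt.2 hx'.1.le)

theorem exists_mem_piece {x : ℝ} (hx : x ∈ 𝕀) (hξ : x ∉ range P.ξ) :
    ∃ i, x ∈ P.piece i := by
  by_contra! h
  have key : ∀ j : Fin (N + 1), P.ξ j < x := fun j => by
    induction j using Fin.induction with
    | zero => exact P.ξ_zero ▸ hx.1
    | succ i ih =>
      by_contra! h1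
      exact h i ⟨ih, lt_of_le_of_ne h1 fun e => hξ ⟨_, e.symm⟩⟩
  have := key (Fin.last N)
  rw [P.ξ_last] at this
  exact absurd this (not_lt.2 hx.2.le)

/-- The part of the thin domain over the `i`-th piece. -/
def pieceDomain (i : Fin N) (ε : ℝ) : Set ℝ² := subgraph (P.piece i) (scaled ε (P.g i))

theorem isOpen_pieceDomain (i : Fin N) (ε : ℝ) : IsOpen (P.pieceDomain i ε) :=
  (P.isProfile i).isOpen_scaled (P.isOpen_piece i)

theorem measurableSet_pieceDomain (i : Fin N) (ε : ℝ) : MeasurableSet (P.pieceDomain i ε) :=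
  (P.isOpen_pieceDomain i ε).measurableSet

theorem pieceDomain_subset_strip (i : Fin N) (ε : ℝ) :
    P.pieceDomain i ε ⊆ subgraph univ (scaled ε (P.g i)) := fun _ hz => ⟨mem_univ _, hz.2⟩

theorem mem_thinDomain_iff {i : Fin N} {ε : ℝ} {z : ℝ²} (hz : z.1 ∈ P.piece i) :
    z ∈ P.thinDomain ε ↔ z ∈ P.pieceDomain i ε := by
  have h1 := P.piece_subset i hz
  have h2 := P.G_piece i z.1 hz (z.1 / ε)
  simp only [thinDomain, pieceDomain, subgraph, scaled, mem_ofPred_eq, h2, h1, hz, true_and]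

theorem pieceDomain_subset (i : Fin N) (ε : ℝ) : P.pieceDomain i ε ⊆ P.thinDomain ε :=
  fun _ hz => (P.mem_thinDomain_iff hz.1).2 hz

theorem ae_fst_notMem_range : ∀ᵐ x : ℝ, x ∉ range P.ξ :=
  measure_eq_zero_iff_ae_notMem.1 ((finite_range P.ξ).measure_zero volume)

theorem iUnion_piece_ae_eq : (⋃ i, P.piece i : Set ℝ) =ᵐ[volume] 𝕀 := by
  filter_upwards [P.ae_fst_notMem_range] with x hx
  refine propext ⟨fun h => ?_, fun h => mem_iUnion.2 (P.exists_mem_piece h hx)⟩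
  obtain ⟨i, hi⟩ := mem_iUnion.1 h
  exact P.piece_subset i hi

theorem iUnion_pieceDomain_ae_eq (ε : ℝ) :
    (⋃ i, P.pieceDomain i ε : Set ℝ²) =ᵐ[volume] P.thinDomain ε := by
  filter_upwards [ae_comp_fst P.ae_fst_notMem_range] with z hz
  refine propext ⟨fun h => ?_, fun h => ?_⟩
  · obtain ⟨i, hi⟩ := mem_iUnion.1 h
    exact P.pieceDomain_subset i ε hi
  · obtain ⟨i, hi⟩ := P.exists_mem_piece h.1 hz
    exact mem_iUnion.2 ⟨i, (P.mem_thinDomain_iff hi).1 h⟩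

theorem restrict_Ioo : (volume : Measure ℝ).restrict (Ioo 0 1) =
    ∑ i, vol[P.piece i] := by
  rw [← Measure.restrict_congr_set P.iUnion_piece_ae_eq,
    Measure.restrict_iUnion P.pairwise_disjoint_piece P.measurableSet_piece,
    Measure.sum_fintype]

theorem restrict_thinDomain (ε : ℝ) : (volume : Measure ℝ²).restrict (P.thinDomain ε) =
    ∑ i, vol[P.pieceDomain i ε] := by
  rw [← Measure.restrict_congr_set (P.iUnion_pieceDomain_ae_eq ε),
    Measure.restrict_iUnion (fun i j hij => ?_) (P.measurableSet_pieceDomain · ε),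
    Measure.sum_fintype]
  exact disjoint_left.2 fun z hz hz' =>
    disjoint_left.1 (P.pairwise_disjoint_piece hij) hz.1 hz'.1

theorem nullMeasurableSet_thinDomain (ε : ℝ) : NullMeasurableSet (P.thinDomain ε) :=
  (MeasurableSet.iUnion (P.measurableSet_pieceDomain · ε)).nullMeasurableSet.congr
    (P.iUnion_pieceDomain_ae_eq ε)

theorem box_subset_thinDomain {ε : ℝ} (hε : 0 < ε) :
    𝕀 ×ˢ Ioo 0 (ε * G₀) ⊆ P.thinDomain ε := by
  rintro ⟨x, t⟩ ⟨hx, ht⟩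
  refine ⟨hx, ht.1, ht.2.trans_le (mul_le_mul_of_nonneg_left ?_ hε.le)⟩
  change G₀ ≤ P.G x (x / ε)
  by_cases hξ : x ∈ range P.ξ
  · obtain ⟨j, rfl⟩ := hξ
    -- a partition point in `(0, 1)` separates two consecutive pieces
    have h0 : (j : ℕ) ≠ 0 := fun h => by
      have : j = 0 := Fin.ext h
      rw [this, P.ξ_zero] at hx
      exact lt_irrefl _ hx.1
    have h1 : (j : ℕ) ≠ N := fun h => by
      have : j = Fin.last N := Fin.ext h
      rw [this, P.ξ_last] at hx
      exact lt_irrefl _ hx.2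
    have hj := j.2
    have h2 := P.G_interface ⟨j - 1, by omega⟩ ⟨j, by omega⟩ (by simp only; omega)
      (P.ξ j / ε)
    have h3 : P.ξ (Fin.castSucc ⟨j, by omega⟩) = P.ξ j := by congr 1
    rw [h3] at h2
    rw [h2]
    exact le_min (P.lower _ _) (P.lower _ _)
  · obtain ⟨i, hi⟩ := P.exists_mem_piece hx hξ
    rw [P.G_piece i x hi]
    exact P.lower _ _

theorem sum_setIntegral_piece {F : ℝ → ℝ} (hF : IntegrableOn F (Ioo 0 1)) :
    ∫ x in 𝕀, F x = ∑ i, ∫ x in P.piece i, F x := by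
  rw [P.restrict_Ioo]
  exact integral_finsetSum_measure fun i _ => hF.mono_set (P.piece_subset i)

theorem piecewiseConst_of_mem (a : Fin N → ℝ) {i : Fin N} {x : ℝ} (hx : x ∈ P.piece i) :
    P.piecewiseConst a x = a i := by
  unfold piecewiseConst
  rw [Finset.sum_eq_single i (fun j _ hj => indicator_of_notMem (fun h =>
    disjoint_left.1 (P.pairwise_disjoint_piece hj) h hx) _) (by simp), indicator_of_mem hx]

theorem measurable_piecewiseConst (a : Fin N → ℝ) : Measurable (P.piecewiseConst a) :=
  Finset.measurable_fun_sum _ fun i _ => measurable_const.indicator (P.measurableSet_piece i)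

end Profile

/-! ### The rescaled measure on a thin domain -/

/-- Lebesgue measure on a domain of thickness of order `ε`, divided by `ε`. -/
def thinMeasure (ε : ℝ) (Ω : Set ℝ²) : Measure ℝ² :=
  ENNReal.ofReal ε⁻¹ • vol[Ω]

notation "𝔪[" P "," ε "]" => thinMeasure ε (Profile.thinDomain P ε)

notation "𝔪[" P "," i "," ε "]" => thinMeasure ε (Profile.pieceDomain P i ε)

section ThinMeasure

variable {ε : ℝ} {Ω : Set ℝ²}

theorem integral_thinMeasure {V : Type*} [NormedAddCommGroup V] [NormedSpace ℝ V] (hε : 0 < ε)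
    (F : ℝ² → V) : ∫ z, F z ∂(thinMeasure ε Ω) = ε⁻¹ • ∫ z in Ω, F z := by
  rw [thinMeasure, integral_smul_measure, ENNReal.toReal_ofReal (inv_pos.2 hε).le]

theorem integrable_thinMeasure_iff {V : Type*} [NormedAddCommGroup V] (hε : 0 < ε)
    {F : ℝ² → V} : Integrable F (thinMeasure ε Ω) ↔ IntegrableOn F Ω :=
  integrable_smul_measure (by simpa using hε) ENNReal.ofReal_ne_top

theorem memLp_thin (ε : ℝ) {V : Type*} [NormedAddCommGroup V] {F : ℝ² → V} {p : ENNReal}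
    (h : MemLp F p vol[Ω]) : MemLp F p (thinMeasure ε Ω) :=
  h.smul_measure ENNReal.ofReal_ne_top

theorem memLp_of_thin {V : Type*} [NormedAddCommGroup V] (hε : 0 < ε) {F : ℝ² → V} {p : ENNReal}
    (h : MemLp F p (thinMeasure ε Ω)) : MemLp F p vol[Ω] := by
  have h1 := h.smul_measure (c := ENNReal.ofReal ε) ENNReal.ofReal_ne_top
  rwa [thinMeasure, smul_smul, ← ENNReal.ofReal_mul hε.le, mul_inv_cancel₀ hε.ne',
    ENNReal.ofReal_one, one_smul] at h1

theorem ae_thinMeasure_of_ae {p : ℝ² → Prop} (h : ∀ᵐ z ∂vol[Ω], p z) :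
    ∀ᵐ z ∂(thinMeasure ε Ω), p z := Measure.ae_smul_measure h _

theorem Profile.thinMeasure_thinDomain {N : ℕ} {L G₀ G₁ : ℝ} (P : Profile N L G₀ G₁) (ε : ℝ) :
    𝔪[P, ε] = ∑ i, thinMeasure ε (P.pieceDomain i ε) := by
  simp only [thinMeasure, P.restrict_thinDomain, Finset.smul_sum]

theorem Profile.integral_thinDomain {N : ℕ} {L G₀ G₁ : ℝ} (P : Profile N L G₀ G₁)
    (hε : 0 < ε) {F : ℝ² → ℝ} (hF : IntegrableOn F (P.thinDomain ε)) :
    ∫ z, F z ∂𝔪[P, ε] =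
      ∑ i, ∫ z, F z ∂𝔪[P, i, ε] := by
  rw [P.thinMeasure_thinDomain]
  exact integral_finsetSum_measure fun i _ =>
    (integrable_thinMeasure_iff hε).2 (hF.mono_set (P.pieceDomain_subset i ε))

end ThinMeasure

/-! ### Approximation by test functions -/

/-- Test functions are dense in `L^p` of a bounded interval. -/
theorem exists_isTest_integral_sub_le {p a b : ℝ} (hp : 1 < p) {f : ℝ → ℝ}
    (hf : MemLp f ofR(p) vol[Ioo a b]) {η : ℝ} (hη : 0 < η) :
    ∃ b', IsTest (Ioo a b) b' ∧ ∫ x in Ioo a b, ‖b' x - f x‖ ^ p ≤ η := by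
  have hp0 : 0 < p := by linarith
  have hpe : (1 : ENNReal) ≤ ofR(p) := by simpa using hp.le
  set η₁ := η / (2 * 2 ^ p) with hη₁
  have h2p : (0 : ℝ) < 2 ^ p := by positivity
  have hη₁0 : 0 < η₁ := by positivity
  obtain ⟨g, hgc, hgs, hg⟩ := hf.exist_eLpNorm_sub_le ENNReal.ofReal_ne_top hpe
    (Real.rpow_pos_of_pos hη₁0 (1 / p))
  have hgL : MemLp g ofR(p) vol[Ioo a b] :=
    (hgs.continuous.memLp_of_hasCompactSupport hgc)
  have hg1 : ∫ x in Ioo a b, ‖g x - f x‖ ^ p ≤ η₁ := by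
    have h1 : ∫ x in Ioo a b, ‖g x - f x‖ ^ p = ∫ x in Ioo a b, ‖(f - g) x‖ ^ p := by
      simp only [Pi.sub_apply, norm_sub_rev]
    have h2 := hf.sub hgL
    rw [eLpNorm_eq_ofReal hp0 h2, ENNReal.ofReal_le_ofReal_iff (by positivity)] at hg
    rw [h1]
    exact (Real.rpow_le_rpow_iff (integral_rpow_nonneg _) hη₁0.le (by positivity)).1 hg
  -- cut-off functions that exhaust the interval
  have cut : ∀ n : ℕ, ∃ θ : ℝ → ℝ, IsTest (Ioo a b) θ ∧ (∀ x, θ x ∈ Icc (0 : ℝ) 1) ∧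
      ∀ x ∈ Icc (a + 1 / (n + 1)) (b - 1 / (n + 1)), θ x = 1 := by
    intro n
    have hn : (0 : ℝ) < 1 / (n + 1) := by positivity
    obtain ⟨θ, h1, h2, h3, h4⟩ := exists_contMDiff_support_eq_eq_one_iff (n := ⊤)
      (modelWithCornersSelf ℝ ℝ) (isOpen_Ioo (a := a + 1 / (n + 1) / 2) (b := b - 1 / (n + 1) / 2))
      (isClosed_Icc (a := a + 1 / (n + 1)) (b := b - 1 / (n + 1)))
      (fun x hx => ⟨by linarith [hx.1], by linarith [hx.2]⟩)
    have hs : tsupport θ ⊆ Icc (a + 1 / (n + 1) / 2) (b - 1 / (n + 1) / 2) := by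
      rw [tsupport, h3]
      exact closure_minimal Ioo_subset_Icc_self isClosed_Icc
    refine ⟨θ, ⟨h1.contDiff, isCompact_Icc.of_isClosed_subset (isClosed_tsupport _) hs,
      hs.trans fun x hx => ⟨by linarith [hx.1], by linarith [hx.2]⟩⟩, fun x => h2 ⟨x, rfl⟩,
      fun x hx => (h4 x).1 hx⟩
  choose θ hθt hθ01 hθ1 using cut
  have lim : Tendsto (fun n : ℕ => ∫ x in Ioo a b, ‖θ n x * g x - g x‖ ^ p) atTop (𝓝 0) := by
    have h0 : (0 : ℝ) = ∫ x in Ioo a b, (0 : ℝ) := by simp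
    rw [h0]
    refine tendsto_integral_of_dominated_convergence (fun x => ‖g x‖ ^ p) (fun n => ?_)
      (integrable_norm_rpow hp0 hgL) (fun n => .of_forall fun x => ?_) ?_
    · exact ((continuous_norm_rpow hp0.le).comp (((hθt n).continuous.mul
        hgs.continuous).sub hgs.continuous)).aestronglyMeasurable
    · rw [Real.norm_of_nonneg (by positivity)]
      refine Real.rpow_le_rpow (norm_nonneg _) ?_ hp0.le
      rw [← sub_one_mul, norm_mul]
      refine mul_le_of_le_one_left (norm_nonneg _) ?_
      rw [Real.norm_eq_abs, abs_le]
      exact ⟨by linarith [(hθ01 n x).1], by linarith [(hθ01 n x).2]⟩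
    · filter_upwards [ae_restrict_mem measurableSet_Ioo] with x hx
      refine tendsto_const_nhds.congr' ?_
      have h1 : ∀ᶠ n : ℕ in atTop, 1 / ((n : ℝ) + 1) < min (x - a) (b - x) :=
        tendsto_one_div_add_atTop_nhds_zero_nat.eventually
          (gt_mem_nhds (lt_min (by linarith [hx.1]) (by linarith [hx.2])))
      filter_upwards [h1] with n hn
      rw [lt_min_iff] at hn
      rw [hθ1 n x ⟨by linarith, by linarith⟩]
      simp [hp0.ne']
  obtain ⟨n, hn⟩ := ((tendsto_order.1 lim).2 η₁ hη₁0).exists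
  have hθg : MemLp (fun x => θ n x * g x) ofR(p) vol[Ioo a b] :=
    ((hθt n).continuous.mul hgs.continuous).memLp_of_hasCompactSupport hgc.mul_left
  refine ⟨fun x => θ n x * g x, ⟨(hθt n).smooth.mul hgs, hgc.mul_left,
    tsupport_mul_subset_left.trans (hθt n).subset⟩, ?_⟩
  have h1 := integral_norm_add_rpow_le hp (hθg.sub hgL) (hgL.sub hf)
  simp only [Pi.sub_apply, sub_add_sub_cancel] at h1
  refine h1.trans ?_
  calc 2 ^ p * ((∫ x in Ioo a b, ‖θ n x * g x - g x‖ ^ p) + ∫ x in Ioo a b, ‖g x - f x‖ ^ p)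
      ≤ 2 ^ p * (η₁ + η₁) := mul_le_mul_of_nonneg_left (add_le_add hn.le hg1) h2p.le
    _ = η := by
      rw [hη₁]
      field_simp
      ring

/-! ### Estimates on thin domains -/

section ThinEstimates

/-- The rescaling of a density on `(0, h)` to a density on `(0, ε h)`. -/
def rescale (ε : ℝ) (ρ : ℝ → ℝ) (t : ℝ) : ℝ := ε⁻¹ * ρ (ε⁻¹ * t)

theorem IsDensity.rescale {ε h : ℝ} (hε : 0 < ε) {ρ : ℝ → ℝ} (hρ : IsDensity h ρ) :
    IsDensity (ε * h) (rescale ε ρ) where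
  test := by
    have h1 : IsTest ((fun y : ℝ => ε • y + 0) ⁻¹' Ioo 0 (ε * h)) ρ := by
      refine hρ.test.mono fun y hy => ?_
      simp only [add_zero, smul_eq_mul, mem_preimage, mem_Ioo]
      exact ⟨mul_pos hε hy.1, mul_lt_mul_of_pos_left hy.2 hε⟩
    have h2 := (h1.comp_affine hε.ne' 0).mul_left (Ω' := Ioo 0 (ε * h))
      (contDiff_const (c := ε⁻¹)) inter_subset_right
    simp only [sub_zero, smul_eq_mul] at h2
    exact h2
  nonneg t := mul_nonneg (inv_pos.2 hε).le (hρ.nonneg _)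
  integral_eq_one := by
    unfold ThinDomain.rescale
    rw [integral_const_mul, Measure.integral_comp_mul_left ρ, hρ.integral_eq_one, inv_inv,
      abs_of_pos hε]
    simp [hε.ne']

variable {p p' L G₀ G₁ ε : ℝ} {g : ℝ → ℝ}

/-- On a thin domain a Sobolev function is close to its vertical averages. -/
theorem IsProfile.thin_poincare (hg : IsProfile L G₀ G₁ g) (hp : 1 < p) (hε : 0 < ε) {I : Set ℝ}
    (hI : IsOpen I) (hIv : volume I ≠ ⊤) {ρ : ℝ → ℝ} (hρ : IsDensity G₀ ρ) {w : ℝ² → ℝ}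
    {Dw : ℝ² → Plane} (hw : IsW1p (subgraph I (scaled ε g)) p w Dw) :
    MemLp (fun z => w z - verticalAverage (rescale ε ρ) w z.1) ofR(p)
        (thinMeasure ε (subgraph I (scaled ε g))) ∧
      ∫ z, ‖w z - verticalAverage (rescale ε ρ) w z.1‖ ^ p
          ∂(thinMeasure ε (subgraph I (scaled ε g))) ≤
        (ε * G₁) ^ p * ∫ z, ‖Dw z‖ ^ p ∂(thinMeasure ε (subgraph I (scaled ε g))) := by
  have h1 := vertical_poincare hp hI hIv (hg.continuous_scaled ε) (mul_pos hε hg.G₀_pos)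
    (M := ε * G₁) (fun x => mul_le_mul_of_nonneg_left (hg.lower _) hε.le)
    (fun x => mul_le_mul_of_nonneg_left (hg.upper _) hε.le) (hρ.rescale hε) hw
  refine ⟨memLp_thin ε h1.1, ?_⟩
  rw [integral_thinMeasure hε, integral_thinMeasure hε, smul_eq_mul, smul_eq_mul, mul_left_comm]
  exact mul_le_mul_of_nonneg_left h1.2 (inv_pos.2 hε).le

variable {N : ℕ} (P : Profile N L G₀ G₁)

/-- Vertical averages of Sobolev functions on the thin domains are Sobolev functions, with norms
that are controlled by the rescaled norms. -/
theorem Profile.exists_verticalAverage_bound (hp : 1 < p) {ρ : ℝ → ℝ} (hρ : IsDensity G₀ ρ) :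
    ∃ K, 0 ≤ K ∧ ∀ ε, 0 < ε → ∀ w Dw, IsW1p (P.thinDomain ε) p w Dw →
      IsW1pLine (Ioo 0 1) p (verticalAverage (rescale ε ρ) w)
        (verticalAverage (rescale ε ρ) fun z => Dw z 0) ∧
      ∫ x in 𝕀, ‖verticalAverage (rescale ε ρ) w x‖ ^ p ≤
        K ^ p * ∫ z, ‖w z‖ ^ p ∂𝔪[P, ε] ∧
      ∫ x in 𝕀, ‖verticalAverage (rescale ε ρ) (fun z => Dw z 0) x‖ ^ p ≤
        K ^ p * ∫ z, ‖Dw z‖ ^ p ∂𝔪[P, ε] := by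
  obtain ⟨C, hC⟩ := hρ.test.exists_norm_le
  have hC0 : 0 ≤ C := (norm_nonneg _).trans (hC 0)
  have hp0 : 0 < p := by linarith
  have hG := P.G₀_pos
  refine ⟨(C ^ p * G₀ ^ (p - 1)) ^ (1 / p), by positivity, fun ε hε w Dw hw => ?_⟩
  rw [← Real.rpow_mul (by positivity), one_div_mul_cancel hp0.ne', Real.rpow_one]
  have hbox := P.box_subset_thinDomain hε
  have hεh : 0 ≤ ε * G₀ := (mul_pos hε hG).le
  have hCε : ∀ t, |rescale ε ρ t| ≤ ε⁻¹ * C := fun t => by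
    rw [rescale, abs_mul, abs_of_pos (inv_pos.2 hε)]
    exact mul_le_mul_of_nonneg_left (hC _) (inv_pos.2 hε).le
  have hconst : (ε⁻¹ * C) ^ p * (ε * G₀) ^ (p - 1) = C ^ p * G₀ ^ (p - 1) * ε⁻¹ := by
    rw [Real.mul_rpow (inv_pos.2 hε).le hC0, Real.mul_rpow hε.le hG.le, Real.rpow_sub_one hε.ne',
      Real.inv_rpow hε.le]
    have := Real.rpow_pos_of_pos hε p
    field_simp
  have key : ∀ F : ℝ² → ℝ, MemLp F ofR(p) vol[P.thinDomain ε] →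
      ∫ x in 𝕀, ‖verticalAverage (rescale ε ρ) F x‖ ^ p ≤
        C ^ p * G₀ ^ (p - 1) * (ε⁻¹ * ∫ z in P.thinDomain ε, ‖F z‖ ^ p) := by
    intro F hF
    refine (memLp_verticalAverage hp hεh (hρ.rescale hε) hCε
      (hF.mono_measure (Measure.restrict_mono hbox le_rfl))).2.trans ?_
    rw [hconst, mul_assoc (C ^ p * G₀ ^ (p - 1))]
    refine mul_le_mul_of_nonneg_left (mul_le_mul_of_nonneg_left ?_ (inv_pos.2 hε).le)
      (by positivity)
    exact setIntegral_mono_set (integrable_norm_rpow hp0 hF)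
      (.of_forall fun z => Real.rpow_nonneg (norm_nonneg _) _) hbox.eventuallyLE
  refine ⟨isW1pLine_verticalAverage hp hεh (hρ.rescale hε) hbox hw, ?_, ?_⟩
  · rw [integral_thinMeasure hε, smul_eq_mul]
    exact key w hw.memLp
  · rw [integral_thinMeasure hε, smul_eq_mul]
    refine (key _ (memLp_plane_apply hw.grad_memLp 0)).trans ?_
    refine mul_le_mul_of_nonneg_left (mul_le_mul_of_nonneg_left ?_ (inv_pos.2 hε).le)
      (by positivity)
    exact integral_plane_apply_le hp0 hw.grad_memLp 0

theorem integral_rpow_le_of_rescaledNorm_le {Ω : Set ℝ²} (hp : 0 < p) (hε : 0 < ε)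
    {f : ℝ² → ℝ} (hf : MemLp f ofR(p) vol[Ω]) {c : ℝ}
    (hc : rescaledNorm ε p Ω f ≤ c) : ∫ z, ‖f z‖ ^ p ∂(thinMeasure ε Ω) ≤ c ^ p := by
  have h0 := integral_rpow_nonneg (μ := vol[Ω]) (p := p) f
  rw [rescaledNorm, eLpNorm_eq_ofReal hp hf, ENNReal.toReal_ofReal (Real.rpow_nonneg h0 _)] at hc
  have h1 := Real.rpow_le_rpow (by positivity) hc hp.le
  rw [Real.mul_rpow (by positivity) (Real.rpow_nonneg h0 _), ← Real.rpow_mul hε.le,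
    ← Real.rpow_mul h0, neg_mul, one_div_mul_cancel hp.ne', Real.rpow_neg_one, Real.rpow_one] at h1
  rwa [integral_thinMeasure hε, smul_eq_mul]

/-- The equation of a Neumann problem on a thin domain, with respect to the rescaled measure. -/
theorem IsNeumannSolution.equation_thin {Ω : Set ℝ²} (hp : p.HolderConjugate p')
    (hε : 0 < ε) {f u : ℝ² → ℝ} {Du : ℝ² → Plane} (hu : IsNeumannSolution Ω p f u Du)
    {φ : ℝ² → ℝ} {Dφ : ℝ² → Plane} (hφ : IsW1p Ω p φ Dφ) :
    (∫ z, inner ℝ (pFlux p (Du z)) (Dφ z) ∂(thinMeasure ε Ω)) +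
        ∫ z, pFlux p (u z) * φ z ∂(thinMeasure ε Ω) = ∫ z, f z * φ z ∂(thinMeasure ε Ω) := by
  have i1 := integrable_inner_of_memLp hp hφ.grad_memLp (memLp_pFlux hp hu.isW1p.grad_memLp)
  have i2 := integrable_mul_of_memLp hp.symm (memLp_pFlux hp hu.isW1p.memLp) hφ.memLp
  have h1 := hu.equation φ Dφ hφ
  rw [integral_add i1 i2] at h1
  simp only [integral_thinMeasure hε, smul_eq_mul, ← h1]
  ring

/-- The energy estimate for a Neumann problem on a thin domain. -/
theorem IsNeumannSolution.energy_le {Ω : Set ℝ²} (hp : p.HolderConjugate p')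
    (hε : 0 < ε) {f u : ℝ² → ℝ} {Du : ℝ² → Plane}
    (hf : MemLp f ofR(p') vol[Ω])
    (hu : IsNeumannSolution Ω p f u Du) :
    (∫ z, ‖Du z‖ ^ p ∂(thinMeasure ε Ω)) + ∫ z, ‖u z‖ ^ p ∂(thinMeasure ε Ω) ≤
      ∫ z, ‖f z‖ ^ p' ∂(thinMeasure ε Ω) := by
  have h1 := hu.equation_thin hp hε hu.isW1p
  have e2 : ∀ z, pFlux p (u z) * u z = ‖u z‖ ^ p := fun z => by
    rw [← inner_pFlux_self hp.lt]
    simp [mul_comm]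
  simp only [inner_pFlux_self hp.lt, e2] at h1
  set A := ∫ z, ‖Du z‖ ^ p ∂(thinMeasure ε Ω)
  set B := ∫ z, ‖u z‖ ^ p ∂(thinMeasure ε Ω)
  set F := ∫ z, ‖f z‖ ^ p' ∂(thinMeasure ε Ω)
  have hA : 0 ≤ A := integral_rpow_nonneg _
  have hB : 0 ≤ B := integral_rpow_nonneg _
  have hF : 0 ≤ F := integral_rpow_nonneg _
  have h2 : A + B ≤ F ^ (1 / p') * (A + B) ^ (1 / p) := by
    rw [h1]
    refine (le_abs_self _).trans ((abs_integral_mul_le hp.symm (memLp_thin ε hf)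
      (memLp_thin ε hu.isW1p.memLp)).trans ?_)
    rw [← h1]
    exact mul_le_mul_of_nonneg_left
      (Real.rpow_le_rpow hB (by linarith) (by have := hp.pos; positivity)) (Real.rpow_nonneg hF _)
  rcases (add_nonneg hA hB).eq_or_lt with h0 | h0
  · rw [← h0]
    exact hF
  have hS := Real.rpow_pos_of_pos h0 (1 / p)
  have h3 : (A + B) ^ (1 / p') * (A + B) ^ (1 / p) = A + B := by
    rw [← Real.rpow_add h0, one_div, one_div, hp.symm.inv_add_inv_eq_one, Real.rpow_one]
  have h4 : (A + B) ^ (1 / p') ≤ F ^ (1 / p') := le_of_mul_le_mul_right (h3.trans_le h2) hS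
  exact (Real.rpow_le_rpow_iff h0.le hF (by have := hp.symm.pos; positivity)).1 h4

end ThinEstimates

/-! ### Products with functions of the first variable and oscillating functions -/

section Oscillating

variable {p p' L G₀ G₁ ε : ℝ} {g : ℝ → ℝ}

theorem fderiv_comp_fst {β : ℝ → ℝ} (hβ : Differentiable ℝ β) (z e : ℝ²) :
    fderiv ℝ (fun z : ℝ² => β z.1) z e = e.1 * deriv β z.1 := by
  have h : HasFDerivAt (fun z : ℝ² => β z.1) _ z :=
    ((hβ z.1).hasDerivAt.hasFDerivAt).comp z hasFDerivAt_fst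
  rw [h.fderiv]
  simp

theorem IsTest.deriv {J : Set ℝ} {β : ℝ → ℝ} (hβ : IsTest J β) : IsTest J (deriv β) := by
  simpa only [fderiv_apply_one_eq_deriv] using hβ.fderiv_apply 1

theorem memLp_test_smul {V : Type*} [NormedAddCommGroup V] [NormedSpace ℝ V] {J : Set ℝ}
    {β : ℝ → ℝ} (hβ : IsTest J β) {q : ENNReal} {μ : Measure ℝ²} {F : ℝ² → V}
    (hF : MemLp F q μ) : MemLp (fun z => β z.1 • F z) q μ := by
  obtain ⟨C, hC⟩ := hβ.exists_norm_le
  refine hF.of_le_mul (c := C)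
    ((hβ.continuous.comp continuous_fst).aestronglyMeasurable.smul hF.1) (.of_forall fun z => ?_)
  rw [norm_smul]
  exact mul_le_mul_of_nonneg_right (hC _) (norm_nonneg _)

theorem memLp_single_fst {α : Type*} [MeasurableSpace α] {μ : Measure α} {q : ENNReal} {F : α → ℝ}
    (hF : MemLp F q μ) : MemLp (fun z => EuclideanSpace.single (0 : Fin 2) (F z)) q μ := by
  refine hF.of_le ?_ (.of_forall fun z => by rw [norm_single_fst, Real.norm_eq_abs])
  have h : Continuous fun t : ℝ => EuclideanSpace.single (0 : Fin 2) t := by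
    refine (PiLp.continuous_toLp 2 _).comp (continuous_pi fun j => ?_)
    fin_cases j
    · exact continuous_id
    · exact continuous_const
  exact h.comp_aestronglyMeasurable hF.1

/-- The product of a Sobolev function with a test function of the first variable is a Sobolev
function on larger domains that have the same section over the support of the test function. -/
theorem IsW1p.mul_fst (hp : 1 ≤ p) {Ω Ω' : Set ℝ²} (hm' : MeasurableSet Ω')
    (hm : NullMeasurableSet Ω) (hΩ : Ω' ⊆ Ω) {J : Set ℝ} {β : ℝ → ℝ} (hβ : IsTest J β)
    (hs : ∀ z ∈ Ω, z.1 ∈ J → z ∈ Ω') {w : ℝ² → ℝ} {Dw : ℝ² → Plane}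
    (hw : IsW1p Ω' p w Dw) :
    IsW1p Ω p (fun z => β z.1 * w z)
      (fun z => β z.1 • Dw z + EuclideanSpace.single 0 (deriv β z.1 * w z)) := by
  have hb : Smooth fun z : ℝ² => β z.1 :=
    hβ.smooth.comp contDiff_fst
  have hd := fderiv_comp_fst (hβ.smooth.differentiable (by simp))
  have hsupp : tsupport (fun z : ℝ² => β z.1) ∩ Ω ⊆ Ω' := fun z hz =>
    hs z hz.2 (hβ.subset (tsupport_comp_subset_preimage β continuous_fst hz.1))
  have h0 : ∀ ζ, IsTest J ζ → ∀ z ∈ Ω, z ∉ Ω' → ζ z.1 = 0 := fun ζ hζ z hz hz' =>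
    hζ.eq_zero fun h => hz' (hs z hz h)
  obtain ⟨li, lg⟩ := hw.locallyIntegrableOn hp
  refine ⟨?_, ?_, ?_, ?_⟩
  · refine memLp_of_eq_zero hm' hm hΩ (memLp_test_smul hβ hw.memLp) fun z hz hz' => ?_
    rw [h0 β hβ z hz hz', zero_mul]
  · refine memLp_of_eq_zero hm' hm hΩ ((memLp_test_smul hβ hw.grad_memLp).add
      (memLp_single_fst (memLp_test_smul hβ.deriv hw.memLp))) fun z hz hz' => ?_
    rw [h0 β hβ z hz hz', h0 _ hβ.deriv z hz hz']
    simp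
  · have h := hw.weakDeriv_fst.mul_smooth (Ω := Ω) li (lg 0) hb hsupp
    simpa [hd] using h
  · have h := hw.weakDeriv_snd.mul_smooth (Ω := Ω) li (lg 1) hb hsupp
    simpa [hd] using h

theorem preimage_inv_smul_subgraph (hε : 0 < ε) (I : Set ℝ) (g : ℝ → ℝ) :
    (fun z : ℝ² => ε⁻¹ • z) ⁻¹' subgraph ((fun x => ε * x) ⁻¹' I) g =
      subgraph I (scaled ε g) := by
  ext z
  simp only [subgraph, scaled, mem_preimage, mem_ofPred_eq, Prod.smul_fst, Prod.smul_snd,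
    smul_eq_mul, mul_inv_cancel_left₀ hε.ne']
  rw [inv_mul_eq_div, inv_mul_eq_div, div_pos_iff_of_pos_right hε, div_lt_iff₀' hε]

/-- Oscillating functions on a bounded part of a thin strip. -/
theorem IsProfile.memLp_oscillating {V : Type*} [NormedAddCommGroup V] (hg : IsProfile L G₀ G₁ g)
    (hp : 1 ≤ p) (hε : 0 < ε) {F : ℝ² → V}
    (hF : MemLp F ofR(p) vol[cell L g]) {a b : ℝ} :
    MemLp (fun z => perExt L F (ε⁻¹ • z)) ofR(p)
      vol[subgraph (Ioo a b) (scaled ε g)] := by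
  have hI : (fun x => ε * x) ⁻¹' Ioo a b = Ioo (a / ε) (b / ε) := by
    ext x
    simp [div_lt_iff₀' hε, lt_div_iff₀' hε]
  have h := memLp_comp_inv_smul hε (hg.isOpen_subgraph isOpen_Ioo).measurableSet
    (hg.memLp_perExt hp hF (Metric.isBounded_Ioo (a / ε) (b / ε)))
  rwa [← hI, preimage_inv_smul_subgraph hε] at h

end Oscillating

/-! ### The oscillating flux against Sobolev functions -/

section Flux

variable {p p' L G₀ G₁ ε : ℝ} {g : ℝ → ℝ} {v : ℝ² → ℝ} {Dv : ℝ² → Plane}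

/-- The oscillating flux is divergence free on the thin strip. -/
theorem IsCellSolution.integral_thin_strip_eq_zero (hp : p.HolderConjugate p')
    (hg : IsProfile L G₀ G₁ g) (h : IsCellSolution L g p v Dv) (hε : 0 < ε)
    {Ψ : ℝ² → ℝ} {DΨ : ℝ² → Plane} (hΨ : IsW1p (subgraph univ (scaled ε g)) p Ψ DΨ) {R : ℝ}
    (h0 : ∀ z, R ≤ |z.1| → Ψ z = 0) (h0' : ∀ z, R ≤ |z.1| → DΨ z = 0) :
    ∫ z in subgraph univ (scaled ε g),
      inner ℝ (perExt L (fun y => pFlux p (Dv y)) (ε⁻¹ • z)) (DΨ z) = 0 := by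
  have hm := (hg.isOpen_scaled (ε := ε) isOpen_univ).measurableSet
  have hpre : (fun z : ℝ² => ε • z) ⁻¹' subgraph univ (scaled ε g) = subgraph univ g := by
    ext z
    simp only [subgraph, scaled, mem_preimage, mem_ofPred_eq, Prod.smul_fst, Prod.smul_snd,
      smul_eq_mul, mul_div_cancel_left₀ _ hε.ne', mem_univ, true_and]
    rw [mul_pos_iff_of_pos_left hε, mul_lt_mul_iff_right₀ hε]
  have hmem : ∀ {V : Type} [NormedAddCommGroup V] {F : ℝ² → V},
      MemLp F ofR(p) vol[subgraph univ (scaled ε g)] →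
      MemLp (fun z => F (ε • z)) ofR(p) vol[subgraph univ g] := by
    intro V _ F hF
    have := memLp_comp_inv_smul (inv_pos.2 hε) hm hF
    simpa only [inv_inv, hpre] using this
  have hΦ : IsW1p (subgraph univ g) p (fun y => Ψ (ε • y)) fun y => ε • DΨ (ε • y) := by
    refine ⟨hmem hΨ.memLp, (hmem hΨ.grad_memLp).const_smul ε, ?_, ?_⟩
    · simpa only [hpre, add_zero, PiLp.smul_apply, smul_eq_mul] using
        hΨ.weakDeriv_fst.comp_affine hε.ne' 0
    · simpa only [hpre, add_zero, PiLp.smul_apply, smul_eq_mul] using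
        hΨ.weakDeriv_snd.comp_affine hε.ne' 0
  obtain ⟨n, hn⟩ := exists_nat_ge (R / (ε * L))
  rw [div_le_iff₀ (mul_pos hε hg.L_pos)] at hn
  have hR : ∀ y : ℝ², n * L ≤ |y.1| → R ≤ |(ε • y).1| := fun y hy => by
    rw [Prod.smul_fst, smul_eq_mul, abs_mul, abs_of_pos hε]
    calc R ≤ ε * (n * L) := by linarith
      _ ≤ ε * |y.1| := mul_le_mul_of_nonneg_left hy hε.le
  have h1 := h.integral_strip_eq_zero hp hg hΦ (n := n) (fun y hy => h0 _ (hR y hy))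
    fun y hy => by rw [h0' _ (hR y hy), smul_zero]
  have h2 := setIntegral_comp_inv_smul hε (hg.isOpen_subgraph isOpen_univ).measurableSet
    fun y => inner ℝ (perExt L (fun y => pFlux p (Dv y)) y) (ε • DΨ (ε • y))
  rw [h1, mul_zero, preimage_inv_smul_strip hε] at h2
  simp only [smul_smul, mul_inv_cancel₀ hε.ne', one_smul, inner_smul_right] at h2
  rw [integral_const_mul] at h2
  exact (mul_eq_zero.1 h2).resolve_left hε.ne'

/-- The section flux through the thin strip. -/
theorem IsCellSolution.section_flux_scaled (hp : p.HolderConjugate p')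
    (hg : IsProfile L G₀ G₁ g) (h : IsCellSolution L g p v Dv) (hε : 0 < ε) :
    ∀ᵐ x : ℝ, ∫ t in Ioo 0 (scaled ε g x), perExt L (fun y => pFlux p (Dv y) 0) (ε⁻¹ • (x, t)) =
      ε * qCoeff L g p Dv := by
  have h1 : Measure.QuasiMeasurePreserving (fun x : ℝ => ε⁻¹ * x) volume volume := by
    refine ⟨measurable_const_mul _, ?_⟩
    rw [Real.map_volume_mul_left (inv_ne_zero hε.ne')]
    exact Measure.smul_absolutelyContinuous
  filter_upwards [h1.ae (h.section_flux hp hg)] with x hx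
  rw [← hx]
  have h2 := integral_indicator (μ := volume) (f := fun t =>
    perExt L (fun y => pFlux p (Dv y) 0) (ε⁻¹ * x, t))
    (measurableSet_Ioo (a := (0 : ℝ)) (b := g (ε⁻¹ * x)))
  have h3 := Measure.integral_comp_mul_left ((Ioo 0 (g (ε⁻¹ * x))).indicator fun t =>
    perExt L (fun y => pFlux p (Dv y) 0) (ε⁻¹ * x, t)) ε⁻¹
  rw [h2, inv_inv, abs_of_pos hε, smul_eq_mul] at h3
  rw [← h3, ← integral_indicator measurableSet_Ioo]
  refine integral_congr_ae (.of_forall fun t => ?_)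
  simp only
  have hmem : t ∈ Ioo 0 (scaled ε g x) ↔ ε⁻¹ * t ∈ Ioo 0 (g (ε⁻¹ * x)) := by
    rw [scaled, mem_Ioo, mem_Ioo, inv_mul_eq_div, inv_mul_eq_div, div_pos_iff_of_pos_right hε,
      div_lt_iff₀' hε]
  by_cases ht : t ∈ Ioo 0 (scaled ε g x)
  · rw [indicator_of_mem ht, indicator_of_mem (hmem.1 ht)]
    rfl
  · rw [indicator_of_notMem ht, indicator_of_notMem (mt hmem.2 ht)]

/-- Against the gradient of a Sobolev function `φ` on the thin domain, the oscillating flux with a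
slowly varying weight `β` acts like the constant `q` against the vertical average of `∂₁φ`. The
error is small as the flux is divergence free and has constant section flux, so that only the
oscillation of `φ` in the vertical direction enters. -/
theorem IsCellSolution.abs_integral_flux_sub_le (hp : p.HolderConjugate p')
    (hg : IsProfile L G₀ G₁ g) (h : IsCellSolution L g p v Dv) (hε : 0 < ε) {a b : ℝ} {β : ℝ → ℝ}
    (hβ : IsTest (Ioo a b) β) {ρ : ℝ → ℝ} (hρ : IsDensity G₀ ρ)
    {φ : ℝ² → ℝ} {Dφ : ℝ² → Plane} (hφ : IsW1p (subgraph (Ioo a b) (scaled ε g)) p φ Dφ) :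
    |(∫ z, β z.1 * inner ℝ (perExt L (fun y => pFlux p (Dv y)) (ε⁻¹ • z)) (Dφ z)
          ∂(thinMeasure ε (subgraph (Ioo a b) (scaled ε g)))) -
        qCoeff L g p Dv * ∫ x in Ioo a b, β x * verticalAverage (rescale ε ρ) (fun z => Dφ z 0) x| ≤
      ε * G₁ * (∫ z, ‖Dφ z‖ ^ p ∂(thinMeasure ε (subgraph (Ioo a b) (scaled ε g)))) ^ (1 / p) *
        (∫ z, ‖deriv β z.1 * perExt L (fun y => pFlux p (Dv y) 0) (ε⁻¹ • z)‖ ^ p'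
          ∂(thinMeasure ε (subgraph (Ioo a b) (scaled ε g)))) ^ (1 / p') := by
  set R := subgraph (Ioo a b) (scaled ε g) with hR
  set A : ℝ² → Plane := fun z => perExt L (fun y => pFlux p (Dv y)) (ε⁻¹ • z) with hA
  set A0 : ℝ² → ℝ := fun z => perExt L (fun y => pFlux p (Dv y) 0) (ε⁻¹ • z) with hA0
  have hA0' : ∀ z, A z 0 = A0 z := fun z => rfl
  set φb := verticalAverage (rescale ε ρ) φ with hφb
  set dφb := verticalAverage (rescale ε ρ) (fun z => Dφ z 0) with hdφb
  have hRm : MeasurableSet R := (hg.isOpen_scaled isOpen_Ioo).measurableSet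
  have hSm : MeasurableSet (subgraph univ (scaled ε g)) :=
    (hg.isOpen_scaled isOpen_univ).measurableSet
  have hRS : R ⊆ subgraph univ (scaled ε g) := fun z hz => ⟨mem_univ _, hz.2⟩
  have hAL : MemLp A ofR(p') vol[R] :=
    hg.memLp_oscillating hp.symm.lt.le hε (memLp_pFlux hp (h.memLp hg))
  have hA0L : MemLp A0 ofR(p') vol[R] := memLp_plane_apply hAL 0
  -- the product of `φ` with the weight is admissible on the whole strip
  have hΨ : IsW1p (subgraph univ (scaled ε g)) p (fun z => β z.1 * φ z) _ :=
    IsW1p.mul_fst hp.lt.le hRm hSm.nullMeasurableSet hRS hβ (fun z hz hz' => ⟨hz', hz.2⟩) hφ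
  obtain ⟨K, hK⟩ := hβ.compact.isCompact.isBounded.exists_norm_le
  have hβ0 : ∀ ζ, IsTest (tsupport β) ζ → ∀ z : ℝ², K + 1 ≤ |z.1| → ζ z.1 = 0 :=
    fun ζ hζ z hz => hζ.eq_zero fun hmem => by
      have := hK _ hmem
      rw [Real.norm_eq_abs] at this
      linarith
  have tβ : IsTest (tsupport β) β := ⟨hβ.smooth, hβ.compact, le_rfl⟩
  have h1 := h.integral_thin_strip_eq_zero hp hg hε hΨ (R := K + 1)
    (fun z hz => by rw [hβ0 β tβ z hz, zero_mul])
    (fun z hz => by rw [hβ0 β tβ z hz, hβ0 _ tβ.deriv z hz]; simp)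
  have hval : ∀ z, inner ℝ (A z) (β z.1 • Dφ z + EuclideanSpace.single 0 (deriv β z.1 * φ z)) =
      β z.1 * inner ℝ (A z) (Dφ z) + deriv β z.1 * A0 z * φ z := fun z => by
    rw [inner_add_right, inner_smul_right, inner_single_fst, hA0']
    ring
  have h2 : ∫ z in R, (β z.1 * inner ℝ (A z) (Dφ z) + deriv β z.1 * A0 z * φ z) = 0 := by
    refine Eq.trans ?_ h1
    rw [setIntegral_eq_of_subset_of_forall_sdiff_eq_zero hSm hRS]
    · exact setIntegral_congr_fun hRm fun z _ => (hval z).symm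
    · intro z hz
      have hz' : z.1 ∉ Ioo a b := fun hz' => hz.2 ⟨hz', hz.1.2⟩
      rw [hval, hβ.eq_zero hz', hβ.deriv.eq_zero hz']
      simp
  have hβA : MemLp (fun z => deriv β z.1 * A0 z) ofR(p') vol[R] :=
    memLp_test_smul hβ.deriv hA0L
  have i1 : Integrable (fun z => β z.1 * inner ℝ (A z) (Dφ z)) vol[R] := by
    have := integrable_inner_of_memLp hp (memLp_test_smul hβ hφ.grad_memLp) hAL
    simpa only [inner_smul_right] using this
  have i2 : Integrable (fun z => deriv β z.1 * A0 z * φ z) vol[R] :=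
    integrable_mul_of_memLp hp.symm hβA hφ.memLp
  obtain ⟨hosc, hoscle⟩ := hg.thin_poincare hp.lt hε isOpen_Ioo (by simp) hρ hφ
  replace hosc := memLp_of_thin hε hosc
  have i3 : Integrable (fun z => (φ z - φb z.1) * (deriv β z.1 * A0 z)) vol[R] :=
    integrable_mul_of_memLp hp hosc hβA
  have i4 : Integrable (fun z => deriv β z.1 * φb z.1 * A0 z) vol[R] :=
    (i2.sub i3).congr (.of_forall fun z => by simp only [Pi.sub_apply]; ring)
  rw [integral_add i1 i2] at h2
  have h3 : ∫ z in R, deriv β z.1 * A0 z * φ z =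
      (∫ z in R, (φ z - φb z.1) * (deriv β z.1 * A0 z)) +
        ∫ z in R, deriv β z.1 * φb z.1 * A0 z := by
    rw [← integral_add i3 i4]
    exact integral_congr_ae (.of_forall fun z => by simp only; ring)
  have hbox : Ioo a b ×ˢ Ioo 0 (ε * G₀) ⊆ R := fun z hz => ⟨hz.1, hz.2.1,
    hz.2.2.trans_le (mul_le_mul_of_nonneg_left (hg.lower _) hε.le)⟩
  have hline : IsW1pLine (Ioo a b) p φb dφb := isW1pLine_verticalAverage hp.lt
    (mul_pos hε hg.G₀_pos).le (hρ.rescale hε) hbox hφ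
  have h4 : ∫ z in R, deriv β z.1 * φb z.1 * A0 z =
      -(ε * qCoeff L g p Dv * ∫ x in Ioo a b, β x * dφb x) := by
    rw [(setIntegral_subgraph measurableSet_Ioo hRm i4).1]
    have h5 := hasWeakDeriv_iff.1 hline.weakDeriv β hβ
    simp only [fderiv_apply_one_eq_deriv] at h5
    have h6 : ∫ x in Ioo a b, β x * dφb x = ∫ x in Ioo a b, dφb x * β x :=
      integral_congr_ae (.of_forall fun x => mul_comm _ _)
    rw [h6, ← mul_neg, ← h5, ← integral_const_mul]
    refine integral_congr_ae (ae_restrict_of_ae ?_)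
    filter_upwards [h.section_flux_scaled hp hg hε] with x hx
    rw [integral_const_mul, hA0, hx]
    ring
  rw [h3, h4] at h2
  have h7 : (∫ z, β z.1 * inner ℝ (A z) (Dφ z) ∂(thinMeasure ε R)) -
      qCoeff L g p Dv * ∫ x in Ioo a b, β x * dφb x =
      -∫ z, (φ z - φb z.1) * (deriv β z.1 * A0 z) ∂(thinMeasure ε R) := by
    rw [integral_thinMeasure hε, integral_thinMeasure hε, smul_eq_mul, smul_eq_mul]
    have h8 : ∫ z in R, β z.1 * inner ℝ (A z) (Dφ z) =
        ε * (qCoeff L g p Dv * ∫ x in Ioo a b, β x * dφb x) -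
          ∫ z in R, (φ z - φb z.1) * (deriv β z.1 * A0 z) := by linarith
    rw [h8, mul_sub, inv_mul_cancel_left₀ hε.ne']
    ring
  rw [h7, abs_neg]
  exact (abs_integral_mul_le hp (memLp_thin ε hosc) (memLp_thin ε hβA)).trans
    (mul_le_mul_of_nonneg_right (rpow_integral_le_mul hp.pos (mul_pos hε hg.G₁_pos).le hoscle)
      (by positivity))

end Flux

/-! ### Correctors -/

section Corrector

variable {p p' L G₀ G₁ : ℝ} {g : ℝ → ℝ} {v : ℝ² → ℝ} {Dv : ℝ² → Plane} {a b : ℝ}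

theorem IsProfile.tendsto_integral_piece (hg : IsProfile L G₀ G₁ g) {h : ℝ → ℝ}
    (hc : Continuous h) (hs : HasCompactSupport h) (h0 : ∀ x ∉ Ioo a b, h x = 0) {F : ℝ² → ℝ}
    (hF : IntegrableOn F (cell L g)) :
    Tendsto (fun ε => ∫ z, h z.1 * perExt L F (ε⁻¹ • z)
        ∂(thinMeasure ε (subgraph (Ioo a b) (scaled ε g))))
      (𝓝[>] 0) (𝓝 (L⁻¹ * ((∫ x in Ioo a b, h x) * ∫ y in cell L g, F y))) := by
  have e1 : ∫ x in Ioo a b, h x = ∫ x, h x :=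
    setIntegral_eq_integral_of_forall_compl_eq_zero h0
  rw [e1]
  refine (hg.tendsto_integral_oscillating hc hs hF).congr' ?_
  filter_upwards [self_mem_nhdsWithin] with ε hε
  rw [integral_thinMeasure hε, smul_eq_mul, setIntegral_eq_of_subset_of_forall_sdiff_eq_zero
    (hg.isOpen_scaled isOpen_univ).measurableSet
    (s := subgraph (Ioo a b) (scaled ε g)) (fun z hz => ⟨mem_univ _, hz.2⟩)]
  intro z hz
  rw [h0 z.1 fun hz' => hz.2 ⟨hz', hz.1.2⟩, zero_mul]

theorem IsProfile.tendsto_integral_norm_piece {V : Type*} [NormedAddCommGroup V]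
    (hg : IsProfile L G₀ G₁ g) (hp : 0 < p) {β : ℝ → ℝ} (hc : Continuous β)
    (hs : HasCompactSupport β) (h0 : ∀ x ∉ Ioo a b, β x = 0) {F : ℝ² → V}
    (hF : MemLp F ofR(p) vol[cell L g]) :
    Tendsto (fun ε => ∫ z, ‖β z.1‖ ^ p * ‖perExt L F (ε⁻¹ • z)‖ ^ p
        ∂(thinMeasure ε (subgraph (Ioo a b) (scaled ε g))))
      (𝓝[>] 0) (𝓝 (L⁻¹ * ((∫ x in Ioo a b, ‖β x‖ ^ p) * ∫ y in cell L g, ‖F y‖ ^ p))) :=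
  hg.tendsto_integral_piece (h := fun x => ‖β x‖ ^ p) ((continuous_norm_rpow hp.le).comp hc)
    (hs.comp_left (g := fun t => ‖t‖ ^ p) (by simp [hp.ne']))
    (fun x hx => by simp [h0 x hx, hp.ne']) (integrable_norm_rpow hp hF)

/-- The gradient of the corrector `U + ε b χ(z/ε)` with `U' = b`, where `χ = v - y₁`. -/
def correctorGrad (L : ℝ) (v : ℝ² → ℝ) (Dv : ℝ² → Plane) (b : ℝ → ℝ) (ε : ℝ)
    (z : ℝ²) : Plane :=
  b z.1 • perExt L Dv (ε⁻¹ • z) +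
    EuclideanSpace.single 0 (ε * (deriv b z.1 * perExt L (fun y => v y - y.1) (ε⁻¹ • z)))

theorem IsCellSolution.memLp_corrector (h : IsCellSolution L g p v Dv) :
    MemLp (fun y => v y - y.1) ofR(p) vol[cell L g] :=
  h.periodic.1.memLp

/-- The oscillating part `ε χ(z/ε)` of the corrector. -/
theorem IsCellSolution.isW1p_oscillating (hp : 1 < p) (hg : IsProfile L G₀ G₁ g)
    (h : IsCellSolution L g p v Dv) {ε : ℝ} (hε : 0 < ε) (a b : ℝ) :
    IsW1p (subgraph (Ioo a b) (scaled ε g)) p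
      (fun z => ε * perExt L (fun y => v y - y.1) (ε⁻¹ • z))
      (fun z => perExt L Dv (ε⁻¹ • z) - EuclideanSpace.single 0 1) := by
  have hP := (hg.isPerW1p_iff hp.le).1 h.periodic
  have hsub : subgraph (Ioo a b) (scaled ε g) ⊆ subgraph univ (scaled ε g) :=
    fun z hz => ⟨mem_univ _, hz.2⟩
  have hε' := inv_ne_zero hε.ne'
  refine ⟨(hg.memLp_oscillating hp.le hε h.memLp_corrector).const_mul ε,
    hg.memLp_oscillating hp.le hε hP.grad_memLp, ?_, ?_⟩
  · have h1 := (hP.weakDeriv_fst.comp_affine hε' 0).const_mul ε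
    simp only [add_zero, preimage_inv_smul_strip hε, mul_inv_cancel_left₀ hε.ne'] at h1
    exact h1.mono hsub
  · have h1 := (hP.weakDeriv_snd.comp_affine hε' 0).const_mul ε
    simp only [add_zero, preimage_inv_smul_strip hε, mul_inv_cancel_left₀ hε.ne'] at h1
    exact h1.mono hsub

variable {β : ℝ → ℝ}

theorem IsCellSolution.memLp_correctorGrad (hp : 1 < p) (hg : IsProfile L G₀ G₁ g)
    (h : IsCellSolution L g p v Dv) (hβ : IsTest (Ioo a b) β) {ε : ℝ} (hε : 0 < ε) :
    MemLp (correctorGrad L v Dv β ε) ofR(p)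
      (thinMeasure ε (subgraph (Ioo a b) (scaled ε g))) :=
  memLp_thin ε ((memLp_test_smul hβ
    (hg.memLp_oscillating hp.le hε (h.memLp hg))).add (memLp_single_fst
      ((memLp_test_smul hβ.deriv (hg.memLp_oscillating hp.le hε h.memLp_corrector)).const_mul ε)))

/-- The oscillating part of the corrector, with a slowly varying weight, tends to zero. -/
theorem IsCellSolution.tendsto_integral_corrector (hp : 1 < p) (hg : IsProfile L G₀ G₁ g)
    (h : IsCellSolution L g p v Dv) (hβ : IsTest (Ioo a b) β) :
    Tendsto (fun ε => ∫ z, ‖ε * (β z.1 * perExt L (fun y => v y - y.1) (ε⁻¹ • z))‖ ^ p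
        ∂(thinMeasure ε (subgraph (Ioo a b) (scaled ε g)))) (𝓝[>] 0) (𝓝 0) := by
  have hp0 : 0 < p := by linarith
  have h1 := hg.tendsto_integral_norm_piece hp0 hβ.continuous hβ.compact
    (fun x hx => hβ.eq_zero hx) h.memLp_corrector
  have h2 : Tendsto (fun ε : ℝ => ε ^ p) (𝓝[>] 0) (𝓝 0) := by
    have := (Real.continuousAt_rpow_const 0 p (Or.inr hp0.le)).tendsto.mono_left
      (nhdsWithin_le_nhds (s := Ioi 0))
    rwa [Real.zero_rpow hp0.ne'] at this
  have h3 := h2.mul h1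
  rw [zero_mul] at h3
  refine h3.congr' ?_
  filter_upwards [self_mem_nhdsWithin] with ε hε
  rw [← integral_const_mul]
  refine integral_congr_ae (.of_forall fun z => ?_)
  simp only
  rw [norm_mul, norm_mul, Real.mul_rpow (norm_nonneg _) (by positivity),
    Real.mul_rpow (norm_nonneg _) (norm_nonneg _), Real.norm_of_nonneg (le_of_lt hε)]

/-- The gradient of the corrector is close to `b ∇v(z/ε)`. -/
theorem IsCellSolution.tendsto_integral_correctorGrad_sub (hp : 1 < p) (hg : IsProfile L G₀ G₁ g)
    (h : IsCellSolution L g p v Dv) (hβ : IsTest (Ioo a b) β) :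
    Tendsto (fun ε => ∫ z, ‖correctorGrad L v Dv β ε z - β z.1 • perExt L Dv (ε⁻¹ • z)‖ ^ p
        ∂(thinMeasure ε (subgraph (Ioo a b) (scaled ε g)))) (𝓝[>] 0) (𝓝 0) := by
  simp only [correctorGrad, add_sub_cancel_left, norm_single_fst, ← Real.norm_eq_abs]
  exact h.tendsto_integral_corrector hp hg hβ.deriv

theorem IsCellSolution.tendsto_integral_main (hp : 1 < p) (hg : IsProfile L G₀ G₁ g)
    (h : IsCellSolution L g p v Dv) (hβ : IsTest (Ioo a b) β) :
    Tendsto (fun ε => ∫ z, ‖β z.1 • perExt L Dv (ε⁻¹ • z)‖ ^ p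
        ∂(thinMeasure ε (subgraph (Ioo a b) (scaled ε g)))) (𝓝[>] 0)
      (𝓝 (L⁻¹ * ((∫ x in Ioo a b, ‖β x‖ ^ p) * ∫ y in cell L g, ‖Dv y‖ ^ p))) := by
  simp only [norm_smul, Real.mul_rpow (norm_nonneg _) (norm_nonneg _)]
  exact hg.tendsto_integral_norm_piece (by linarith) hβ.continuous hβ.compact
    (fun x hx => hβ.eq_zero hx) (h.memLp hg)

/-- The rescaled energy of the corrector. -/
theorem IsCellSolution.eventually_integral_correctorGrad_le (hp : 1 < p)
    (hg : IsProfile L G₀ G₁ g) (h : IsCellSolution L g p v Dv) (hβ : IsTest (Ioo a b) β) :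
    ∀ᶠ ε in 𝓝[>] 0, ∫ z, ‖correctorGrad L v Dv β ε z‖ ^ p
        ∂(thinMeasure ε (subgraph (Ioo a b) (scaled ε g))) ≤
      2 ^ p * (L⁻¹ * ((∫ x in Ioo a b, ‖β x‖ ^ p) * ∫ y in cell L g, ‖Dv y‖ ^ p)) + 1 := by
  have h1 := ((h.tendsto_integral_main hp hg hβ).add
    (h.tendsto_integral_correctorGrad_sub hp hg hβ)).const_mul (2 ^ p)
  rw [add_zero] at h1
  filter_upwards [(tendsto_order.1 h1).2 _ (lt_add_one _), self_mem_nhdsWithin] with ε hlt hε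
  refine le_trans ?_ hlt.le
  have m1 := memLp_thin ε (memLp_test_smul hβ
    (hg.memLp_oscillating hp.le hε (h.memLp hg) (a := a) (b := b)))
  have h2 := integral_norm_add_rpow_le hp m1 ((h.memLp_correctorGrad hp hg hβ hε).sub m1)
  simpa only [Pi.sub_apply, add_sub_cancel] using h2

/-- The flux of the corrector is close to `β |∇v|^{p-2}∇v (z/ε)` if `β` is close to
`|b|^{p-2} b`. -/
theorem IsCellSolution.eventually_integral_flux_sub_le (hp : p.HolderConjugate p')
    (hg : IsProfile L G₀ G₁ g) (h : IsCellSolution L g p v Dv) (hβ : IsTest (Ioo a b) β)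
    {γ : ℝ → ℝ} (hγ : IsTest (Ioo a b) γ) {η : ℝ} (hη : 0 < η) :
    ∀ᶠ ε in 𝓝[>] 0, ∫ z, ‖pFlux p (correctorGrad L v Dv β ε z) -
          γ z.1 • perExt L (fun y => pFlux p (Dv y)) (ε⁻¹ • z)‖ ^ p'
        ∂(thinMeasure ε (subgraph (Ioo a b) (scaled ε g))) ≤
      2 ^ p' * (L⁻¹ * ((∫ x in Ioo a b, ‖pFlux p (β x) - γ x‖ ^ p') *
        ∫ y in cell L g, ‖pFlux p (Dv y)‖ ^ p')) + η := by
  have hp'0 := hp.symm.pos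
  set T : ℝ := L⁻¹ * ((∫ x in Ioo a b, ‖β x‖ ^ p) * ∫ y in cell L g, ‖Dv y‖ ^ p) with hT
  have hT0 : 0 ≤ T := mul_nonneg (inv_pos.2 hg.L_pos).le
    (mul_nonneg (integral_rpow_nonneg _) (integral_rpow_nonneg _))
  have c1 : (0 : ℝ) < 2 ^ p := by positivity
  have c2 : (0 : ℝ) < 2 ^ p' := by positivity
  set δ : ℝ := η / (2 ^ p' * ((2 ^ p + 1) * (T + 1))) with hδ
  have hδ0 : 0 < δ := by positivity
  obtain ⟨C, hC0, hC⟩ := norm_pFlux_sub_rpow_le (V := Plane) hp hδ0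
  have lT := h.tendsto_integral_main hp.lt hg hβ
  have lS := h.tendsto_integral_correctorGrad_sub hp.lt hg hβ
  have lQ := hg.tendsto_integral_norm_piece (a := a) (b := b) hp'0
    (((continuous_pFlux hp.lt).comp hβ.continuous).sub hγ.continuous)
    ((hβ.compact.comp_left (g := pFlux p) pFlux_zero).sub hγ.compact)
    (fun x hx => by simp [hβ.eq_zero hx, hγ.eq_zero hx, pFlux_zero]) (memLp_pFlux hp (h.memLp hg))
  have lim := ((((lT.const_mul (2 ^ p + 1)).add (lS.const_mul (2 ^ p))).const_mul δ).add
    (lS.const_mul C)).add lQ |>.const_mul (2 ^ p')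
  have hlt : 2 ^ p' * (δ * ((2 ^ p + 1) * T + 2 ^ p * 0) + C * 0 +
      L⁻¹ * ((∫ x in Ioo a b, ‖pFlux p (β x) - γ x‖ ^ p') *
        ∫ y in cell L g, ‖pFlux p (Dv y)‖ ^ p')) <
      2 ^ p' * (L⁻¹ * ((∫ x in Ioo a b, ‖pFlux p (β x) - γ x‖ ^ p') *
        ∫ y in cell L g, ‖pFlux p (Dv y)‖ ^ p')) + η := by
    have h1 : 2 ^ p' * (δ * ((2 ^ p + 1) * T)) < η := by
      have h2 : 2 ^ p' * (δ * ((2 ^ p + 1) * (T + 1))) = η := by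
        rw [hδ]
        field_simp
      rw [← h2]
      gcongr
      linarith
    linarith
  filter_upwards [(tendsto_order.1 lim).2 _ hlt, self_mem_nhdsWithin] with ε hε1 hε
  refine le_trans ?_ hε1.le
  set μ := thinMeasure ε (subgraph (Ioo a b) (scaled ε g))
  set W := correctorGrad L v Dv β ε
  set B : ℝ² → Plane := fun z => β z.1 • perExt L Dv (ε⁻¹ • z) with hB
  set A : ℝ² → Plane := fun z => perExt L (fun y => pFlux p (Dv y)) (ε⁻¹ • z) with hA
  have mW : MemLp W ofR(p) μ := h.memLp_correctorGrad hp.lt hg hβ hε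
  have mB : MemLp B ofR(p) μ := memLp_thin ε
    (memLp_test_smul hβ (hg.memLp_oscillating hp.lt.le hε (h.memLp hg)))
  have hBA : ∀ z, pFlux p (B z) = pFlux p (β z.1) • A z := fun z => pFlux_smul _ _
  have mγ : MemLp (fun z => γ z.1 • A z) ofR(p') μ := memLp_thin ε
    (memLp_test_smul hγ (hg.memLp_oscillating hp.symm.lt.le hε (memLp_pFlux hp (h.memLp hg))))
  have h1 := integral_norm_add_rpow_le hp.symm.lt ((memLp_pFlux hp mW).sub (memLp_pFlux hp mB))
    ((memLp_pFlux hp mB).sub mγ)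
  simp only [Pi.sub_apply, sub_add_sub_cancel] at h1
  refine h1.trans (mul_le_mul_of_nonneg_left (add_le_add ?_ (le_of_eq ?_)) c2.le)
  · have i1 := integrable_norm_rpow hp.pos mW
    have i2 := integrable_norm_rpow hp.pos mB
    have i3 := integrable_norm_rpow hp.pos (mW.sub mB)
    simp only [Pi.sub_apply] at i3
    have h2 : ∫ z, ‖pFlux p (W z) - pFlux p (B z)‖ ^ p' ∂μ ≤
        δ * ((∫ z, ‖W z‖ ^ p ∂μ) + ∫ z, ‖B z‖ ^ p ∂μ) + C * ∫ z, ‖W z - B z‖ ^ p ∂μ := by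
      rw [← integral_add i1 i2, ← integral_const_mul, ← integral_const_mul,
        ← integral_add ((i1.fun_add i2).const_mul _) (i3.const_mul _)]
      exact integral_mono (integrable_norm_rpow hp'0 ((memLp_pFlux hp mW).sub (memLp_pFlux hp mB)))
        (((i1.fun_add i2).const_mul _).add (i3.const_mul _)) fun z => hC _ _
    have h3 : ∫ z, ‖W z‖ ^ p ∂μ ≤ 2 ^ p * ((∫ z, ‖B z‖ ^ p ∂μ) + ∫ z, ‖W z - B z‖ ^ p ∂μ) := by
      have h4 := integral_norm_add_rpow_le hp.lt mB (mW.sub mB)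
      simpa only [Pi.sub_apply, add_sub_cancel] using h4
    refine h2.trans (add_le_add (mul_le_mul_of_nonneg_left ?_ hδ0.le) le_rfl)
    linarith
  · refine integral_congr_ae (.of_forall fun z => ?_)
    simp only
    rw [hBA, ← sub_smul, norm_smul, Real.mul_rpow (norm_nonneg _) (norm_nonneg _)]
    rfl

end Corrector

/-! ### Weak convergence on the line -/

section Line

variable {p p' L G₀ G₁ : ℝ} {g : ℝ → ℝ}

/-- The rapidly oscillating profile converges weakly to its mean value. -/
theorem IsProfile.tendsto_integral_mul_profile (hg : IsProfile L G₀ G₁ g) {k : ℝ → ℝ}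
    (hk : Integrable k) :
    Tendsto (fun ε => ∫ x, k x * g (x / ε)) (𝓝[>] 0) (𝓝 (rCoeff L g * ∫ x, k x)) := by
  have hfin := hg.isFiniteMeasure_cell
  have hG₁ : 0 < G₁ := hg.G₁_pos
  have hb : ∀ y, ‖g y‖ ≤ G₁ := fun y => by
    rw [Real.norm_of_nonneg (hg.pos y).le]
    exact hg.upper y
  have hint : ∀ (ε : ℝ) (k : ℝ → ℝ), Integrable k → Integrable fun x => k x * g (x / ε) :=
    fun ε k hk => hk.mul_bdd (c := G₁)
      (hg.contDiff.continuous.comp (continuous_id.div_const ε)).aestronglyMeasurable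
      (.of_forall fun x => hb _)
  have hcont : ∀ h : ℝ → ℝ, Continuous h → HasCompactSupport h →
      Tendsto (fun ε => ∫ x, h x * g (x / ε)) (𝓝[>] 0) (𝓝 (rCoeff L g * ∫ x, h x)) := by
    intro h hc hs
    have h1 := hg.tendsto_integral_oscillating hc hs (a := fun _ => 1) (integrable_const _)
    have e1 : L⁻¹ * ((∫ x, h x) * ∫ y in cell L g, (1 : ℝ)) = rCoeff L g * ∫ x, h x := by
      rw [integral_const, smul_eq_mul, mul_one, rCoeff, measureReal_restrict_apply_univ]
      ring
    rw [e1] at h1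
    refine h1.congr' ?_
    filter_upwards [self_mem_nhdsWithin] with ε (hε : 0 < ε)
    have hSm := (hg.isOpen_scaled (ε := ε) isOpen_univ).measurableSet
    have hi : IntegrableOn (fun z : ℝ² => h z.1) (subgraph univ (scaled ε g)) := by
      obtain ⟨C, hC⟩ := hc.bounded_above_of_compact_support hs
      obtain ⟨K, hK⟩ := hs.isCompact.isBounded.subset_closedBall 0
      have h2 : IntegrableOn (fun z : ℝ² => h z.1)
          (Metric.closedBall 0 K ×ˢ Ioo 0 (ε * G₁)) := by
        refine Measure.integrableOn_of_bounded (M := C) ?_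
          (hc.comp continuous_fst).aestronglyMeasurable (.of_forall fun z => hC _)
        rw [Measure.volume_eq_prod, Measure.prod_prod]
        exact ENNReal.mul_ne_top measure_closedBall_lt_top.ne (by simp)
      refine h2.of_forall_sdiff_eq_zero hSm fun z hz => ?_
      by_contra h0
      exact hz.2 ⟨hK (subset_tsupport _ h0), hz.1.2.1,
        hz.1.2.2.trans_le (mul_le_mul_of_nonneg_left (hg.upper _) hε.le)⟩
    simp only [perExt, mul_one]
    rw [(setIntegral_subgraph MeasurableSet.univ hSm hi).1, setIntegral_univ, ← integral_const_mul]
    refine integral_congr_ae (.of_forall fun x => ?_)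
    simp only
    rw [setIntegral_const, smul_eq_mul, scaled, Real.volume_real_Ioo_of_le
      (mul_pos hε (hg.pos _)).le]
    field_simp
    simp
  have hr : 0 ≤ rCoeff L g := div_nonneg measureReal_nonneg hg.L_pos.le
  refine Metric.tendsto_nhds.2 fun η hη => ?_
  set δ := η / (2 * (G₁ + rCoeff L g + 1)) with hδ
  have hδ0 : 0 < δ := by positivity
  obtain ⟨h, hs, hh, hc, hhi⟩ := hk.exists_hasCompactSupport_integral_sub_le hδ0
  have hd := hk.sub hhi
  filter_upwards [Metric.tendsto_nhds.1 (hcont h hc hs) (η / 2) (half_pos hη)] with ε hε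
  rw [Real.dist_eq] at hε ⊢
  have e2 : (∫ x, k x * g (x / ε)) - rCoeff L g * ∫ x, k x =
      (∫ x, (k x - h x) * g (x / ε)) - (rCoeff L g * ∫ x, (k x - h x)) +
        ((∫ x, h x * g (x / ε)) - rCoeff L g * ∫ x, h x) := by
    simp only [sub_mul]
    rw [integral_sub (hint ε k hk) (hint ε h hhi), integral_sub hk hhi]
    ring
  have b1 : |∫ x, (k x - h x) * g (x / ε)| ≤ G₁ * δ := by
    rw [← Real.norm_eq_abs]
    refine (norm_integral_le_integral_norm _).trans ?_
    refine le_trans ?_ (mul_le_mul_of_nonneg_left hh hG₁.le)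
    rw [← integral_const_mul]
    refine integral_mono (hint ε _ hd).norm (hd.norm.const_mul _) fun x => ?_
    simp only [norm_mul]
    rw [mul_comm]
    exact mul_le_mul_of_nonneg_right (hb _) (norm_nonneg _)
  have b2 : |rCoeff L g * ∫ x, (k x - h x)| ≤ rCoeff L g * δ := by
    rw [abs_mul, abs_of_nonneg hr]
    exact mul_le_mul_of_nonneg_left ((norm_integral_le_integral_norm _).trans hh) hr
  have b3 : (G₁ + rCoeff L g) * δ < η / 2 := by
    have : (G₁ + rCoeff L g + 1) * δ = η / 2 := by
      rw [hδ]
      field_simp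
    linarith
  rw [e2]
  refine (abs_add_le _ _).trans_lt ?_
  have := abs_sub (∫ x, (k x - h x) * g (x / ε)) (rCoeff L g * ∫ x, (k x - h x))
  linarith

theorem abs_setIntegral_le {S T : Set ℝ} (hST : S ⊆ T) {k : ℝ → ℝ} (hk : IntegrableOn k T) :
    |∫ x in S, k x| ≤ ∫ x in T, ‖k x‖ :=
  (norm_integral_le_integral_norm _).trans
    (setIntegral_mono_set hk.norm (.of_forall fun _ => norm_nonneg _) hST.eventuallyLE)

/-- Functions whose primitives tend to zero pointwise, and which are bounded in `L¹(0,1)`, tend to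
zero uniformly when they are tested with the unit ball of `W^{1,p}(0,1)`. -/
theorem eventually_abs_integral_mul_le (hp : p.HolderConjugate p') {h : ℝ → ℝ → ℝ}
    (hi : ∀ ε, 0 < ε → IntegrableOn (h ε) (Ioo 0 1)) {C : ℝ}
    (hC : ∀ ε, 0 < ε → ∫ x in 𝕀, ‖h ε x‖ ≤ C)
    (hlim : ∀ t ∈ Ico (0 : ℝ) 1, Tendsto (fun ε => ∫ x in Ioo t 1, h ε x) (𝓝[>] 0) (𝓝 0))
    {η : ℝ} (hη : 0 < η) :
    ∀ᶠ ε in 𝓝[>] 0, ∀ ψ dψ, IsW1pLine (Ioo 0 1) p ψ dψ →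
      |∫ x in 𝕀, h ε x * ψ x| ≤
        η * ((∫ x in 𝕀, ‖ψ x‖ ^ p) ^ (1 / p) +
          (∫ x in 𝕀, ‖dψ x‖ ^ p) ^ (1 / p)) := by
  set J : Set ℝ := Ioo 0 1 with hJ
  have hJm : MeasurableSet J := measurableSet_Ioo
  have hp'0 := hp.symm.pos
  -- the primitives of `h`, which tend to zero in `L^{p'}`
  set H : ℝ → ℝ → ℝ := fun ε t => ∫ x in Ioo t 1, h ε x with hH
  have hHi : ∀ ε t, t ∈ J → H ε t = ∫ x in J, (Ioi t).indicator (h ε) x := by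
    intro ε t ht
    rw [setIntegral_indicator measurableSet_Ioi, hJ, Ioo_inter_Ioi, max_eq_right ht.1.le]
  have hHb : ∀ ε, 0 < ε → ∀ t ∈ J, ‖H ε t‖ ≤ C := fun ε hε t ht =>
    (abs_setIntegral_le (Ioo_subset_Ioo_left ht.1.le) (hi ε hε)).trans (hC ε hε)
  -- the kernel of the iterated integral
  have hker : ∀ ε, 0 < ε → ∀ k : ℝ → ℝ, IntegrableOn k J →
      Integrable (fun q : ℝ² => k q.1 * (Ioi q.1).indicator (h ε) q.2)
        (vol[J].prod vol[J]) := by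
    intro ε hε k hk
    have h1 := (Integrable.mul_prod hk (hi ε hε)).indicator
      (measurableSet_lt (measurable_fst (α := ℝ) (β := ℝ)) measurable_snd)
    refine h1.congr (.of_forall fun q => ?_)
    by_cases hq : q.1 < q.2 <;> simp [indicator, hq]
  have hHm : ∀ ε, 0 < ε → AEStronglyMeasurable (H ε) vol[J] := by
    intro ε hε
    have h1 := (hker ε hε (fun _ => 1) (integrable_const _)).integral_prod_left.1
    refine h1.congr ?_
    filter_upwards [ae_restrict_mem hJm] with t ht
    simp only [one_mul]
    exact (hHi ε t ht).symm
  have hHL : ∀ ε, 0 < ε → MemLp (H ε) ofR(p') vol[J] := fun ε hε =>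
    MemLp.of_bound (hHm ε hε) C ((ae_restrict_mem hJm).mono (hHb ε hε))
  have lim1 : Tendsto (fun ε => ∫ t in J, ‖H ε t‖ ^ p') (𝓝[>] 0) (𝓝 0) := by
    suffices hs : Tendsto (fun ε => ∫ t in J, ‖H ε t‖ ^ p') (𝓝[>] 0) (𝓝 (∫ t in J, (0 : ℝ))) by
      rwa [integral_zero] at hs
    refine tendsto_integral_filter_of_dominated_convergence (fun _ => C ^ p') ?_ ?_
      (integrable_const _) ?_
    · filter_upwards [self_mem_nhdsWithin] with ε hε
      exact (continuous_norm_rpow hp'0.le).comp_aestronglyMeasurable (hHm ε hε)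
    · filter_upwards [self_mem_nhdsWithin] with ε hε
      filter_upwards [ae_restrict_mem hJm] with t ht
      rw [Real.norm_of_nonneg (by positivity)]
      exact Real.rpow_le_rpow (norm_nonneg _) (hHb ε hε t ht) hp'0.le
    · filter_upwards [ae_restrict_mem hJm] with t ht
      have h1 := (continuous_norm_rpow (W := ℝ) hp'0.le).tendsto 0 |>.comp
        (hlim t ⟨ht.1.le, ht.2⟩)
      simpa [hp'0.ne', Function.comp_def] using h1
  have lim2 : Tendsto (fun ε => |H ε 0| + (∫ t in J, ‖H ε t‖ ^ p') ^ (1 / p')) (𝓝[>] 0) (𝓝 0) := by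
    have h1 := (hlim 0 ⟨le_rfl, one_pos⟩).abs.add
      (lim1.rpow_const (p := 1 / p') (Or.inr (by positivity)))
    rwa [abs_zero, Real.zero_rpow (by positivity), add_zero] at h1
  filter_upwards [(tendsto_order.1 lim2).2 η hη, self_mem_nhdsWithin] with ε hεη hε ψ dψ hψ
  have hp1 : (1 : ENNReal) ≤ ofR(p) := by simpa using hp.lt.le
  have iψ : IntegrableOn ψ J := hψ.memLp.integrable hp1
  have idψ : IntegrableOn dψ J := hψ.deriv_memLp.integrable hp1
  obtain ⟨K, hK⟩ := exists_eq_add_integral one_pos iψ idψ hψ.weakDeriv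
  have hle : ∀ {k : ℝ → ℝ}, MemLp k ofR(p) vol[J] →
      ∫ x in J, ‖k x‖ ≤ (∫ x in J, ‖k x‖ ^ p) ^ (1 / p) := by
    intro k hk
    exact integral_norm_le_rpow hp.lt hk (by simp [hJ])
  set A := (∫ x in J, ‖ψ x‖ ^ p) ^ (1 / p)
  set B := (∫ x in J, ‖dψ x‖ ^ p) ^ (1 / p)
  have hA : 0 ≤ A := Real.rpow_nonneg (integral_rpow_nonneg _) _
  have hB : 0 ≤ B := Real.rpow_nonneg (integral_rpow_nonneg _) _
  have hKle : |K| ≤ A + B := by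
    have h1 : ∀ᵐ x ∂vol[J], |K| ≤ ‖ψ x‖ + ∫ t in J, ‖dψ t‖ := by
      filter_upwards [ae_restrict_of_ae hK, ae_restrict_mem hJm] with x hx hxJ
      rw [show K = ψ x - ∫ t in Ioo 0 x, dψ t by rw [hx hxJ]; ring]
      exact (abs_sub _ _).trans
        (add_le_add le_rfl (abs_setIntegral_le (Ioo_subset_Ioo_right hxJ.2.le) idψ))
    have h2 := integral_mono_ae (integrable_const _) (Integrable.add iψ.norm (integrable_const _)) h1
    rw [integral_add' iψ.norm (integrable_const _), integral_const, integral_const] at h2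
    simp only [measureReal_restrict_apply_univ, hJ, Real.volume_real_Ioo, sub_zero, smul_eq_mul]
      at h2
    norm_num at h2
    exact h2.trans (add_le_add (hle hψ.memLp) (hle hψ.deriv_memLp))
  have i1 := hker ε hε dψ idψ
  -- Fubini's theorem replaces an integration by parts
  have key : ∫ x in J, h ε x * ψ x = K * H ε 0 + ∫ t in J, dψ t * H ε t := by
    have e1 : ∫ t in J, dψ t * H ε t =
        ∫ t in J, ∫ x in J, dψ t * (Ioi t).indicator (h ε) x := by
      refine setIntegral_congr_fun hJm fun t ht => ?_
      rw [hHi ε t ht, integral_const_mul]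
    have e2 : ∀ x ∈ J, ∫ t in J, dψ t * (Ioi t).indicator (h ε) x =
        h ε x * ∫ t in Ioo 0 x, dψ t := by
      intro x hx
      rw [← integral_const_mul]
      have h1 : Ioo 0 x = J ∩ Iio x := by rw [hJ, Ioo_inter_Iio, min_eq_right hx.2.le]
      rw [h1, ← setIntegral_indicator measurableSet_Iio]
      refine integral_congr_ae (.of_forall fun t => ?_)
      by_cases ht : t < x <;> simp [indicator, ht, mul_comm]
    have e3 : H ε 0 = ∫ x in J, h ε x := rfl
    have i2 : IntegrableOn (fun x => h ε x * ∫ t in Ioo 0 x, dψ t) J :=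
      i1.integral_prod_right.congr ((ae_restrict_mem hJm).mono e2)
    rw [e1, integral_integral_swap i1, setIntegral_congr_fun hJm e2, e3, ← integral_const_mul,
      ← integral_add ((hi ε hε).const_mul K) i2]
    refine integral_congr_ae ?_
    filter_upwards [ae_restrict_of_ae hK, ae_restrict_mem hJm] with x hx hxJ
    rw [hx hxJ]
    ring
  have hHö := abs_integral_mul_le hp hψ.deriv_memLp (hHL ε hε)
  rw [key]
  set D := (∫ t in J, ‖H ε t‖ ^ p') ^ (1 / p')
  have hD : 0 ≤ D := Real.rpow_nonneg (integral_rpow_nonneg _) _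
  calc |K * H ε 0 + ∫ t in J, dψ t * H ε t| ≤ |K * H ε 0| + |∫ t in J, dψ t * H ε t| :=
        abs_add_le _ _
    _ ≤ (A + B) * |H ε 0| + B * D := by
        rw [abs_mul]
        exact add_le_add (mul_le_mul_of_nonneg_right hKle (abs_nonneg _)) hHö
    _ ≤ (|H ε 0| + D) * (A + B) := by nlinarith [mul_nonneg hA hD]
    _ ≤ η * (A + B) := mul_le_mul_of_nonneg_right hεη.le (add_nonneg hA hB)

end Line

/-! ### Vertical means of the data -/

namespace Profile

variable {N : ℕ} {L G₀ G₁ : ℝ} (P : Profile N L G₀ G₁) {p p' ε : ℝ}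

theorem integrableOn_of_piece {k : ℝ → ℝ} (h : ∀ i, IntegrableOn k (P.piece i)) :
    IntegrableOn k (Ioo 0 1) := by
  rw [IntegrableOn, P.restrict_Ioo]
  exact integrable_finsetSum_measure.2 fun i _ => h i

theorem verticalMean_of_mem {i : Fin N} {x : ℝ} (hx : x ∈ P.piece i) (f : ℝ² → ℝ) :
    P.verticalMean ε f x = ε⁻¹ * ∫ t in Ioo 0 (scaled ε (P.g i) x), f (x, t) := by
  rw [verticalMean, P.G_piece i x hx]
  rfl

theorem verticalMean_comp_fst (hε : 0 < ε) {i : Fin N} {x : ℝ} (hx : x ∈ P.piece i) (k : ℝ → ℝ) :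
    P.verticalMean ε (fun z => k z.1) x = k x * P.g i (x / ε) := by
  have h := (P.isProfile i).pos (x / ε)
  rw [P.verticalMean_of_mem hx]
  simp only
  rw [setIntegral_const, smul_eq_mul, scaled,
    Real.volume_real_Ioo_of_le (mul_pos hε h).le, sub_zero]
  field_simp

/-- Integration in the vertical direction turns integrals over the thin domain into integrals over
the unit interval. -/
theorem integral_mul_comp_fst (hε : 0 < ε) {f : ℝ² → ℝ} {k : ℝ → ℝ}
    (hi : IntegrableOn (fun z => f z * k z.1) (P.thinDomain ε)) :
    IntegrableOn (fun x => P.verticalMean ε f x * k x) (Ioo 0 1) ∧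
      ∫ z, f z * k z.1 ∂𝔪[P, ε] =
        ∫ x in 𝕀, P.verticalMean ε f x * k x := by
  have h1 : ∀ i, IntegrableOn (fun x => P.verticalMean ε f x * k x) (P.piece i) ∧
      ∫ z, f z * k z.1 ∂𝔪[P, i, ε] =
        ∫ x in P.piece i, P.verticalMean ε f x * k x := by
    intro i
    obtain ⟨h2, h3⟩ := setIntegral_subgraph (P.measurableSet_piece i)
      (P.measurableSet_pieceDomain i ε) (hi.mono_set (P.pieceDomain_subset i ε))
    have h4 : ∀ x ∈ P.piece i, ε⁻¹ * ∫ t in Ioo 0 (scaled ε (P.g i) x), f (x, t) * k x =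
        P.verticalMean ε f x * k x := fun x hx => by
      rw [P.verticalMean_of_mem hx, integral_mul_const, mul_assoc]
    refine ⟨(integrableOn_congr_fun h4 (P.measurableSet_piece i)).1 (h3.const_mul ε⁻¹), ?_⟩
    rw [integral_thinMeasure hε, smul_eq_mul]
    refine (congrArg (ε⁻¹ * ·) h2).trans ?_
    simp only
    rw [← integral_const_mul]
    exact setIntegral_congr_fun (P.measurableSet_piece i) h4
  have h2 := P.integrableOn_of_piece fun i => (h1 i).1
  refine ⟨h2, ?_⟩
  rw [P.integral_thinDomain hε hi, P.sum_setIntegral_piece h2]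
  exact Finset.sum_congr rfl fun i _ => (h1 i).2

theorem integral_norm_verticalMean_le (hε : 0 < ε) {f : ℝ² → ℝ}
    (hf : IntegrableOn f (P.thinDomain ε)) :
    IntegrableOn (P.verticalMean ε f) (Ioo 0 1) ∧ ∫ x in 𝕀, ‖P.verticalMean ε f x‖ ≤
      ∫ z, ‖f z‖ ∂𝔪[P, ε] := by
  have h1 := P.integral_mul_comp_fst hε (f := f) (k := fun _ => 1) (by simpa using hf)
  have h2 := P.integral_mul_comp_fst hε (f := fun z => ‖f z‖) (k := fun _ => 1)
    (by simp only [mul_one]; exact hf.norm)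
  simp only [mul_one] at h1 h2
  refine ⟨h1.1, ?_⟩
  rw [h2.2]
  refine setIntegral_mono h1.1.norm h2.1 fun x => ?_
  rw [verticalMean, verticalMean, norm_mul, Real.norm_of_nonneg (inv_pos.2 hε).le]
  exact mul_le_mul_of_nonneg_left (norm_integral_le_integral_norm _) (inv_pos.2 hε).le

theorem thinMeasure_univ_le (hε : 0 < ε) :
    𝔪[P, ε] univ ≤ ENNReal.ofReal (N * G₁) := by
  have h1 : ∀ i, volume (P.pieceDomain i ε) ≤ ENNReal.ofReal (ε * G₁) := fun i => by
    have h2 : P.pieceDomain i ε ⊆ 𝕀 ×ˢ Ioo 0 (ε * G₁) := fun z hz =>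
      ⟨P.piece_subset i hz.1, hz.2.1,
        hz.2.2.trans_le (mul_le_mul_of_nonneg_left (P.upper i _) hε.le)⟩
    refine (measure_mono h2).trans ?_
    rw [Measure.volume_eq_prod, Measure.prod_prod]
    simp
  have h3 : volume (P.thinDomain ε) ≤ N * ENNReal.ofReal (ε * G₁) := by
    rw [← Measure.restrict_apply_univ, P.restrict_thinDomain, Measure.finsetSum_apply]
    refine (Finset.sum_le_card_nsmul _ _ (ENNReal.ofReal (ε * G₁)) fun i _ => ?_).trans ?_
    · rw [Measure.restrict_apply_univ]
      exact h1 i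
    · simp
  rw [thinMeasure, Measure.smul_apply, Measure.restrict_apply_univ, smul_eq_mul]
  refine (mul_le_mul_right h3 _).trans ?_
  rw [← ENNReal.ofReal_natCast, ← ENNReal.ofReal_mul (Nat.cast_nonneg N),
    ← ENNReal.ofReal_mul (inv_pos.2 hε).le]
  refine ENNReal.ofReal_le_ofReal (le_of_eq ?_)
  field_simp

theorem isFiniteMeasure_thinMeasure (hε : 0 < ε) :
    IsFiniteMeasure 𝔪[P, ε] :=
  ⟨(P.thinMeasure_univ_le hε).trans_lt ENNReal.ofReal_lt_top⟩

theorem thinMeasure_real_univ_le (hε : 0 < ε) :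
    𝔪[P, ε].real univ ≤ |N * G₁| := by
  refine (ENNReal.toReal_mono ENNReal.ofReal_ne_top (P.thinMeasure_univ_le hε)).trans ?_
  rw [ENNReal.toReal_ofReal']
  exact max_le (le_abs_self _) (abs_nonneg _)

theorem integral_norm_le (hp : 1 < p) (hε : 0 < ε) {f : ℝ² → ℝ}
    (hf : MemLp f ofR(p) vol[P.thinDomain ε]) {K : ℝ}
    (hK : ∫ z, ‖f z‖ ^ p ∂𝔪[P, ε] ≤ K) :
    ∫ z, ‖f z‖ ∂𝔪[P, ε] ≤ (|N * G₁| ^ (p - 1) * K) ^ (1 / p) := by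
  have := P.isFiniteMeasure_thinMeasure hε
  exact integral_norm_le_rpow hp (memLp_thin ε hf) (mul_le_mul (Real.rpow_le_rpow measureReal_nonneg
    (P.thinMeasure_real_univ_le hε) (by linarith)) hK (integral_rpow_nonneg _) (by positivity))

theorem exists_norm_le_of_continuous {k : ℝ → ℝ} (hk : Continuous k) :
    ∃ C, 0 ≤ C ∧ ∀ x ∈ 𝕀, ‖k x‖ ≤ C := by
  obtain ⟨C, hC⟩ := isCompact_Icc (a := (0 : ℝ)) (b := 1) |>.exists_bound_of_continuousOn
    hk.continuousOn
  exact ⟨C, (norm_nonneg _).trans (hC 0 (by simp)), fun x hx => hC x (Ioo_subset_Icc_self hx)⟩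

theorem memLp_comp_fst_of_continuous (hε : 0 < ε) {k : ℝ → ℝ} (hk : Continuous k) (q : ENNReal) :
    MemLp (fun z : ℝ² => k z.1) q vol[P.thinDomain ε] := by
  have := P.isFiniteMeasure_thinMeasure hε
  obtain ⟨C, -, hC⟩ := exists_norm_le_of_continuous hk
  exact memLp_of_thin hε (MemLp.of_bound (hk.comp continuous_fst).aestronglyMeasurable
    C (ae_thinMeasure_of_ae ((ae_restrict_mem₀ (P.nullMeasurableSet_thinDomain ε)).mono
      fun z hz => hC _ hz.1)))

theorem integral_comp_fst_le (hp : 0 < p) (hε : 0 < ε) {k : ℝ → ℝ} (hk : Continuous k) {C : ℝ}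
    (hC0 : 0 ≤ C) (hC : ∀ x ∈ 𝕀, |k x| ≤ C) :
    ∫ z, ‖k z.1‖ ^ p ∂𝔪[P, ε] ≤ C ^ p * |N * G₁| := by
  have := P.isFiniteMeasure_thinMeasure hε
  have h1 : ∀ᵐ z ∂𝔪[P, ε], ‖k z.1‖ ^ p ≤ C ^ p :=
    ae_thinMeasure_of_ae ((ae_restrict_mem₀ (P.nullMeasurableSet_thinDomain ε)).mono
      fun z hz => Real.rpow_le_rpow (norm_nonneg _) (hC _ hz.1) hp.le)
  refine (integral_mono_ae (integrable_norm_rpow hp (memLp_thin ε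
    (P.memLp_comp_fst_of_continuous hε hk _))) (integrable_const _) h1).trans ?_
  rw [integral_const, smul_eq_mul, mul_comm]
  exact mul_le_mul_of_nonneg_left (P.thinMeasure_real_univ_le hε) (by positivity)

theorem exists_integral_comp_fst_le (hp : 0 < p) {k : ℝ → ℝ} (hk : Continuous k) :
    ∃ C, ∀ ε, 0 < ε → ∫ z, ‖k z.1‖ ^ p ∂𝔪[P, ε] ≤ C := by
  obtain ⟨C, hC0, hC⟩ := exists_norm_le_of_continuous hk
  exact ⟨C ^ p * |N * G₁|, fun ε hε => P.integral_comp_fst_le hp hε hk hC0 hC⟩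

theorem abs_piecewiseConst_le (a : Fin N → ℝ) (x : ℝ) : |P.piecewiseConst a x| ≤ ∑ i, |a i| := by
  refine (Finset.abs_sum_le_sum_abs _ _).trans (Finset.sum_le_sum fun i _ => ?_)
  by_cases h : x ∈ P.piece i
  · rw [indicator_of_mem h]
  · rw [indicator_of_notMem h, abs_zero]
    exact abs_nonneg _

theorem memLp_piecewiseConst_mul (a : Fin N → ℝ) {q : ENNReal} {μ : Measure ℝ} {X : ℝ → ℝ}
    (hX : MemLp X q μ) : MemLp (fun x => P.piecewiseConst a x * X x) q μ :=
  hX.of_le_mul (c := ∑ i, |a i|)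
    ((P.measurable_piecewiseConst a).aestronglyMeasurable.mul hX.1) (.of_forall fun x => by
      rw [norm_mul]
      exact mul_le_mul_of_nonneg_right (P.abs_piecewiseConst_le a x) (norm_nonneg _))

theorem integrableOn_piecewiseConst_mul (a : Fin N → ℝ) {k : ℝ → ℝ}
    (hk : IntegrableOn k (Ioo 0 1)) :
    IntegrableOn (fun x => P.piecewiseConst a x * k x) (Ioo 0 1) :=
  memLp_one_iff_integrable.1 (P.memLp_piecewiseConst_mul a (memLp_one_iff_integrable.2 hk))

/-- The vertical means of a fixed function of the first variable converge weakly. -/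
theorem tendsto_integral_verticalMean {k : ℝ → ℝ} (hk : IntegrableOn k (Ioo 0 1)) :
    Tendsto (fun ε => ∫ x in 𝕀, P.verticalMean ε (fun z => k z.1) x) (𝓝[>] 0)
      (𝓝 (∫ x in 𝕀, P.piecewiseConst (fun i => rCoeff L (P.g i)) x * k x)) := by
  have hki : ∀ i, IntegrableOn k (P.piece i) := fun i => hk.mono_set (P.piece_subset i)
  have h1 : ∀ i, Tendsto (fun ε => ∫ x in P.piece i, k x * P.g i (x / ε)) (𝓝[>] 0)
      (𝓝 (rCoeff L (P.g i) * ∫ x in P.piece i, k x)) := fun i => by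
    have h2 := (P.isProfile i).tendsto_integral_mul_profile
      ((integrable_indicator_iff (P.measurableSet_piece i)).2 (hki i))
    rw [integral_indicator (P.measurableSet_piece i)] at h2
    simpa only [integral_indicator_mul (P.measurableSet_piece i)] using h2
  have e1 : ∫ x in 𝕀, P.piecewiseConst (fun i => rCoeff L (P.g i)) x * k x =
      ∑ i, rCoeff L (P.g i) * ∫ x in P.piece i, k x := by
    rw [P.sum_setIntegral_piece (P.integrableOn_piecewiseConst_mul _ hk)]
    refine Finset.sum_congr rfl fun i _ => ?_
    rw [← integral_const_mul]
    exact setIntegral_congr_fun (P.measurableSet_piece i) fun x hx => by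
      simp only [P.piecewiseConst_of_mem _ hx]
  rw [e1]
  refine (tendsto_finsetSum _ fun i _ => h1 i).congr' ?_
  filter_upwards [self_mem_nhdsWithin] with ε (hε : 0 < ε)
  have h4 : ∀ i, ∀ x ∈ P.piece i, k x * P.g i (x / ε) =
      P.verticalMean ε (fun z => k z.1) x := fun i x hx =>
    (P.verticalMean_comp_fst hε hx k).symm
  have h5 : ∀ i, IntegrableOn (fun x => k x * P.g i (x / ε)) (P.piece i) := fun i =>
    (hki i).mul_bdd (c := G₁) ((P.contDiff i).continuous.comp
      (continuous_id.div_const ε)).aestronglyMeasurable (.of_forall fun x => by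
        rw [Real.norm_of_nonneg ((P.isProfile i).pos _).le]
        exact P.upper _ _)
  rw [P.sum_setIntegral_piece (P.integrableOn_of_piece fun i =>
      (integrableOn_congr_fun (h4 i) (P.measurableSet_piece i)).1 (h5 i))]
  exact Finset.sum_congr rfl fun i _ => setIntegral_congr_fun (P.measurableSet_piece i) (h4 i)

/-- The vertical means of the right-hand sides minus the lower order term at a fixed continuous
function converge weakly. -/
theorem tendsto_integral_verticalMean_sub (hp : p.HolderConjugate p') {f : ℝ → ℝ² → ℝ}
    (hf : ∀ ε, 0 < ε → MemLp (f ε) ofR(p') vol[P.thinDomain ε]) {fhat : ℝ → ℝ}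
    (hfhat : TendstoWeaklyLp p' p vol[𝕀] (fun ε => P.verticalMean ε (f ε)) fhat) {k : ℝ → ℝ}
    (hk : Continuous k) {t : ℝ} (ht : 0 ≤ t) :
    Tendsto (fun ε => ∫ x in Ioo t 1, P.verticalMean ε (fun z => f ε z - k z.1) x) (𝓝[>] 0)
      (𝓝 (∫ x in Ioo t 1, (fhat x - P.piecewiseConst (fun i => rCoeff L (P.g i)) x * k x))) := by
  have hp1 : (1 : ENNReal) ≤ ofR(p') := by simpa using hp.symm.lt.le
  set χ : ℝ → ℝ := (Ioo t 1).indicator fun _ => 1 with hχ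
  have hχm : Measurable χ := measurable_const.indicator measurableSet_Ioo
  have hχ1 : ∀ x, ‖χ x‖ ≤ 1 := fun x => by by_cases hx : x ∈ Ioo t 1 <;> simp [hχ, hx]
  have e0 : ∀ F : ℝ → ℝ, ∫ x in Ioo t 1, F x = ∫ x in 𝕀, F x * χ x := fun F => by
    have h : ∀ x, F x * χ x = (Ioo t 1).indicator F x := fun x => by
      by_cases hx : x ∈ Ioo t 1 <;> simp [hχ, hx]
    simp only [h]
    rw [setIntegral_indicator measurableSet_Ioo,
      inter_eq_self_of_subset_right (Ioo_subset_Ioo_left ht)]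
  have i1 : IntegrableOn (fun x => k x * χ x) (Ioo 0 1) :=
    ((hk.integrableOn_Icc (a := 0) (b := 1)).mono_set Ioo_subset_Icc_self).mul_bdd
      hχm.aestronglyMeasurable (.of_forall hχ1)
  have i2 : IntegrableOn (fun x => fhat x * χ x) (Ioo 0 1) :=
    (hfhat.limit_memLp.integrable hp1).mul_bdd hχm.aestronglyMeasurable (.of_forall hχ1)
  have l := (hfhat.tendsto χ ((memLp_const 1).indicator measurableSet_Ioo)).sub
    (P.tendsto_integral_verticalMean i1)
  rw [← integral_sub i2 (P.integrableOn_piecewiseConst_mul _ i1)] at l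
  simp_rw [e0, sub_mul, mul_assoc]
  refine l.congr' ?_
  filter_upwards [self_mem_nhdsWithin] with ε (hε : 0 < ε)
  have := P.isFiniteMeasure_thinMeasure hε
  have hi : ∀ {h : ℝ² → ℝ}, MemLp h ofR(p') vol[P.thinDomain ε] →
      IntegrableOn (fun z => h z * χ z.1) (P.thinDomain ε) := fun hh =>
    ((integrable_thinMeasure_iff hε).1 ((memLp_thin ε hh).integrable hp1)).mul_bdd
      (hχm.comp measurable_fst).aestronglyMeasurable (.of_forall fun z => hχ1 _)
  have mk := P.memLp_comp_fst_of_continuous hε hk ofR(p')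
  rw [← (P.integral_mul_comp_fst hε (f := fun z => f ε z - k z.1)
    (hi ((hf ε hε).sub mk))).2, ← (P.integral_mul_comp_fst hε (hi (hf ε hε))).2]
  have h1 := (P.integral_mul_comp_fst hε (f := fun z => k z.1 * χ z.1) (k := fun _ => 1)
    (by simpa using hi mk)).2
  simp only [mul_one] at h1
  rw [← h1, ← integral_sub ((integrable_thinMeasure_iff hε).2 (hi (hf ε hε)))
    ((integrable_thinMeasure_iff hε).2 (hi mk))]
  simp only [sub_mul]

/-- Weak convergence of vertical means is uniform on the unit ball of `W^{1,p}(0,1)`. -/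
theorem eventually_abs_integral_verticalMean_sub_le (hp : p.HolderConjugate p') {g : ℝ → ℝ² → ℝ}
    {K : ℝ} (hg : ∀ ε, 0 < ε → MemLp (g ε) ofR(p') vol[P.thinDomain ε] ∧
      ∫ z, ‖g ε z‖ ^ p' ∂𝔪[P, ε] ≤ K) {ghat : ℝ → ℝ} (hgh : IntegrableOn ghat (Ioo 0 1))
    (lim : ∀ t, 0 ≤ t → Tendsto (fun ε => ∫ x in Ioo t 1, P.verticalMean ε (g ε) x) (𝓝[>] 0)
      (𝓝 (∫ x in Ioo t 1, ghat x))) {η : ℝ} (hη : 0 < η) :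
    ∀ᶠ ε in 𝓝[>] 0, ∀ ψ dψ, IsW1pLine (Ioo 0 1) p ψ dψ →
      |∫ x in 𝕀, (P.verticalMean ε (g ε) x - ghat x) * ψ x| ≤
        η * ((∫ x in 𝕀, ‖ψ x‖ ^ p) ^ (1 / p) + (∫ x in 𝕀, ‖dψ x‖ ^ p) ^ (1 / p)) := by
  have v := fun ε (hε : 0 < ε) => P.integral_norm_verticalMean_le hε (f := g ε) (by
    have := P.isFiniteMeasure_thinMeasure hε
    exact (integrable_thinMeasure_iff hε).1 ((memLp_thin ε (hg ε hε).1).integrable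
      (by simpa using hp.symm.lt.le)))
  refine eventually_abs_integral_mul_le hp
    (C := (|N * G₁| ^ (p' - 1) * K) ^ (1 / p') + ∫ x in 𝕀, ‖ghat x‖)
    (fun ε hε => (v ε hε).1.sub hgh) (fun ε hε => ?_) (fun t ht => ?_) hη
  · have h1 := setIntegral_mono ((v ε hε).1.sub hgh).norm ((v ε hε).1.norm.fun_add hgh.norm)
      fun x => norm_sub_le _ _
    rw [integral_add (v ε hε).1.norm hgh.norm] at h1
    exact h1.trans (add_le_add ((v ε hε).2.trans
      (P.integral_norm_le hp.symm.lt hε (hg ε hε).1 (hg ε hε).2)) le_rfl)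
  · have l := (lim t ht.1).sub_const (∫ x in Ioo t 1, ghat x)
    rw [sub_self] at l
    have hsub : Ioo t 1 ⊆ Ioo 0 1 := Ioo_subset_Ioo_left ht.1
    refine l.congr' ?_
    filter_upwards [self_mem_nhdsWithin] with ε (hε : 0 < ε)
    exact (integral_sub ((v ε hε).1.mono_set hsub) (hgh.mono_set hsub)).symm

end Profile

/-! ### Smooth approximation of the limit -/

section Approx

variable {p p' : ℝ}

/-- The map `X ↦ |X|^{p-2} X` from `L^p` to `L^{p'}` is continuous, uniformly on bounded sets and with
respect to the measure. -/
theorem exists_pos_integral_pFlux_sub_le (α V : Type*) [MeasurableSpace α]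
    [NormedAddCommGroup V] [InnerProductSpace ℝ V] [FiniteDimensional ℝ V]
    (hp : p.HolderConjugate p') (T : ℝ) {θ : ℝ} (hθ : 0 < θ) :
    ∃ η, 0 < η ∧ ∀ (μ : Measure α) (X Y : α → V), MemLp X ofR(p) μ →
      MemLp Y ofR(p) μ → ∫ x, ‖X x‖ ^ p ∂μ ≤ T → ∫ x, ‖Y x - X x‖ ^ p ∂μ ≤ η →
      ∫ x, ‖pFlux p (Y x) - pFlux p (X x)‖ ^ p' ∂μ ≤ θ := by
  have c1 : (0 : ℝ) < 2 ^ p := by positivity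
  set δ := θ / (2 * (2 ^ p * (|T| + 1) + |T| + 1)) with hδ
  have hδ0 : 0 < δ := by positivity
  obtain ⟨C, hC0, hC⟩ := norm_pFlux_sub_rpow_le (V := V) hp hδ0
  refine ⟨min 1 (θ / (2 * (C + 1))), lt_min one_pos (by positivity),
    fun μ X Y hX hY hT hle => ?_⟩
  have hT' := hT.trans (le_abs_self T)
  have i1 := integrable_norm_rpow hp.pos hX
  have i2 := integrable_norm_rpow hp.pos hY
  have i3 := integrable_norm_rpow hp.pos (hY.sub hX)
  simp only [Pi.sub_apply] at i3
  have h1 : ∫ x, ‖pFlux p (Y x) - pFlux p (X x)‖ ^ p' ∂μ ≤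
      δ * ((∫ x, ‖Y x‖ ^ p ∂μ) + ∫ x, ‖X x‖ ^ p ∂μ) + C * ∫ x, ‖Y x - X x‖ ^ p ∂μ := by
    rw [← integral_add i2 i1, ← integral_const_mul, ← integral_const_mul,
      ← integral_add ((i2.fun_add i1).const_mul _) (i3.const_mul _)]
    exact integral_mono (integrable_norm_rpow hp.symm.pos ((memLp_pFlux hp hY).sub
      (memLp_pFlux hp hX))) (((i2.fun_add i1).const_mul _).fun_add (i3.const_mul _))
      fun z => hC _ _
  have h2 : ∫ x, ‖Y x‖ ^ p ∂μ ≤ 2 ^ p * (|T| + 1) := by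
    have h3 := integral_norm_add_rpow_le hp.lt hX (hY.sub hX)
    simp only [Pi.sub_apply, add_sub_cancel] at h3
    exact h3.trans (mul_le_mul_of_nonneg_left
      (add_le_add hT' (hle.trans (min_le_left _ _))) c1.le)
  have h4 : C * ∫ x, ‖Y x - X x‖ ^ p ∂μ ≤ θ / 2 := by
    have h5 : ∫ x, ‖Y x - X x‖ ^ p ∂μ ≤ θ / (2 * (C + 1)) := hle.trans (min_le_right _ _)
    have h6 : (C + 1) * (θ / (2 * (C + 1))) = θ / 2 := by field_simp
    have h7 := integral_rpow_nonneg (μ := μ) (p := p) fun x => Y x - X x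
    nlinarith
  have h8 : δ * ((∫ x, ‖Y x‖ ^ p ∂μ) + ∫ x, ‖X x‖ ^ p ∂μ) ≤ θ / 2 := by
    have h9 : δ * (2 ^ p * (|T| + 1) + |T| + 1) = θ / 2 := by
      rw [hδ]
      field_simp
    rw [← h9]
    exact mul_le_mul_of_nonneg_left (by linarith) hδ0.le
  linarith

variable {N : ℕ} {L G₀ G₁ : ℝ} (P : Profile N L G₀ G₁)

/-- Smooth data for the correctors: on each piece a test function `b i`, the primitive `U` of their
sum, and test functions `γ i` that stand for the fluxes `|b i|^{p-2} b i`, which need not be smooth.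
The data are `θ`-close to a function `u₀` with weak derivative `du₀`. -/
structure IsSmoothApprox (p p' θ : ℝ) (u₀ du₀ : ℝ → ℝ) (b γ : Fin N → ℝ → ℝ) (U : ℝ → ℝ) :
    Prop where
  test : ∀ i, IsTest (P.piece i) (b i)
  flux_test : ∀ i, IsTest (P.piece i) (γ i)
  smooth : Smooth U
  hasDerivAt : ∀ x, HasDerivAt U (∑ i, b i x) x
  abs_sub_le : ∀ᵐ x ∂vol[Ioo 0 1], |U x - u₀ x| ≤ θ
  deriv_close : ∀ i, ∫ x in P.piece i, ‖b i x - du₀ x‖ ^ p ≤ θ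
  flux_close : ∀ i, ∫ x in P.piece i, ‖γ i x - pFlux p (du₀ x)‖ ^ p' ≤ θ
  flux_close' : ∀ i, ∫ x in P.piece i, ‖pFlux p (b i x) - γ i x‖ ^ p' ≤ θ
  zero_close : ∫ x in 𝕀, ‖pFlux p (U x) - pFlux p (u₀ x)‖ ^ p' ≤ θ

theorem IsSmoothApprox.mono {P : Profile N L G₀ G₁} {θ θ' : ℝ} {u₀ du₀ : ℝ → ℝ} {b γ : Fin N → ℝ → ℝ} {U : ℝ → ℝ}
    (h : IsSmoothApprox P p p' θ u₀ du₀ b γ U) (hθ : θ ≤ θ') :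
    IsSmoothApprox P p p' θ' u₀ du₀ b γ U :=
  ⟨h.test, h.flux_test, h.smooth, h.hasDerivAt, h.abs_sub_le.mono fun _ hx => hx.trans hθ,
    fun i => (h.deriv_close i).trans hθ, fun i => (h.flux_close i).trans hθ,
    fun i => (h.flux_close' i).trans hθ, h.zero_close.trans hθ⟩

theorem Profile.sum_eq_of_mem {b : Fin N → ℝ → ℝ} (hb : ∀ i, IsTest (P.piece i) (b i)) {i : Fin N}
    {x : ℝ} (hx : x ∈ P.piece i) : ∑ j, b j x = b i x :=
  Finset.sum_eq_single i (fun j _ hj => (hb j).eq_zero fun h =>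
    disjoint_left.1 (P.pairwise_disjoint_piece hj) h hx) (by simp)

/-- The functions `U` may be chosen bounded uniformly with respect to `θ`. -/
theorem Profile.exists_isSmoothApprox (hp : p.HolderConjugate p') {u₀ du₀ : ℝ → ℝ}
    (h : IsW1pLine (Ioo 0 1) p u₀ du₀) :
    ∃ M, ∀ θ, 0 < θ → ∃ b γ U, IsSmoothApprox P p p' θ u₀ du₀ b γ U ∧
      ∀ x ∈ 𝕀, |U x| ≤ M := by
  have hp1 : (1 : ENNReal) ≤ ofR(p) := by simpa using hp.lt.le
  have iu : IntegrableOn u₀ (Ioo 0 1) := h.memLp.integrable hp1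
  have idu : IntegrableOn du₀ (Ioo 0 1) := h.deriv_memLp.integrable hp1
  obtain ⟨C₀, hC₀⟩ := exists_eq_add_integral one_pos iu idu h.weakDeriv
  refine ⟨|C₀| + (∫ t in 𝕀, ‖du₀ t‖) + 1, fun θ hθ => ?_⟩
  have hdi : ∀ i, MemLp du₀ ofR(p) vol[P.piece i] := fun i =>
    h.deriv_memLp.mono_measure (Measure.restrict_mono (P.piece_subset i) le_rfl)
  have hp'2 : (0 : ℝ) < 2 ^ p' := by positivity
  have hθ2 : 0 < θ / (2 ^ p' * 2) := by positivity
  choose ηi hηi0 hηi using fun i : Fin N => exists_pos_integral_pFlux_sub_le ℝ ℝ hp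
    (∫ x in P.piece i, ‖du₀ x‖ ^ p) hθ2
  obtain ⟨η₀, hη₀, hη₀'⟩ := exists_pos_integral_pFlux_sub_le ℝ ℝ hp
    (∫ x in 𝕀, ‖u₀ x‖ ^ p) hθ
  have hN : (0 : ℝ) ≤ N := Nat.cast_nonneg N
  have l1 : Tendsto (fun s : ℝ => N * s ^ (1 / p)) (𝓝[>] 0) (𝓝 0) := by
    have hp' : 0 < 1 / p := one_div_pos.2 hp.pos
    have h1 := ((Real.continuousAt_rpow_const 0 (1 / p) (Or.inr hp'.le)).tendsto.mono_left
      (nhdsWithin_le_nhds (s := Ioi 0))).const_mul (N : ℝ)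
    rwa [Real.zero_rpow hp'.ne', mul_zero] at h1
  have l2 : Tendsto (fun s : ℝ => (N * s ^ (1 / p)) ^ p) (𝓝[>] 0) (𝓝 0) := by
    have h1 := l1.rpow_const (p := p) (Or.inr hp.nonneg)
    rwa [Real.zero_rpow hp.ne_zero] at h1
  -- the accuracy `s` with which `b i` has to approximate the derivative
  have ev : ∀ᶠ s : ℝ in 𝓝[>] 0, 0 < s ∧ s ≤ θ ∧ (∀ i, s ≤ ηi i) ∧ N * s ^ (1 / p) < min θ 1 ∧
      (N * s ^ (1 / p)) ^ p < η₀ := by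
    filter_upwards [Ioc_mem_nhdsGT hθ, eventually_all.2 fun i => Ioc_mem_nhdsGT (hηi0 i),
      (tendsto_order.1 l1).2 _ (lt_min hθ one_pos), (tendsto_order.1 l2).2 _ hη₀]
      with s h1 h2 h3 h4
    exact ⟨h1.1, h1.2, fun i => (h2 i).2, h3, h4⟩
  obtain ⟨s, hs0, hsθ, hsη, hsN, hsN'⟩ := ev.exists
  choose b hb hbs using fun i => exists_isTest_integral_sub_le hp.lt (hdi i) hs0
  have hs' : 0 < min θ (θ / (2 ^ p' * 2)) := lt_min hθ hθ2
  choose γ hγ hγs using fun i => exists_isTest_integral_sub_le hp.symm.lt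
    (memLp_pFlux hp (hdi i)) hs'
  set B : ℝ → ℝ := fun x => ∑ i, b i x with hB
  have hBs : Smooth B := ContDiff.sum fun i _ => (hb i).smooth
  have hbi : ∀ i, Integrable (b i) := fun i =>
    (hb i).integrable
  have hBi : Integrable B := integrable_finsetSum _ fun i _ => hbi i
  set U : ℝ → ℝ := fun x => C₀ + ∫ t in Iic x, B t with hU
  have hUd : ∀ x, HasDerivAt U (B x) x := fun x =>
    (hasDerivAt_integral_Iic hBs.continuous hBi x).const_add C₀
  have hUs : Smooth U := contDiff_const.add (contDiff_primitive hBs hBi)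
  have hUe : ∀ x ∈ 𝕀, U x = C₀ + ∫ t in Ioo 0 x, B t := by
    intro x hx
    simp only [hU]
    congr 1
    rw [integral_Iic_eq_integral_Iio]
    refine (setIntegral_eq_of_subset_of_forall_sdiff_eq_zero measurableSet_Iio
      (fun t ht => ht.2) fun t ht => ?_)
    refine Finset.sum_eq_zero fun i _ => (hb i).eq_zero fun hi => ?_
    exact ht.2 ⟨(P.piece_subset i hi).1, ht.1⟩
  -- the derivatives are close in the mean
  have hclose : ∫ x in 𝕀, ‖B x - du₀ x‖ ≤ N * s ^ (1 / p) := by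
    have hd : IntegrableOn (fun x => ‖B x - du₀ x‖) (Ioo 0 1) := (hBi.integrableOn.sub idu).norm
    rw [P.sum_setIntegral_piece hd]
    have h1 : ∀ i ∈ Finset.univ, ∫ x in P.piece i, ‖B x - du₀ x‖ ≤ s ^ (1 / p) := by
      intro i _
      have h2 : ∫ x in P.piece i, ‖B x - du₀ x‖ = ∫ x in P.piece i, ‖b i x - du₀ x‖ :=
        setIntegral_congr_fun (P.measurableSet_piece i) fun x hx => by
          simp only [hB]
          rw [P.sum_eq_of_mem hb hx]
      rw [h2]
      have hfin : IsFiniteMeasure vol[P.piece i] :=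
        ⟨by simp [Profile.piece]⟩
      have h4 : vol[P.piece i].real univ ≤ 1 := by
        have := measureReal_mono (μ := volume) (P.piece_subset i) (by simp)
        simpa using this
      exact integral_norm_le_rpow hp.lt (((hb i).memLp ofR(p) (P.piece i)).sub (hdi i))
        ((mul_le_of_le_one_left (integral_rpow_nonneg _) (Real.rpow_le_one measureReal_nonneg h4
          (by linarith [hp.lt]))).trans (hbs i))
    refine (Finset.sum_le_sum h1).trans_eq ?_
    simp
  have hprim : ∀ x ∈ 𝕀, |U x - (C₀ + ∫ t in Ioo 0 x, du₀ t)| ≤ N * s ^ (1 / p) := by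
    intro x hx
    have hsub : Ioo 0 x ⊆ 𝕀 := Ioo_subset_Ioo_right hx.2.le
    rw [hUe x hx, add_sub_add_left_eq_sub, ← integral_sub hBi.integrableOn (idu.mono_set hsub)]
    exact (abs_setIntegral_le hsub (hBi.integrableOn.sub idu)).trans hclose
  have hUu : ∀ᵐ x ∂vol[Ioo 0 1], |U x - u₀ x| ≤ N * s ^ (1 / p) := by
    filter_upwards [ae_restrict_of_ae hC₀, ae_restrict_mem measurableSet_Ioo] with x h1 h2
    rw [h1 h2]
    exact hprim x h2
  have hUb : ∀ x ∈ 𝕀, |U x| ≤ |C₀| + (∫ t in 𝕀, ‖du₀ t‖) + 1 := by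
    intro x hx
    have h1 := hprim x hx
    have h2 := abs_setIntegral_le (Ioo_subset_Ioo_right hx.2.le) idu
    have h3 : U x = (U x - (C₀ + ∫ t in Ioo 0 x, du₀ t)) + (C₀ + ∫ t in Ioo 0 x, du₀ t) := by ring
    rw [h3]
    refine (abs_add_le _ _).trans ?_
    have h4 := abs_add_le C₀ (∫ t in Ioo 0 x, du₀ t)
    have h5 := hsN.le.trans (min_le_right _ _)
    linarith
  have hUL : MemLp U ofR(p) vol[Ioo 0 1] :=
    MemLp.of_bound hUs.continuous.aestronglyMeasurable _
      ((ae_restrict_mem measurableSet_Ioo).mono hUb)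
  refine ⟨b, γ, U, ⟨hb, hγ, hUs, hUd, ?_, fun i => (hbs i).trans hsθ,
    fun i => (hγs i).trans (min_le_left _ _), fun i => ?_, ?_⟩, hUb⟩
  · exact hUu.mono fun x hx => hx.trans (hsN.le.trans (min_le_left _ _))
  · have mb : MemLp (b i) ofR(p) vol[P.piece i] :=
      (hb i).memLp _ _
    have mγ : MemLp (γ i) ofR(p') vol[P.piece i] := (hγ i).memLp _ _
    have h1 := integral_norm_sub_rpow_le hp.symm.lt
      ((memLp_pFlux hp mb).sub (memLp_pFlux hp (hdi i))) (mγ.sub (memLp_pFlux hp (hdi i)))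
    simp only [Pi.sub_apply, sub_sub_sub_cancel_right] at h1
    refine h1.trans ?_
    have h2 := hηi i _ _ (b i) (hdi i) mb le_rfl ((hbs i).trans (hsη i))
    have h3 := (hγs i).trans (min_le_right _ _)
    calc 2 ^ p' * ((∫ x in P.piece i, ‖pFlux p (b i x) - pFlux p (du₀ x)‖ ^ p') +
          ∫ x in P.piece i, ‖γ i x - pFlux p (du₀ x)‖ ^ p')
        ≤ 2 ^ p' * (θ / (2 ^ p' * 2) + θ / (2 ^ p' * 2)) :=
          mul_le_mul_of_nonneg_left (add_le_add h2 h3) hp'2.le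
      _ = θ := by
          field_simp
          ring
  · refine hη₀' _ _ U h.memLp hUL le_rfl (le_trans ?_ hsN'.le)
    have h1 : ∀ᵐ x ∂vol[𝕀], ‖U x - u₀ x‖ ^ p ≤
        (N * s ^ (1 / p)) ^ p := hUu.mono fun x hx =>
      Real.rpow_le_rpow (norm_nonneg _) hx hp.nonneg
    have h2 := integral_mono_ae (integrable_norm_rpow hp.pos (hUL.sub h.memLp))
      (integrable_const _) h1
    simpa using h2

end Approx

/-! ### Correctors on the thin domain -/

namespace Profile

variable {N : ℕ} {L G₀ G₁ : ℝ} (P : Profile N L G₀ G₁) {p p' ε : ℝ}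
  {v : Fin N → ℝ² → ℝ} {Dv : Fin N → ℝ² → Plane} {b γ : Fin N → ℝ → ℝ} {U : ℝ → ℝ}

/-- The corrector `U(x) + ε ∑ b i (x) χ i (z / ε)`, where `χ i = v i - y₁`. -/
def corrector (L : ℝ) (v : Fin N → ℝ² → ℝ) (b : Fin N → ℝ → ℝ) (U : ℝ → ℝ) (ε : ℝ)
    (z : ℝ²) : ℝ :=
  U z.1 + ∑ i, b i z.1 * (ε * perExt L (fun y => v i y - y.1) (ε⁻¹ • z))

/-- The gradient of `corrector`. -/
def gradCorrector (L : ℝ) (v : Fin N → ℝ² → ℝ) (Dv : Fin N → ℝ² → Plane)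
    (b : Fin N → ℝ → ℝ) (ε : ℝ) (z : ℝ²) : Plane :=
  ∑ i, correctorGrad L (v i) (Dv i) (b i) ε z

theorem corrector_of_mem (hb : ∀ i, IsTest (P.piece i) (b i)) {i : Fin N} {z : ℝ²}
    (hz : z.1 ∈ P.piece i) : corrector L v b U ε z =
      U z.1 + ε * (b i z.1 * perExt L (fun y => v i y - y.1) (ε⁻¹ • z)) := by
  unfold corrector
  rw [Finset.sum_eq_single i (fun j _ hj => by
    rw [(hb j).eq_zero fun h => disjoint_left.1 (P.pairwise_disjoint_piece hj) h hz, zero_mul])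
    (by simp)]
  ring

theorem gradCorrector_of_mem (hb : ∀ i, IsTest (P.piece i) (b i)) {i : Fin N} {z : ℝ²}
    (hz : z.1 ∈ P.piece i) :
    gradCorrector L v Dv b ε z = correctorGrad L (v i) (Dv i) (b i) ε z := by
  unfold gradCorrector
  refine Finset.sum_eq_single i (fun j _ hj => ?_) (by simp)
  have h : z.1 ∉ P.piece j := fun h => disjoint_left.1 (P.pairwise_disjoint_piece hj) h hz
  rw [correctorGrad, (hb j).eq_zero h, (hb j).deriv.eq_zero h]
  simp

/-- The corrector is a Sobolev function on the thin domain. -/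
theorem isW1p_corrector (hp : 1 < p) (hv : ∀ i, IsCellSolution L (P.g i) p (v i) (Dv i))
    (hb : ∀ i, IsTest (P.piece i) (b i)) (hU : Smooth U)
    (hUd : ∀ x, HasDerivAt U (∑ i, b i x) x) (hε : 0 < ε) :
    IsW1p (P.thinDomain ε) p (corrector L v b U ε) (gradCorrector L v Dv b ε) := by
  have hd : deriv U = fun x => ∑ i, b i x := funext fun x => (hUd x).deriv
  have h1 : IsW1p (P.thinDomain ε) p (fun z => U z.1)
      (fun z => EuclideanSpace.single 0 (deriv U z.1)) := by
    have hs : Smooth fun z : ℝ² => U z.1 := hU.comp contDiff_fst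
    have hf := fderiv_comp_fst (hU.differentiable (by simp))
    refine ⟨P.memLp_comp_fst_of_continuous hε hU.continuous _, memLp_single_fst
      (P.memLp_comp_fst_of_continuous hε (hU.continuous_deriv (by simp)) _), ?_, ?_⟩
    · simpa [hf] using hasWeakDeriv_of_contDiff (Ω := P.thinDomain ε) (e := (1, 0)) hs
    · simpa [hf] using hasWeakDeriv_of_contDiff (Ω := P.thinDomain ε) (e := (0, 1)) hs
  have h2 : ∀ i ∈ Finset.univ, IsW1p (P.thinDomain ε) p
      (fun z => b i z.1 * (ε * perExt L (fun y => v i y - y.1) (ε⁻¹ • z))) _ := fun i _ =>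
    IsW1p.mul_fst hp.le (P.measurableSet_pieceDomain i ε) (P.nullMeasurableSet_thinDomain ε)
      (P.pieceDomain_subset i ε) (hb i) (fun z hz hz' => (P.mem_thinDomain_iff hz').1 hz)
      ((hv i).isW1p_oscillating hp (P.isProfile i) hε _ _)
  have h3 := h1.add hp.le (IsW1p.finset_sum hp.le _ h2)
  have h4 : (fun z => EuclideanSpace.single 0 (deriv U z.1) + ∑ i, (b i z.1 •
      (perExt L (Dv i) (ε⁻¹ • z) - EuclideanSpace.single 0 1) + EuclideanSpace.single 0
        (deriv (b i) z.1 * (ε * perExt L (fun y => v i y - y.1) (ε⁻¹ • z))))) =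
      gradCorrector L v Dv b ε := by
    funext z
    have e1 : (EuclideanSpace.single (0 : Fin 2) (∑ i, b i z.1) : Plane) =
        ∑ i, b i z.1 • EuclideanSpace.single (0 : Fin 2) (1 : ℝ) := by
      rw [← Finset.sum_smul]
      ext j
      fin_cases j <;> simp
    rw [hd]
    simp only
    rw [e1, ← Finset.sum_add_distrib]
    refine Finset.sum_congr rfl fun i _ => ?_
    rw [correctorGrad, smul_sub, mul_left_comm]
    abel
  rw [← h4]
  exact h3

/-- The corrector is close to `U`. -/
theorem tendsto_integral_corrector_sub (hp : 1 < p)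
    (hv : ∀ i, IsCellSolution L (P.g i) p (v i) (Dv i))
    (hb : ∀ i, IsTest (P.piece i) (b i)) (i : Fin N) :
    Tendsto (fun ε => ∫ z, ‖corrector L v b U ε z - U z.1‖ ^ p
      ∂𝔪[P, i, ε]) (𝓝[>] 0) (𝓝 0) := by
  refine ((hv i).tendsto_integral_corrector hp (P.isProfile i) (hb i)).congr fun ε => ?_
  refine integral_congr_ae (ae_thinMeasure_of_ae ((ae_restrict_mem
    (P.measurableSet_pieceDomain i ε)).mono fun z hz => ?_))
  simp only
  rw [P.corrector_of_mem hb hz.1, add_sub_cancel_left]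

theorem integral_gradCorrector {i : Fin N} (hb : ∀ i, IsTest (P.piece i) (b i))
    (Φ : ℝ² → Plane → ℝ) :
    ∫ z, Φ z (gradCorrector L v Dv b ε z) ∂𝔪[P, i, ε] =
      ∫ z, Φ z (correctorGrad L (v i) (Dv i) (b i) ε z) ∂𝔪[P, i, ε] := by
  refine integral_congr_ae (ae_thinMeasure_of_ae ((ae_restrict_mem
    (P.measurableSet_pieceDomain i ε)).mono fun z hz => ?_))
  simp only
  rw [P.gradCorrector_of_mem hb hz.1]

theorem integral_piece_le (hε : 0 < ε) {F : ℝ² → ℝ} (hF : IntegrableOn F (P.thinDomain ε))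
    (h0 : ∀ z, 0 ≤ F z) (i : Fin N) : ∫ z, F z ∂𝔪[P, i, ε] ≤
      ∫ z, F z ∂𝔪[P, ε] := by
  rw [P.integral_thinDomain hε hF]
  exact Finset.single_le_sum (f := fun i => ∫ z, F z ∂𝔪[P, i, ε])
    (fun j _ => integral_nonneg h0) (Finset.mem_univ i)

/-- On the whole thin domain Sobolev functions are close to their vertical averages. -/
theorem thin_poincare (hp : 1 < p) (hε : 0 < ε) {ρ : ℝ → ℝ} (hρ : IsDensity G₀ ρ)
    {w : ℝ² → ℝ} {Dw : ℝ² → Plane} (hw : IsW1p (P.thinDomain ε) p w Dw) :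
    MemLp (fun z => w z - verticalAverage (rescale ε ρ) w z.1) ofR(p)
        𝔪[P, ε] ∧
      ∫ z, ‖w z - verticalAverage (rescale ε ρ) w z.1‖ ^ p ∂𝔪[P, ε] ≤
        (ε * G₁) ^ p * ∫ z, ‖Dw z‖ ^ p ∂𝔪[P, ε] := by
  have hp0 : 0 < p := by linarith
  have h1 := fun i => (P.isProfile i).thin_poincare hp hε (P.isOpen_piece i)
    (by simp [Profile.piece]) hρ (hw.mono (P.pieceDomain_subset i ε))
  have hm : MemLp (fun z => w z - verticalAverage (rescale ε ρ) w z.1) ofR(p)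
      𝔪[P, ε] := by
    have hm1 : AEStronglyMeasurable (fun z => w z - verticalAverage (rescale ε ρ) w z.1)
        𝔪[P, ε] := by
      rw [P.thinMeasure_thinDomain, ← Measure.sum_fintype, aestronglyMeasurable_sum_measure_iff]
      exact fun i => (h1 i).1.1
    refine memLp_of_integrable_norm_rpow hp0 hm1 ?_
    rw [P.thinMeasure_thinDomain]
    exact integrable_finsetSum_measure.2 fun i _ => integrable_norm_rpow hp0 (h1 i).1
  refine ⟨hm, ?_⟩
  rw [P.integral_thinDomain hε ((integrable_thinMeasure_iff hε).1 (integrable_norm_rpow hp0 hm)),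
    P.integral_thinDomain hε (integrable_norm_rpow hp0 hw.grad_memLp), Finset.mul_sum]
  exact Finset.sum_le_sum fun i _ => (h1 i).2

end Profile

/-! ### The residual of the correctors -/

namespace Profile

variable {N : ℕ} {L G₀ G₁ : ℝ} (P : Profile N L G₀ G₁) {p p' ε : ℝ}
  {v : Fin N → ℝ² → ℝ} {Dv : Fin N → ℝ² → Plane} {b γ : Fin N → ℝ → ℝ} {U : ℝ → ℝ}

/-- The norm of `W^{1,p}` of the thin domain with respect to the rescaled measure. -/
def sobolevNorm (p ε : ℝ) (e : ℝ² → ℝ) (De : ℝ² → Plane) : ℝ :=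
  (∫ z, ‖De z‖ ^ p ∂𝔪[P, ε]) ^ (1 / p) +
    (∫ z, ‖e z‖ ^ p ∂𝔪[P, ε]) ^ (1 / p)

theorem rpow_grad_le_sobolevNorm (e : ℝ² → ℝ) (De : ℝ² → Plane) :
    (∫ z, ‖De z‖ ^ p ∂𝔪[P, ε]) ^ (1 / p) ≤ P.sobolevNorm p ε e De :=
  le_add_of_nonneg_right (by positivity)

theorem rpow_le_sobolevNorm (e : ℝ² → ℝ) (De : ℝ² → Plane) :
    (∫ z, ‖e z‖ ^ p ∂𝔪[P, ε]) ^ (1 / p) ≤ P.sobolevNorm p ε e De :=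
  le_add_of_nonneg_left (by positivity)

theorem sobolevNorm_nonneg (e : ℝ² → ℝ) (De : ℝ² → Plane) : 0 ≤ P.sobolevNorm p ε e De :=
  add_nonneg (by positivity) (by positivity)

/-- The corrector is close to `U` on the whole thin domain. -/
theorem tendsto_integral_thin_corrector_sub (hp : 1 < p)
    (hv : ∀ i, IsCellSolution L (P.g i) p (v i) (Dv i))
    (hb : ∀ i, IsTest (P.piece i) (b i)) (hU : Smooth U)
    (hUd : ∀ x, HasDerivAt U (∑ i, b i x) x) :
    Tendsto (fun ε => ∫ z, ‖corrector L v b U ε z - U z.1‖ ^ p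
      ∂𝔪[P, ε]) (𝓝[>] 0) (𝓝 0) := by
  have h1 := tendsto_finsetSum Finset.univ fun i _ =>
    P.tendsto_integral_corrector_sub (U := U) hp hv hb i
  rw [Finset.sum_const_zero] at h1
  refine h1.congr' ?_
  filter_upwards [self_mem_nhdsWithin] with ε (hε : 0 < ε)
  exact (P.integral_thinDomain hε (integrable_norm_rpow (by linarith)
    ((P.isW1p_corrector hp hv hb hU hUd hε).memLp.sub
      (P.memLp_comp_fst_of_continuous hε hU.continuous _)))).symm

/-- The flux of the correctors against Sobolev functions on the thin domain. -/
theorem eventually_abs_integral_flux_sub_le (hp : p.HolderConjugate p')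
    (hv : ∀ i, IsCellSolution L (P.g i) p (v i) (Dv i))
    (hb : ∀ i, IsTest (P.piece i) (b i)) (hγ : ∀ i, IsTest (P.piece i) (γ i)) {θ : ℝ} (hθ : 0 < θ)
    (hbγ : ∀ i, ∫ x in P.piece i, ‖pFlux p (b i x) - γ i x‖ ^ p' ≤ θ)
    {ρ : ℝ → ℝ} (hρ : IsDensity G₀ ρ) {κ : ℝ} (hκ : 0 < κ) :
    ∀ᶠ ε in 𝓝[>] 0, ∀ i, ∀ e De, IsW1p (P.thinDomain ε) p e De →
      |(∫ z, inner ℝ (pFlux p (gradCorrector L v Dv b ε z)) (De z)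
            ∂𝔪[P, i, ε]) -
          qCoeff L (P.g i) p (Dv i) *
            ∫ x in P.piece i, γ i x * verticalAverage (rescale ε ρ) (fun z => De z 0) x| ≤
        (((2 ^ p' * (L⁻¹ * ∫ y in cell L (P.g i), ‖pFlux p (Dv i y)‖ ^ p') + 1) * θ) ^ (1 / p') +
          κ) * P.sobolevNorm p ε e De := by
  refine eventually_all.2 fun i => ?_
  have hg := P.isProfile i
  have hp'0 := hp.symm.pos
  have ev1 := (hv i).eventually_integral_flux_sub_le hp hg (hb i) (hγ i) hθ
  have l1 := hg.tendsto_integral_norm_piece hp'0 (hγ i).deriv.continuous (hγ i).deriv.compact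
    (fun x hx => (hγ i).deriv.eq_zero hx)
    (memLp_plane_apply (memLp_pFlux hp ((hv i).memLp hg)) 0)
  have l2 : Tendsto (fun ε : ℝ => ε * G₁) (𝓝[>] 0) (𝓝 (0 * G₁)) :=
    (tendsto_id.mono_left nhdsWithin_le_nhds).mul_const G₁
  have l3 := l2.mul (l1.rpow_const (p := 1 / p') (Or.inr (by positivity)))
  rw [zero_mul, zero_mul] at l3
  filter_upwards [ev1, (tendsto_order.1 l3).2 κ hκ, self_mem_nhdsWithin] with ε hε1 hε2 hε e De he
  set μ := thinMeasure ε (P.pieceDomain i ε) with hμ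
  have heR := he.mono (P.pieceDomain_subset i ε)
  have hDe : MemLp De ofR(p) μ := memLp_thin ε heR.grad_memLp
  have hE : (∫ z, ‖De z‖ ^ p ∂μ) ^ (1 / p) ≤ P.sobolevNorm p ε e De :=
    (rpow_integral_le hp.pos (P.integral_piece_le hε (integrable_norm_rpow hp.pos
      he.grad_memLp) (fun z => by positivity) i)).trans (P.rpow_grad_le_sobolevNorm e De)
  have hS := P.sobolevNorm_nonneg (p := p) (ε := ε) e De
  set W := correctorGrad L (v i) (Dv i) (b i) ε with hW
  set A : ℝ² → Plane := fun z => perExt L (fun y => pFlux p (Dv i y)) (ε⁻¹ • z) with hA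
  have mW : MemLp (fun z => pFlux p (W z)) ofR(p') μ :=
    memLp_pFlux hp ((hv i).memLp_correctorGrad hp.lt hg (hb i) hε)
  have mA : MemLp (fun z => γ i z.1 • A z) ofR(p') μ := memLp_thin ε
    (memLp_test_smul (hγ i) (hg.memLp_oscillating hp.symm.lt.le hε
      (memLp_pFlux hp ((hv i).memLp hg))))
  have e1 := P.integral_gradCorrector (v := v) (Dv := Dv) (ε := ε) (i := i) hb
    fun z X => inner ℝ (pFlux p X) (De z)
  rw [e1]
  have e2 : ∫ z, inner ℝ (pFlux p (W z)) (De z) ∂μ =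
      (∫ z, inner ℝ (pFlux p (W z) - γ i z.1 • A z) (De z) ∂μ) +
        ∫ z, γ i z.1 * inner ℝ (A z) (De z) ∂μ := by
    have i1 := integrable_inner_of_memLp hp hDe (mW.sub mA)
    have i2 := integrable_inner_of_memLp hp hDe mA
    simp only [real_inner_smul_left, Pi.sub_apply] at i1 i2
    rw [← integral_add i1 i2]
    refine integral_congr_ae (.of_forall fun z => ?_)
    simp only [inner_sub_left, real_inner_smul_left]
    ring
  rw [e2, add_sub_assoc]
  refine (abs_add_le _ _).trans ?_
  rw [add_mul]
  refine add_le_add ?_ ?_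
  · refine (abs_integral_inner_le hp hDe (mW.sub mA)).trans ?_
    set Q := ∫ y in cell L (P.g i), ‖pFlux p (Dv i y)‖ ^ p'
    have hQ : 0 ≤ Q := integral_rpow_nonneg _
    have hL := P.L_pos
    refine mul_le_mul (rpow_integral_le hp'0 (hε1.trans ?_)) hE (by positivity) (by positivity)
    calc _ ≤ 2 ^ p' * (L⁻¹ * (θ * Q)) + θ := by gcongr; exact hbγ i
      _ = _ := by ring
  · refine ((hv i).abs_integral_flux_sub_le hp hg hε (hγ i) hρ heR).trans ?_
    have h5 : (∫ z, ‖deriv (γ i) z.1 * perExt L (fun y => pFlux p (Dv i y) 0) (ε⁻¹ • z)‖ ^ p' ∂μ) =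
        ∫ z, ‖deriv (γ i) z.1‖ ^ p' * ‖perExt L (fun y => pFlux p (Dv i y) 0) (ε⁻¹ • z)‖ ^ p' ∂μ :=
      integral_congr_ae (.of_forall fun z => by
        simp only
        rw [norm_mul, Real.mul_rpow (norm_nonneg _) (norm_nonneg _)])
    have h6 : thinMeasure ε (subgraph (Ioo (P.ξ i.castSucc) (P.ξ i.succ)) (scaled ε (P.g i))) = μ :=
      rfl
    rw [h6, h5, mul_right_comm]
    have hG := (mul_pos hε hg.G₁_pos).le
    exact mul_le_mul hε2.le hE (by positivity) hκ.le

end Profile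

namespace Profile

variable {N : ℕ} {L G₀ G₁ : ℝ} (P : Profile N L G₀ G₁) {p p' ε : ℝ}
  {v : Fin N → ℝ² → ℝ} {Dv : Fin N → ℝ² → Plane}

theorem eventually_abs_integral_zero_order_le (hp : p.HolderConjugate p')
    (hv : ∀ i, IsCellSolution L (P.g i) p (v i) (Dv i)) {b : Fin N → ℝ → ℝ} {U : ℝ → ℝ}
    (hb : ∀ i, IsTest (P.piece i) (b i)) (hU : Smooth U)
    (hUd : ∀ x, HasDerivAt U (∑ i, b i x) x) {κ : ℝ} (hκ : 0 < κ) :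
    ∀ᶠ ε in 𝓝[>] 0, ∀ e De, IsW1p (P.thinDomain ε) p e De →
      |∫ z, (pFlux p (corrector L v b U ε z) - pFlux p (U z.1)) * e z ∂𝔪[P, ε]| ≤
        κ * P.sobolevNorm p ε e De := by
  obtain ⟨T, hT⟩ := P.exists_integral_comp_fst_le hp.pos hU.continuous
  obtain ⟨η, hη, hηle⟩ := exists_pos_integral_pFlux_sub_le ℝ² ℝ hp T
    (Real.rpow_pos_of_pos hκ p')
  filter_upwards [(tendsto_order.1 (P.tendsto_integral_thin_corrector_sub hp.lt hv hb hU hUd)).2 η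
    hη, self_mem_nhdsWithin] with ε hε1 (hε : 0 < ε) e De he
  have mw := memLp_thin ε (P.isW1p_corrector hp.lt hv hb hU hUd hε).memLp
  have mU := memLp_thin ε (P.memLp_comp_fst_of_continuous hε hU.continuous ofR(p))
  refine (abs_integral_mul_le hp.symm ((memLp_pFlux hp mw).sub (memLp_pFlux hp mU))
    (memLp_thin ε he.memLp)).trans ?_
  refine mul_le_mul ((rpow_integral_le hp.symm.pos
    (hηle _ _ _ mU mw (hT ε hε) hε1.le)).trans_eq ?_) (P.rpow_le_sobolevNorm e De)
    (by positivity) hκ.le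
  rw [← Real.rpow_mul hκ.le, mul_one_div_cancel hp.symm.ne_zero, Real.rpow_one]

/-- The part of the data that is orthogonal to the functions of the first variable is negligible. -/
theorem eventually_abs_integral_oscillation_le (hp : p.HolderConjugate p') {g : ℝ → ℝ² → ℝ} {T : ℝ}
    (hg : ∀ ε, 0 < ε → MemLp (g ε) ofR(p') vol[P.thinDomain ε] ∧ ∫ z, ‖g ε z‖ ^ p' ∂𝔪[P, ε] ≤ T)
    {ρ : ℝ → ℝ} (hρ : IsDensity G₀ ρ) {κ : ℝ} (hκ : 0 < κ) :
    ∀ᶠ ε in 𝓝[>] 0, ∀ e De, IsW1p (P.thinDomain ε) p e De →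
      |∫ z, (e z - verticalAverage (rescale ε ρ) e z.1) * g ε z ∂𝔪[P, ε]| ≤
        κ * P.sobolevNorm p ε e De := by
  have l1 : Tendsto (fun ε : ℝ => |ε * G₁| * T ^ (1 / p')) (𝓝[>] 0)
      (𝓝 (|0 * G₁| * T ^ (1 / p'))) :=
    (((tendsto_id.mono_left nhdsWithin_le_nhds).mul_const G₁).abs).mul_const _
  rw [zero_mul, abs_zero, zero_mul] at l1
  filter_upwards [(tendsto_order.1 l1).2 κ hκ, self_mem_nhdsWithin] with ε hε1 (hε : 0 < ε) e De he
  obtain ⟨h1, h2⟩ := P.thin_poincare hp.lt hε hρ he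
  refine (abs_integral_mul_le hp h1 (memLp_thin ε (hg ε hε).1)).trans ?_
  have h3 := rpow_integral_le_mul hp.pos (abs_nonneg (ε * G₁)) (h2.trans
    (mul_le_mul_of_nonneg_right ((le_abs_self _).trans (Real.abs_rpow_le_abs_rpow _ _))
      (by positivity)))
  have hS := P.sobolevNorm_nonneg (p := p) (ε := ε) e De
  refine (mul_le_mul (h3.trans (mul_le_mul_of_nonneg_left (P.rpow_grad_le_sobolevNorm e De)
    (abs_nonneg _))) (rpow_integral_le hp.symm.pos (hg ε hε).2) (by positivity)
    (by positivity)).trans ?_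
  rw [mul_right_comm]
  exact mul_le_mul_of_nonneg_right hε1.le hS

/-- The data and the solutions of the cell problems, of the Neumann problems on the thin domains and
of the limit problem. -/
structure IsHomogenization (p p' c : ℝ) (v : Fin N → ℝ² → ℝ) (Dv : Fin N → ℝ² → Plane)
    (f : ℝ → ℝ² → ℝ) (fhat u₀ du₀ : ℝ → ℝ) (u : ℝ → ℝ² → ℝ) (Du : ℝ → ℝ² → Plane) : Prop where
  isCell : ∀ i, IsCellSolution L (P.g i) p (v i) (Dv i)
  data : ∀ ε, 0 < ε → MemLp (f ε) ofR(p') vol[P.thinDomain ε] ∧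
    rescaledNorm ε p' (P.thinDomain ε) (f ε) ≤ c
  data_weak : TendstoWeaklyLp p' p vol[𝕀] (fun ε => P.verticalMean ε (f ε)) fhat
  limit : IsLimitSolution p (P.piecewiseConst fun i => qCoeff L (P.g i) p (Dv i))
    (P.piecewiseConst fun i => rCoeff L (P.g i)) fhat u₀ du₀
  solution : ∀ ε, 0 < ε → IsNeumannSolution (P.thinDomain ε) p (f ε) (u ε) (Du ε)

variable {P} {c : ℝ} {f : ℝ → ℝ² → ℝ} {fhat u₀ du₀ : ℝ → ℝ} {u : ℝ → ℝ² → ℝ} {Du : ℝ → ℝ² → Plane}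

/-- The correctors solve the Neumann problems on the thin domains up to a small residual, if their
data are close to the solution of the limit problem. -/
theorem IsHomogenization.exists_residual_le (hp : p.HolderConjugate p')
    (H : P.IsHomogenization p p' c v Dv f fhat u₀ du₀ u Du) {κ : ℝ} (hκ : 0 < κ) :
    ∃ θ, 0 < θ ∧ ∀ θ' ≤ θ, 0 < θ' → ∀ b γ U, IsSmoothApprox P p p' θ' u₀ du₀ b γ U →
      ∀ᶠ ε in 𝓝[>] 0, ∀ e De, IsW1p (P.thinDomain ε) p e De →
        |(∫ z, f ε z * e z ∂𝔪[P, ε]) -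
            (∫ z, inner ℝ (pFlux p (gradCorrector L v Dv b ε z)) (De z) ∂𝔪[P, ε]) -
            ∫ z, pFlux p (corrector L v b U ε z) * e z ∂𝔪[P, ε]| ≤
          κ * P.sobolevNorm p ε e De := by
  have hp0 := hp.pos
  have hp'0 := hp.symm.pos
  obtain ⟨ρ, hρ⟩ := exists_isDensity P.G₀_pos
  obtain ⟨K, hK0, hK⟩ := P.exists_verticalAverage_bound hp.lt hρ
  set q : Fin N → ℝ := fun i => qCoeff L (P.g i) p (Dv i) with hq
  set r := P.piecewiseConst fun i => rCoeff L (P.g i) with hr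
  set rm := ∑ i, |rCoeff L (P.g i)| with hrm
  have hrm0 : 0 ≤ rm := Finset.sum_nonneg fun i _ => abs_nonneg _
  set A : Fin N → ℝ := fun i =>
    2 ^ p' * (L⁻¹ * ∫ y in cell L (P.g i), ‖pFlux p (Dv i y)‖ ^ p') + 1 with hA'
  -- the total size of the errors that are due to the approximation of the limit
  set Φ : ℝ → ℝ := fun θ => rm * θ ^ (1 / p') * K +
    ∑ i, (|q i| * (θ ^ (1 / p') * K) + (A i * θ) ^ (1 / p')) with hΦ
  have limΦ : Tendsto Φ (𝓝[>] 0) (𝓝 0) := by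
    have h1 : ContinuousAt Φ 0 := by
      have := one_div_nonneg.2 hp'0.le
      fun_prop (disch := simp [*])
    have h2 := h1.tendsto.mono_left (nhdsWithin_le_nhds (s := Ioi 0))
    have h3 : Φ 0 = 0 := by simp [hΦ, Real.zero_rpow (inv_ne_zero hp'0.ne')]
    rwa [h3] at h2
  obtain ⟨θ, hθ, hθ0⟩ :=
    (((tendsto_order.1 limΦ).2 _ (half_pos hκ)).and self_mem_nhdsWithin).exists
  have hθ0 : 0 < θ := hθ0
  refine ⟨θ, hθ0, fun θ' hθ' hθ'0 b γ U hA => ?_⟩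
  -- the errors that vanish with `ε` are at most `κ₁` each, up to a factor that the choice accounts for
  set κ₁ := κ / (2 * (2 * K + 2 + N)) with hκ₁
  have hκ₁0 : 0 < κ₁ := by positivity
  set k : ℝ → ℝ := fun x => pFlux p (U x) with hk
  have hkc : Continuous k := (continuous_pFlux hp.lt).comp hA.smooth.continuous
  obtain ⟨T, hT⟩ := P.exists_integral_comp_fst_le hp'0 hkc
  set g : ℝ → ℝ² → ℝ := fun ε z => f ε z - k z.1 with hg
  have mk := fun {ε : ℝ} (hε : 0 < ε) => P.memLp_comp_fst_of_continuous hε hkc ofR(p')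
  have hgT : ∀ ε, 0 < ε → MemLp (g ε) ofR(p') vol[P.thinDomain ε] ∧
      ∫ z, ‖g ε z‖ ^ p' ∂𝔪[P, ε] ≤ 2 ^ p' * (c ^ p' + T) := fun ε hε =>
    ⟨(H.data ε hε).1.sub (mk hε), (integral_norm_sub_rpow_le hp.symm.lt
      (memLp_thin ε (H.data ε hε).1) (memLp_thin ε (mk hε))).trans (mul_le_mul_of_nonneg_left
      (add_le_add (integral_rpow_le_of_rescaledNorm_le hp'0 hε (H.data ε hε).1 (H.data ε hε).2)
        (hT ε hε)) (by positivity))⟩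
  set J : Set ℝ := Ioo 0 1 with hJ
  have mkJ : MemLp k ofR(p') vol[J] := by
    obtain ⟨C, -, hC⟩ := exists_norm_le_of_continuous hkc
    exact MemLp.of_bound hkc.aestronglyMeasurable C
      ((ae_restrict_mem measurableSet_Ioo).mono hC)
  have mrk : MemLp (fun x => r x * k x) ofR(p') vol[J] := P.memLp_piecewiseConst_mul _ mkJ
  have mgh := H.data_weak.limit_memLp.sub mrk
  filter_upwards [P.eventually_abs_integral_flux_sub_le hp H.isCell hA.test hA.flux_test hθ0
      (fun i => (hA.flux_close' i).trans hθ') hρ hκ₁0,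
    P.eventually_abs_integral_zero_order_le hp H.isCell hA.test hA.smooth hA.hasDerivAt hκ₁0,
    P.eventually_abs_integral_oscillation_le hp hgT hρ hκ₁0,
    P.eventually_abs_integral_verticalMean_sub_le hp hgT
      (mgh.integrable (by simpa using hp.symm.lt.le))
      (fun t ht => P.tendsto_integral_verticalMean_sub hp (fun ε hε => (H.data ε hε).1)
        H.data_weak hkc ht) hκ₁0, self_mem_nhdsWithin]
    with ε t1 t2 t3 t4 (hε : 0 < ε) e De he
  obtain ⟨hline, hKe, hKde⟩ := hK ε hε e De he
  set S := P.sobolevNorm p ε e De with hS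
  have hS0 : 0 ≤ S := P.sobolevNorm_nonneg e De
  set μ := 𝔪[P, ε] with hμ
  set eb := verticalAverage (rescale ε ρ) e with heb
  set deb := verticalAverage (rescale ε ρ) (fun z => De z 0) with hdeb
  specialize t2 e De he
  specialize t3 e De he
  specialize t4 eb deb hline
  have n1 : (∫ x in J, ‖eb x‖ ^ p) ^ (1 / p) ≤ K * S :=
    (rpow_integral_le_mul hp0 hK0 hKe).trans
      (mul_le_mul_of_nonneg_left (P.rpow_le_sobolevNorm e De) hK0)
  have n2 : (∫ x in J, ‖deb x‖ ^ p) ^ (1 / p) ≤ K * S :=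
    (rpow_integral_le_mul hp0 hK0 hKde).trans
      (mul_le_mul_of_nonneg_left (P.rpow_grad_le_sobolevNorm e De) hK0)
  have me := memLp_thin ε he.memLp
  have mg := memLp_thin ε (hgT ε hε).1
  have hcorr := P.isW1p_corrector hp.lt H.isCell hA.test hA.smooth hA.hasDerivAt hε
  have mw := memLp_pFlux hp (memLp_thin ε hcorr.memLp)
  have mosc := (P.thin_poincare hp.lt hε hρ he).1
  have meb : MemLp (fun z : ℝ² => eb z.1) ofR(p) μ := by
    refine (me.sub mosc).ae_eq (.of_forall fun z => ?_)
    simp only [Pi.sub_apply, sub_sub_cancel]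
    rfl
  set ID := ∫ z, inner ℝ (pFlux p (gradCorrector L v Dv b ε z)) (De z) ∂μ with hID
  -- reduction to the unit interval
  have j3 := integrable_mul_of_memLp hp.symm mg meb
  have a1 : (∫ z, f ε z * e z ∂μ) - ∫ z, pFlux p (corrector L v b U ε z) * e z ∂μ =
      (∫ z, (e z - eb z.1) * g ε z ∂μ) + (∫ z, g ε z * eb z.1 ∂μ) -
        ∫ z, (pFlux p (corrector L v b U ε z) - pFlux p (U z.1)) * e z ∂μ := by
    have j1 := integrable_mul_of_memLp hp mosc mg
    have j2 := integrable_mul_of_memLp hp.symm (mw.sub (memLp_thin ε (mk hε))) me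
    simp only [Pi.sub_apply] at j2
    rw [← integral_sub (integrable_mul_of_memLp hp.symm (memLp_thin ε (H.data ε hε).1) me)
      (integrable_mul_of_memLp hp.symm mw me), ← integral_add j1 j3,
      ← integral_sub (j1.fun_add j3) j2]
    congr 1
    ext z
    simp only [hg, hk]
    ring
  obtain ⟨j5, a2⟩ := P.integral_mul_comp_fst hε (f := g ε) (k := eb)
    ((integrable_thinMeasure_iff hε).1 j3)
  have mu₀ := memLp_pFlux hp H.limit.isW1p.memLp
  have mdu₀ := memLp_pFlux hp H.limit.isW1p.deriv_memLp
  have j7 := integrable_mul_of_memLp hp.symm H.data_weak.limit_memLp hline.memLp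
  have j8 := integrable_mul_of_memLp hp.symm mrk hline.memLp
  have j9 : Integrable (fun x => r x * pFlux p (u₀ x) * eb x) vol[J] :=
    integrable_mul_of_memLp hp.symm (P.memLp_piecewiseConst_mul _ mu₀) hline.memLp
  have j10 := integrable_mul_of_memLp hp.symm
    (P.memLp_piecewiseConst_mul q mdu₀) hline.deriv_memLp
  -- the limit equation, tested with the vertical average of `e`
  have a5 := H.limit.equation eb deb hline
  rw [integral_add j10 j9] at a5
  simp only [Pi.sub_apply, sub_mul _ _ (eb _)] at t4
  have j11 : Integrable (fun x => fhat x * eb x - r x * k x * eb x) vol[J] := j7.sub j8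
  rw [integral_sub j5 j11, integral_sub j7 j8, ← a2] at t4
  have a6 : ∫ x in J, (k x - pFlux p (u₀ x)) * (r x * eb x) =
      (∫ x in J, r x * k x * eb x) - ∫ x in J, r x * pFlux p (u₀ x) * eb x := by
    rw [← integral_sub j8 j9]
    congr 1
    ext x
    ring
  have b6 : |∫ x in J, (k x - pFlux p (u₀ x)) * (r x * eb x)| ≤ rm * θ ^ (1 / p') * K * S := by
    have m1 : MemLp (fun x => r x * eb x) ofR(p) vol[J] :=
      P.memLp_piecewiseConst_mul _ hline.memLp
    have h4 : ∫ x in J, ‖r x * eb x‖ ^ p ≤ rm ^ p * ∫ x in J, ‖eb x‖ ^ p := by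
      rw [← integral_const_mul]
      refine integral_mono (integrable_norm_rpow hp0 m1)
        ((integrable_norm_rpow hp0 hline.memLp).const_mul _) fun x => ?_
      simp only
      rw [norm_mul, Real.mul_rpow (norm_nonneg _) (norm_nonneg _)]
      gcongr
      exact P.abs_piecewiseConst_le _ x
    refine (abs_integral_mul_le hp.symm (mkJ.sub mu₀) m1).trans ((mul_le_mul
      (rpow_integral_le hp'0 (hA.zero_close.trans hθ')) ((rpow_integral_le_mul hp0 hrm0 h4).trans
        (mul_le_mul_of_nonneg_left n1 hrm0)) (by positivity) (by positivity)).trans_eq ?_)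
    ring
  -- the flux terms
  have a7 : ID = ∑ i, ∫ z, inner ℝ (pFlux p (gradCorrector L v Dv b ε z)) (De z) ∂𝔪[P, i, ε] :=
    P.integral_thinDomain hε ((integrable_thinMeasure_iff hε).1 (integrable_inner_of_memLp hp
      (memLp_thin ε he.grad_memLp) (memLp_pFlux hp (memLp_thin ε hcorr.grad_memLp))))
  have a8 : ∫ x in J, P.piecewiseConst q x * pFlux p (du₀ x) * deb x =
      ∑ i, q i * ∫ x in P.piece i, pFlux p (du₀ x) * deb x := by
    rw [P.sum_setIntegral_piece j10]
    refine Finset.sum_congr rfl fun i _ => ?_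
    rw [← integral_const_mul]
    refine setIntegral_congr_fun (P.measurableSet_piece i) fun x hx => ?_
    rw [P.piecewiseConst_of_mem _ hx, mul_assoc]
  have b8 : ∀ i, |q i * (∫ x in P.piece i, pFlux p (du₀ x) * deb x) -
      ∫ z, inner ℝ (pFlux p (gradCorrector L v Dv b ε z)) (De z) ∂𝔪[P, i, ε]| ≤
      (|q i| * (θ ^ (1 / p') * K) + (A i * θ) ^ (1 / p') + κ₁) * S := by
    intro i
    have hmono := Measure.restrict_mono (P.piece_subset i) (le_refl (volume : Measure ℝ))
    have h1 := t1 i e De he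
    have mγ : MemLp (γ i) ofR(p') vol[P.piece i] := (hA.flux_test i).memLp _ _
    have mdui := mdu₀.mono_measure hmono
    have mdebi := hline.deriv_memLp.mono_measure hmono
    have h2 := integral_sub (integrable_mul_of_memLp hp.symm mγ mdebi)
      (integrable_mul_of_memLp hp.symm mdui mdebi)
    simp only [← sub_mul] at h2
    have h3 : |∫ x in P.piece i, (γ i x - pFlux p (du₀ x)) * deb x| ≤ θ ^ (1 / p') * (K * S) := by
      refine (abs_integral_mul_le hp.symm (mγ.sub mdui) mdebi).trans (mul_le_mul
        (rpow_integral_le hp'0 ((hA.flux_close i).trans hθ')) (le_trans ?_ n2)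
        (by positivity) (by positivity))
      exact rpow_integral_le hp0 (setIntegral_mono_set (integrable_norm_rpow hp0 hline.deriv_memLp)
          (.of_forall fun x => by positivity) (P.piece_subset i).eventuallyLE)
    have h4 := mul_le_mul_of_nonneg_left h3 (abs_nonneg (q i))
    rw [← abs_mul, h2] at h4
    rw [abs_le] at *
    constructor <;> linarith [h1.1, h1.2, h4.1, h4.2]
  have b9 : |(∫ x in J, P.piecewiseConst q x * pFlux p (du₀ x) * deb x) - ID| ≤
      (∑ i, (|q i| * (θ ^ (1 / p') * K) + (A i * θ) ^ (1 / p')) + N * κ₁) * S := by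
    rw [a7, a8, ← Finset.sum_sub_distrib]
    refine (Finset.abs_sum_le_sum_abs _ _).trans ((Finset.sum_le_sum fun i _ => b8 i).trans_eq ?_)
    rw [← Finset.sum_mul, Finset.sum_add_distrib (g := fun _ => κ₁)]
    simp
  have t4' := t4.trans (mul_le_mul_of_nonneg_left (add_le_add n1 n2) hκ₁0.le)
  have hΦS : Φ θ * S ≤ κ / 2 * S := mul_le_mul_of_nonneg_right hθ.le hS0
  have hκS : κ₁ * (2 * K + 2 + N) * S = κ / 2 * S := by
    rw [hκ₁]
    field_simp
  simp only [hΦ] at hΦS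
  rw [abs_le] at *
  constructor <;> linarith [t2.1, t2.2, t3.1, t3.2, t4'.1, t4'.2, b6.1, b6.2, b9.1, b9.2]

end Profile

/-! ### Strong convergence to the correctors -/

/-- Strict monotonicity of the flux turns a small residual into a small distance from the weak
solution. -/
theorem IsNeumannSolution.integral_norm_sub_rpow_le {p p' ε : ℝ} (hp : p.HolderConjugate p')
    (hε : 0 < ε) {Ω : Set ℝ²} {f u w : ℝ² → ℝ} {Du Dw : ℝ² → Plane}
    (hu : IsNeumannSolution Ω p f u Du) (hw : IsW1p Ω p w Dw) {δ C₁ C₂ R : ℝ} (hC₁ : 0 ≤ C₁)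
    (hC₂ : 0 ≤ C₂)
    (h₁ : ∀ a b : Plane, ‖a - b‖ ^ p ≤ δ * (‖a‖ ^ p + ‖b‖ ^ p) +
      C₁ * inner ℝ (pFlux p a - pFlux p b) (a - b))
    (h₂ : ∀ a b : ℝ, ‖a - b‖ ^ p ≤ δ * (‖a‖ ^ p + ‖b‖ ^ p) +
      C₂ * inner ℝ (pFlux p a - pFlux p b) (a - b))
    (hR : |(∫ z, f z * (u z - w z) ∂(thinMeasure ε Ω)) -
        (∫ z, inner ℝ (pFlux p (Dw z)) (Du z - Dw z) ∂(thinMeasure ε Ω)) -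
        ∫ z, pFlux p (w z) * (u z - w z) ∂(thinMeasure ε Ω)| ≤ R) :
    (∫ z, ‖Du z - Dw z‖ ^ p ∂(thinMeasure ε Ω)) + ∫ z, ‖u z - w z‖ ^ p ∂(thinMeasure ε Ω) ≤
      δ * (((∫ z, ‖Du z‖ ^ p ∂(thinMeasure ε Ω)) + ∫ z, ‖u z‖ ^ p ∂(thinMeasure ε Ω)) +
        ((∫ z, ‖Dw z‖ ^ p ∂(thinMeasure ε Ω)) + ∫ z, ‖w z‖ ^ p ∂(thinMeasure ε Ω))) +
      (C₁ + C₂) * R := by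
  set μ := thinMeasure ε Ω
  have he := hu.isW1p.sub hp.lt.le hw
  have eq := hu.equation_thin hp hε he
  have key : ∀ {V : Type} [NormedAddCommGroup V] [InnerProductSpace ℝ V] {X Y : ℝ² → V} {C : ℝ},
      MemLp X ofR(p) vol[Ω] → MemLp Y ofR(p) vol[Ω] →
      (∀ a b : V, ‖a - b‖ ^ p ≤ δ * (‖a‖ ^ p + ‖b‖ ^ p) +
        C * inner ℝ (pFlux p a - pFlux p b) (a - b)) →
      0 ≤ (∫ z, inner ℝ (pFlux p (X z)) (X z - Y z) ∂μ) -
          ∫ z, inner ℝ (pFlux p (Y z)) (X z - Y z) ∂μ ∧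
        ∫ z, ‖X z - Y z‖ ^ p ∂μ ≤ δ * ((∫ z, ‖X z‖ ^ p ∂μ) + ∫ z, ‖Y z‖ ^ p ∂μ) +
        C * ((∫ z, inner ℝ (pFlux p (X z)) (X z - Y z) ∂μ) -
          ∫ z, inner ℝ (pFlux p (Y z)) (X z - Y z) ∂μ) := by
    intro V _ _ X Y C mX mY h
    replace mX := memLp_thin ε mX
    replace mY := memLp_thin ε mY
    have k1 := integrable_norm_rpow hp.pos mX
    have k2 := integrable_norm_rpow hp.pos mY
    have k3 := integrable_inner_of_memLp hp (mX.sub mY) (memLp_pFlux hp mX)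
    have k4 := integrable_inner_of_memLp hp (mX.sub mY) (memLp_pFlux hp mY)
    simp only [Pi.sub_apply] at k3 k4
    have k5 := k3.sub k4
    simp only [Pi.sub_def, ← inner_sub_left] at k5
    rw [← integral_sub k3 k4]
    simp only [← inner_sub_left]
    refine ⟨integral_nonneg fun z => (inner_pFlux_sub_nonneg hp.lt _ _).1, ?_⟩
    rw [← integral_add k1 k2, ← integral_const_mul, ← integral_const_mul,
      ← integral_add ((k1.fun_add k2).const_mul _) (k5.const_mul _)]
    exact integral_mono (integrable_norm_rpow hp.pos (mX.sub mY))
      (((k1.fun_add k2).const_mul _).fun_add (k5.const_mul _)) fun z => h (X z) (Y z)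
  obtain ⟨n1, e1⟩ := key hu.isW1p.grad_memLp hw.grad_memLp h₁
  obtain ⟨n2, e2⟩ := key hu.isW1p.memLp hw.memLp h₂
  have cm : ∀ a b : ℝ, inner ℝ a b = a * b := fun a b => mul_comm _ _
  simp only [cm] at n2 e2
  have hsum := (le_abs_self _).trans hR
  rw [← eq] at hsum
  linarith [mul_nonneg hC₁ n2, mul_nonneg hC₂ n1,
    mul_le_mul_of_nonneg_left hsum (add_nonneg hC₁ hC₂)]

namespace Profile

variable {N : ℕ} {L G₀ G₁ : ℝ} (P : Profile N L G₀ G₁) {p p' : ℝ}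
  {v : Fin N → ℝ² → ℝ} {Dv : Fin N → ℝ² → Plane}

/-- The energy of the correctors is bounded, uniformly with respect to the approximation. -/
theorem exists_eventually_energy_corrector_le (hp : p.HolderConjugate p')
    (hv : ∀ i, IsCellSolution L (P.g i) p (v i) (Dv i)) {u₀ du₀ : ℝ → ℝ}
    (hu₀ : IsW1pLine (Ioo 0 1) p u₀ du₀) {M : ℝ} (hM : 0 ≤ M) :
    ∃ K, ∀ b γ U, IsSmoothApprox P p p' 1 u₀ du₀ b γ U → (∀ x ∈ 𝕀, |U x| ≤ M) →
      ∀ᶠ ε in 𝓝[>] 0, (∫ z, ‖gradCorrector L v Dv b ε z‖ ^ p ∂𝔪[P, ε]) +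
        ∫ z, ‖corrector L v b U ε z‖ ^ p ∂𝔪[P, ε] ≤ K := by
  refine ⟨(∑ i, (2 ^ p * (L⁻¹ * ((2 ^ p * (1 + ∫ x in P.piece i, ‖du₀ x‖ ^ p)) *
    ∫ y in cell L (P.g i), ‖Dv i y‖ ^ p)) + 1)) + 2 ^ p * (1 + M ^ p * |N * G₁|),
    fun b γ U hA hUM => ?_⟩
  have ev := eventually_all.2 fun i =>
    (hv i).eventually_integral_correctorGrad_le hp.lt (P.isProfile i) (hA.test i)
  filter_upwards [ev, (tendsto_order.1 (P.tendsto_integral_thin_corrector_sub hp.lt hv hA.test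
    hA.smooth hA.hasDerivAt)).2 1 one_pos, self_mem_nhdsWithin] with ε h1 h2 (hε : 0 < ε)
  have hw := P.isW1p_corrector hp.lt hv hA.test hA.smooth hA.hasDerivAt hε
  refine add_le_add ?_ ?_
  · rw [P.integral_thinDomain hε (integrable_norm_rpow hp.pos hw.grad_memLp)]
    refine Finset.sum_le_sum fun i _ => ?_
    rw [P.integral_gradCorrector hA.test fun _ a => ‖a‖ ^ p]
    refine (h1 i).trans ?_
    have hL := P.L_pos
    have mb := (hA.test i).memLp ofR(p) (P.piece i)
    have mdu : MemLp du₀ ofR(p) vol[P.piece i] :=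
      hu₀.deriv_memLp.mono_measure (Measure.restrict_mono (P.piece_subset i) le_rfl)
    have h3 := integral_norm_add_rpow_le hp.lt (mb.sub mdu) mdu
    simp only [Pi.sub_apply, sub_add_cancel] at h3
    have h4 : ∫ x in P.piece i, ‖b i x‖ ^ p ≤ 2 ^ p * (1 + ∫ x in P.piece i, ‖du₀ x‖ ^ p) :=
      h3.trans (mul_le_mul_of_nonneg_left (add_le_add_left (hA.deriv_close i) _) (by positivity))
    have h5 := integral_rpow_nonneg (μ := vol[cell L (P.g i)]) (p := p) (Dv i)
    gcongr
    exact h4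
  · have mU := memLp_thin ε
      (P.memLp_comp_fst_of_continuous hε hA.smooth.continuous ofR(p))
    have h3 := integral_norm_add_rpow_le hp.lt ((memLp_thin ε hw.memLp).sub mU) mU
    simp only [Pi.sub_apply, sub_add_cancel] at h3
    exact h3.trans (mul_le_mul_of_nonneg_left (add_le_add h2.le
      (P.integral_comp_fst_le hp.pos hε hA.smooth.continuous hM hUM)) (by positivity))

variable {P} {f : ℝ → ℝ² → ℝ} {c : ℝ} {fhat u₀ du₀ : ℝ → ℝ} {u : ℝ → ℝ² → ℝ}
  {Du : ℝ → ℝ² → Plane}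

/-- The solutions on the thin domains are close to correctors that are built from smooth
approximations of the solution of the limit problem. -/
theorem IsHomogenization.exists_corrector_close (hp : p.HolderConjugate p')
    (H : P.IsHomogenization p p' c v Dv f fhat u₀ du₀ u Du)
    {η : ℝ} (hη : 0 < η) :
    ∃ b γ U, IsSmoothApprox P p p' η u₀ du₀ b γ U ∧ ∀ᶠ ε in 𝓝[>] 0,
      (∫ z, ‖Du ε z - gradCorrector L v Dv b ε z‖ ^ p ∂𝔪[P, ε]) +
        ∫ z, ‖u ε z - corrector L v b U ε z‖ ^ p ∂𝔪[P, ε] ≤ η := by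
  have hp0 := hp.pos
  obtain ⟨M, hM⟩ := P.exists_isSmoothApprox hp H.limit.isW1p
  obtain ⟨K₂, hK₂⟩ := P.exists_eventually_energy_corrector_le hp H.isCell H.limit.isW1p (abs_nonneg M)
  set K := |c ^ p' + K₂| with hK
  have hK0 : 0 ≤ K := abs_nonneg _
  obtain ⟨C₁, hC₁, h₁⟩ := norm_sub_rpow_le_inner_pFlux (V := Plane) hp.lt
    (show 0 < η / (2 * (K + 1)) by positivity)
  obtain ⟨C₂, hC₂, h₂⟩ := norm_sub_rpow_le_inner_pFlux (V := ℝ) hp.lt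
    (show 0 < η / (2 * (K + 1)) by positivity)
  set S₀ := 2 * (2 ^ p * K) ^ (1 / p) with hS₀
  have hS₀0 : 0 ≤ S₀ := by positivity
  obtain ⟨θ, hθ, hres⟩ := H.exists_residual_le hp
    (show 0 < η / (2 * ((C₁ + C₂) * S₀ + 1)) by positivity)
  obtain ⟨b, γ, U, hA, hUM⟩ := hM (min θ (min η 1)) (by positivity)
  refine ⟨b, γ, U, hA.mono ((min_le_right _ _).trans (min_le_left _ _)), ?_⟩
  filter_upwards [hres _ (min_le_left _ _) (by positivity) b γ U hA,
    hK₂ b γ U (hA.mono ((min_le_right _ _).trans (min_le_right _ _)))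
      fun x hx => (hUM x hx).trans (le_abs_self M), self_mem_nhdsWithin] with ε r1 r2 (hε : 0 < ε)
  have hw := P.isW1p_corrector hp.lt H.isCell hA.test hA.smooth hA.hasDerivAt hε
  have hu' := (H.solution ε hε).isW1p
  have en := ((H.solution ε hε).energy_le hp hε (H.data ε hε).1).trans
    (integral_rpow_le_of_rescaledNorm_le hp.symm.pos hε (H.data ε hε).1 (H.data ε hε).2)
  specialize r1 _ _ (hu'.sub hp.lt.le hw)
  refine ((H.solution ε hε).integral_norm_sub_rpow_le hp hε hw hC₁ hC₂ h₁ h₂ r1).trans ?_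
  have hKle := le_abs_self (c ^ p' + K₂)
  set A₁ := ∫ z, ‖Du ε z‖ ^ p ∂𝔪[P, ε]
  set A₂ := ∫ z, ‖u ε z‖ ^ p ∂𝔪[P, ε]
  set A₃ := ∫ z, ‖gradCorrector L v Dv b ε z‖ ^ p ∂𝔪[P, ε]
  set A₄ := ∫ z, ‖corrector L v b U ε z‖ ^ p ∂𝔪[P, ε]
  have d1 : 0 ≤ A₁ := integral_rpow_nonneg _
  have d2 : 0 ≤ A₂ := integral_rpow_nonneg _
  have d3 : 0 ≤ A₃ := integral_rpow_nonneg _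
  have d4 : 0 ≤ A₄ := integral_rpow_nonneg _
  have hS : P.sobolevNorm p ε (fun z => u ε z - corrector L v b U ε z)
      (fun z => Du ε z - gradCorrector L v Dv b ε z) ≤ S₀ := by
    have g1 := integral_norm_sub_rpow_le hp.lt (memLp_thin ε hu'.grad_memLp)
      (memLp_thin ε hw.grad_memLp)
    have g2 := integral_norm_sub_rpow_le hp.lt (memLp_thin ε hu'.memLp)
      (memLp_thin ε hw.memLp)
    rw [hS₀, two_mul]
    refine add_le_add ?_ ?_ <;> refine rpow_integral_le hp0 (le_trans (by assumption)
        (mul_le_mul_of_nonneg_left ?_ (by positivity))) <;> linarith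
  have t1 : η / (2 * (K + 1)) * ((A₁ + A₂) + (A₃ + A₄)) ≤ η / 2 := by
    refine (mul_le_mul_of_nonneg_left (show _ ≤ K + 1 by linarith) (by positivity)).trans_eq ?_
    field_simp
  set S := P.sobolevNorm p ε (fun z => u ε z - corrector L v b U ε z)
      (fun z => Du ε z - gradCorrector L v Dv b ε z)
  have t2 : (C₁ + C₂) * (η / (2 * ((C₁ + C₂) * S₀ + 1)) * S) ≤ η / 2 := by
    have t3 : (C₁ + C₂) * S ≤ (C₁ + C₂) * S₀ + 1 :=
      (mul_le_mul_of_nonneg_left hS (by positivity)).trans (by linarith)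
    rw [mul_left_comm]
    refine (mul_le_mul_of_nonneg_left t3 (by positivity)).trans_eq ?_
    field_simp
  linarith

/-- Each piece separately, with the corrector replaced by its leading order term. -/
theorem IsHomogenization.exists_approx_close (hp : p.HolderConjugate p')
    (H : P.IsHomogenization p p' c v Dv f fhat u₀ du₀ u Du)
    {η : ℝ} (hη : 0 < η) (i : Fin N) :
    ∃ b γ U, IsSmoothApprox P p p' η u₀ du₀ b γ U ∧ ∀ᶠ ε in 𝓝[>] 0,
      ∫ z, ‖u ε z - U z.1‖ ^ p ∂𝔪[P, i, ε] ≤ η ∧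
      ∫ z, ‖Du ε z - b i z.1 • perExt L (Dv i) (ε⁻¹ • z)‖ ^ p
        ∂𝔪[P, i, ε] ≤ η := by
  have hp0 := hp.pos
  have hσ : 0 < min η (η / (2 * 2 ^ p)) := by positivity
  have hσ2 : 2 ^ p * (min η (η / (2 * 2 ^ p)) + min η (η / (2 * 2 ^ p))) ≤ η := by
    refine (mul_le_mul_of_nonneg_left (add_le_add (min_le_right _ _) (min_le_right _ _))
      (by positivity)).trans_eq ?_
    field_simp
    ring
  obtain ⟨b, γ, U, hA, hE⟩ := H.exists_corrector_close hp hσ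
  refine ⟨b, γ, U, hA.mono (min_le_left _ _), ?_⟩
  filter_upwards [hE, (tendsto_order.1 (P.tendsto_integral_corrector_sub (U := U) hp.lt H.isCell hA.test
    i)).2 _ hσ, (tendsto_order.1 ((H.isCell i).tendsto_integral_correctorGrad_sub hp.lt (P.isProfile i)
    (hA.test i))).2 _ hσ, self_mem_nhdsWithin] with ε e1 e2 e3 (hε : 0 < ε)
  have hw := P.isW1p_corrector hp.lt H.isCell hA.test hA.smooth hA.hasDerivAt hε
  have he := (H.solution ε hε).isW1p.sub hp.lt.le hw
  have k1 := P.integral_piece_le hε (integrable_norm_rpow hp0 he.memLp) (fun z => by positivity) i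
  have k2 := P.integral_piece_le hε (integrable_norm_rpow hp0 he.grad_memLp)
    (fun z => by positivity) i
  have n1 := integral_rpow_nonneg (μ := 𝔪[P, ε]) (p := p)
    fun z => u ε z - corrector L v b U ε z
  have n2 := integral_rpow_nonneg (μ := 𝔪[P, ε]) (p := p)
    fun z => Du ε z - gradCorrector L v Dv b ε z
  have hw' := hw.mono (P.pieceDomain_subset i ε)
  have he' := he.mono (P.pieceDomain_subset i ε)
  constructor
  · have h1 := integral_norm_add_rpow_le hp.lt (memLp_thin ε he'.memLp)
      ((memLp_thin ε hw'.memLp).sub (memLp_thin ε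
        ((P.memLp_comp_fst_of_continuous hε hA.smooth.continuous _).mono_measure
          (Measure.restrict_mono (P.pieceDomain_subset i ε) le_rfl))))
    simp only [Pi.sub_apply, sub_add_sub_cancel] at h1
    exact h1.trans ((mul_le_mul_of_nonneg_left (add_le_add (k1.trans (by linarith)) e2.le)
      (by positivity)).trans hσ2)
  · have e3' := (P.integral_gradCorrector (v := v) (Dv := Dv) (ε := ε) hA.test fun z a =>
      ‖a - b i z.1 • perExt L (Dv i) (ε⁻¹ • z)‖ ^ p).le.trans e3.le
    have h1 := integral_norm_add_rpow_le hp.lt (memLp_thin ε he'.grad_memLp)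
      ((memLp_thin ε hw'.grad_memLp).sub (memLp_thin ε
        (memLp_test_smul (hA.test i) ((P.isProfile i).memLp_oscillating hp.lt.le hε
          ((H.isCell i).memLp (P.isProfile i))))))
    simp only [Pi.sub_apply, sub_add_sub_cancel] at h1
    exact h1.trans ((mul_le_mul_of_nonneg_left (add_le_add (k2.trans (by linarith)) e3')
      (by positivity)).trans hσ2)

end Profile

/-! ### Unfolding -/

theorem memLp_prod_smul {p : ℝ} (hp : 0 < p) {V : Type*} [NormedAddCommGroup V] [NormedSpace ℝ V]
    {I : Set ℝ} {Y : Set ℝ²} {h : ℝ → ℝ} {F : ℝ² → V}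
    (hh : MemLp h ofR(p) vol[I])
    (hF : MemLp F ofR(p) vol[Y]) :
    MemLp (fun q : ℝ × ℝ² => h q.1 • F q.2) ofR(p)
      vol[I ×ˢ Y] := by
  rw [Measure.volume_eq_prod, ← Measure.prod_restrict]
  refine memLp_of_integrable_norm_rpow hp (hh.1.comp_fst.smul hF.1.comp_snd) ?_
  simp only [norm_smul, Real.mul_rpow (norm_nonneg _) (norm_nonneg _)]
  exact (integrable_norm_rpow hp hh).mul_prod (integrable_norm_rpow hp hF)

theorem tendstoWeaklyLp_of_tendsto {p p' : ℝ} (hp : p.HolderConjugate p') {X : Type*}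
    [MeasurableSpace X] {μ : Measure X} {F : ℝ → X → ℝ} {F₀ : X → ℝ}
    (hF : ∀ ε, 0 < ε → MemLp (F ε) ofR(p) μ) (hF₀ : MemLp F₀ ofR(p) μ)
    (h : Tendsto (fun ε => ∫ x, ‖F ε x - F₀ x‖ ^ p ∂μ) (𝓝[>] 0) (𝓝 0)) :
    TendstoWeaklyLp p p' μ F F₀ := by
  refine ⟨hF, hF₀, fun ψ hψ => ?_⟩
  -- the values at `ε ≤ 0` are irrelevant
  have e : (fun ε => if 0 < ε then F ε else F₀) =ᶠ[𝓝[>] 0] F := by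
    filter_upwards [self_mem_nhdsWithin] with ε (hε : 0 < ε)
    exact if_pos hε
  refine (tendsto_integral_mul_of_tendsto_rpow hp (X := fun ε => if 0 < ε then F ε else F₀)
    (fun ε => ?_) hF₀ hψ (h.congr' ?_)).congr' ?_
  · split_ifs with hε
    exacts [hF ε hε, hF₀]
  · exact e.mono fun ε hε => by simp only [hε]
  · exact e.mono fun ε hε => by simp only [hε]

namespace Profile

variable {N : ℕ} {L G₀ G₁ : ℝ} (P : Profile N L G₀ G₁) {p p' ε : ℝ} {i : Fin N}

/-- The interval of length `Lε` that contains a point of the unfolded part lies in the closure of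
the piece. -/
theorem floor_mem_of_mem_unfoldedPart (hε : 0 < ε) {x : ℝ} (hx : x ∈ P.unfoldedPart i ε) :
    P.ξ i.castSucc ≤ ⌊x / (ε * L)⌋ * L * ε ∧ (⌊x / (ε * L)⌋ + 1) * L * ε ≤ P.ξ i.succ := by
  have hLε : 0 < ε * L := mul_pos hε P.L_pos
  set k := ⌊x / (ε * L)⌋ with hk
  have h1 : k * (ε * L) ≤ x := (le_div_iff₀ hLε).1 (Int.floor_le _)
  have h2 : x < (k + 1) * (ε * L) := (div_lt_iff₀ hLε).1 (Int.lt_floor_add_one _)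
  -- a point of the union a little to the right of `x`, so that `x` is not its left neighbour's end
  obtain ⟨t, ht, hxt, htk⟩ : ∃ t ∈ P.unfoldedPart i ε, x < t ∧ t < (k + 1) * (ε * L) := by
    have : ∀ᶠ t in 𝓝[>] x, t ∈ P.unfoldedPart i ε :=
      mem_nhdsWithin_of_mem_nhds (isOpen_interior.mem_nhds hx)
    obtain ⟨t, ht, hxt, htk⟩ := (this.and (Ioo_mem_nhdsGT h2)).exists
    exact ⟨t, ht, hxt, htk⟩
  obtain ⟨j, hj, hjt⟩ := mem_iUnion₂.1 (interior_subset ht)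
  have h3 : (j : ℝ) * (ε * L) < (k + 1) * (ε * L) := by linarith [hjt.1]
  have h4 : (k : ℝ) * (ε * L) < (j + 1) * (ε * L) := by linarith [hjt.2]
  have h5 : (j : ℝ) < k + 1 := lt_of_mul_lt_mul_right h3 hLε.le
  have h6 : (k : ℝ) < j + 1 := lt_of_mul_lt_mul_right h4 hLε.le
  have h7 : j = k := by
    have h8 : j < k + 1 := by exact_mod_cast h5
    have h9 : k < j + 1 := by exact_mod_cast h6
    omega
  rw [← h7]
  exact hj

theorem unfoldMap_mem_pieceDomain (hε : 0 < ε) {q : ℝ × ℝ²} (hx : q.1 ∈ P.unfoldedPart i ε)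
    (hy : q.2 ∈ P.pieceCell i) : unfoldMap L ε q ∈ P.pieceDomain i ε := by
  obtain ⟨h1, h2⟩ := P.floor_mem_of_mem_unfoldedPart hε hx
  have h3 : 0 < ε * q.2.1 := mul_pos hε hy.1
  have h4 : ε * q.2.1 < ε * L := mul_lt_mul_of_pos_left hy.2.1 hε
  refine ⟨⟨?_, ?_⟩, mul_pos hε hy.2.2.1, ?_⟩
  · simp only [unfoldMap]
    linarith
  · simp only [unfoldMap]
    linarith
  · have h5 : (unfoldMap L ε q).1 / ε = q.2.1 + ⌊q.1 / (ε * L)⌋ * L := by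
      simp only [unfoldMap]
      field_simp
      ring
    rw [scaled, h5, (P.periodic i).int_mul]
    exact mul_lt_mul_of_pos_left hy.2.2.2 hε

/-- The unfolded parts exhaust the piece. -/
theorem eventually_mem_unfoldedPart {x : ℝ} (hx : x ∈ P.piece i) :
    ∀ᶠ ε in 𝓝[>] 0, x ∈ P.unfoldedPart i ε := by
  have hL := P.L_pos
  have l : Tendsto (fun ε : ℝ => 2 * (ε * L)) (𝓝[>] 0) (𝓝 0) := by
    have h : Tendsto (fun ε : ℝ => 2 * (ε * L)) (𝓝 0) (𝓝 (2 * (0 * L))) :=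
      (tendsto_id.mul_const L).const_mul 2
    rw [zero_mul, mul_zero] at h
    exact h.mono_left nhdsWithin_le_nhds
  filter_upwards [(tendsto_order.1 l).2 _ (sub_pos.2 hx.1),
    (tendsto_order.1 l).2 _ (sub_pos.2 hx.2), self_mem_nhdsWithin] with ε h1 h2 (hε : 0 < ε)
  have hLε : 0 < ε * L := mul_pos hε hL
  set k := ⌊x / (ε * L)⌋ with hk
  have h3 : k * (ε * L) ≤ x := (le_div_iff₀ hLε).1 (Int.floor_le _)
  have h4 : x < (k + 1) * (ε * L) := (div_lt_iff₀ hLε).1 (Int.lt_floor_add_one _)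
  -- two adjacent intervals, since `x` may be the common end point
  refine mem_interior.2 ⟨Ioo (((k : ℝ) - 1) * (ε * L)) ((k + 1) * (ε * L)), fun t ht => ?_,
    isOpen_Ioo, by linarith, h4⟩
  rcases le_total t (k * (ε * L)) with h | h
  · refine mem_iUnion₂.2 ⟨k - 1, ⟨?_, ?_⟩, ?_, ?_⟩ <;> push_cast <;> linarith [ht.1]
  · refine mem_iUnion₂.2 ⟨k, ⟨?_, ?_⟩, ?_, ?_⟩ <;> linarith [ht.2]

/-- The unfolding operator for functions with values in an arbitrary space. -/
def unfoldVec {V : Type*} [Zero V] (i : Fin N) (ε : ℝ) (φ : ℝ² → V) : ℝ × ℝ² → V :=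
  (P.unfoldedPart i ε ×ˢ univ).indicator fun q => φ (unfoldMap L ε q)

theorem unfoldVec_of_mem {V : Type*} [Zero V] {φ : ℝ² → V} {q : ℝ × ℝ²}
    (hq : q.1 ∈ P.unfoldedPart i ε) : P.unfoldVec i ε φ q = φ (unfoldMap L ε q) :=
  indicator_of_mem (show q ∈ P.unfoldedPart i ε ×ˢ univ from ⟨hq, mem_univ _⟩) _

theorem unfoldVec_of_notMem {V : Type*} [Zero V] {φ : ℝ² → V} {q : ℝ × ℝ²}
    (hq : q.1 ∉ P.unfoldedPart i ε) : P.unfoldVec i ε φ q = 0 :=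
  indicator_of_notMem (fun h => hq h.1) _

theorem unfold_eq (i : Fin N) (ε : ℝ) (φ : ℝ² → ℝ) : P.unfold i ε φ = P.unfoldVec i ε φ := by
  ext q
  by_cases hx : q.1 ∈ P.unfoldedPart i ε
  · rw [P.unfoldVec_of_mem hx, unfold, if_pos hx, unfoldMap]
  · rw [P.unfoldVec_of_notMem hx, unfold, if_neg hx]

theorem measurableSet_unfoldedPart (i : Fin N) (ε : ℝ) : MeasurableSet (P.unfoldedPart i ε) :=
  isOpen_interior.measurableSet

theorem volume_restrict_prod_cell (i : Fin N) :
    (volume : Measure (ℝ × ℝ²)).restrict (P.piece i ×ˢ P.pieceCell i) =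
      ((volume : Measure ℝ).prod vol[cell L (P.g i)]).restrict
        (P.piece i ×ˢ univ) := by
  rw [Measure.volume_eq_prod, ← Measure.prod_restrict, ← Measure.prod_restrict,
    Measure.restrict_univ, pieceCell]

theorem measurableSet_prod_cell (i : Fin N) : MeasurableSet (P.piece i ×ˢ P.pieceCell i) :=
  (P.measurableSet_piece i).prod (P.isProfile i).isOpen_cell.measurableSet

/-- On the unfolded domain the function may be cut off outside of the piece of the thin domain. -/
theorem unfoldVec_indicator {V : Type*} [Zero V] (hε : 0 < ε) (φ : ℝ² → V) {q : ℝ × ℝ²}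
    (hq : q.2 ∈ P.pieceCell i) :
    P.unfoldVec i ε ((P.pieceDomain i ε).indicator φ) q = P.unfoldVec i ε φ q := by
  by_cases h : q.1 ∈ P.unfoldedPart i ε
  · rw [P.unfoldVec_of_mem h, P.unfoldVec_of_mem h,
      indicator_of_mem (P.unfoldMap_mem_pieceDomain hε h hq)]
  · rw [P.unfoldVec_of_notMem h, P.unfoldVec_of_notMem h]

theorem memLp_unfoldVec {V : Type*} [NormedAddCommGroup V] (hε : 0 < ε) {φ : ℝ² → V}
    {r : ENNReal} (hφ : MemLp φ r vol[P.pieceDomain i ε]) :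
    MemLp (P.unfoldVec i ε φ) r vol[P.piece i ×ˢ P.pieceCell i] := by
  have h1 : MemLp ((P.pieceDomain i ε).indicator φ) r
      vol[subgraph univ (scaled ε (P.g i))] :=
    ((memLp_indicator_iff_restrict (P.measurableSet_pieceDomain i ε)).2 hφ).restrict _
  have h2 := (h1.smul_measure ENNReal.ofReal_ne_top).comp_measurePreserving
    ((P.isProfile i).measurePreserving_unfoldMap hε)
  have h3 := (h2.indicator ((P.measurableSet_unfoldedPart i ε).prod .univ)).restrict
    (P.piece i ×ˢ univ)
  rw [← P.volume_restrict_prod_cell] at h3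
  exact h3.ae_eq ((ae_restrict_mem (P.measurableSet_prod_cell i)).mono fun q hq =>
    P.unfoldVec_indicator hε φ hq.2)

theorem integral_norm_unfoldVec_le {V : Type*} [NormedAddCommGroup V] (hp : 0 < p) (hε : 0 < ε)
    {φ : ℝ² → V} (hφ : MemLp φ ofR(p) vol[P.pieceDomain i ε]) :
    ∫ q in P.piece i ×ˢ P.pieceCell i, ‖P.unfoldVec i ε φ q‖ ^ p ≤
      L * ∫ z, ‖φ z‖ ^ p ∂𝔪[P, i, ε] := by
  set H : ℝ² → ℝ := (P.pieceDomain i ε).indicator fun z => ‖φ z‖ ^ p with hH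
  have hHi : Integrable H := (integrable_indicator_iff (P.measurableSet_pieceDomain i ε)).2
    (integrable_norm_rpow hp hφ)
  have hH0 : ∀ z, 0 ≤ H z := indicator_nonneg fun z _ => by positivity
  have hT := (P.isProfile i).measurePreserving_unfoldMap hε
  have hHT : Integrable (fun q => H (unfoldMap L ε q))
      ((volume : Measure ℝ).prod vol[cell L (P.g i)]) :=
    hT.integrable_comp_of_integrable (hHi.restrict.smul_measure ENNReal.ofReal_ne_top)
  have h1 : ∫ q in P.piece i ×ˢ P.pieceCell i, ‖P.unfoldVec i ε φ q‖ ^ p ≤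
      ∫ q in P.piece i ×ˢ P.pieceCell i, H (unfoldMap L ε q) := by
    refine setIntegral_mono_on (integrable_norm_rpow hp (P.memLp_unfoldVec hε hφ)) ?_
      (P.measurableSet_prod_cell i) fun q hq => ?_
    · rw [IntegrableOn, P.volume_restrict_prod_cell]
      exact hHT.restrict
    · by_cases h : q.1 ∈ P.unfoldedPart i ε
      · rw [P.unfoldVec_of_mem h, hH, indicator_of_mem (P.unfoldMap_mem_pieceDomain hε h hq.2)]
      · rw [P.unfoldVec_of_notMem h, norm_zero, Real.zero_rpow hp.ne']
        exact hH0 _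
  refine h1.trans ?_
  rw [P.volume_restrict_prod_cell]
  refine (setIntegral_le_integral hHT (.of_forall fun q => hH0 _)).trans_eq ?_
  rw [(P.isProfile i).integral_unfoldMap hε hHi.1.restrict, integral_thinMeasure hε, hH,
    setIntegral_indicator (P.measurableSet_pieceDomain i ε),
    inter_eq_self_of_subset_right (P.pieceDomain_subset_strip i ε), smul_eq_mul]
  ring

/-- Convergence of the unfolded functions, if the functions are close to products of a continuous
function of the first variable and an oscillating function. -/
theorem tendsto_integral_unfold_sub (hp : 1 < p) {F : ℝ² → ℝ} {h₀ : ℝ → ℝ} {φ : ℝ → ℝ² → ℝ}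
    (hF : MemLp F ofR(p) vol[P.pieceCell i])
    (hh₀ : MemLp h₀ ofR(p) vol[P.piece i])
    (hφ : ∀ ε, 0 < ε → MemLp (φ ε) ofR(p) vol[P.pieceDomain i ε])
    (H : ∀ η, 0 < η → ∃ h : ℝ → ℝ, Continuous h ∧ ∫ x in P.piece i, ‖h x - h₀ x‖ ^ p ≤ η ∧
      ∀ᶠ ε in 𝓝[>] 0, ∫ z, ‖φ ε z - h z.1 * perExt L F (ε⁻¹ • z)‖ ^ p
        ∂𝔪[P, i, ε] ≤ η) :
    Tendsto (fun ε => ∫ q in P.piece i ×ˢ P.pieceCell i,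
      ‖P.unfold i ε (φ ε) q - h₀ q.1 * F q.2‖ ^ p) (𝓝[>] 0) (𝓝 0) := by
  have hp0 : 0 < p := by linarith
  have hL := P.L_pos
  have mlim := memLp_prod_smul hp0 hh₀ hF
  simp only [smul_eq_mul] at mlim
  refine tendsto_order.2 ⟨fun a ha => .of_forall fun ε =>
    ha.trans_le (integral_rpow_nonneg _), fun a ha => ?_⟩
  set A := ∫ y in P.pieceCell i, ‖F y‖ ^ p with hA
  have hA0 : 0 ≤ A := integral_rpow_nonneg _
  obtain ⟨h, hc, hh, hev⟩ := H (a / (2 * (2 ^ p * (L + A)))) (by positivity)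
  set η := a / (2 * (2 ^ p * (L + A))) with hη
  obtain ⟨C, hC0, hC⟩ := exists_norm_le_of_continuous hc
  have hCp : ∀ x ∈ P.piece i, ‖h x‖ ≤ C := fun x hx =>
    hC x (P.piece_subset i hx)
  have mprod : ∀ ε, 0 < ε → MemLp (fun z => h z.1 * perExt L F (ε⁻¹ • z)) ofR(p)
      vol[P.pieceDomain i ε] := fun ε hε => by
    have m := (P.isProfile i).memLp_oscillating hp.le hε hF (a := P.ξ i.castSucc) (b := P.ξ i.succ)
    refine m.of_le_mul ((hc.comp continuous_fst).aestronglyMeasurable.mul m.1)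
      ((ae_restrict_mem (P.measurableSet_pieceDomain i ε)).mono fun z hz => ?_) (c := C)
    rw [norm_mul]
    exact mul_le_mul_of_nonneg_right (hCp _ hz.1) (norm_nonneg _)
  -- the unfolded products converge
  have lim : Tendsto (fun ε => ∫ q in P.piece i ×ˢ P.pieceCell i,
      ‖P.unfoldVec i ε (fun z => h z.1 * perExt L F (ε⁻¹ • z)) q - h₀ q.1 * F q.2‖ ^ p) (𝓝[>] 0)
      (𝓝 (∫ q in P.piece i ×ˢ P.pieceCell i, ‖h q.1 - h₀ q.1‖ ^ p * ‖F q.2‖ ^ p)) := by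
    have mb : MemLp (fun x => C + ‖h₀ x‖) ofR(p) vol[P.piece i] := by
      have : IsFiniteMeasure vol[P.piece i] := by rw [piece]; infer_instance
      exact (memLp_const C).add hh₀.norm
    refine tendsto_integral_filter_of_dominated_convergence _ ?_ ?_
      (integrable_norm_rpow hp0 (memLp_prod_smul hp0 mb hF)) ?_
    · filter_upwards [self_mem_nhdsWithin] with ε (hε : 0 < ε)
      exact (integrable_norm_rpow hp0 ((P.memLp_unfoldVec hε (mprod ε hε)).sub mlim)).1
    · filter_upwards [self_mem_nhdsWithin] with ε (hε : 0 < ε)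
      filter_upwards [ae_restrict_mem (P.measurableSet_prod_cell i)] with q hq
      rw [Real.norm_of_nonneg (by positivity)]
      refine Real.rpow_le_rpow (norm_nonneg _) ?_ hp0.le
      rw [smul_eq_mul, norm_mul, Real.norm_of_nonneg (show 0 ≤ C + ‖h₀ q.1‖ by positivity), add_mul,
        ← norm_mul (h₀ q.1)]
      refine (norm_sub_le _ _).trans (add_le_add_left ?_ _)
      by_cases hx : q.1 ∈ P.unfoldedPart i ε
      · rw [P.unfoldVec_of_mem hx, (P.isProfile i).perExt_unfoldMap hε F hq.2, norm_mul]
        exact mul_le_mul_of_nonneg_right (hCp _ (P.unfoldMap_mem_pieceDomain hε hx hq.2).1)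
          (norm_nonneg _)
      · rw [P.unfoldVec_of_notMem hx, norm_zero]
        positivity
    · filter_upwards [ae_restrict_mem (P.measurableSet_prod_cell i)] with q hq
      rw [← Real.mul_rpow (norm_nonneg _) (norm_nonneg _), ← norm_mul, sub_mul]
      have l1 := ((((hc.tendsto _).comp (tendsto_unfoldMap_fst hL (q := q)
        ⟨hq.2.1, hq.2.2.1⟩)).mul_const (F q.2)).sub_const (h₀ q.1 * F q.2)).norm.rpow_const
        (p := p) (Or.inr hp0.le)
      refine l1.congr' ?_
      filter_upwards [P.eventually_mem_unfoldedPart hq.1, self_mem_nhdsWithin] with ε hx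
        (hε : 0 < ε)
      simp only [Function.comp]
      rw [P.unfoldVec_of_mem hx, (P.isProfile i).perExt_unfoldMap hε F hq.2]
  have limle : ∫ q in P.piece i ×ˢ P.pieceCell i, ‖h q.1 - h₀ q.1‖ ^ p * ‖F q.2‖ ^ p ≤ η * A := by
    rw [Measure.volume_eq_prod, ← Measure.prod_restrict,
      integral_prod_mul (fun x => ‖h x - h₀ x‖ ^ p) (fun y => ‖F y‖ ^ p)]
    exact mul_le_mul_of_nonneg_right hh hA0
  have hfin : 2 ^ p * (L * η + η * A) < a := by
    have e : 2 ^ p * (L * η + η * A) = a / 2 := by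
      rw [hη]
      field_simp
    linarith
  have hlt : ∫ q in P.piece i ×ˢ P.pieceCell i, ‖h q.1 - h₀ q.1‖ ^ p * ‖F q.2‖ ^ p <
      a / 2 ^ p - L * η := by
    rw [lt_sub_iff_add_lt, lt_div_iff₀ (by positivity)]
    refine lt_of_le_of_lt ?_ hfin
    rw [mul_comm, add_comm]
    exact mul_le_mul_of_nonneg_left (add_le_add_right limle _) (by positivity)
  filter_upwards [hev, (tendsto_order.1 lim).2 _ hlt, self_mem_nhdsWithin] with ε e1 e2
    (hε : 0 < ε)
  have m1 := (hφ ε hε).sub (mprod ε hε)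
  have m2 := P.memLp_unfoldVec hε (mprod ε hε)
  have i1 := P.integral_norm_unfoldVec_le hp0 hε m1
  have i2 := integral_norm_add_rpow_le hp (P.memLp_unfoldVec hε m1) (m2.sub mlim)
  have e3 : ∀ q, P.unfoldVec i ε (φ ε - fun z => h z.1 * perExt L F (ε⁻¹ • z)) q =
      P.unfold i ε (φ ε) q - P.unfoldVec i ε (fun z => h z.1 * perExt L F (ε⁻¹ • z)) q := fun q => by
    rw [unfold_eq]
    by_cases hx : q.1 ∈ P.unfoldedPart i ε
    · simp only [P.unfoldVec_of_mem hx, Pi.sub_apply]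
    · simp only [P.unfoldVec_of_notMem hx, sub_zero]
  have i3 := i1.trans (mul_le_mul_of_nonneg_left e1 hL.le)
  simp only [e3, Pi.sub_apply, sub_add_sub_cancel] at i2 i3
  refine i2.trans_lt ?_
  rw [← lt_div_iff₀' (by positivity)]
  linarith

end Profile

/-! ### Convergence of the unfolded solutions -/

namespace Profile

variable {N : ℕ} {L G₀ G₁ : ℝ} (P : Profile N L G₀ G₁) {p p' ε : ℝ} {i : Fin N}

theorem ae_memLp_slice {V : Type*} [NormedAddCommGroup V] (hp : 0 < p) {I : Set ℝ}
    {Y : Set ℝ²} {w : ℝ × ℝ² → V}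
    (hw : MemLp w ofR(p) vol[I ×ˢ Y]) :
    ∀ᵐ x ∂vol[I], MemLp (fun y => w (x, y)) ofR(p)
      vol[Y] := by
  rw [Measure.volume_eq_prod, ← Measure.prod_restrict] at hw
  filter_upwards [hw.1.prodMk_left, (integrable_norm_rpow hp hw).prod_right_ae] with x h1 h2
  exact memLp_of_integrable_norm_rpow hp h1 h2

/-- For a fixed first variable, the unfolded function is an affine change of variables. -/
theorem isLpW1p_unfold (hp : 1 ≤ p) (hε : 0 < ε) {w : ℝ² → ℝ} {Dw : ℝ² → Plane}
    (hw : IsW1p (P.pieceDomain i ε) p w Dw) :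
    IsLpW1p (P.piece i) (P.pieceCell i) p (P.unfold i ε w) (fun q => ε • P.unfoldVec i ε Dw q) := by
  have hp0 : 0 < p := by linarith
  have m1 := P.memLp_unfoldVec hε hw.memLp
  have m2 := (P.memLp_unfoldVec hε hw.grad_memLp).const_smul ε
  rw [unfold_eq]
  refine ⟨m1, m2, ?_⟩
  filter_upwards [ae_memLp_slice hp0 m1, ae_memLp_slice hp0 m2] with x s1 s2
  by_cases hx : x ∈ P.unfoldedPart i ε
  · have hs : P.pieceCell i ⊆ (fun y : ℝ² => ε • y + (ε * (⌊x / (ε * L)⌋ * L), 0)) ⁻¹'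
        P.pieceDomain i ε := fun y hy => by
      have := P.unfoldMap_mem_pieceDomain hε (q := (x, y)) hx hy
      rw [unfoldMap_eq] at this
      simpa using this
    have e : ∀ y : ℝ², unfoldMap L ε (x, y) = ε • y + (ε * (⌊x / (ε * L)⌋ * L), 0) := fun y => by
      rw [unfoldMap_eq]
      simp
    refine ⟨s1, s2, ?_, ?_⟩
    · have h := (hw.weakDeriv_fst.comp_affine hε.ne' (ε * (⌊x / (ε * L)⌋ * L), 0)).mono hs
      simpa [P.unfoldVec_of_mem (q := (x, _)) hx, e] using h
    · have h := (hw.weakDeriv_snd.comp_affine hε.ne' (ε * (⌊x / (ε * L)⌋ * L), 0)).mono hs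
      simpa [P.unfoldVec_of_mem (q := (x, _)) hx, e] using h
  · have h := isW1p_zero (P.pieceCell i) p
    simpa [P.unfoldVec_of_notMem (q := (x, _)) hx] using h

theorem unfoldVec_apply (Dw : ℝ² → Plane) (q : ℝ × ℝ²) (j : Fin 2) :
    P.unfoldVec i ε Dw q j = P.unfold i ε (fun z => Dw z j) q := by
  rw [unfold_eq]
  by_cases hx : q.1 ∈ P.unfoldedPart i ε
  · simp only [P.unfoldVec_of_mem hx]
  · simp [P.unfoldVec_of_notMem hx]

theorem memLp_unfold (hε : 0 < ε) {w : ℝ² → ℝ} {r : ENNReal}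
    (hw : MemLp w r vol[P.pieceDomain i ε]) :
    MemLp (P.unfold i ε w) r vol[P.piece i ×ˢ P.pieceCell i] := by
  rw [unfold_eq]
  exact P.memLp_unfoldVec hε hw

theorem isLpW1p_comp_fst {u₀ : ℝ → ℝ} (hp : 1 < p)
    (hu₀ : MemLp u₀ ofR(p) vol[P.piece i]) :
    IsLpW1p (P.piece i) (P.pieceCell i) p (fun q => u₀ q.1) fun _ => 0 := by
  have hg := P.isProfile i
  have := hg.isFiniteMeasure_cell
  refine ⟨?_, MemLp.zero', .of_forall fun x =>
    ((hg.isPerW1p_iff hp.le).2 (hg.hasPerWeakGrad_const p (u₀ x))).1⟩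
  have h := memLp_prod_smul (by linarith : 0 < p) hu₀
    (memLp_const (μ := vol[cell L (P.g i)]) (1 : ℝ))
  simp only [smul_eq_mul, mul_one] at h
  exact h

theorem isLpPerW1p_mul {du₀ : ℝ → ℝ} (hp : 1 < p)
    (hdu₀ : MemLp du₀ ofR(p) vol[P.piece i])
    {w : ℝ² → ℝ} {Dw : ℝ² → Plane} (hw : IsPerW1p L (P.g i) p w Dw) :
    IsLpPerW1p (P.piece i) L (P.g i) p (fun q => du₀ q.1 * w q.2) fun q => du₀ q.1 • Dw q.2 := by
  have hg := P.isProfile i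
  have hp0 : 0 < p := by linarith
  exact ⟨memLp_prod_smul hp0 hdu₀ hw.1.memLp, memLp_prod_smul hp0 hdu₀ hw.1.grad_memLp,
    .of_forall fun x => (hg.isPerW1p_iff hp.le).2
      (((hg.isPerW1p_iff hp.le).1 hw).const_mul (du₀ x))⟩

variable {f : ℝ → ℝ² → ℝ} {c : ℝ} {fhat u₀ du₀ : ℝ → ℝ} {u : ℝ → ℝ² → ℝ}
  {Du : ℝ → ℝ² → Plane} {v : Fin N → ℝ² → ℝ} {Dv : Fin N → ℝ² → Plane}

/-- The unfolded solutions and their unfolded gradients converge strongly. -/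
theorem tendsto_integral_unfold_solution (hp : p.HolderConjugate p')
    (H : P.IsHomogenization p p' c v Dv f fhat u₀ du₀ u Du) (i : Fin N) :
    Tendsto (fun ε => ∫ q in P.piece i ×ˢ P.pieceCell i, ‖P.unfold i ε (u ε) q - u₀ q.1‖ ^ p)
        (𝓝[>] 0) (𝓝 0) ∧
      ∀ j : Fin 2, Tendsto (fun ε => ∫ q in P.piece i ×ˢ P.pieceCell i,
        ‖P.unfold i ε (fun z => Du ε z j) q - du₀ q.1 * Dv i q.2 j‖ ^ p) (𝓝[>] 0) (𝓝 0) := by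
  have hp0 := hp.pos
  have hg := P.isProfile i
  have := hg.isFiniteMeasure_cell
  have hres := Measure.restrict_mono (P.piece_subset i) (le_refl (volume : Measure ℝ))
  have mu := H.limit.isW1p.memLp.mono_measure hres
  have mdu := H.limit.isW1p.deriv_memLp.mono_measure hres
  have hu' := fun ε hε => (H.solution ε hε).isW1p.mono (P.pieceDomain_subset i ε)
  have fin : IsFiniteMeasure vol[P.piece i] := by
    rw [piece]
    infer_instance
  constructor
  · have h := P.tendsto_integral_unfold_sub (F := fun _ => (1 : ℝ)) (φ := u) hp.lt
      (memLp_const (μ := vol[cell L (P.g i)]) (1 : ℝ)) mu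
      (fun ε hε => (hu' ε hε).memLp) fun η hη => ?_
    · simpa only [mul_one] using h
    have hV : 0 ≤ volume.real (P.piece i) := measureReal_nonneg
    set σ := min η ((η / (volume.real (P.piece i) + 1)) ^ (1 / p)) with hσ
    have hσ0 : 0 < σ := by positivity
    obtain ⟨b, γ, U, hA, hev⟩ := H.exists_approx_close hp hσ0 i
    refine ⟨U, hA.smooth.continuous, ?_, hev.mono fun ε h => ?_⟩
    · have mU : MemLp U ofR(p) vol[P.piece i] := by
        refine (mu.norm.add (memLp_const σ)).of_le hA.smooth.continuous.aestronglyMeasurable ?_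
        filter_upwards [ae_mono hres hA.abs_sub_le] with x hx
        rw [← Real.norm_eq_abs] at hx
        have h1 := norm_sub_norm_le (U x) (u₀ x)
        refine le_trans ?_ (le_abs_self _)
        simp only [Pi.add_apply]
        linarith
      have h1 : ∫ x in P.piece i, ‖U x - u₀ x‖ ^ p ≤
          ∫ x in P.piece i, η / (volume.real (P.piece i) + 1) := by
        refine integral_mono_ae (integrable_norm_rpow hp0 (mU.sub mu)) (integrable_const _) ?_
        filter_upwards [ae_mono hres hA.abs_sub_le] with x hx
        refine (Real.rpow_le_rpow (norm_nonneg _) (hx.trans (min_le_right _ _)) hp0.le).trans_eq ?_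
        rw [← Real.rpow_mul (by positivity), one_div_mul_cancel hp0.ne', Real.rpow_one]
      refine h1.trans ?_
      rw [setIntegral_const, smul_eq_mul, mul_div_assoc', div_le_iff₀ (by positivity)]
      linarith
    · refine le_trans ?_ (h.1.trans (min_le_left _ _))
      simp [perExt]
  · intro j
    refine P.tendsto_integral_unfold_sub (F := fun y => Dv i y j) (φ := fun ε z => Du ε z j) hp.lt
      (memLp_plane_apply ((H.isCell i).memLp hg) j) mdu
      (fun ε hε => memLp_plane_apply (hu' ε hε).grad_memLp j) fun η hη => ?_
    obtain ⟨b, γ, U, hA, hev⟩ := H.exists_approx_close hp hη i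
    refine ⟨b i, (hA.test i).continuous, hA.deriv_close i, ?_⟩
    filter_upwards [hev, self_mem_nhdsWithin] with ε h (hε : 0 < ε)
    have m := (memLp_thin ε (hu' ε hε).grad_memLp).sub
      (memLp_thin ε (memLp_test_smul (hA.test i)
        (hg.memLp_oscillating hp.lt.le hε ((H.isCell i).memLp hg))))
    exact (integral_plane_apply_le hp0 m j).trans h.2

/-- The coefficients of the limit problem lie between two positive constants. -/
theorem exists_coeff_mem_Icc (hp : p.HolderConjugate p')
    (hv : ∀ i, IsCellSolution L (P.g i) p (v i) (Dv i)) :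
    ∃ c₀ c₁, 0 < c₀ ∧ c₀ ≤ c₁ ∧
      (∀ᵐ x ∂vol[𝕀],
        P.piecewiseConst (fun i => qCoeff L (P.g i) p (Dv i)) x ∈ Icc c₀ c₁) ∧
      ∀ᵐ x ∂vol[𝕀],
        P.piecewiseConst (fun i => rCoeff L (P.g i)) x ∈ Icc c₀ c₁ := by
  have hq : ∀ i, 0 < qCoeff L (P.g i) p (Dv i) := fun i => (hv i).qCoeff_pos hp (P.isProfile i)
  have hr : ∀ i, 0 < rCoeff L (P.g i) := fun i => div_pos (P.isProfile i).volume_cell_pos P.L_pos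
  -- finitely many positive numbers
  have low : ∀ a : Fin N → ℝ, (∀ i, 0 < a i) → ∀ᶠ c in 𝓝[>] (0 : ℝ), ∀ i, c < a i := fun a ha =>
    eventually_all.2 fun i => mem_nhdsWithin_of_mem_nhds (Iio_mem_nhds (ha i))
  obtain ⟨c₀, ⟨h1, h2⟩, h0⟩ := (((low _ hq).and (low _ hr)).and self_mem_nhdsWithin).exists
  have up : ∀ a : Fin N → ℝ, ∀ᶠ c in atTop, ∀ i, a i ≤ c := fun a =>
    eventually_all.2 fun i => eventually_ge_atTop (a i)
  obtain ⟨c₁, ⟨h3, h4⟩, h5⟩ := (((up fun i => qCoeff L (P.g i) p (Dv i)).and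
    (up fun i => rCoeff L (P.g i))).and (eventually_ge_atTop c₀)).exists
  have key : ∀ a : Fin N → ℝ, (∀ i, c₀ < a i) → (∀ i, a i ≤ c₁) →
      ∀ᵐ x ∂vol[𝕀], P.piecewiseConst a x ∈ Icc c₀ c₁ := by
    intro a ha ha'
    filter_upwards [ae_restrict_mem measurableSet_Ioo, ae_restrict_of_ae P.ae_fst_notMem_range]
      with x hx hx'
    obtain ⟨i, hi⟩ := P.exists_mem_piece hx hx'
    rw [P.piecewiseConst_of_mem a hi]
    exact ⟨(ha i).le, ha' i⟩
  exact ⟨c₀, c₁, h0, h5, key _ h1 h3, key _ h2 h4⟩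

end Profile

end ThinDomain

end

theorem mainTheorem3 {N : ℕ} {L G₀ G₁ : ℝ} (P : ThinDomain.Profile N L G₀ G₁)
    {p p' : ℝ} (hp : p.HolderConjugate p')
    (f : ℝ → ℝ × ℝ → ℝ) (c : ℝ)
    (hf : ∀ ε, 0 < ε →
      MemLp (f ε) (ENNReal.ofReal p') (volume.restrict (P.thinDomain ε)) ∧
      ThinDomain.rescaledNorm ε p' (P.thinDomain ε) (f ε) ≤ c)
    (fhat : ℝ → ℝ)
    (hfhat : ThinDomain.TendstoWeaklyLp p' p (volume.restrict (Ioo (0 : ℝ) 1))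
      (fun ε => P.verticalMean ε (f ε)) fhat)
    (u : ℝ → ℝ × ℝ → ℝ) (Du : ℝ → ℝ × ℝ → ThinDomain.Plane)
    (hu : ∀ ε, 0 < ε →
      ThinDomain.IsNeumannSolution (P.thinDomain ε) p (f ε) (u ε) (Du ε)) :
    ∃ (v : Fin N → ℝ × ℝ → ℝ) (Dv : Fin N → ℝ × ℝ → ThinDomain.Plane),
      -- `v i` is the solution of the auxiliary problem on the `i`-th cell
      (∀ i, ThinDomain.IsCellSolution L (P.g i) p (v i) (Dv i) ∧
        ∀ w Dw, ThinDomain.IsCellSolution L (P.g i) p w Dw →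
          w =ᵐ[volume.restrict (P.pieceCell i)] v i) ∧
      ∃ u₀ du₀ : ℝ → ℝ,
        -- `u₀` is the solution of the homogenized problem
        (ThinDomain.IsLimitSolution p
            (P.piecewiseConst fun i => ThinDomain.qCoeff L (P.g i) p (Dv i))
            (P.piecewiseConst fun i => ThinDomain.rCoeff L (P.g i)) fhat u₀ du₀ ∧
          ∀ w dw, ThinDomain.IsLimitSolution p
              (P.piecewiseConst fun i => ThinDomain.qCoeff L (P.g i) p (Dv i))
              (P.piecewiseConst fun i => ThinDomain.rCoeff L (P.g i)) fhat w dw →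
            w =ᵐ[volume.restrict (Ioo (0 : ℝ) 1)] u₀) ∧
        ∃ (u₁ : Fin N → ℝ × ℝ × ℝ → ℝ) (Du₁ : Fin N → ℝ × ℝ × ℝ → ThinDomain.Plane),
          ∀ i, ThinDomain.IsLpPerW1p (P.piece i) L (P.g i) p (u₁ i) (Du₁ i) ∧
            ThinDomain.TendstoWeaklyLpW1p (P.piece i) (P.pieceCell i) p p'
              (fun ε => P.unfold i ε (u ε)) (fun z => u₀ z.1) ∧
            ThinDomain.TendstoWeaklyLp p p' (volume.restrict (P.piece i ×ˢ P.pieceCell i))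
              (fun ε => P.unfold i ε (fun z => Du ε z 0)) (fun z => du₀ z.1 + Du₁ i z 0) ∧
            ThinDomain.TendstoWeaklyLp p p' (volume.restrict (P.piece i ×ˢ P.pieceCell i))
              (fun ε => P.unfold i ε (fun z => Du ε z 1)) (fun z => Du₁ i z 1) := by
  have hp0 := hp.pos
  have hv : ∀ i, ∃ v Dv, ThinDomain.IsCellSolution L (P.g i) p v Dv := fun i =>
    (P.isProfile i).exists_isCellSolution hp
  choose v Dv hv using hv
  obtain ⟨c₀, c₁, hc₀, hc, hq, hr⟩ := P.exists_coeff_mem_Icc hp hv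
  have hqm := fun a => (P.measurable_piecewiseConst a).aestronglyMeasurable
    (μ := volume.restrict (Ioo (0 : ℝ) 1))
  obtain ⟨u₀, du₀, hu₀⟩ := ThinDomain.exists_isLimitSolution hp hc₀ hc (hqm _) (hqm _) hq hr
    hfhat.limit_memLp
  refine ⟨v, Dv, fun i => ⟨hv i, fun w Dw hw => (hv i).ae_eq hp (P.isProfile i) hw⟩, u₀, du₀,
    ⟨hu₀, fun w dw hw => hu₀.ae_eq hp hc₀ (hqm _) (hqm _) hq hr hw⟩,
    fun i q => du₀ q.1 * (v i q.2 - q.2.1),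
    fun i q => du₀ q.1 • (Dv i q.2 - EuclideanSpace.single 0 1), fun i => ?_⟩
  have hres := Measure.restrict_mono (P.piece_subset i) (le_refl (volume : Measure ℝ))
  have mu := hu₀.isW1p.memLp.mono_measure hres
  have mdu := hu₀.isW1p.deriv_memLp.mono_measure hres
  have hu' := fun ε hε => (hu ε hε).isW1p.mono (P.pieceDomain_subset i ε)
  obtain ⟨lim₀, lim₁⟩ := P.tendsto_integral_unfold_solution hp ⟨hv, hf, hfhat, hu₀, hu⟩ i
  have w₀ := P.isLpW1p_comp_fst hp.lt mu
  have w₁ := fun j => ThinDomain.tendstoWeaklyLp_of_tendsto hp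
    (fun ε hε => P.memLp_unfold hε (ThinDomain.memLp_plane_apply (hu' ε hε).grad_memLp j))
    (ThinDomain.memLp_prod_smul hp0 mdu
      (ThinDomain.memLp_plane_apply ((hv i).memLp (P.isProfile i)) j)) (lim₁ j)
  refine ⟨P.isLpPerW1p_mul hp.lt mdu (hv i).periodic, ⟨_, _,
    fun ε hε => P.isLpW1p_unfold hp.lt.le hε (hu' ε hε), w₀,
    ThinDomain.tendstoWeaklyLp_of_tendsto hp
      (fun ε hε => P.memLp_unfold hε (hu' ε hε).memLp) w₀.memLp lim₀, fun j => ?_⟩, ?_, ?_⟩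
  · -- the gradient of the unfolded solution is `ε` times the unfolded gradient
    refine ⟨fun ε hε => ThinDomain.memLp_plane_apply
      (P.isLpW1p_unfold hp.lt.le hε (hu' ε hε)).grad_memLp j,
      ThinDomain.memLp_plane_apply w₀.grad_memLp j, fun ψ hψ => ?_⟩
    have h := ((tendsto_id (x := 𝓝 (0 : ℝ))).mono_left (nhdsWithin_le_nhds (s := Ioi 0))).mul
      ((w₁ j).tendsto ψ hψ)
    rw [zero_mul] at h
    simp only [PiLp.zero_apply, zero_mul, integral_zero]
    refine h.congr fun ε => ?_
    rw [← integral_const_mul]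
    refine integral_congr_ae (.of_forall fun q => ?_)
    simp [P.unfoldVec_apply, mul_assoc]
  · convert w₁ 0 using 2 with q
    simp [mul_sub]
  · convert w₁ 1 using 2 with q
    simp
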